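/- Let $d\ge 2$, let $V=\{\pm e_1,\dots,\pm e_d\}$ and $V^+=\{e_1,\dots,e_d\}$ in $\mathbb Z^d$, and let $\alpha=(\alpha(e))_{e\in V}$ be a probability vector with strictly positive entries. Let $$\mathcal E_\alpha=\Big\{r\in[-1,1]^V:\ \sum_{e\in V} r(e)\alpha(e)=0,\ \max_{e\in V}|r(e)|=1\Big\},$$ and let $\mathbb Q$ be a probability measure on $\mathcal E_\alpha^{\mathbb Z^d}$ under which the coordinates $\xi(x)$, $x\in\mathbb Z^d$, are i.i.d. with $\mathbb E[\xi(x,e)]=0$ for all $e\in V$. For $\varepsilon\in[0,1)$ let $\mathbb P_\varepsilon$ be the law of the environment $\omega_\varepsilon(x,e)=\alpha(e)(1+\varepsilon\xi(x,e))$. Fix $0<\kappa<\min_e\alpha(e)$ and put $\varepsilon_{\max}=1-\kappa/\min_e\alpha(e)\in(0,1)$. For an environment $\omega$ let $P_{0,\omega}$ be the law of the Markov chain $(X_n)$ on $\mathbb Z^d$ started at $0$ that jumps from $x$ to $x+e$ with probability $\omega(x,e)$, $e\in V$. Let $\partial R_n=\{x\in\mathbb Z^d: |x|_1=n,\ x_j\ge0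 \text{ for all } j\}$ and $$J_n=\max_{x\in\mathbb Z^d}P_{0,\omega}\big(X_{n-1}=x\mid X_{n-1}\in\partial R_{n-1}\big),\qquad n\ge 1 .$$ A law $\mathbb P$ of environments is called *localized* if $\liminf_n \frac1n\sum_{k=1}^nJ_k>0$ $\mathbb P$-a.s., and *delocalized* if this lower limit is $0$ $\mathbb P$-a.s. Put $\Psi(\omega,x)=\log\sum_{e\in V^+}\omega(x,e)$ and $\pi(\omega,x,e)=\omega(x,e)e^{-\Psi(\omega,x)}$ for $e\in V^+$, and let $E_{0,\pi}$ be the expectation for the walk from $0$ with jumps in $V^+$ and transition probabilities $\pi$. The quenched and annealed free energies are $$p=\lim_{n\to\infty}\frac1n\log E_{0,\pi}\Big[e^{\sum_{i=0}^{n-1}\Psi(\omega,X_i)}\Big]\ (\mathbb P\text{-a.s. constant}),\qquad \lambda=\lim_{n\to\infty}\frac1n\log \mathbb E\,E_{0,\pi}\Big[e^{\sum_{i=0}^{n-1}\Psi(\omega,X_i)}\Big].$$ Say that $\mathbb P$ is *non-degenerate* if $\mathbb P(\Psi(\omega,0)=\log c)<1$, where $c=\sum_{e\in V^+}\mathbb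 E[\omega(0,e)]$. **Proposition.** For $\varepsilon\in[0,\varepsilon_{\max}]$ the free energies $p(\varepsilon)$ and $\lambda$ of $\mathbb P_\varepsilon$ exist, with $\lambda=\log\sum_{e\in V^+}\alpha(e)$ for every $\varepsilon$, and there is $\overline\varepsilon\in[0,\varepsilon_{\max}]$ such that - for $0\le\varepsilon\le\overline\varepsilon$, $\mathbb P_\varepsilon$ is delocalized and $p(\varepsilon)=\lambda$; - for $\overline\varepsilon<\varepsilon\le\varepsilon_{\max}$, $\mathbb P_\varepsilon$ is localized and $p(\varepsilon)<\lambda$. Moreover, for every $\varepsilon\in(0,\varepsilon_{\max}]$: 1. if $\mathbb P_\varepsilon$ is not non-degenerate, then $\overline\varepsilon=\varepsilon_{\max}$; 2. if $\mathbb P_\varepsilon$ is non-degenerate and $d\in\{2,3\}$, then $\overline\varepsilon=0$; 3. if $\mathbb P_\varepsilon$ is non-degenerate and $d\ge4$, then $\overline\varepsilon>0$. Finally, in every dimension $d\ge4$ (in particular $d=4$) there are $\alpha,\mathbb Q,\kappa$ as above with $0<\overline\varepsilon<\varepsilon_{\max}$. They can be chosen with $\alpha(e_i)=\alpha(-e_i)$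 for all $i$, with $\alpha$ not constant on $V^+$, and with Rademacher disorder: a.s. $\xi(x,e_i)=\xi(x,e_j)$ and $\xi(x,-e_i)=-\xi(x,e_i)$ for all $x,i,j$, and $\mathbb Q(\xi(0,e_i)=1)=\mathbb Q(\xi(0,e_i)=-1)=\tfrac12$. -/

import Mathlib

open MeasureTheory ProbabilityTheory Filter Topology

noncomputable section

/-- The sites of the lattice `ℤ^d`. -/
abbrev Site (d : ℕ) : Type := Fin d → ℤ

/-- The index set of the jumps `V = {± e_1, …, ± e_d}`: the pair `(i, s)` with `s = ± 1` stands for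
the vector `s e_i`. The subset `V⁺ = {e_1, …, e_d}` consists of the pairs `(i, 1)`. -/
abbrev Jump (d : ℕ) : Type := Fin d × ℤˣ

/-- The lattice vector of a jump. -/
def Jump.vec {d : ℕ} (e : Jump d) : Site d := Pi.single e.1 (e.2 : ℤ)

/-- Families `ω(x, e)` of transition weights. An environment is such a family for which every
`ω(x, ·)` is a probability vector, see `IsEnvironment`. It carries the product σ-algebra. -/
abbrev Env (d : ℕ) : Type := Site d → Jump d → ℝ

/-- Every `ω(x, ·)` is a probability vector on `V`. -/
def IsEnvironment {d : ℕ} (ω : Env d) : Prop :=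
  ∀ x, (∀ e, 0 ≤ ω x e) ∧ ∑ e, ω x e = 1

/-! ### The walk started at the origin, up to a finite time -/

/-- The position at time `k ≤ n` of the walk which starts at `0` and makes the jumps `s`. -/
def pos {d n : ℕ} (s : Fin n → Jump d) (k : ℕ) : Site d :=
  ∑ i : Fin n with i.val < k, (s i).vec

/-- The quenched probability that the first `n` jumps of the Markov chain with transition
probabilities `ω`, started at `0`, are `s`. -/
def pathProb {d n : ℕ} (ω : Env d) (s : Fin n → Jump d) : ℝ :=
  ∏ i : Fin n, ω (pos s i) (s i)

open Classical in
/-- The quenched probability `P_{0,ω}(X_n ∈ S)`. -/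
def quenchedProb {d : ℕ} (ω : Env d) (n : ℕ) (S : Set (Site d)) : ℝ :=
  ∑ s : Fin n → Jump d with pos s n ∈ S, pathProb ω s

/-- `∂R_n`: the sites with nonnegative coordinates and `ℓ¹`-norm `n`. -/
def boundaryFace (d n : ℕ) : Set (Site d) :=
  {x | ∑ j, |x j| = (n : ℤ) ∧ ∀ j, 0 ≤ x j}

/-- `max_x P_{0,ω}(X_m = x | X_m ∈ ∂R_m)`; this is the quantity `J_{m+1}`. -/
def maxCondProb {d : ℕ} (ω : Env d) (m : ℕ) : ℝ :=
  ⨆ x : Site d, quenchedProb ω m ({x} ∩ boundaryFace d m) / quenchedProb ω m (boundaryFace d m)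

/-- `(1/n) ∑_{k=1}^n J_k`. -/
def avgMaxProb {d : ℕ} (ω : Env d) (n : ℕ) : ℝ :=
  (1 / (n : ℝ)) * ∑ m ∈ Finset.range n, maxCondProb ω m

/-- Localization at the boundary, for environments with law `P`. -/
def Localized {d : ℕ} (P : Measure (Env d)) : Prop :=
  ∀ᵐ ω ∂P, 0 < liminf (fun n : ℕ => avgMaxProb ω n) atTop

/-- Delocalization at the boundary, for environments with law `P`. -/
def Delocalized {d : ℕ} (P : Measure (Env d)) : Prop :=
  ∀ᵐ ω ∂P, liminf (fun n : ℕ => avgMaxProb ω n) atTop = 0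

/-! ### The directed polymer formulation and the free energies -/

/-- `Ψ(ω, x) = log ∑_{e ∈ V⁺} ω(x, e)`. -/
def Psi {d : ℕ} (ω : Env d) (x : Site d) : ℝ := Real.log (∑ i : Fin d, ω x (i, 1))

/-- `π(ω, x, e) = ω(x, e) / ∑_{e' ∈ V⁺} ω(x, e')` for `e ∈ V⁺`; the other jumps are forbidden. -/
def dirEnv {d : ℕ} (ω : Env d) : Env d :=
  fun x e => if e.2 = 1 then ω x e / ∑ i : Fin d, ω x (i, 1) else 0

/-- `E_{0,π}(exp(∑_{i=0}^{n-1} Ψ(ω, X_i)))`. -/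
def partitionFn {d : ℕ} (ω : Env d) (n : ℕ) : ℝ :=
  ∑ s : Fin n → Jump d, pathProb (dirEnv ω) s * Real.exp (∑ i : Fin n, Psi ω (pos s i))

/-- The quenched free energy exists almost surely and is the constant `p`. -/
def HasQuenchedFreeEnergy {d : ℕ} (P : Measure (Env d)) (p : ℝ) : Prop :=
  ∀ᵐ ω ∂P, Tendsto (fun n : ℕ => (1 / (n : ℝ)) * Real.log (partitionFn ω n)) atTop (𝓝 p)

/-- The annealed free energy exists and is `l`. -/
def HasAnnealedFreeEnergy {d : ℕ} (P : Measure (Env d)) (l : ℝ) : Prop :=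
  Tendsto (fun n : ℕ => (1 / (n : ℝ)) * Real.log (∫ ω, partitionFn ω n ∂P)) atTop (𝓝 l)

/-- The non-degeneracy condition `P(Ψ(ω, 0) = log c) < 1`, where `c = ∑_{e ∈ V⁺} q(e)` and
`q(e)` is the mean of `ω(0, e)`. -/
def EnvCondition {d : ℕ} (P : Measure (Env d)) : Prop :=
  P {ω | Psi ω 0 = Real.log (∑ i : Fin d, ∫ ω', ω' 0 (i, 1) ∂P)} < 1

/-! ### The parametrized environments -/

/-- The set `E_α` of the vectors `r ∈ [-1,1]^V` with `∑_e r(e) α(e) = 0` and `max_e |r(e)| = 1`. -/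
def disorderSet {d : ℕ} (α : Jump d → ℝ) : Set (Jump d → ℝ) :=
  {r | (∀ e, r e ∈ Set.Icc (-1 : ℝ) 1) ∧ ∑ e, r e * α e = 0 ∧ ⨆ e, |r e| = 1}

/-- The coordinates `ξ(x)` are i.i.d. and centered under the probability measure `Q` on
`Γ_α = E_α^{ℤ^d}`. -/
structure IsDisorderLaw {d : ℕ} (α : Jump d → ℝ) (Q : Measure (Site d → disorderSet α)) :
    Prop where
  isProb : IsProbabilityMeasure Q
  indep : iIndepFun (fun (x : Site d) (ξ : Site d → disorderSet α) => ξ x) Q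
  ident : ∀ x : Site d, IdentDistrib (fun ξ : Site d → disorderSet α => ξ x) (fun ξ => ξ 0) Q Q
  centered : ∀ (x : Site d) (e : Jump d), ∫ ξ, (ξ x : Jump d → ℝ) e ∂Q = 0

/-- `ω_ε(x, e) = α(e) (1 + ε ξ(x, e))`. -/
def perturbedEnv {d : ℕ} (α : Jump d → ℝ) (ε : ℝ) (ξ : Site d → disorderSet α) : Env d :=
  fun x e => α e * (1 + ε * (ξ x : Jump d → ℝ) e)

/-- For `0 ≤ ε ≤ 1` the family `ω_ε` is an environment. -/
theorem perturbedEnv_isEnvironment {d : ℕ} {α : Jump d → ℝ} (hα : ∀ e, 0 < α e)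
    (hα1 : ∑ e, α e = 1) {ε : ℝ} (h0 : 0 ≤ ε) (h1 : ε ≤ 1) (ξ : Site d → disorderSet α) :
    IsEnvironment (perturbedEnv α ε ξ) := by
  intro x
  obtain ⟨hb, hs, -⟩ := (ξ x).2
  refine ⟨fun e => mul_nonneg (hα e).le ?_, ?_⟩
  · have := (hb e).1
    nlinarith
  · have h : ∀ e, perturbedEnv α ε ξ x e = α e + ε * ((ξ x : Jump d → ℝ) e * α e) := by
      intro e
      simp only [perturbedEnv]
      ring
    simp only [h, Finset.sum_add_distrib, ← Finset.mul_sum, hs, hα1]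
    simp

/-- The law `P_ε` of the environment `ω_ε`. -/
def envLaw {d : ℕ} (α : Jump d → ℝ) (Q : Measure (Site d → disorderSet α)) (ε : ℝ) :
    Measure (Env d) :=
  Q.map (perturbedEnv α ε)

/-- `ε_max = 1 - κ / min_e α(e)`. -/
def epsMax {d : ℕ} (α : Jump d → ℝ) (κ : ℝ) : ℝ := 1 - κ / ⨅ e, α e

/-- The value `log ∑_{e ∈ V⁺} α(e)`. -/
def lam {d : ℕ} (α : Jump d → ℝ) : ℝ := Real.log (∑ i : Fin d, α (i, 1))

/-- `b ∈ [0, ε_max]` separates delocalization (equal free energies), for `0 ≤ ε ≤ b`, from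
localization (quenched free energy below the annealed one), for `b < ε ≤ ε_max`. -/
structure IsThreshold {d : ℕ} (α : Jump d → ℝ) (Q : Measure (Site d → disorderSet α)) (κ b : ℝ) :
    Prop where
  mem : b ∈ Set.Icc 0 (epsMax α κ)
  annealed : ∀ ε ∈ Set.Icc 0 (epsMax α κ), HasAnnealedFreeEnergy (envLaw α Q ε) (lam α)
  below : ∀ ε ∈ Set.Icc 0 b,
    Delocalized (envLaw α Q ε) ∧ HasQuenchedFreeEnergy (envLaw α Q ε) (lam α)
  above : ∀ ε ∈ Set.Ioc b (epsMax α κ),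
    Localized (envLaw α Q ε) ∧ ∃ p < lam α, HasQuenchedFreeEnergy (envLaw α Q ε) p

/-- Rademacher disorder: `ξ(x, e_i) = ξ(x, e_j)` and `ξ(x, -e_i) = -ξ(x, e_i)` for all `i` and `j`,
and `ξ(0, e_i)` takes each of the values `1` and `-1` with probability `1/2`. -/
def IsRademacher {d : ℕ} {α : Jump d → ℝ} (Q : Measure (Site d → disorderSet α)) : Prop :=
  (∀ᵐ ξ ∂Q, ∀ (x : Site d) (i j : Fin d),
    (ξ x : Jump d → ℝ) (i, 1) = (ξ x : Jump d → ℝ) (j, 1) ∧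
    (ξ x : Jump d → ℝ) (i, -1) = -(ξ x : Jump d → ℝ) (i, 1)) ∧
  ∀ i : Fin d, Q {ξ | (ξ 0 : Jump d → ℝ) (i, 1) = 1} = 1 / 2 ∧
    Q {ξ | (ξ 0 : Jump d → ℝ) (i, 1) = -1} = 1 / 2

end

set_option linter.unusedSectionVars false

noncomputable section

/-! A walk that sits on the face `∂R_n` after `n` steps has made positive jumps only. Conditioned on
this event, the walk is a directed polymer with independent site weights. After dividing by the mass
of the positive jumps, its partition function `tot` (written `W_n` here) has mean one, the annealed
free energy is `λ`, and `p(ε) = λ + freeEnergy` with `freeEnergy = lim E[log W_n] / n ≤ 0`.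
Everything reduces to deciding when this limit vanishes.

Existence and threshold. `meanLog_add_le` (superadditivity) and `variance_log_wtot_le` (a variance
linear in `n`) give the almost sure limit. In `ε` the limit is Lipschitz (`freeEnergy_le_add`) and
antitone (`integral_log_wtot_antitone`: shrinking the fluctuations of one level towards their mean
can only raise `E log`, by concavity). So its zero set in `[0, ε_max]` is an interval `[0, b]`, and
`b` is the threshold.

Localization. `W_{n+1} / W_n = 1 + U_n`, where `U_n` (`relInc`) is centered given the past, with
conditional variance `v` times the overlap of two endpoints; `v` is the variance of the total weight
of a site. Since `log(1+u) - u` is comparable to `-u²`, the decay rate of `W_n` is comparable to `v`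
times the averaged overlap, and the overlap is sandwiched between the square of the largest endpoint
mass and that mass itself. Hence a negative free energy means localization, and a zero free energy
means delocalization if `v > 0`. If `v = 0` then `W_n = 1`; the difference of two replicas is then a
Markov chain, and a discrete Tanaka formula bounds its visits to the origin by a multiple of `√n`
(`sum_collisions_le`), so delocalization holds again.

Dimension at least four. The difference of two directed walks is transient. A bounded Green
function, built by a Fourier integral over three coordinates (`exists_green`), gives a supersolution
of the two-replica operator, hence bounded second moments of `W_n` and a zero free energy for small
`ε`.

Dimensions two and three. The square root of `W_n` has an exponentially decaying mean. Blocks of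
length `2n` are cut into cells of diffusive width `√n`, and `√(∑) ≤ ∑ √` separates the cells.
Distant cells are handled by an exponential moment. For nearby cells one uses a rare event
(`exists_block_event`): a quadratic form in the fluctuations, with kernel `1/|time difference|` on
diffusively close pairs, is large. Under the original law it is centered of size about `n √(log n)`,
since at most about `k` sites at time distance `k` are diffusively close. Under the size-biased law
the fluctuations along the path have mean `v`, and the form is of order `n log n`. The logarithm
wins, also in the marginal dimension three.

Intermediate threshold. If `α` is concentrated on one axis, one step already contracts the mean of
the square root at `ε = 1/2`, so `b < 1/2 = ε_max`, while `b > 0` by the second moment argument. -/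

/-! ### Bounded measurable functions -/

/-- Bounded measurable real functions. -/
structure BMeas {Ω : Type*} [MeasurableSpace Ω] (f : Ω → ℝ) : Prop where
  meas : Measurable f
  bdd : ∃ C, ∀ x, |f x| ≤ C

namespace BMeas

variable {Ω Ω' ι : Type*} [MeasurableSpace Ω] [MeasurableSpace Ω'] {f g : Ω → ℝ}

theorem const (c : ℝ) : BMeas (fun _ : Ω => c) := ⟨measurable_const, |c|, fun _ => le_rfl⟩

theorem add (hf : BMeas f) (hg : BMeas g) : BMeas (fun x => f x + g x) := by
  obtain ⟨C, hC⟩ := hf.bdd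
  obtain ⟨D, hD⟩ := hg.bdd
  exact ⟨hf.meas.add hg.meas, C + D, fun x => (abs_add_le _ _).trans (add_le_add (hC x) (hD x))⟩

theorem neg (hf : BMeas f) : BMeas (fun x => -f x) := by
  obtain ⟨C, hC⟩ := hf.bdd
  exact ⟨hf.meas.neg, C, fun x => by simpa using hC x⟩

theorem sub (hf : BMeas f) (hg : BMeas g) : BMeas (fun x => f x - g x) := by
  simpa only [sub_eq_add_neg] using hf.add hg.neg

theorem mul (hf : BMeas f) (hg : BMeas g) : BMeas (fun x => f x * g x) := by
  obtain ⟨C, hC⟩ := hf.bdd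
  obtain ⟨D, hD⟩ := hg.bdd
  refine ⟨hf.meas.mul hg.meas, C * D, fun x => ?_⟩
  rw [abs_mul]
  exact mul_le_mul (hC x) (hD x) (abs_nonneg _) ((abs_nonneg _).trans (hC x))

theorem const_mul (c : ℝ) (hf : BMeas f) : BMeas (fun x => c * f x) := (const c).mul hf

theorem mul_const (hf : BMeas f) (c : ℝ) : BMeas (fun x => f x * c) := hf.mul (const c)

theorem div_const (hf : BMeas f) (c : ℝ) : BMeas (fun x => f x / c) := by
  simpa only [div_eq_mul_inv] using hf.mul_const c⁻¹

theorem pow (hf : BMeas f) (n : ℕ) : BMeas (fun x => f x ^ n) := by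
  induction n with
  | zero => simpa using const (Ω := Ω) 1
  | succ n ih => simpa only [pow_succ] using ih.mul hf

theorem sum (s : Finset ι) {F : ι → Ω → ℝ} (h : ∀ i ∈ s, BMeas (F i)) :
    BMeas (fun x => ∑ i ∈ s, F i x) := by
  classical
  induction s using Finset.induction_on with
  | empty => simpa using const (Ω := Ω) 0
  | insert a s ha ih =>
    simp only [Finset.sum_insert ha]
    exact (h a (by simp)).add (ih fun i hi => h i (by simp [hi]))

theorem prod (s : Finset ι) {F : ι → Ω → ℝ} (h : ∀ i ∈ s, BMeas (F i)) :
    BMeas (fun x => ∏ i ∈ s, F i x) := by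
  classical
  induction s using Finset.induction_on with
  | empty => simpa using const (Ω := Ω) 1
  | insert a s ha ih =>
    simp only [Finset.prod_insert ha]
    exact (h a (by simp)).mul (ih fun i hi => h i (by simp [hi]))

theorem sqrt (hf : BMeas f) : BMeas (fun x => √(f x)) := by
  obtain ⟨C, hC⟩ := hf.bdd
  refine ⟨hf.meas.sqrt, √C, fun x => ?_⟩
  rw [abs_of_nonneg (Real.sqrt_nonneg _)]
  exact Real.sqrt_le_sqrt ((le_abs_self _).trans (hC x))

theorem log (hf : BMeas f) {δ : ℝ} (hδ : 0 < δ) (h : ∀ x, δ ≤ f x) :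
    BMeas (fun x => Real.log (f x)) := by
  obtain ⟨C, hC⟩ := hf.bdd
  refine ⟨hf.meas.log, max |Real.log δ| |Real.log C|, fun x => ?_⟩
  exact abs_le_max_abs_abs (Real.log_le_log hδ (h x))
    (Real.log_le_log (hδ.trans_le (h x)) ((le_abs_self _).trans (hC x)))

theorem div (hf : BMeas f) (hg : BMeas g) {δ : ℝ} (hδ : 0 < δ) (h : ∀ x, δ ≤ g x) :
    BMeas (fun x => f x / g x) := by
  obtain ⟨C, hC⟩ := hf.bdd
  refine ⟨hf.meas.div hg.meas, C / δ, fun x => ?_⟩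
  rw [abs_div]
  exact div_le_div₀ ((abs_nonneg _).trans (hC x)) (hC x) hδ ((h x).trans (le_abs_self _))

theorem indicator (hf : BMeas f) {s : Set Ω} (hs : MeasurableSet s) : BMeas (s.indicator f) := by
  obtain ⟨C, hC⟩ := hf.bdd
  refine ⟨hf.meas.indicator hs, C, fun x => ?_⟩
  by_cases hx : x ∈ s
  · simpa [hx] using hC x
  · simpa [hx] using (abs_nonneg _).trans (hC x)

theorem comp (hf : BMeas f) {T : Ω' → Ω} (hT : Measurable T) : BMeas (fun x => f (T x)) := by
  obtain ⟨C, hC⟩ := hf.bdd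
  exact ⟨hf.meas.comp hT, C, fun x => hC _⟩

theorem integrable (hf : BMeas f) (P : Measure Ω) [IsFiniteMeasure P] : Integrable f P := by
  obtain ⟨C, hC⟩ := hf.bdd
  exact Integrable.of_bound hf.meas.aestronglyMeasurable C (ae_of_all _ fun x => hC x)

theorem abs_integral_le {P : Measure Ω} [IsProbabilityMeasure P] {C : ℝ}
    (h : ∀ x, |f x| ≤ C) : |∫ x, f x ∂P| ≤ C := by
  have := norm_integral_le_of_norm_le_const (μ := P) (f := f) (C := C)
    (ae_of_all _ fun x => h x)
  simpa using this

theorem integral_right {F : Ω × Ω' → ℝ} (hF : BMeas F) (P : Measure Ω') [IsProbabilityMeasure P] :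
    BMeas (fun x => ∫ y, F (x, y) ∂P) := by
  obtain ⟨C, hC⟩ := hF.bdd
  exact ⟨(hF.meas.stronglyMeasurable.integral_prod_right' (ν := P)).measurable, C,
    fun x => abs_integral_le fun y => hC _⟩

theorem integral_left {F : Ω × Ω' → ℝ} (hF : BMeas F) (P : Measure Ω) [IsProbabilityMeasure P] :
    BMeas (fun y => ∫ x, F (x, y) ∂P) :=
  integral_right (F := fun p : Ω' × Ω => F (p.2, p.1)) (hF.comp measurable_swap) P

end BMeas

/-! ### Resampling of coordinates in a product measure -/

section Glue

variable {ι E : Type*}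

open Classical in
/-- The configuration which agrees with `ξ` on `S` and with `ξ'` off `S`. -/
def glue (S : Set ι) (ξ ξ' : ι → E) : ι → E := fun x => if x ∈ S then ξ x else ξ' x

theorem glue_of_mem {S : Set ι} {ξ ξ' : ι → E} {x : ι} (h : x ∈ S) : glue S ξ ξ' x = ξ x := by
  simp [glue, h]

theorem glue_of_notMem {S : Set ι} {ξ ξ' : ι → E} {x : ι} (h : x ∉ S) :
    glue S ξ ξ' x = ξ' x := by
  simp [glue, h]

theorem DependsOn.glue_left {f : (ι → E) → ℝ} {S : Set ι} (hf : DependsOn f S) (ξ ξ' : ι → E) :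
    f (glue S ξ ξ') = f ξ := hf fun _ hx => glue_of_mem hx

theorem DependsOn.glue_right {f : (ι → E) → ℝ} {S T : Set ι} (hf : DependsOn f T)
    (h : Disjoint T S) (ξ ξ' : ι → E) : f (glue S ξ ξ') = f ξ' :=
  hf fun _ hx => glue_of_notMem (Set.disjoint_left.1 h hx)

variable [MeasurableSpace E]

theorem measurable_glue (S : Set ι) :
    Measurable (fun p : (ι → E) × (ι → E) => glue S p.1 p.2) := by
  refine measurable_pi_lambda _ fun x => ?_
  by_cases h : x ∈ S
  · simp only [glue, h, if_true]; fun_prop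
  · simp only [glue, h, if_false]; fun_prop

/-- The law of an i.i.d. field. -/
abbrev fieldLaw (ι : Type*) (μ : Measure E) : Measure (ι → E) := Measure.infinitePi fun _ => μ

variable (μ : Measure E) [IsProbabilityMeasure μ]

/-- The coordinates on `S` are independent of those off `S`: a box pulls back to a product of two
boxes, and boxes determine the measure. Integrating over the second copy plays the role of
conditional expectation given the coordinates in `S`. -/
theorem measurePreserving_glue (S : Set ι) :
    MeasurePreserving (fun p : (ι → E) × (ι → E) => glue S p.1 p.2)
      ((fieldLaw ι μ).prod (fieldLaw ι μ)) (fieldLaw ι μ) := by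
  classical
  refine ⟨measurable_glue S, ?_⟩
  refine Measure.eq_infinitePi _ fun s t ht => ?_
  rw [Measure.map_apply (measurable_glue S)
    (MeasurableSet.pi s.countable_toSet fun i _ => ht i)]
  have h : (fun p : (ι → E) × (ι → E) => glue S p.1 p.2) ⁻¹' (Set.pi s t)
      = (Set.pi (s.filter (· ∈ S)) t) ×ˢ (Set.pi (s.filter (· ∉ S)) t) := by
    ext p
    simp only [Set.mem_preimage, Set.mem_pi, Set.mem_prod, Finset.mem_coe, Finset.mem_filter]
    constructor
    · intro h
      exact ⟨fun i hi => by simpa [glue, hi.2] using h i hi.1,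
        fun i hi => by simpa [glue, hi.2] using h i hi.1⟩
    · rintro ⟨h1, h2⟩ i hi
      by_cases hS : i ∈ S
      · simpa [glue, hS] using h1 i ⟨hi, hS⟩
      · simpa [glue, hS] using h2 i ⟨hi, hS⟩
  rw [h, Measure.prod_prod, Measure.infinitePi_pi _ fun i _ => ht i,
    Measure.infinitePi_pi _ fun i _ => ht i,
    Finset.prod_filter_mul_prod_filter_not]

variable {μ}

theorem BMeas.glue {f : (ι → E) → ℝ} (hf : BMeas f) (S : Set ι) :
    BMeas (fun p : (ι → E) × (ι → E) => f (glue S p.1 p.2)) := hf.comp (measurable_glue S)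

theorem integral_eq_glue {f : (ι → E) → ℝ} (hf : BMeas f) (S : Set ι) :
    ∫ ξ, f ξ ∂fieldLaw ι μ = ∫ ξ, ∫ ξ', f (glue S ξ ξ') ∂fieldLaw ι μ ∂fieldLaw ι μ := by
  rw [← (measurePreserving_glue μ S).map_eq,
    integral_map (measurable_glue S).aemeasurable hf.meas.aestronglyMeasurable,
    (measurePreserving_glue μ S).map_eq,
    integral_prod _ ((hf.glue S).integrable _)]

theorem integral_eq_glue' {f : (ι → E) → ℝ} (hf : BMeas f) (S : Set ι) :
    ∫ ξ, f ξ ∂fieldLaw ι μ = ∫ ξ', ∫ ξ, f (glue S ξ ξ') ∂fieldLaw ι μ ∂fieldLaw ι μ := by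
  rw [integral_eq_glue hf S, integral_integral_swap]
  exact (hf.glue S).integrable _

/-- After gluing along `S`, one factor sees only the first copy of the field and the other only the
second, so the double integral factorizes. -/
theorem integral_mul_of_dependsOn {f g : (ι → E) → ℝ} {S T : Set ι} (hf : BMeas f) (hg : BMeas g)
    (hfS : DependsOn f S) (hgT : DependsOn g T) (h : Disjoint T S) :
    ∫ ξ, f ξ * g ξ ∂fieldLaw ι μ = (∫ ξ, f ξ ∂fieldLaw ι μ) * ∫ ξ, g ξ ∂fieldLaw ι μ := by
  rw [integral_eq_glue (hf.mul hg) S]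
  simp only [hfS.glue_left, hgT.glue_right h, integral_const_mul, integral_mul_const]

theorem integral_eval {f : E → ℝ} (hf : Measurable f) (x : ι) :
    ∫ ξ, f (ξ x) ∂fieldLaw ι μ = ∫ r, f r ∂μ := by
  conv_rhs => rw [← Measure.infinitePi_map_eval (fun _ : ι => μ) x]
  rw [integral_map (measurable_pi_apply x).aemeasurable hf.aestronglyMeasurable]

/-- Distinct coordinates stay distinct under an injection, so the relabelled field is again i.i.d.
For translations this is the stationarity of the environment. -/
theorem measurePreserving_precomp {σ : ι → ι} (hσ : Function.Injective σ) :
    MeasurePreserving (fun (ξ : ι → E) x => ξ (σ x)) (fieldLaw ι μ) (fieldLaw ι μ) := by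
  classical
  have hm : Measurable (fun (ξ : ι → E) x => ξ (σ x)) :=
    measurable_pi_lambda _ fun x => measurable_pi_apply _
  refine ⟨hm, Measure.eq_infinitePi _ fun s t ht => ?_⟩
  rw [Measure.map_apply hm (MeasurableSet.pi s.countable_toSet fun i _ => ht i)]
  -- The sides of the box are transported along `σ`; the value `univ` off the range of `σ` never
  -- enters.
  have hinv : ∀ x, Function.extend σ t (fun _ => Set.univ) (σ x) = t x := fun x =>
    hσ.extend_apply _ _ _
  have h : (fun (ξ : ι → E) x => ξ (σ x)) ⁻¹' (Set.pi s t)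
      = Set.pi (s.image σ) (Function.extend σ t fun _ => Set.univ) := by
    ext ξ
    simp only [Set.mem_preimage, Set.mem_pi, Finset.mem_coe, Finset.mem_image]
    constructor
    · rintro h _ ⟨i, hi, rfl⟩
      rw [hinv]; exact h i hi
    · intro h i hi
      have := h (σ i) ⟨i, hi, rfl⟩
      rwa [hinv] at this
  rw [h, Measure.infinitePi_pi, Finset.prod_image fun i _ j _ hij => hσ hij]
  · simp only [hinv]
  · intro i hi
    obtain ⟨j, -, rfl⟩ := Finset.mem_image.1 hi
    rw [hinv]; exact ht j

end Glue

/-! ### Directed paths and partition functions in an i.i.d. field -/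

/-- The jump `e_i`. -/
def unitStep {d : ℕ} (i : Fin d) : Site d := Pi.single i 1

/-- The level (time coordinate) of a site. -/
def level {d : ℕ} (x : Site d) : ℤ := ∑ j, x j

theorem level_add {d : ℕ} (x y : Site d) : level (x + y) = level x + level y := by
  simp [level, Finset.sum_add_distrib]

theorem level_unitStep {d : ℕ} (i : Fin d) : level (unitStep i) = 1 := by
  simp [level, unitStep]

@[simp] theorem level_add_unitStep {d : ℕ} (x : Site d) (i : Fin d) :
    level (x + unitStep i) = level x + 1 := by
  rw [level_add, level_unitStep]

@[simp] theorem level_zero {d : ℕ} : level (0 : Site d) = 0 := by simp [level]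

/-- The position after `k` steps of the directed path which starts at `x` and makes steps `e`. -/
def dirPos {d n : ℕ} (x : Site d) (e : Fin n → Fin d) (k : ℕ) : Site d :=
  x + ∑ j : Fin n with j.val < k, unitStep (e j)

theorem dirPos_zero {d n : ℕ} (x : Site d) (e : Fin n → Fin d) : dirPos x e 0 = x := by
  simp [dirPos]

theorem dirPos_cons_succ {d n : ℕ} (x : Site d) (i : Fin d) (e : Fin n → Fin d) (k : ℕ) :
    dirPos x (Fin.cons i e : Fin (n + 1) → Fin d) (k + 1) = dirPos (x + unitStep i) e k := by
  simp only [dirPos, Finset.sum_filter]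
  rw [Fin.sum_univ_succ]
  simp [add_assoc]

theorem level_dirPos {d n : ℕ} (x : Site d) (e : Fin n → Fin d) {k : ℕ} (hk : k ≤ n) :
    level (dirPos x e k) = level x + k := by
  rw [dirPos, level_add]
  congr 1
  have : level (∑ j : Fin n with j.val < k, unitStep (e j))
      = ∑ j : Fin n with j.val < k, level (unitStep (e j)) := by
    simp only [level, Finset.sum_apply]
    exact Finset.sum_comm
  rw [this]
  simp only [level_unitStep, Finset.sum_const, nsmul_eq_mul, mul_one]
  norm_cast
  have : (Finset.univ.filter fun j : Fin n => j.val < k).card = k := by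
    rw [Fin.card_filter_val_lt]; omega
  exact this

section Partition

variable {d : ℕ} {E : Type*}

/-- The weight of a directed path. -/
def pathWt (w : E → Fin d → ℝ) (ξ : Site d → E) {n : ℕ} (x : Site d) (e : Fin n → Fin d) : ℝ :=
  ∏ i : Fin n, w (ξ (dirPos x e i)) (e i)

/-- The partition function of `n`-step directed paths from `x`, with terminal function `g`. -/
def part (w : E → Fin d → ℝ) (g : Site d → ℝ) (n : ℕ) (x : Site d) (ξ : Site d → E) : ℝ :=
  ∑ e : Fin n → Fin d, pathWt w ξ x e * g (dirPos x e n)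

/-- The partition function with free endpoint. -/
abbrev tot (w : E → Fin d → ℝ) (n : ℕ) (x : Site d) (ξ : Site d → E) : ℝ :=
  part w (fun _ => 1) n x ξ

/-- The point-to-point partition function. -/
abbrev ptp (w : E → Fin d → ℝ) (n : ℕ) (x y : Site d) (ξ : Site d → E) : ℝ :=
  part w (Pi.single y 1) n x ξ

variable {w : E → Fin d → ℝ}

@[simp] theorem part_zero (g : Site d → ℝ) (x : Site d) (ξ : Site d → E) :
    part w g 0 x ξ = g x := by
  simp [part, pathWt, dirPos_zero]

theorem pathWt_cons (ξ : Site d → E) {n : ℕ} (x : Site d) (i : Fin d) (e : Fin n → Fin d) :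
    pathWt w ξ x (Fin.cons i e : Fin (n + 1) → Fin d)
      = w (ξ x) i * pathWt w ξ (x + unitStep i) e := by
  simp only [pathWt]
  rw [Fin.prod_univ_succ]
  simp [dirPos_zero, dirPos_cons_succ]

theorem sum_cons {β : Type*} [AddCommMonoid β] {n : ℕ} (f : (Fin (n + 1) → Fin d) → β) :
    ∑ e, f e = ∑ i : Fin d, ∑ e : Fin n → Fin d, f (Fin.cons i e) := by
  rw [← (Fin.consEquiv fun _ => Fin d).sum_comp, Fintype.sum_prod_type]
  rfl

theorem part_succ (g : Site d → ℝ) (n : ℕ) (x : Site d) (ξ : Site d → E) :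
    part w g (n + 1) x ξ = ∑ i, w (ξ x) i * part w g n (x + unitStep i) ξ := by
  simp only [part, sum_cons, pathWt_cons, dirPos_cons_succ, Finset.mul_sum, mul_assoc]

theorem part_add (g : Site d → ℝ) (m n : ℕ) (x : Site d) (ξ : Site d → E) :
    part w g (m + n) x ξ
      = part w (fun y => part w g n y ξ) m x ξ := by
  induction m generalizing x with
  | zero => simp
  | succ m ih =>
    rw [show m + 1 + n = (m + n) + 1 by ring, part_succ, part_succ]
    simp only [ih]

/-- The weight of a step is read at the site that it leaves, so the terminal level is not looked at.
This half-open range of levels is what makes consecutive blocks independent. -/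
theorem part_dependsOn (g : Site d → ℝ) (n : ℕ) (x : Site d) :
    DependsOn (part w g n x) {y | level x ≤ level y ∧ level y < level x + n} := by
  induction n generalizing x with
  | zero => intro ξ ξ' _; simp
  | succ n ih =>
    intro ξ ξ' h
    rw [part_succ, part_succ, h x (by simp)]
    refine Finset.sum_congr rfl fun i _ => ?_
    rw [ih (x + unitStep i) fun y hy => h y ?_]
    simp only [Set.mem_ofPred_eq, level_add_unitStep] at hy ⊢
    push_cast
    omega

theorem part_mono (hw : ∀ r i, 0 ≤ w r i) {g g' : Site d → ℝ} {n : ℕ} {x : Site d}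
    (h : ∀ y, level y = level x + n → g y ≤ g' y) (ξ : Site d → E) :
    part w g n x ξ ≤ part w g' n x ξ :=
  Finset.sum_le_sum fun e _ => mul_le_mul_of_nonneg_left
    (h _ (level_dirPos x e le_rfl)) (Finset.prod_nonneg fun _ _ => hw _ _)

theorem part_nonneg (hw : ∀ r i, 0 ≤ w r i) {g : Site d → ℝ} (hg : ∀ y, 0 ≤ g y) (n : ℕ)
    (x : Site d) (ξ : Site d → E) : 0 ≤ part w g n x ξ :=
  Finset.sum_nonneg fun _ _ => mul_nonneg (Finset.prod_nonneg fun _ _ => hw _ _) (hg _)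

theorem part_sum {ι : Type*} (s : Finset ι) (g : ι → Site d → ℝ) (n : ℕ) (x : Site d)
    (ξ : Site d → E) :
    part w (fun y => ∑ i ∈ s, g i y) n x ξ = ∑ i ∈ s, part w (g i) n x ξ := by
  simp only [part, Finset.mul_sum]
  exact Finset.sum_comm

theorem part_const_mul (c : ℝ) (g : Site d → ℝ) (n : ℕ) (x : Site d) (ξ : Site d → E) :
    part w (fun y => c * g y) n x ξ = c * part w g n x ξ := by
  simp only [part, Finset.mul_sum]
  exact Finset.sum_congr rfl fun e _ => by ring

/-- The endpoints of `n`-step directed paths from `x`. -/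
def ends (n : ℕ) (x : Site d) : Finset (Site d) :=
  Finset.univ.image fun e : Fin n → Fin d => dirPos x e n

theorem level_of_mem_ends {n : ℕ} {x y : Site d} (h : y ∈ ends n x) :
    level y = level x + n := by
  obtain ⟨e, -, rfl⟩ := Finset.mem_image.1 h
  exact level_dirPos x e le_rfl

theorem part_eq_sum_ptp (g : Site d → ℝ) (n : ℕ) (x : Site d) (ξ : Site d → E) :
    part w g n x ξ = ∑ y ∈ ends n x, ptp w n x y ξ * g y := by
  simp only [ptp, part, Finset.sum_mul]
  rw [Finset.sum_comm]
  refine Finset.sum_congr rfl fun e _ => ?_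
  rw [Finset.sum_eq_single (dirPos x e n)]
  · simp
  · intro y _ hy
    simp [hy.symm]
  · intro h
    exact absurd (Finset.mem_image_of_mem _ (Finset.mem_univ e)) h

theorem ptp_eq_zero {n : ℕ} {x y : Site d} (h : y ∉ ends n x) (ξ : Site d → E) :
    ptp w n x y ξ = 0 := by
  refine Finset.sum_eq_zero fun e _ => ?_
  have : dirPos x e n ≠ y := fun he => h (he ▸ Finset.mem_image_of_mem _ (Finset.mem_univ e))
  simp [this]

theorem part_shift (n : ℕ) (x z : Site d) (ξ : Site d → E) :
    tot w n (z + x) ξ = tot w n x (fun y => ξ (z + y)) := by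
  simp only [tot, part, pathWt, dirPos, add_assoc]

end Partition

/-! ### Admissible weights -/

/-- The weights `w` are centered at the strictly positive probability vector `a`, with relative
fluctuations at most `t < 1`. -/
structure IsWeight {d : ℕ} {E : Type*} [MeasurableSpace E] (μ : Measure E) (a : Fin d → ℝ) (t : ℝ)
    (w : E → Fin d → ℝ) : Prop where
  meas : ∀ i, Measurable fun r => w r i
  pos : ∀ i, 0 < a i
  sum_one : ∑ i, a i = 1
  t_nonneg : 0 ≤ t
  t_lt : t < 1
  lower : ∀ r i, (1 - t) * a i ≤ w r i
  upper : ∀ r i, w r i ≤ (1 + t) * a i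
  mean : ∀ i, ∫ r, w r i ∂μ = a i

namespace IsWeight

variable {d : ℕ} {E : Type*} [MeasurableSpace E] {μ : Measure E} {a : Fin d → ℝ} {t : ℝ}
  {w : E → Fin d → ℝ}

theorem w_pos (h : IsWeight μ a t w) (r : E) (i : Fin d) : 0 < w r i :=
  (mul_pos (sub_pos.2 h.t_lt) (h.pos i)).trans_le (h.lower r i)

theorem w_nonneg (h : IsWeight μ a t w) (r : E) (i : Fin d) : 0 ≤ w r i := (h.w_pos r i).le

theorem a_nonneg (h : IsWeight μ a t w) (i : Fin d) : 0 ≤ a i := (h.pos i).le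

theorem bmeas (h : IsWeight μ a t w) (i : Fin d) : BMeas fun r => w r i :=
  ⟨h.meas i, (1 + t) * a i, fun r => by rw [abs_of_pos (h.w_pos r i)]; exact h.upper r i⟩

theorem bmeas_eval (h : IsWeight μ a t w) (i : Fin d) (x : Site d) :
    BMeas fun ξ : Site d → E => w (ξ x) i := (h.bmeas i).comp (measurable_pi_apply x)

theorem bmeas_pathWt (h : IsWeight μ a t w) {n : ℕ} (x : Site d) (e : Fin n → Fin d) :
    BMeas fun ξ : Site d → E => pathWt w ξ x e :=
  BMeas.prod _ fun i _ => h.bmeas_eval (e i) _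

theorem bmeas_part (h : IsWeight μ a t w) (g : Site d → ℝ) (n : ℕ) (x : Site d) :
    BMeas fun ξ : Site d → E => part w g n x ξ :=
  BMeas.sum _ fun e _ => (h.bmeas_pathWt x e).mul_const _

theorem pathWt_pos (h : IsWeight μ a t w) {n : ℕ} (x : Site d) (e : Fin n → Fin d)
    (ξ : Site d → E) : 0 < pathWt w ξ x e := Finset.prod_pos fun _ _ => h.w_pos _ _

/-- A deterministic bound away from zero: logarithms of `tot` and quotients by `tot` are bounded for
each fixed `n`, which settles their integrability. -/
theorem tot_lower (h : IsWeight μ a t w) (n : ℕ) (x : Site d) (ξ : Site d → E) :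
    (1 - t) ^ n ≤ tot w n x ξ := by
  induction n generalizing x with
  | zero => simp [tot]
  | succ n ih =>
    have h1 : 0 < 1 - t := sub_pos.2 h.t_lt
    calc (1 - t) ^ (n + 1) = ∑ i, ((1 - t) * a i) * (1 - t) ^ n := by
          rw [← Finset.sum_mul, ← Finset.mul_sum, h.sum_one]; ring
      _ ≤ tot w (n + 1) x ξ := by
          rw [tot, part_succ]
          exact Finset.sum_le_sum fun i _ => mul_le_mul (h.lower _ _) (ih _) (pow_nonneg h1.le n)
            (h.w_nonneg _ _)

theorem tot_pos (h : IsWeight μ a t w) (n : ℕ) (x : Site d) (ξ : Site d → E) :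
    0 < tot w n x ξ := (pow_pos (sub_pos.2 h.t_lt) n).trans_le (h.tot_lower n x ξ)

theorem tot_upper (h : IsWeight μ a t w) (n : ℕ) (x : Site d) (ξ : Site d → E) :
    tot w n x ξ ≤ (1 + t) ^ n := by
  induction n generalizing x with
  | zero => simp [tot]
  | succ n ih =>
    have h1 : 0 ≤ 1 + t := by linarith [h.t_nonneg]
    calc tot w (n + 1) x ξ ≤ ∑ i, ((1 + t) * a i) * (1 + t) ^ n := by
          rw [tot, part_succ]
          exact Finset.sum_le_sum fun i _ => mul_le_mul (h.upper _ _) (ih _) (h.tot_pos _ _ _).le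
            (mul_nonneg h1 (h.a_nonneg i))
      _ = (1 + t) ^ (n + 1) := by
          rw [← Finset.sum_mul, ← Finset.mul_sum, h.sum_one]; ring

variable [IsProbabilityMeasure μ]

theorem integral_w (h : IsWeight μ a t w) (i : Fin d) (x : Site d) :
    ∫ ξ, w (ξ x) i ∂fieldLaw (Site d) μ = a i := by
  rw [integral_eval (h.meas i), h.mean]

/-- A function of the environment at `x` is independent of a partition function that starts
at a higher level. -/
theorem integral_eval_mul_part (h : IsWeight μ a t w) {φ : E → ℝ} (hφ : BMeas φ) (g : Site d → ℝ)
    (n : ℕ) (x : Site d) (i : Fin d) :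
    ∫ ξ, φ (ξ x) * part w g n (x + unitStep i) ξ ∂fieldLaw (Site d) μ
      = (∫ r, φ r ∂μ) * ∫ ξ, part w g n (x + unitStep i) ξ ∂fieldLaw (Site d) μ := by
  rw [integral_mul_of_dependsOn (S := {x}) (hφ.comp (measurable_pi_apply x))
    (h.bmeas_part g n _) _ (part_dependsOn g n _), integral_eval hφ.meas]
  · rw [Set.disjoint_singleton_right]
    simp
  · intro ξ ξ' hx
    simp [hx x rfl]

theorem integral_tot (h : IsWeight μ a t w) (n : ℕ) (x : Site d) :
    ∫ ξ, tot w n x ξ ∂fieldLaw (Site d) μ = 1 := by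
  induction n generalizing x with
  | zero => simp [tot]
  | succ n ih =>
    simp only [tot, part_succ]
    rw [integral_finsetSum _ fun i _ =>
      ((h.bmeas_eval i x).mul (h.bmeas_part _ n _)).integrable _]
    simp only [h.integral_eval_mul_part (h.bmeas _), h.mean]
    refine (Finset.sum_congr rfl fun i _ => ?_).trans h.sum_one
    rw [ih (x + unitStep i), mul_one]

end IsWeight

/-! ### A strong law along a sequence with linearly growing second moments -/

/-- Along the squares `n = k²` the second moments of `X_n / n` are at most `C / k²`, hence summable,
and the terms tend to zero almost surely. The bounded increments fill the gaps between consecutive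
squares. -/
theorem ae_tendsto_div_of_sq_le {Ω : Type*} [MeasurableSpace Ω] {P : Measure Ω}
    {X : ℕ → Ω → ℝ} {C : ℝ} (hC : 0 ≤ C) (hm : ∀ n, Measurable (X n))
    (hi : ∀ n, Integrable (fun ω => X n ω ^ 2) P)
    (h2 : ∀ n, ∫ ω, X n ω ^ 2 ∂P ≤ C * n)
    (hinc : ∀ n ω, |X (n + 1) ω - X n ω| ≤ C) :
    ∀ᵐ ω ∂P, Tendsto (fun n : ℕ => X n ω / n) atTop (𝓝 0) := by
  have hsum : Summable fun k : ℕ => C / (k : ℝ) ^ 2 := by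
    simpa [div_eq_mul_inv] using (Real.summable_nat_pow_inv.2 (by norm_num : 1 < 2)).mul_left C
  have hfin : ∫⁻ ω, ∑' k : ℕ, ENNReal.ofReal ((X (k ^ 2) ω / (k : ℝ) ^ 2) ^ 2) ∂P ≠ ⊤ := by
    rw [lintegral_tsum fun k => ((((hm _).div_const _).pow_const _).ennreal_ofReal).aemeasurable]
    refine ne_top_of_le_ne_top hsum.tsum_ofReal_ne_top (ENNReal.tsum_le_tsum fun k => ?_)
    rw [← ofReal_integral_eq_lintegral_ofReal]
    · refine ENNReal.ofReal_le_ofReal ?_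
      simp only [div_pow]
      rw [integral_div]
      rcases Nat.eq_zero_or_pos k with rfl | hk
      · simp
      · have hk' : (0 : ℝ) < k := by exact_mod_cast hk
        rw [div_le_div_iff₀ (by positivity) (by positivity)]
        have := h2 (k ^ 2)
        push_cast at this
        calc _ ≤ (C * (k : ℝ) ^ 2) * (k : ℝ) ^ 2 := by gcongr
          _ = _ := by ring
    · simp only [div_pow]
      exact (hi _).div_const _
    · exact ae_of_all _ fun ω => sq_nonneg _
  have hae := ae_lt_top' (μ := P) (f := fun ω => ∑' k : ℕ,
    ENNReal.ofReal ((X (k ^ 2) ω / (k : ℝ) ^ 2) ^ 2))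
    (AEMeasurable.tsum fun k =>
      ((((hm _).div_const _).pow_const _).ennreal_ofReal).aemeasurable) hfin
  filter_upwards [hae] with ω hω
  have h0 : Tendsto (fun k : ℕ => |X (k ^ 2) ω / (k : ℝ) ^ 2|) atTop (𝓝 0) := by
    have h := ENNReal.tendsto_atTop_zero_of_tsum_ne_top hω.ne
    have h' := (ENNReal.tendsto_toReal ENNReal.zero_ne_top).comp h
    simp only [Function.comp_def, ENNReal.toReal_zero, ENNReal.toReal_ofReal (sq_nonneg _)] at h'
    have h'' := h'.sqrt
    simpa [Real.sqrt_sq_eq_abs] using h''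
  have hlip : ∀ m n : ℕ, |X (m + n) ω - X m ω| ≤ C * n := by
    intro m n
    induction n with
    | zero => simp
    | succ n ih =>
      calc |X (m + (n + 1)) ω - X m ω|
          = |(X (m + n + 1) ω - X (m + n) ω) + (X (m + n) ω - X m ω)| := by ring_nf
        _ ≤ C + C * n := (abs_add_le _ _).trans (add_le_add (hinc _ _) ih)
        _ = C * ((n + 1 : ℕ) : ℝ) := by push_cast; ring
  have hs : Tendsto (fun n : ℕ => Nat.sqrt n) atTop atTop := by
    refine tendsto_atTop.2 fun b => ?_
    filter_upwards [eventually_ge_atTop (b * b)] with n hn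
    exact Nat.le_sqrt.2 hn
  -- For `k² ≤ n ≤ k² + 2k` the increments cost at most `2kC`, which is `2C / k` after division by
  -- `k² ≤ n`.
  have hbound : Tendsto (fun k : ℕ => |X (k ^ 2) ω / (k : ℝ) ^ 2| + C * 2 / k) atTop (𝓝 0) := by
    simpa using h0.add (tendsto_const_div_atTop_nhds_zero_nat (C * 2))
  refine squeeze_zero_norm' ?_ (hbound.comp hs)
  filter_upwards [eventually_ge_atTop 1] with n hn
  have hk : 0 < Nat.sqrt n := Nat.sqrt_pos.2 hn
  obtain ⟨j, hj⟩ := Nat.exists_eq_add_of_le (Nat.sqrt_le' n)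
  have hj2 : j ≤ 2 * Nat.sqrt n := by
    have := Nat.sqrt_le_add n
    nlinarith
  simp only [Function.comp_def, Real.norm_eq_abs]
  set k := Nat.sqrt n
  have hk' : (0 : ℝ) < k := by exact_mod_cast hk
  have hn' : (k : ℝ) ^ 2 ≤ n := by exact_mod_cast Nat.sqrt_le' n
  have hX : |X n ω| ≤ |X (k ^ 2) ω| + C * (2 * k) := by
    have h1 := hlip (k ^ 2) j
    rw [← hj] at h1
    have h2 : C * j ≤ C * (2 * k) := by gcongr; exact_mod_cast hj2
    have h3 := abs_sub_abs_le_abs_sub (X n ω) (X (k ^ 2) ω)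
    linarith
  calc |X n ω / n| = |X n ω| / n := by rw [abs_div, Nat.abs_cast]
    _ ≤ (|X (k ^ 2) ω| + C * (2 * k)) / (k : ℝ) ^ 2 := by gcongr
    _ = |X (k ^ 2) ω / (k : ℝ) ^ 2| + C * 2 / k := by
      rw [abs_div, abs_of_pos (pow_pos hk' 2)]
      field_simp

/-! ### Weighted starting points -/

section Start

variable {d : ℕ} {E : Type*}

/-- The partition function with starting points `p i` of weight `ν i`. -/
def wtot (w : E → Fin d → ℝ) {ι : Type} (s : Finset ι) (ν : ι → ℝ) (p : ι → Site d) (n : ℕ)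
    (ξ : Site d → E) : ℝ := ∑ i ∈ s, ν i * tot w n (p i) ξ

variable {w : E → Fin d → ℝ} {ι : Type}

theorem wtot_succ (s : Finset ι) (ν : ι → ℝ) (p : ι → Site d) (n : ℕ) (ξ : Site d → E) :
    wtot w s ν p (n + 1) ξ = wtot w (s ×ˢ Finset.univ) (fun q => ν q.1 * w (ξ (p q.1)) q.2)
      (fun q => p q.1 + unitStep q.2) n ξ := by
  simp only [wtot, tot, part_succ, Finset.sum_product, Finset.mul_sum, mul_assoc]

/-- With level `k` frozen, the partition function is again one of a weighted family of starting
points, one level higher. This closure is why inductions over levels run over `wtot` with arbitrary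
weights and index types, and not over `tot`. -/
theorem wtot_glue {s : Finset ι} (ν : ι → ℝ) {p : ι → Site d} {k : ℤ}
    (hp : ∀ i ∈ s, level (p i) = k) (n : ℕ) (ξ ξ' : Site d → E) :
    wtot w s ν p (n + 1) (glue {x | level x = k} ξ ξ')
      = wtot w (s ×ˢ Finset.univ) (fun q => ν q.1 * w (ξ (p q.1)) q.2)
        (fun q => p q.1 + unitStep q.2) n ξ' := by
  rw [wtot_succ]
  refine Finset.sum_congr rfl fun q hq => ?_
  have hl := hp q.1 (Finset.mem_product.1 hq).1
  have h1 : glue {x | level x = k} ξ ξ' (p q.1) = ξ (p q.1) := glue_of_mem hl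
  have h2 := (part_dependsOn (w := w) (fun _ => 1) n (p q.1 + unitStep q.2)).glue_right
    (S := {x | level x = k}) (Set.disjoint_left.2 fun y hy hy' => by
      simp only [level_add_unitStep, Set.mem_ofPred_eq] at hy hy'
      omega) ξ ξ'
  simp only [tot, h1, h2]

theorem wtot_le {s : Finset ι} {ν ν' : ι → ℝ} (hw : ∀ r i, 0 ≤ w r i) {c : ℝ}
    (h : ∀ i ∈ s, ν i ≤ c * ν' i) (p : ι → Site d) (n : ℕ) (ξ : Site d → E) :
    wtot w s ν p n ξ ≤ c * wtot w s ν' p n ξ := by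
  rw [wtot, wtot, Finset.mul_sum]
  refine Finset.sum_le_sum fun i hi => ?_
  rw [← mul_assoc]
  exact mul_le_mul_of_nonneg_right (h i hi) (part_nonneg hw (fun _ => zero_le_one) _ _ _)

variable [MeasurableSpace E] {μ : Measure E} {a : Fin d → ℝ} {t : ℝ}

namespace IsWeight

theorem bmeas_wtot (h : IsWeight μ a t w) (s : Finset ι) (ν : ι → ℝ) (p : ι → Site d) (n : ℕ) :
    BMeas (fun ξ => wtot w s ν p n ξ) :=
  BMeas.sum _ fun i _ => (h.bmeas_part _ n (p i)).const_mul _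

theorem wtot_lower (h : IsWeight μ a t w) {s : Finset ι} {ν : ι → ℝ} (hν : ∀ i ∈ s, 0 ≤ ν i)
    (p : ι → Site d) (n : ℕ) (ξ : Site d → E) :
    (∑ i ∈ s, ν i) * (1 - t) ^ n ≤ wtot w s ν p n ξ := by
  rw [Finset.sum_mul]
  exact Finset.sum_le_sum fun i hi => mul_le_mul_of_nonneg_left (h.tot_lower _ _ _) (hν i hi)

theorem wtot_pos (h : IsWeight μ a t w) {s : Finset ι} (hs : s.Nonempty) {ν : ι → ℝ}
    (hν : ∀ i ∈ s, 0 < ν i) (p : ι → Site d) (n : ℕ) (ξ : Site d → E) :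
    0 < wtot w s ν p n ξ :=
  Finset.sum_pos (fun i hi => mul_pos (hν i hi) (h.tot_pos _ _ _)) hs

theorem bmeas_log_wtot (h : IsWeight μ a t w) {s : Finset ι} (hs : s.Nonempty) {ν : ι → ℝ}
    (hν : ∀ i ∈ s, 0 < ν i) (p : ι → Site d) (n : ℕ) :
    BMeas (fun ξ => Real.log (wtot w s ν p n ξ)) :=
  (h.bmeas_wtot s ν p n).log (mul_pos (Finset.sum_pos hν hs) (pow_pos (sub_pos.2 h.t_lt) n))
    (h.wtot_lower (fun i hi => (hν i hi).le) p n)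

variable [IsProbabilityMeasure μ]

/-- The variance is split by exposing the first level. Given that level, the induction hypothesis
bounds the variance of the rest. The conditional mean moves by at most `L = log((1+t)/(1-t))`,
because altering one level changes every path weight by a factor of at most `(1+t)/(1-t)`. -/
theorem variance_log_wtot_le [Nonempty (Fin d)] (h : IsWeight μ a t w) {s : Finset ι}
    (hs : s.Nonempty) {ν : ι → ℝ}
    (hν : ∀ i ∈ s, 0 < ν i) {p : ι → Site d} {k : ℤ} (hp : ∀ i ∈ s, level (p i) = k) (n : ℕ) :
    ∫ ξ, (Real.log (wtot w s ν p n ξ)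
        - ∫ ξ, Real.log (wtot w s ν p n ξ) ∂fieldLaw (Site d) μ) ^ 2 ∂fieldLaw (Site d) μ
      ≤ Real.log ((1 + t) / (1 - t)) ^ 2 * n := by
  induction n generalizing ι k with
  | zero => simp [wtot]
  | succ n ih =>
    have h1t : 0 < 1 - t := sub_pos.2 h.t_lt
    have h1t' : 0 < 1 + t := by linarith [h.t_nonneg]
    set L := Real.log ((1 + t) / (1 - t))
    set S : Set (Site d) := {x | level x = k} with hS
    set Q := fieldLaw (Site d) μ with hQ
    set F : (Site d → E) → ℝ := fun ξ => Real.log (wtot w s ν p (n + 1) ξ) with hF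
    have hFb : BMeas F := h.bmeas_log_wtot hs hν p (n + 1)
    set G : (Site d → E) × (Site d → E) → ℝ := fun q => F (glue S q.1 q.2) with hG
    have hGb : BMeas G := hFb.glue S
    set m : ℝ := ∫ ξ, F ξ ∂Q with hm
    set f : (Site d → E) → ℝ := fun ξ => ∫ ξ', G (ξ, ξ') ∂Q with hf
    have hfb : BMeas f := hGb.integral_right Q
    have hfm : ∫ ξ, f ξ ∂Q = m := (integral_eq_glue hFb S).symm
    have hGe : ∀ ξ ξ', G (ξ, ξ') = Real.log (wtot w (s ×ˢ Finset.univ)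
        (fun q => ν q.1 * w (ξ (p q.1)) q.2) (fun q => p q.1 + unitStep q.2) n ξ') := by
      intro ξ ξ'
      simp only [hG, hF, hS, wtot_glue ν hp]
    have hs' : (s ×ˢ (Finset.univ : Finset (Fin d))).Nonempty :=
      hs.product Finset.univ_nonempty
    have hν' : ∀ ξ : Site d → E, ∀ q ∈ s ×ˢ (Finset.univ : Finset (Fin d)),
        0 < ν q.1 * w (ξ (p q.1)) q.2 := fun ξ q hq =>
      mul_pos (hν _ (Finset.mem_product.1 hq).1) (h.w_pos _ _)
    have hin : ∀ ξ, ∫ ξ', (G (ξ, ξ') - f ξ) ^ 2 ∂Q ≤ L ^ 2 * n := by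
      intro ξ
      have := ih hs' (hν' ξ) (p := fun q => p q.1 + unitStep q.2) (k := k + 1) (fun q hq => by
        rw [level_add_unitStep, hp _ (Finset.mem_product.1 hq).1])
      simpa only [hf, hGe] using this
    have hdiff : ∀ ξ₁ ξ₂, f ξ₁ ≤ f ξ₂ + L := by
      intro ξ₁ ξ₂
      have hsec : ∀ ξ, BMeas fun ξ' => G (ξ, ξ') := fun ξ => hGb.comp measurable_prodMk_left
      have hle : ∀ ξ', G (ξ₁, ξ') ≤ G (ξ₂, ξ') + L := by
        intro ξ'
        rw [hGe, hGe, add_comm, ← Real.log_mul (by positivity)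
          (h.wtot_pos hs' (hν' ξ₂) _ n ξ').ne']
        refine Real.log_le_log (h.wtot_pos hs' (hν' ξ₁) _ n ξ')
          (wtot_le h.w_nonneg (fun q hq => ?_) _ _ _)
        have hq' := hν _ (Finset.mem_product.1 hq).1
        calc ν q.1 * w (ξ₁ (p q.1)) q.2 ≤ ν q.1 * ((1 + t) * a q.2) :=
              mul_le_mul_of_nonneg_left (h.upper _ _) hq'.le
          _ = (1 + t) / (1 - t) * (ν q.1 * ((1 - t) * a q.2)) := by
              field_simp
          _ ≤ _ := by
              have := h.lower (ξ₂ (p q.1)) q.2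
              gcongr
      calc f ξ₁ ≤ ∫ ξ', (G (ξ₂, ξ') + L) ∂Q :=
            integral_mono ((hsec ξ₁).integrable Q) (((hsec ξ₂).add (BMeas.const L)).integrable Q)
              hle
        _ = f ξ₂ + L := by
            rw [integral_add ((hsec ξ₂).integrable Q) (integrable_const _)]
            simp [hf]
    have hfdev : ∀ ξ, (f ξ - m) ^ 2 ≤ L ^ 2 := by
      intro ξ
      have hu : f ξ ≤ m + L := by
        have := integral_mono (μ := Q) (integrable_const (f ξ))
          ((hfb.add (BMeas.const L)).integrable Q) (fun ξ₂ => hdiff ξ ξ₂)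
        rw [integral_add (hfb.integrable Q) (integrable_const _), hfm] at this
        simpa using this
      have hl : m ≤ f ξ + L := by
        have := integral_mono (μ := Q) (hfb.integrable Q) (integrable_const (f ξ + L))
          (fun ξ₂ => hdiff ξ₂ ξ)
        rw [hfm] at this
        simpa using this
      have : |f ξ - m| ≤ L := abs_le.2 ⟨by linarith, by linarith⟩
      rw [← sq_abs]
      exact pow_le_pow_left₀ (abs_nonneg _) this 2
    -- Pythagoras: `f ξ` is the mean of `G (ξ, ·)`, so the cross term integrates to zero.
    have hkey : ∀ ξ, ∫ ξ', (G (ξ, ξ') - m) ^ 2 ∂Q ≤ L ^ 2 * n + L ^ 2 := by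
      intro ξ
      have hsec : BMeas fun ξ' => G (ξ, ξ') := hGb.comp measurable_prodMk_left
      have he : ∀ ξ', (G (ξ, ξ') - m) ^ 2 = (G (ξ, ξ') - f ξ) ^ 2
          + (2 * (f ξ - m) * G (ξ, ξ') + ((f ξ - m) ^ 2 - 2 * (f ξ - m) * f ξ)) := by
        intro ξ'; ring
      simp only [he]
      rw [integral_add (((hsec.sub (BMeas.const _)).pow 2).integrable Q)
        (((hsec.const_mul _).add (BMeas.const _)).integrable Q),
        integral_add ((hsec.const_mul _).integrable Q) (integrable_const _),
        integral_const_mul]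
      have h3 : ∫ ξ', G (ξ, ξ') ∂Q = f ξ := rfl
      rw [h3]
      simp only [integral_const, probReal_univ, smul_eq_mul, one_mul]
      linarith [hin ξ, hfdev ξ]
    calc ∫ ξ, (F ξ - m) ^ 2 ∂Q = ∫ ξ, ∫ ξ', (G (ξ, ξ') - m) ^ 2 ∂Q ∂Q :=
          integral_eq_glue ((hFb.sub (BMeas.const m)).pow 2) S
      _ ≤ ∫ _ξ, (L ^ 2 * n + L ^ 2) ∂Q :=
          integral_mono ((((hGb.sub (BMeas.const m)).pow 2).integral_right Q).integrable Q)
            (integrable_const _) hkey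
      _ = L ^ 2 * ((n + 1 : ℕ) : ℝ) := by simp; ring

end IsWeight

end Start

/-! ### The free energy -/

section

variable {d : ℕ} {E : Type*} {w : E → Fin d → ℝ}

theorem tot_add (m n : ℕ) (x : Site d) (ξ : Site d → E) :
    tot w (m + n) x ξ = ∑ y ∈ ends m x, ptp w m x y ξ * tot w n y ξ := by
  rw [tot, part_add, part_eq_sum_ptp]

theorem tot_eq_sum_ptp (n : ℕ) (x : Site d) (ξ : Site d → E) :
    tot w n x ξ = ∑ y ∈ ends n x, ptp w n x y ξ := by
  rw [tot, part_eq_sum_ptp]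
  simp

theorem ratio_dependsOn (n : ℕ) (x y : Site d) :
    DependsOn (fun ξ : Site d → E => ptp w n x y ξ / tot w n x ξ)
      {z | level x ≤ level z ∧ level z < level x + n} := by
  intro ξ ξ' hξ
  simp only [ptp, tot]
  rw [part_dependsOn _ n x hξ, part_dependsOn _ n x hξ]

namespace IsWeight

variable [MeasurableSpace E] {μ : Measure E} {a : Fin d → ℝ} {t : ℝ}

theorem ptp_nonneg (h : IsWeight μ a t w) (n : ℕ) (x y : Site d) (ξ : Site d → E) :
    0 ≤ ptp w n x y ξ :=
  part_nonneg h.w_nonneg (fun z => by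
    by_cases hz : z = y
    · subst hz; simp
    · simp [hz]) _ _ _

theorem bmeas_log_tot (h : IsWeight μ a t w) (n : ℕ) (x : Site d) :
    BMeas (fun ξ : Site d → E => Real.log (tot w n x ξ)) :=
  (h.bmeas_part _ n x).log (pow_pos (sub_pos.2 h.t_lt) n) (h.tot_lower n x)

theorem bmeas_ratio (h : IsWeight μ a t w) (n : ℕ) (x y : Site d) :
    BMeas (fun ξ : Site d → E => ptp w n x y ξ / tot w n x ξ) :=
  (h.bmeas_part _ n x).div (h.bmeas_part _ n x) (pow_pos (sub_pos.2 h.t_lt) n) (h.tot_lower n x)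

end IsWeight

end

section FreeEnergy

variable {d : ℕ} {E : Type*} [MeasurableSpace E]

/-- The mean of `log W_n`. -/
def meanLog (μ : Measure E) (w : E → Fin d → ℝ) (n : ℕ) : ℝ :=
  ∫ ξ, Real.log (tot w n 0 ξ) ∂fieldLaw (Site d) μ

/-- The limit of `E[log W_n] / n`. -/
def freeEnergy (μ : Measure E) (w : E → Fin d → ℝ) : ℝ :=
  limUnder atTop fun n : ℕ => meanLog μ w n / n

variable {μ : Measure E} [IsProbabilityMeasure μ] {a : Fin d → ℝ} {t : ℝ} {w : E → Fin d → ℝ}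

namespace IsWeight

theorem meanLog_shift (h : IsWeight μ a t w) (n : ℕ) (z : Site d) :
    ∫ ξ, Real.log (tot w n z ξ) ∂fieldLaw (Site d) μ = meanLog μ w n := by
  have hmp := measurePreserving_precomp (μ := μ) (add_right_injective z)
  have hb := h.bmeas_log_tot n (0 : Site d)
  rw [meanLog, ← hmp.map_eq, integral_map hmp.measurable.aemeasurable
    hb.meas.aestronglyMeasurable, hmp.map_eq]
  simp only [← part_shift, add_zero]

/-- Jensen's inequality in the form `log x ≤ x - 1`, together with `E[W_n] = 1`. -/
theorem meanLog_nonpos (h : IsWeight μ a t w) (n : ℕ) : meanLog μ w n ≤ 0 := by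
  have hb := h.bmeas_part (fun _ => 1) n (0 : Site d)
  calc meanLog μ w n ≤ ∫ ξ, (tot w n 0 ξ - 1) ∂fieldLaw (Site d) μ :=
        integral_mono ((h.bmeas_log_tot n 0).integrable _) ((hb.sub (BMeas.const 1)).integrable _)
          fun ξ => Real.log_le_sub_one_of_pos (h.tot_pos _ _ _)
    _ = 0 := by
        rw [integral_sub (hb.integrable _) (integrable_const _), h.integral_tot]
        simp

/-- By the Markov property, `W_{m+n} / W_m` is the average of restarted partition functions under
the endpoint law at time `m`; then apply concavity of the logarithm. -/
theorem log_tot_add_ge (h : IsWeight μ a t w) (m n : ℕ) (x : Site d) (ξ : Site d → E) :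
    Real.log (tot w m x ξ)
      + ∑ y ∈ ends m x, (ptp w m x y ξ / tot w m x ξ) * Real.log (tot w n y ξ)
      ≤ Real.log (tot w (m + n) x ξ) := by
  have hT := h.tot_pos m x ξ
  have hsum : ∑ y ∈ ends m x, ptp w m x y ξ / tot w m x ξ = 1 := by
    rw [← Finset.sum_div, ← tot_eq_sum_ptp, div_self hT.ne']
  have hJ := strictConcaveOn_log_Ioi.concaveOn.le_map_sum (t := ends m x)
    (w := fun y => ptp w m x y ξ / tot w m x ξ) (p := fun y => tot w n y ξ)
    (fun y _ => div_nonneg (h.ptp_nonneg _ _ _ _) hT.le) hsum (fun y _ => h.tot_pos _ _ _)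
  simp only [smul_eq_mul] at hJ
  have he : tot w (m + n) x ξ
      = tot w m x ξ * ∑ y ∈ ends m x, ptp w m x y ξ / tot w m x ξ * tot w n y ξ := by
    rw [tot_add, Finset.mul_sum]
    exact Finset.sum_congr rfl fun y _ => by field_simp
  have hpos : 0 < ∑ y ∈ ends m x, ptp w m x y ξ / tot w m x ξ * tot w n y ξ := by
    have := h.tot_pos (m + n) x ξ
    rw [he] at this
    exact pos_of_mul_pos_right this hT.le
  rw [he, Real.log_mul hT.ne' hpos.ne']
  linarith

/-- In the Jensen bound the endpoint masses depend on levels below `m` and the restarted logarithms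
on levels from `m` on. By independence and stationarity each term has mean endpoint mass times
`meanLog μ w n`, and the masses sum to one. Fekete's lemma then gives the limit. -/
theorem meanLog_add_le (h : IsWeight μ a t w) (m n : ℕ) :
    meanLog μ w m + meanLog μ w n ≤ meanLog μ w (m + n) := by
  set Q := fieldLaw (Site d) μ
  have hlog : ∀ y : Site d, DependsOn (fun ξ : Site d → E => Real.log (tot w n y ξ))
      {z | level y ≤ level z ∧ level z < level y + n} := by
    intro y ξ ξ' hξ
    simp only [tot]
    rw [part_dependsOn _ n y hξ]
  have hterm : ∀ y ∈ ends m (0 : Site d),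
      ∫ ξ, (ptp w m 0 y ξ / tot w m 0 ξ) * Real.log (tot w n y ξ) ∂Q
        = (∫ ξ, ptp w m 0 y ξ / tot w m 0 ξ ∂Q) * meanLog μ w n := by
    intro y hy
    rw [integral_mul_of_dependsOn (h.bmeas_ratio m 0 y) (h.bmeas_log_tot n y)
      (ratio_dependsOn m 0 y) (hlog y), h.meanLog_shift]
    refine Set.disjoint_left.2 fun z hz hz' => ?_
    have := level_of_mem_ends hy
    simp only [Set.mem_ofPred_eq] at hz hz'
    omega
  have hb : ∀ y ∈ ends m (0 : Site d),
      BMeas fun ξ : Site d → E => (ptp w m 0 y ξ / tot w m 0 ξ) * Real.log (tot w n y ξ) :=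
    fun y _ => (h.bmeas_ratio m 0 y).mul (h.bmeas_log_tot n y)
  have hmain := integral_mono (μ := Q)
    (((h.bmeas_log_tot m 0).add (BMeas.sum _ hb)).integrable Q)
    ((h.bmeas_log_tot (m + n) 0).integrable Q) (fun ξ => h.log_tot_add_ge m n 0 ξ)
  rw [integral_add ((h.bmeas_log_tot m 0).integrable Q) ((BMeas.sum _ hb).integrable Q),
    integral_finsetSum _ fun y hy => (hb y hy).integrable Q, Finset.sum_congr rfl hterm,
    ← Finset.sum_mul, ← integral_finsetSum _ fun y _ => (h.bmeas_ratio m 0 y).integrable Q] at hmain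
  have h1 : ∀ ξ : Site d → E, ∑ y ∈ ends m 0, ptp w m 0 y ξ / tot w m 0 ξ = 1 := fun ξ => by
    rw [← Finset.sum_div, ← tot_eq_sum_ptp, div_self (h.tot_pos _ _ _).ne']
  simp only [h1] at hmain
  simpa [meanLog] using hmain

theorem tendsto_meanLog (h : IsWeight μ a t w) :
    Tendsto (fun n : ℕ => meanLog μ w n / n) atTop (𝓝 (freeEnergy μ w)) := by
  refine tendsto_nhds_limUnder ?_
  have hsub : Subadditive fun n => -meanLog μ w n := fun m n => by
    have := h.meanLog_add_le m n
    linarith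
  have hbdd : BddBelow (Set.range fun n : ℕ => -meanLog μ w n / n) := by
    refine ⟨0, ?_⟩
    rintro _ ⟨n, rfl⟩
    exact div_nonneg (neg_nonneg.2 (h.meanLog_nonpos n)) (Nat.cast_nonneg n)
  have := (hsub.tendsto_lim hbdd).neg
  exact ⟨_, by simpa [neg_div] using this⟩

theorem freeEnergy_nonpos (h : IsWeight μ a t w) : freeEnergy μ w ≤ 0 :=
  le_of_tendsto' h.tendsto_meanLog fun n =>
    div_nonpos_of_nonpos_of_nonneg (h.meanLog_nonpos n) (Nat.cast_nonneg n)

theorem abs_log_tot_succ_sub_le (h : IsWeight μ a t w) (n : ℕ) (x : Site d) (ξ : Site d → E) :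
    |Real.log (tot w (n + 1) x ξ) - Real.log (tot w n x ξ)|
      ≤ max |Real.log (1 - t)| |Real.log (1 + t)| := by
  have hT := h.tot_pos n x ξ
  have h1 : 0 < 1 - t := sub_pos.2 h.t_lt
  have h2 : 0 < 1 + t := by linarith [h.t_nonneg]
  have hl : (1 - t) * tot w n x ξ ≤ tot w (n + 1) x ξ := by
    rw [tot_add, tot_eq_sum_ptp n, Finset.mul_sum]
    refine Finset.sum_le_sum fun y _ => ?_
    rw [mul_comm]
    exact mul_le_mul_of_nonneg_left (by simpa using h.tot_lower 1 y ξ) (h.ptp_nonneg _ _ _ _)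
  have hu : tot w (n + 1) x ξ ≤ (1 + t) * tot w n x ξ := by
    rw [tot_add, tot_eq_sum_ptp n, Finset.mul_sum]
    refine Finset.sum_le_sum fun y _ => ?_
    rw [mul_comm (1 + t)]
    exact mul_le_mul_of_nonneg_left (by simpa using h.tot_upper 1 y ξ) (h.ptp_nonneg _ _ _ _)
  refine abs_le_max_abs_abs ?_ ?_
  · have := Real.log_le_log (mul_pos h1 hT) hl
    rw [Real.log_mul h1.ne' hT.ne'] at this
    linarith
  · have := Real.log_le_log (h.tot_pos _ _ _) hu
    rw [Real.log_mul h2.ne' hT.ne'] at this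
    linarith

/-- The centered variables `log W_n - E log W_n` have second moments at most linear in `n` and
uniformly bounded increments, so the strong law above applies to them. -/
theorem ae_tendsto_log_tot [Nonempty (Fin d)] (h : IsWeight μ a t w) :
    ∀ᵐ ξ ∂fieldLaw (Site d) μ,
      Tendsto (fun n : ℕ => Real.log (tot w n 0 ξ) / n) atTop (𝓝 (freeEnergy μ w)) := by
  set Q := fieldLaw (Site d) μ
  set M := max |Real.log (1 - t)| |Real.log (1 + t)|
  set L := Real.log ((1 + t) / (1 - t)) ^ 2
  have hM : 0 ≤ M := (abs_nonneg _).trans (le_max_left _ _)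
  have hX : ∀ n, BMeas fun ξ : Site d → E => Real.log (tot w n 0 ξ) - meanLog μ w n :=
    fun n => (h.bmeas_log_tot n 0).sub (BMeas.const _)
  have hvar : ∀ n : ℕ, ∫ ξ, (Real.log (tot w n 0 ξ) - meanLog μ w n) ^ 2 ∂Q ≤ L * n := by
    intro n
    have := h.variance_log_wtot_le (s := {()}) (by simp) (ν := fun _ => 1) (by simp)
      (p := fun _ => (0 : Site d)) (k := 0) (by simp) n
    simp only [wtot, Finset.sum_singleton, one_mul] at this
    exact this
  have hdm : ∀ n, |meanLog μ w (n + 1) - meanLog μ w n| ≤ M := by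
    intro n
    rw [meanLog, meanLog, ← integral_sub ((h.bmeas_log_tot _ 0).integrable _)
      ((h.bmeas_log_tot _ 0).integrable _)]
    exact BMeas.abs_integral_le fun ξ => h.abs_log_tot_succ_sub_le n 0 ξ
  have hae := ae_tendsto_div_of_sq_le (P := Q) (C := L + 2 * M)
    (X := fun n ξ => Real.log (tot w n 0 ξ) - meanLog μ w n) (by positivity)
    (fun n => (hX n).meas) (fun n => ((hX n).pow 2).integrable Q)
    (fun n => (hvar n).trans (by gcongr; linarith))
    (fun n ξ => by
      have h1 := h.abs_log_tot_succ_sub_le n 0 ξ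
      have h2 := hdm n
      have h3 : 0 ≤ L := sq_nonneg _
      rw [abs_le] at h1 h2 ⊢
      constructor <;> linarith [h1.1, h1.2, h2.1, h2.2])
  filter_upwards [hae] with ξ hξ
  have := hξ.add h.tendsto_meanLog
  simpa [← add_div] using this

/-- The free energy vanishes if `W_n` does not tend to `0` in probability. -/
theorem freeEnergy_eq_zero_of_prob [Nonempty (Fin d)] (h : IsWeight μ a t w) {δ : ℝ} (hδ : 0 < δ)
    (hP : ∀ n : ℕ, ENNReal.ofReal δ ≤ fieldLaw (Site d) μ {ξ | δ ≤ tot w n 0 ξ}) :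
    freeEnergy μ w = 0 := by
  by_contra hne
  have hneg : freeEnergy μ w < 0 := lt_of_le_of_ne h.freeEnergy_nonpos hne
  set Q := fieldLaw (Site d) μ
  have hm : ∀ n : ℕ, MeasurableSet {ξ : Site d → E | δ ≤ tot w n 0 ξ} := fun n =>
    measurableSet_le measurable_const (h.bmeas_part _ n 0).meas
  -- A negative free energy would send `W_n` to zero almost surely, and dominated convergence would
  -- send the probability of `{δ ≤ W_n}` to zero, against the uniform lower bound.
  have hae : ∀ᵐ ξ ∂Q, Tendsto (fun n : ℕ => tot w n 0 ξ) atTop (𝓝 0) := by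
    filter_upwards [h.ae_tendsto_log_tot] with ξ hξ
    have h1 : Tendsto (fun n : ℕ => Real.log (tot w n 0 ξ) / n * n) atTop atBot :=
      hξ.neg_mul_atTop hneg tendsto_natCast_atTop_atTop
    have h2 : Tendsto (fun n : ℕ => Real.log (tot w n 0 ξ)) atTop atBot := by
      refine h1.congr' ?_
      filter_upwards [eventually_ne_atTop 0] with n hn
      field_simp
    refine (Real.tendsto_exp_atBot.comp h2).congr fun n => ?_
    exact Real.exp_log (h.tot_pos n 0 ξ)
  have hlim : Tendsto (fun n => ∫ ξ, Set.indicator {ξ : Site d → E | δ ≤ tot w n 0 ξ}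
      (fun _ => (1 : ℝ)) ξ ∂Q) atTop (𝓝 (∫ _ξ, (0 : ℝ) ∂Q)) := by
    refine tendsto_integral_of_dominated_convergence (fun _ => 1)
      (fun n => ((measurable_const.indicator (hm n))).aestronglyMeasurable) (integrable_const _)
      (fun n => ae_of_all _ fun ξ => ?_) ?_
    · by_cases hξ : δ ≤ tot w n 0 ξ <;> simp [Set.indicator, hξ]
    · filter_upwards [hae] with ξ hξ
      refine tendsto_const_nhds.congr' ?_
      filter_upwards [hξ.eventually (gt_mem_nhds hδ)] with n hn
      simp [Set.indicator, not_le.2 hn]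
  simp only [integral_zero] at hlim
  have hge : ∀ n, δ ≤ ∫ ξ, Set.indicator {ξ : Site d → E | δ ≤ tot w n 0 ξ}
      (fun _ => (1 : ℝ)) ξ ∂Q := by
    intro n
    rw [integral_indicator (hm n)]
    simp only [integral_const, smul_eq_mul, mul_one, measureReal_restrict_apply_univ]
    rw [Measure.real]
    exact (ENNReal.ofReal_le_iff_le_toReal (measure_ne_top _ _)).1 (hP n)
  exact absurd (ge_of_tendsto' hlim hge) (not_le.2 hδ)

/-- Exponential decay of a fractional moment implies that the free energy is negative. -/
theorem freeEnergy_neg_of_sqrt (h : IsWeight μ a t w) {N : ℕ} (hN : 0 < N) {ρ : ℝ} (hρ : 0 < ρ)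
    (hρ1 : ρ < 1)
    (hP : ∀ m : ℕ, ∫ ξ, √(tot w (N * m) 0 ξ) ∂fieldLaw (Site d) μ ≤ ρ ^ m) :
    freeEnergy μ w < 0 := by
  have hlogρ : Real.log ρ < 0 := Real.log_neg hρ hρ1
  have hN' : (0 : ℝ) < N := by exact_mod_cast hN
  have hbound : ∀ m : ℕ, meanLog μ w (N * m) ≤ 2 * m * Real.log ρ := by
    intro m
    set I := ∫ ξ, √(tot w (N * m) 0 ξ) ∂fieldLaw (Site d) μ with hI
    have hbs := (h.bmeas_part (fun _ => 1) (N * m) (0 : Site d)).sqrt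
    have hIpos : 0 < I := by
      have h1 : 0 < 1 - t := sub_pos.2 h.t_lt
      have hlow := integral_mono (μ := fieldLaw (Site d) μ)
        (integrable_const (√((1 - t) ^ (N * m)))) (hbs.integrable _)
        (fun ξ => Real.sqrt_le_sqrt (h.tot_lower (N * m) 0 ξ))
      have : 0 < √((1 - t) ^ (N * m)) := Real.sqrt_pos.2 (pow_pos h1 _)
      simp only [integral_const, probReal_univ, smul_eq_mul, one_mul] at hlow
      exact this.trans_le hlow
    -- The tangent line of the logarithm at `I`, evaluated at `√W`. Integrating it gives Jensen's
    -- inequality `E log W ≤ 2 log E√W`.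
    have hpt : ∀ ξ : Site d → E, Real.log (tot w (N * m) 0 ξ)
        ≤ 2 * (Real.log I + (√(tot w (N * m) 0 ξ) / I - 1)) := by
      intro ξ
      have hs : 0 < √(tot w (N * m) 0 ξ) := Real.sqrt_pos.2 (h.tot_pos _ _ _)
      have h1 := Real.log_le_sub_one_of_pos (div_pos hs hIpos)
      rw [Real.log_div hs.ne' hIpos.ne', Real.log_sqrt (h.tot_pos _ _ _).le] at h1
      linarith
    have hint := integral_mono (μ := fieldLaw (Site d) μ) ((h.bmeas_log_tot (N * m) 0).integrable _)
      (((((hbs.div_const I).sub (BMeas.const 1)).const_mul 1).const_mul 2 |>.add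
        (BMeas.const (2 * Real.log I))).integrable _)
      (fun ξ => (hpt ξ).trans (le_of_eq (by ring :
        _ = 2 * (1 * (√(tot w (N * m) 0 ξ) / I - 1)) + 2 * Real.log I)))
    rw [integral_add ((((hbs.div_const I).sub (BMeas.const 1)).const_mul 1).const_mul 2
      |>.integrable _) (integrable_const _), integral_const_mul, integral_const_mul,
      integral_sub ((hbs.div_const I).integrable _) (integrable_const _), integral_div,
      ← hI, div_self hIpos.ne'] at hint
    simp only [integral_const, probReal_univ, smul_eq_mul, one_mul, sub_self, mul_zero,
      zero_add] at hint
    have hlogI := Real.log_le_log hIpos (hP m)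
    rw [Real.log_pow] at hlogI
    calc meanLog μ w (N * m) ≤ 2 * Real.log I := hint
      _ ≤ 2 * m * Real.log ρ := by linarith
  have hsub : Tendsto (fun m : ℕ => N * m) atTop atTop :=
    tendsto_id.const_mul_atTop' hN
  have hle : freeEnergy μ w ≤ 2 * Real.log ρ / N := by
    refine le_of_tendsto (h.tendsto_meanLog.comp hsub) ?_
    filter_upwards [eventually_gt_atTop 0] with m hm
    have hm' : (0 : ℝ) < m := by exact_mod_cast hm
    simp only [Function.comp_def, Nat.cast_mul]
    rw [div_le_div_iff₀ (by positivity) hN']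
    nlinarith [hbound m]
  exact hle.trans_lt (div_neg_of_neg_of_pos (by linarith) hN')

/-- Changing the weights by a bounded factor. -/
theorem freeEnergy_le_add {w' : E → Fin d → ℝ} {t' : ℝ} (h : IsWeight μ a t w)
    (h' : IsWeight μ a t' w') {c : ℝ} (hc : 0 < c) (hww : ∀ r i, w r i ≤ c * w' r i) :
    freeEnergy μ w ≤ freeEnergy μ w' + Real.log c := by
  have hpt : ∀ (n : ℕ) (x : Site d) (ξ : Site d → E), tot w n x ξ ≤ c ^ n * tot w' n x ξ := by
    intro n
    induction n with
    | zero => intro x ξ; simp [tot]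
    | succ n ih =>
      intro x ξ
      simp only [tot, part_succ, Finset.mul_sum]
      refine Finset.sum_le_sum fun i _ => ?_
      calc w (ξ x) i * tot w n (x + unitStep i) ξ
          ≤ (c * w' (ξ x) i) * (c ^ n * tot w' n (x + unitStep i) ξ) :=
            mul_le_mul (hww _ _) (ih _ _) (h.tot_pos _ _ _).le
              (mul_nonneg hc.le (h'.w_nonneg _ _))
        _ = _ := by ring
  refine le_of_tendsto_of_tendsto h.tendsto_meanLog
    (h'.tendsto_meanLog.add_const (Real.log c)) ?_
  filter_upwards [eventually_gt_atTop 0] with n hn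
  have hn' : (0 : ℝ) < n := by exact_mod_cast hn
  have hint := integral_mono (μ := fieldLaw (Site d) μ) ((h.bmeas_log_tot n 0).integrable _)
    (((h'.bmeas_log_tot n 0).add (BMeas.const (n * Real.log c))).integrable _) (fun ξ => by
      have := Real.log_le_log (h.tot_pos n 0 ξ) (hpt n 0 ξ)
      rw [Real.log_mul (pow_pos hc n).ne' (h'.tot_pos _ _ _).ne', Real.log_pow] at this
      linarith)
  rw [integral_add ((h'.bmeas_log_tot n 0).integrable _) (integrable_const _)] at hint
  simp only [integral_const, probReal_univ, smul_eq_mul, one_mul] at hint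
  rw [div_le_iff₀ hn', add_mul, div_mul_cancel₀ _ hn'.ne']
  change meanLog μ w n ≤ meanLog μ w' n + n * Real.log c at hint
  linarith

/-- Scaling down the fluctuations of the weights increases `E[log W_n]`. -/
theorem integral_log_wtot_antitone [Nonempty (Fin d)] {w' : E → Fin d → ℝ} {t' s : ℝ}
    (h : IsWeight μ a t w) (h' : IsWeight μ a t' w') (hs0 : 0 ≤ s) (hs1 : s ≤ 1)
    (hww : ∀ r i, w r i = a i + s * (w' r i - a i))
    {ι : Type} {S : Finset ι} (hS : S.Nonempty) {ν : ι → ℝ} (hν : ∀ i ∈ S, 0 < ν i)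
    {p : ι → Site d} {k : ℤ} (hp : ∀ i ∈ S, level (p i) = k) (n : ℕ) :
    ∫ ξ, Real.log (wtot w' S ν p n ξ) ∂fieldLaw (Site d) μ
      ≤ ∫ ξ, Real.log (wtot w S ν p n ξ) ∂fieldLaw (Site d) μ := by
  induction n generalizing ι k with
  | zero => simp [wtot]
  | succ n ih =>
    set Q := fieldLaw (Site d) μ
    set A : Set (Site d) := {x | level x = k} with hA
    have hS' : (S ×ˢ (Finset.univ : Finset (Fin d))).Nonempty := hS.product Finset.univ_nonempty
    have hν' : ∀ (v : E → Fin d → ℝ), (∀ r i, 0 < v r i) → ∀ ξ : Site d → E,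
        ∀ q ∈ S ×ˢ (Finset.univ : Finset (Fin d)),
        0 < ν q.1 * v (ξ (p q.1)) q.2 := fun v hv ξ q hq =>
      mul_pos (hν _ (Finset.mem_product.1 hq).1) (hv _ _)
    have hp' : ∀ q ∈ S ×ˢ (Finset.univ : Finset (Fin d)),
        level (p q.1 + unitStep q.2) = k + 1 := fun q hq => by
      rw [level_add_unitStep, hp _ (Finset.mem_product.1 hq).1]
    -- `mix ξ ξ'` uses the weights `w` at the first level and `w'` afterwards.
    set mix : (Site d → E) × (Site d → E) → ℝ := fun z => ∑ q ∈ S ×ˢ (Finset.univ : Finset (Fin d)),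
      (ν q.1 * w (z.1 (p q.1)) q.2) * tot w' n (p q.1 + unitStep q.2) z.2 with hmix
    have hmixb : BMeas mix := BMeas.sum _ fun q _ =>
      (((h.bmeas_eval q.2 (p q.1)).comp measurable_fst).const_mul (ν q.1)).mul
        ((h'.bmeas_part _ n _).comp measurable_snd)
    set low : ℝ := ∑ q ∈ S ×ˢ (Finset.univ : Finset (Fin d)),
      (ν q.1 * ((1 - t) * a q.2)) * (1 - t') ^ n with hlow
    have h1t : 0 < 1 - t := sub_pos.2 h.t_lt
    have h1t' : 0 < 1 - t' := sub_pos.2 h'.t_lt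
    have hlowpos : 0 < low := Finset.sum_pos (fun q hq => mul_pos (mul_pos
      (hν _ (Finset.mem_product.1 hq).1) (mul_pos h1t (h.pos _))) (pow_pos h1t' n)) hS'
    have hlowle : ∀ z, low ≤ mix z := fun z => Finset.sum_le_sum fun q hq =>
      mul_le_mul (mul_le_mul_of_nonneg_left (h.lower _ _) (hν _ (Finset.mem_product.1 hq).1).le)
        (h'.tot_lower _ _ _) (pow_pos h1t' n).le (hν' w h.w_pos _ _ hq).le
    have hlogmix : BMeas fun z => Real.log (mix z) := hmixb.log hlowpos hlowle
    have hF : BMeas fun ξ => Real.log (wtot w S ν p (n + 1) ξ) := h.bmeas_log_wtot hS hν p _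
    have hF' : BMeas fun ξ => Real.log (wtot w' S ν p (n + 1) ξ) := h'.bmeas_log_wtot hS hν p _
    -- With the first level frozen, its weights become initial masses of the next level, so the
    -- induction hypothesis compares the later levels.
    have step1 : ∫ ξ, ∫ ξ', Real.log (mix (ξ, ξ')) ∂Q ∂Q
        ≤ ∫ ξ, Real.log (wtot w S ν p (n + 1) ξ) ∂Q := by
      rw [integral_eq_glue hF A]
      refine integral_mono ((hlogmix.integral_right Q).integrable Q)
        (((hF.glue A).integral_right Q).integrable Q) fun ξ => ?_
      simp only [hA, wtot_glue ν hp]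
      exact ih hS' (hν' w h.w_pos ξ) hp'
    -- Now the later levels are frozen and only the first level is integrated. The partition
    -- function `X` has mean `m`, and passing from `w'` to `w` at this level replaces `X` by `(1-s)
    -- m + s X`. Concavity gives `E log((1-s) m + s X) ≥ (1-s) log m + s E log X`, and Jensen's `log
    -- m ≥ E log X` bounds this below by `E log X`.
    have step2 : ∫ ξ, Real.log (wtot w' S ν p (n + 1) ξ) ∂Q
        ≤ ∫ ξ, ∫ ξ', Real.log (mix (ξ, ξ')) ∂Q ∂Q := by
      rw [integral_eq_glue' hF' A,
        integral_integral_swap (f := fun ξ ξ' => Real.log (mix (ξ, ξ')))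
          (hlogmix.integrable (Q.prod Q))]
      refine integral_mono (((hF'.glue A).integral_left Q).integrable Q)
        ((hlogmix.integral_left Q).integrable Q) fun ξ' => ?_
      simp only [hA, wtot_glue ν hp]
      set b : ι × Fin d → ℝ := fun q => tot w' n (p q.1 + unitStep q.2) ξ' with hb
      set m : ℝ := ∑ q ∈ S ×ˢ (Finset.univ : Finset (Fin d)), (ν q.1 * a q.2) * b q with hm
      have hbpos : ∀ q, 0 < b q := fun q => h'.tot_pos _ _ _
      have hmpos : 0 < m := Finset.sum_pos (fun q hq => mul_pos (mul_pos
        (hν _ (Finset.mem_product.1 hq).1) (h.pos _)) (hbpos q)) hS'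
      set X : (Site d → E) → ℝ := fun ξ => wtot w' (S ×ˢ Finset.univ)
        (fun q => ν q.1 * w' (ξ (p q.1)) q.2) (fun q => p q.1 + unitStep q.2) n ξ' with hX
      have hXe : ∀ ξ, X ξ = ∑ q ∈ S ×ˢ (Finset.univ : Finset (Fin d)),
        (ν q.1 * w' (ξ (p q.1)) q.2) * b q := fun ξ => rfl
      have hXb : BMeas X := BMeas.sum _ fun q _ =>
        ((h'.bmeas_eval q.2 (p q.1)).const_mul _).mul_const _
      have hXpos : ∀ ξ, 0 < X ξ := fun ξ => h'.wtot_pos hS' (hν' w' h'.w_pos ξ) _ _ _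
      have hXint : ∫ ξ, X ξ ∂Q = m := by
        simp only [hXe]
        rw [integral_finsetSum _ fun q _ =>
          (((h'.bmeas_eval q.2 (p q.1)).const_mul _).mul_const _).integrable Q]
        refine Finset.sum_congr rfl fun q _ => ?_
        rw [integral_mul_const, integral_const_mul, h'.integral_w]
      have hmixe : ∀ ξ, mix (ξ, ξ') = (1 - s) * m + s * X ξ := by
        intro ξ
        rw [hXe, hm, Finset.mul_sum, Finset.mul_sum, ← Finset.sum_add_distrib]
        refine Finset.sum_congr rfl fun q _ => ?_
        simp only [hww]
        ring
      have hlogX : BMeas fun ξ => Real.log (X ξ) := by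
        refine hXb.log (δ := (∑ q ∈ S ×ˢ (Finset.univ : Finset (Fin d)),
          (ν q.1 * ((1 - t') * a q.2)) * b q)) (Finset.sum_pos (fun q hq => mul_pos (mul_pos
            (hν _ (Finset.mem_product.1 hq).1) (mul_pos h1t' (h.pos _))) (hbpos q)) hS') ?_
        intro ξ
        exact Finset.sum_le_sum fun q hq => mul_le_mul_of_nonneg_right
          (mul_le_mul_of_nonneg_left (h'.lower _ _) (hν _ (Finset.mem_product.1 hq).1).le)
          (hbpos q).le
      have hconc : ∀ ξ, (1 - s) * Real.log m + s * Real.log (X ξ) ≤ Real.log (mix (ξ, ξ')) := by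
        intro ξ
        rw [hmixe]
        exact strictConcaveOn_log_Ioi.concaveOn.2 (Set.mem_Ioi.2 hmpos) (Set.mem_Ioi.2 (hXpos ξ))
          (by linarith) hs0 (by ring)
      have hjen : ∫ ξ, Real.log (X ξ) ∂Q ≤ Real.log m := by
        have hpt : ∀ ξ, Real.log (X ξ) ≤ X ξ * m⁻¹ + (Real.log m - 1) := by
          intro ξ
          have := Real.log_le_sub_one_of_pos (div_pos (hXpos ξ) hmpos)
          rw [Real.log_div (hXpos ξ).ne' hmpos.ne', div_eq_mul_inv] at this
          linarith
        have := integral_mono (μ := Q) (hlogX.integrable Q)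
          (((hXb.mul_const m⁻¹).add (BMeas.const _)).integrable Q) hpt
        rw [integral_add ((hXb.mul_const m⁻¹).integrable Q) (integrable_const _),
          integral_mul_const, hXint, mul_inv_cancel₀ hmpos.ne'] at this
        simpa using this
      have hint := integral_mono (μ := Q)
        (((hlogX.const_mul s).add (BMeas.const ((1 - s) * Real.log m))).integrable Q)
        ((hlogmix.comp measurable_prodMk_right).integrable Q)
        (fun ξ => (add_comm _ _).trans_le (hconc ξ))
      rw [integral_add ((hlogX.const_mul s).integrable Q) (integrable_const _),
        integral_const_mul] at hint
      simp only [integral_const, probReal_univ, smul_eq_mul, one_mul] at hint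
      calc ∫ ξ, Real.log (X ξ) ∂Q
          = s * ∫ ξ, Real.log (X ξ) ∂Q + (1 - s) * ∫ ξ, Real.log (X ξ) ∂Q := by ring
        _ ≤ s * ∫ ξ, Real.log (X ξ) ∂Q + (1 - s) * Real.log m := by
            have : 0 ≤ 1 - s := by linarith
            gcongr
        _ ≤ _ := hint
    exact step2.trans step1

theorem freeEnergy_antitone [Nonempty (Fin d)] {w' : E → Fin d → ℝ} {t' s : ℝ}
    (h : IsWeight μ a t w) (h' : IsWeight μ a t' w') (hs0 : 0 ≤ s) (hs1 : s ≤ 1)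
    (hww : ∀ r i, w r i = a i + s * (w' r i - a i)) :
    freeEnergy μ w' ≤ freeEnergy μ w := by
  refine le_of_tendsto_of_tendsto' h'.tendsto_meanLog h.tendsto_meanLog fun n => ?_
  have := h.integral_log_wtot_antitone h' hs0 hs1 hww (S := {()}) (by simp) (ν := fun _ => 1)
    (by simp) (p := fun _ => (0 : Site d)) (k := 0) (by simp) n
  simp only [wtot, Finset.sum_singleton, one_mul] at this
  exact div_le_div_of_nonneg_right this (Nat.cast_nonneg n)

end IsWeight

end FreeEnergy

/-! ### The increments of `log W_n` and the overlap of the endpoint law -/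

/-- Applying `log y ≤ y - 1` to `y = √(1+u)` and not to `1+u` produces a quadratic gain. -/
theorem Real.log_one_add_le {u : ℝ} (h1 : -1 < u) (h2 : u ≤ 1) :
    Real.log (1 + u) ≤ u - u ^ 2 / 8 := by
  have hs : √(1 + u) ≤ 1 + u / 2 - u ^ 2 / 16 := by
    refine Real.sqrt_le_iff.2 ⟨by nlinarith, ?_⟩
    have : 0 ≤ u ^ 2 * (2 - u) := mul_nonneg (sq_nonneg _) (by linarith)
    nlinarith [sq_nonneg (u ^ 2)]
  have hpos : 0 < 1 + u := by linarith
  have := Real.log_le_sub_one_of_pos (Real.sqrt_pos.2 hpos)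
  rw [Real.log_sqrt hpos.le] at this
  linarith

/-- From `log y ≥ 1 - 1/y` at `y = 1 + u`; the bound `1 + u ≥ 1 - t` makes the quadratic loss
uniform. -/
theorem Real.le_log_one_add {u t : ℝ} (ht : t < 1) (h1 : -t ≤ u) :
    u - u ^ 2 / (1 - t) ≤ Real.log (1 + u) := by
  have hpos : 0 < 1 + u := by linarith
  have h := Real.one_sub_inv_le_log_of_pos hpos
  have h2 : u - u ^ 2 / (1 + u) = 1 - (1 + u)⁻¹ := by field_simp; ring
  have h3 : u ^ 2 / (1 + u) ≤ u ^ 2 / (1 - t) :=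
    div_le_div_of_nonneg_left (sq_nonneg _) (by linarith) (by linarith)
  linarith

/-! ### Averages of bounded orthogonal variables. -/

theorem integral_sum_sq_le_of_orthogonal {Ω : Type*} [MeasurableSpace Ω] {P : Measure Ω}
    [IsProbabilityMeasure P] {ψ : ℕ → Ω → ℝ} (hb : ∀ k, BMeas (ψ k)) {C : ℝ}
    (hC : ∀ k ω, |ψ k ω| ≤ C) (ho : ∀ j k, j < k → ∫ ω, ψ j ω * ψ k ω ∂P = 0) (n : ℕ) :
    ∫ ω, (∑ k ∈ Finset.range n, ψ k ω) ^ 2 ∂P ≤ C ^ 2 * n := by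
  induction n with
  | zero => simp
  | succ n ih =>
    have hS : BMeas fun ω => ∑ k ∈ Finset.range n, ψ k ω := BMeas.sum _ fun k _ => hb k
    have hcross : ∫ ω, (∑ k ∈ Finset.range n, ψ k ω) * ψ n ω ∂P = 0 := by
      simp only [Finset.sum_mul]
      rw [integral_finsetSum _ fun k _ => ((hb k).mul (hb n)).integrable P]
      exact Finset.sum_eq_zero fun k hk => ho k n (Finset.mem_range.1 hk)
    have hsq : ∫ ω, ψ n ω ^ 2 ∂P ≤ C ^ 2 := by
      have := integral_mono (μ := P) (((hb n).pow 2).integrable P) (integrable_const (C ^ 2))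
        (fun ω => by
          rw [← sq_abs]
          exact pow_le_pow_left₀ (abs_nonneg _) (hC n ω) 2)
      simpa using this
    have he : ∀ ω, (∑ k ∈ Finset.range (n + 1), ψ k ω) ^ 2
        = (∑ k ∈ Finset.range n, ψ k ω) ^ 2
          + (2 * ((∑ k ∈ Finset.range n, ψ k ω) * ψ n ω) + ψ n ω ^ 2) := fun ω => by
      rw [Finset.sum_range_succ]; ring
    simp only [he]
    rw [integral_add ((hS.pow 2).integrable P)
      ((((hS.mul (hb n)).const_mul 2).add ((hb n).pow 2)).integrable P),
      integral_add (((hS.mul (hb n)).const_mul 2).integrable P) (((hb n).pow 2).integrable P),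
      integral_const_mul, hcross]
    push_cast
    linarith

theorem ae_tendsto_avg_of_orthogonal {Ω : Type*} [MeasurableSpace Ω] {P : Measure Ω}
    [IsProbabilityMeasure P] {ψ : ℕ → Ω → ℝ} (hb : ∀ k, BMeas (ψ k)) {C : ℝ}
    (hC : ∀ k ω, |ψ k ω| ≤ C) (ho : ∀ j k, j < k → ∫ ω, ψ j ω * ψ k ω ∂P = 0) :
    ∀ᵐ ω ∂P, Tendsto (fun n : ℕ => (∑ k ∈ Finset.range n, ψ k ω) / n) atTop (𝓝 0) := by
  have hS : ∀ n, BMeas fun ω => ∑ k ∈ Finset.range n, ψ k ω := fun n => BMeas.sum _ fun k _ => hb k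
  have hne : Nonempty Ω := P.nonempty_of_neZero
  have hC0 : 0 ≤ C := (abs_nonneg _).trans (hC 0 hne.some)
  refine ae_tendsto_div_of_sq_le (C := C ^ 2 + C) (by positivity) (fun n => (hS n).meas)
    (fun n => ((hS n).pow 2).integrable P)
    (fun n => (integral_sum_sq_le_of_orthogonal hb hC ho n).trans (by gcongr; linarith))
    (fun n ω => ?_)
  rw [Finset.sum_range_succ, add_sub_cancel_left]
  exact (hC n ω).trans (by nlinarith [sq_nonneg C])

section Overlap

variable {d : ℕ} {E : Type*}

/-- The fluctuation of the total weight of a site. -/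
def fluct (w : E → Fin d → ℝ) (r : E) : ℝ := ∑ i, w r i - 1

/-- The endpoint law of the directed polymer of length `n` which starts at `0`. -/
def endLaw (w : E → Fin d → ℝ) (n : ℕ) (x : Site d) (ξ : Site d → E) : ℝ :=
  ptp w n 0 x ξ / tot w n 0 ξ

/-- The relative increment of `W_n`. -/
def relInc (w : E → Fin d → ℝ) (n : ℕ) (ξ : Site d → E) : ℝ :=
  ∑ y ∈ ends n 0, endLaw w n y ξ * fluct w (ξ y)

/-- The overlap of two independent copies of the endpoint. -/
def overlap (w : E → Fin d → ℝ) (n : ℕ) (ξ : Site d → E) : ℝ :=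
  ∑ y ∈ ends n 0, endLaw w n y ξ ^ 2

/-- The largest mass of the endpoint law. -/
def maxEnd (w : E → Fin d → ℝ) (n : ℕ) (ξ : Site d → E) : ℝ := ⨆ x, endLaw w n x ξ

variable {w : E → Fin d → ℝ} [MeasurableSpace E] {μ : Measure E} {a : Fin d → ℝ} {t : ℝ}

namespace IsWeight

theorem abs_fluct_le (h : IsWeight μ a t w) (r : E) : |fluct w r| ≤ t := by
  have h1 : ∑ i, (1 - t) * a i ≤ ∑ i, w r i := Finset.sum_le_sum fun i _ => h.lower r i
  have h2 : ∑ i, w r i ≤ ∑ i, (1 + t) * a i := Finset.sum_le_sum fun i _ => h.upper r i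
  rw [← Finset.mul_sum, h.sum_one] at h1 h2
  rw [fluct, abs_le]
  constructor <;> linarith

theorem bmeas_fluct (h : IsWeight μ a t w) : BMeas (fluct w) :=
  (BMeas.sum _ fun i _ => h.bmeas i).sub (BMeas.const 1)

theorem bmeas_fluct_eval (h : IsWeight μ a t w) (x : Site d) :
    BMeas fun ξ : Site d → E => fluct w (ξ x) := h.bmeas_fluct.comp (measurable_pi_apply x)

theorem integral_fluct [IsProbabilityMeasure μ] (h : IsWeight μ a t w) :
    ∫ r, fluct w r ∂μ = 0 := by
  simp only [fluct]
  rw [integral_sub ((BMeas.sum _ fun i _ => h.bmeas i).integrable μ) (integrable_const _),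
    integral_finsetSum _ fun i _ => (h.bmeas i).integrable μ]
  simp [h.mean, h.sum_one]

theorem endLaw_nonneg (h : IsWeight μ a t w) (n : ℕ) (x : Site d) (ξ : Site d → E) :
    0 ≤ endLaw w n x ξ := div_nonneg (h.ptp_nonneg _ _ _ _) (h.tot_pos _ _ _).le

theorem sum_endLaw (h : IsWeight μ a t w) (n : ℕ) (ξ : Site d → E) :
    ∑ y ∈ ends n 0, endLaw w n y ξ = 1 := by
  simp only [endLaw]
  rw [← Finset.sum_div, ← tot_eq_sum_ptp, div_self (h.tot_pos _ _ _).ne']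

theorem endLaw_eq_zero {n : ℕ} {x : Site d} (hx : x ∉ ends n 0) (ξ : Site d → E) :
    endLaw w n x ξ = 0 := by rw [endLaw, ptp_eq_zero hx, zero_div]

theorem endLaw_le_one (h : IsWeight μ a t w) (n : ℕ) (x : Site d) (ξ : Site d → E) :
    endLaw w n x ξ ≤ 1 := by
  by_cases hx : x ∈ ends n 0
  · rw [← h.sum_endLaw n ξ]
    exact Finset.single_le_sum (fun y _ => h.endLaw_nonneg n y ξ) hx
  · rw [endLaw_eq_zero hx]; exact zero_le_one

theorem bddAbove_endLaw (h : IsWeight μ a t w) (n : ℕ) (ξ : Site d → E) :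
    BddAbove (Set.range fun x => endLaw w n x ξ) :=
  ⟨1, by rintro _ ⟨x, rfl⟩; exact h.endLaw_le_one n x ξ⟩

theorem maxEnd_nonneg (h : IsWeight μ a t w) (n : ℕ) (ξ : Site d → E) : 0 ≤ maxEnd w n ξ :=
  Real.iSup_nonneg fun x => h.endLaw_nonneg n x ξ

theorem maxEnd_le_one (h : IsWeight μ a t w) (n : ℕ) (ξ : Site d → E) : maxEnd w n ξ ≤ 1 :=
  ciSup_le fun x => h.endLaw_le_one n x ξ

theorem overlap_nonneg (n : ℕ) (ξ : Site d → E) : 0 ≤ overlap w n ξ :=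
  Finset.sum_nonneg fun _ _ => sq_nonneg _

theorem overlap_le_maxEnd (h : IsWeight μ a t w) (n : ℕ) (ξ : Site d → E) :
    overlap w n ξ ≤ maxEnd w n ξ := by
  calc overlap w n ξ ≤ ∑ y ∈ ends n 0, maxEnd w n ξ * endLaw w n y ξ :=
        Finset.sum_le_sum fun y _ => by
          rw [sq]
          exact mul_le_mul_of_nonneg_right (le_ciSup (h.bddAbove_endLaw n ξ) y)
            (h.endLaw_nonneg n y ξ)
    _ = maxEnd w n ξ := by rw [← Finset.mul_sum, h.sum_endLaw, mul_one]

/-- The square of each mass is a single term of the overlap. Together with `overlap_le_maxEnd`,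
averages of the overlap and of the largest mass vanish simultaneously. -/
theorem maxEnd_le_sqrt_overlap (n : ℕ) (ξ : Site d → E) :
    maxEnd w n ξ ≤ √(overlap w n ξ) := by
  refine ciSup_le fun x => Real.le_sqrt_of_sq_le ?_
  by_cases hx : x ∈ ends n 0
  · exact Finset.single_le_sum (f := fun y => endLaw w n y ξ ^ 2) (fun y _ => sq_nonneg _) hx
  · rw [endLaw_eq_zero hx]
    simpa using overlap_nonneg n ξ

theorem abs_relInc_le (h : IsWeight μ a t w) (n : ℕ) (ξ : Site d → E) : |relInc w n ξ| ≤ t := by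
  calc |relInc w n ξ| ≤ ∑ y ∈ ends n 0, |endLaw w n y ξ * fluct w (ξ y)| :=
        Finset.abs_sum_le_sum_abs _ _
    _ ≤ ∑ y ∈ ends n 0, endLaw w n y ξ * t := Finset.sum_le_sum fun y _ => by
        rw [abs_mul, abs_of_nonneg (h.endLaw_nonneg n y ξ)]
        exact mul_le_mul_of_nonneg_left (h.abs_fluct_le _) (h.endLaw_nonneg n y ξ)
    _ = t := by rw [← Finset.sum_mul, h.sum_endLaw, one_mul]

/-- The last step multiplies the mass ending at `y` by the total weight `1 + fluct w (ξ y)` of that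
site; divide by `W_n` and average over the endpoint law. -/
theorem tot_succ_eq (h : IsWeight μ a t w) (n : ℕ) (ξ : Site d → E) :
    tot w (n + 1) 0 ξ = tot w n 0 ξ * (1 + relInc w n ξ) := by
  have h1 : ∀ y : Site d, tot w 1 y ξ = 1 + fluct w (ξ y) := fun y => by
    rw [tot, part_succ]; simp [fluct]
  have hT := (h.tot_pos n 0 ξ).ne'
  rw [tot_add, relInc, mul_add, mul_one, Finset.mul_sum]
  nth_rewrite 1 [tot_eq_sum_ptp]
  rw [← Finset.sum_add_distrib]
  refine Finset.sum_congr rfl fun y _ => ?_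
  rw [h1, endLaw]
  field_simp

theorem log_tot_eq_sum (h : IsWeight μ a t w) (n : ℕ) (ξ : Site d → E) :
    Real.log (tot w n 0 ξ) = ∑ k ∈ Finset.range n, Real.log (1 + relInc w k ξ) := by
  induction n with
  | zero => simp [tot]
  | succ n ih =>
    have h1 := (abs_le.1 (h.abs_relInc_le n ξ)).1
    have h2 := h.t_lt
    rw [h.tot_succ_eq, Real.log_mul (h.tot_pos _ _ _).ne' (by linarith), ih,
      Finset.sum_range_succ]

theorem bmeas_endLaw (h : IsWeight μ a t w) (n : ℕ) (x : Site d) :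
    BMeas (fun ξ : Site d → E => endLaw w n x ξ) := h.bmeas_ratio n 0 x

theorem endLaw_dependsOn (n : ℕ) (x : Site d) :
    DependsOn (fun ξ : Site d → E => endLaw w n x ξ) {z | level z < n} :=
  (ratio_dependsOn n 0 x).mono fun z hz => by
    simp only [Set.mem_ofPred_eq, level_zero, zero_add] at hz ⊢
    exact hz.2

theorem bmeas_relInc (h : IsWeight μ a t w) (n : ℕ) :
    BMeas (fun ξ : Site d → E => relInc w n ξ) :=
  BMeas.sum _ fun y _ => (h.bmeas_endLaw n y).mul (h.bmeas_fluct_eval y)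

theorem bmeas_overlap (h : IsWeight μ a t w) (n : ℕ) :
    BMeas (fun ξ : Site d → E => overlap w n ξ) :=
  BMeas.sum _ fun y _ => (h.bmeas_endLaw n y).pow 2

theorem overlap_dependsOn (n : ℕ) :
    DependsOn (fun ξ : Site d → E => overlap w n ξ) {z | level z < n} := by
  intro ξ ξ' hξ
  exact Finset.sum_congr rfl fun y _ => congrArg (· ^ 2) (endLaw_dependsOn n y hξ)

theorem relInc_dependsOn (n : ℕ) :
    DependsOn (fun ξ : Site d → E => relInc w n ξ) {z | level z < n + 1} := by
  intro ξ ξ' hξ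
  refine Finset.sum_congr rfl fun y hy => ?_
  have hl : level y = n := by simpa using level_of_mem_ends hy
  have h1 : endLaw w n y ξ = endLaw w n y ξ' :=
    endLaw_dependsOn n y fun z hz => hξ z (by
      simp only [Set.mem_ofPred_eq] at hz ⊢
      omega)
  rw [h1, hξ y (by simp [hl])]

variable [IsProbabilityMeasure μ]

/-- The martingale difference property: endpoint masses at time `n` depend on levels below `n`,
while the fluctuations multiplying them sit on level `n` and are centered. -/
theorem integral_mul_relInc (h : IsWeight μ a t w) {G : (Site d → E) → ℝ} (hG : BMeas G) {n : ℕ}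
    (hGd : DependsOn G {z | level z < n}) :
    ∫ ξ, G ξ * relInc w n ξ ∂fieldLaw (Site d) μ = 0 := by
  simp only [relInc, Finset.mul_sum]
  rw [integral_finsetSum _ fun y _ =>
    (hG.mul ((h.bmeas_endLaw n y).mul (h.bmeas_fluct_eval y))).integrable _]
  refine Finset.sum_eq_zero fun y hy => ?_
  have hl : level y = n := by simpa using level_of_mem_ends hy
  simp only [← mul_assoc]
  rw [integral_mul_of_dependsOn (S := {z | level z < n}) (T := {y})
    (hG.mul (h.bmeas_endLaw n y)) (h.bmeas_fluct_eval y), integral_eval h.bmeas_fluct.meas,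
    h.integral_fluct, mul_zero]
  · intro ξ ξ' hξ
    simp only [hGd hξ, endLaw_dependsOn n y hξ]
  · intro ξ ξ' hξ
    simp only [hξ y rfl]
  · simp [hl]

theorem integral_fluct_mul_fluct (h : IsWeight μ a t w) (x y : Site d) :
    ∫ ξ, fluct w (ξ x) * fluct w (ξ y) ∂fieldLaw (Site d) μ
      = if x = y then ∫ r, fluct w r ^ 2 ∂μ else 0 := by
  split_ifs with hxy
  · subst hxy
    simp only [← sq]
    exact integral_eval (f := fun r => fluct w r ^ 2) (h.bmeas_fluct.pow 2).meas x
  · rw [integral_mul_of_dependsOn (S := {x}) (T := {y}) (h.bmeas_fluct_eval x)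
      (h.bmeas_fluct_eval y), integral_eval h.bmeas_fluct.meas, h.integral_fluct, zero_mul]
    · intro ξ ξ' hξ
      simp only [hξ x rfl]
    · intro ξ ξ' hξ
      simp only [hξ y rfl]
    · simpa using fun hyx => hxy hyx.symm

/-- The conditional variance of the increment is `v` times the overlap: fluctuations at distinct
sites of level `n` are uncorrelated, so only the diagonal of the squared sum survives. -/
theorem integral_mul_sq_sub (h : IsWeight μ a t w) {G : (Site d → E) → ℝ} (hG : BMeas G) {n : ℕ}
    (hGd : DependsOn G {z | level z < n}) :
    ∫ ξ, G ξ * (relInc w n ξ ^ 2 - (∫ r, fluct w r ^ 2 ∂μ) * overlap w n ξ)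
      ∂fieldLaw (Site d) μ = 0 := by
  set v := ∫ r, fluct w r ^ 2 ∂μ
  have he : ∀ ξ : Site d → E, G ξ * (relInc w n ξ ^ 2 - v * overlap w n ξ)
      = ∑ x ∈ ends n 0, ∑ y ∈ ends n 0, (G ξ * endLaw w n x ξ * endLaw w n y ξ)
        * (fluct w (ξ x) * fluct w (ξ y) - if x = y then v else 0) := by
    intro ξ
    simp only [mul_sub, Finset.sum_sub_distrib]
    congr 1
    · rw [sq, relInc, Finset.sum_mul_sum, Finset.mul_sum]
      refine Finset.sum_congr rfl fun x _ => ?_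
      rw [Finset.mul_sum]
      exact Finset.sum_congr rfl fun y _ => by ring
    · rw [overlap, Finset.mul_sum, Finset.mul_sum]
      refine Finset.sum_congr rfl fun x hx => ?_
      simp only [mul_ite, mul_zero]
      rw [Finset.sum_ite_eq, if_pos hx]
      ring
  have hb : ∀ x y : Site d, BMeas fun ξ : Site d → E => (G ξ * endLaw w n x ξ * endLaw w n y ξ)
        * (fluct w (ξ x) * fluct w (ξ y) - if x = y then v else 0) := fun x y =>
    ((hG.mul (h.bmeas_endLaw n x)).mul (h.bmeas_endLaw n y)).mul
      (((h.bmeas_fluct_eval x).mul (h.bmeas_fluct_eval y)).sub (BMeas.const _))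
  simp only [he]
  rw [integral_finsetSum _ fun x _ => (BMeas.sum _ fun y _ => hb x y).integrable _]
  refine Finset.sum_eq_zero fun x hx => ?_
  rw [integral_finsetSum _ fun y _ => (hb x y).integrable _]
  refine Finset.sum_eq_zero fun y hy => ?_
  have hlx : level x = n := by simpa using level_of_mem_ends hx
  have hly : level y = n := by simpa using level_of_mem_ends hy
  rw [integral_mul_of_dependsOn (S := {z | level z < n}) (T := {z | level z = n})
    ((hG.mul (h.bmeas_endLaw n x)).mul (h.bmeas_endLaw n y))
    (((h.bmeas_fluct_eval x).mul (h.bmeas_fluct_eval y)).sub (BMeas.const _)),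
    integral_sub (((h.bmeas_fluct_eval x).mul (h.bmeas_fluct_eval y)).integrable _)
    (integrable_const _), h.integral_fluct_mul_fluct]
  · simp [v]
  · intro ξ ξ' hξ
    simp only [hGd hξ, endLaw_dependsOn n x hξ, endLaw_dependsOn n y hξ]
  · intro ξ ξ' hξ
    simp only [hξ x hlx, hξ y hly]
  · exact Set.disjoint_left.2 fun z hz hz' => by
      simp only [Set.mem_ofPred_eq] at hz hz'
      omega

theorem ae_tendsto_avg_relInc (h : IsWeight μ a t w) :
    ∀ᵐ ξ ∂fieldLaw (Site d) μ,
      Tendsto (fun n : ℕ => (∑ k ∈ Finset.range n, relInc w k ξ) / n) atTop (𝓝 0) :=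
  ae_tendsto_avg_of_orthogonal (fun k => h.bmeas_relInc k) (fun k ξ => h.abs_relInc_le k ξ)
    fun j k hjk => h.integral_mul_relInc (h.bmeas_relInc j)
      ((relInc_dependsOn j).mono fun z hz => by
        simp only [Set.mem_ofPred_eq] at hz ⊢
        omega)

theorem ae_tendsto_avg_relInc_sq (h : IsWeight μ a t w) :
    ∀ᵐ ξ ∂fieldLaw (Site d) μ,
      Tendsto (fun n : ℕ => (∑ k ∈ Finset.range n,
        (relInc w k ξ ^ 2 - (∫ r, fluct w r ^ 2 ∂μ) * overlap w k ξ)) / n) atTop (𝓝 0) := by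
  have hv0 : 0 ≤ ∫ r, fluct w r ^ 2 ∂μ := integral_nonneg fun r => sq_nonneg _
  have hb : ∀ k, BMeas fun ξ : Site d → E =>
      relInc w k ξ ^ 2 - (∫ r, fluct w r ^ 2 ∂μ) * overlap w k ξ := fun k =>
    ((h.bmeas_relInc k).pow 2).sub ((h.bmeas_overlap k).const_mul _)
  refine ae_tendsto_avg_of_orthogonal (C := t ^ 2 + ∫ r, fluct w r ^ 2 ∂μ) hb (fun k ξ => ?_)
    fun j k hjk => h.integral_mul_sq_sub (hb j) ?_
  · have h1 : relInc w k ξ ^ 2 ≤ t ^ 2 := by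
      rw [← sq_abs]
      exact pow_le_pow_left₀ (abs_nonneg _) (h.abs_relInc_le k ξ) 2
    have h2 : overlap w k ξ ≤ 1 := (h.overlap_le_maxEnd k ξ).trans (h.maxEnd_le_one k ξ)
    have h3 := overlap_nonneg (w := w) k ξ
    rw [abs_le]
    constructor <;> nlinarith [sq_nonneg (relInc w k ξ)]
  · intro ξ ξ' hξ
    have h1 : relInc w j ξ = relInc w j ξ' := relInc_dependsOn j fun z hz => hξ z (by
      simp only [Set.mem_ofPred_eq] at hz ⊢
      omega)
    have h2 : overlap w j ξ = overlap w j ξ' := overlap_dependsOn j fun z hz => hξ z (by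
      simp only [Set.mem_ofPred_eq] at hz ⊢
      omega)
    simp only [h1, h2]

variable [Nonempty (Fin d)]

/-- Summing `log(1+u) ≥ u - u²/(1-t)` over the increments: the linear terms average to zero and the
squares average like `v` times the overlap, so linear decay of `log W_n` forces a positive averaged
overlap. -/
theorem ae_eventually_overlap_ge (h : IsWeight μ a t w) (hp : freeEnergy μ w < 0) :
    ∃ δ > 0, ∀ᵐ ξ ∂fieldLaw (Site d) μ,
      ∀ᶠ n : ℕ in atTop, δ ≤ (∑ k ∈ Finset.range n, overlap w k ξ) / n := by
  set p := freeEnergy μ w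
  set v := ∫ r, fluct w r ^ 2 ∂μ with hv
  have hv0 : 0 ≤ v := integral_nonneg fun r => sq_nonneg _
  have h1t : 0 < 1 - t := sub_pos.2 h.t_lt
  -- The denominator `v + 1` in place of `v` avoids showing first that `v` is nonzero; the factor
  -- `1/2` absorbs the vanishing averages.
  refine ⟨-p / 2 * (1 - t) / (v + 1), by
    have : 0 < -p := by linarith
    positivity, ?_⟩
  filter_upwards [h.ae_tendsto_avg_relInc, h.ae_tendsto_avg_relInc_sq, h.ae_tendsto_log_tot]
    with ξ h1 h2 h3
  have hlim : Tendsto (fun n : ℕ => -(Real.log (tot w n 0 ξ) / n)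
      + ((∑ k ∈ Finset.range n, relInc w k ξ) / n)
      - ((∑ k ∈ Finset.range n, (relInc w k ξ ^ 2 - v * overlap w k ξ)) / n) / (1 - t))
      atTop (𝓝 (-p)) := by
    have := (h3.neg.add h1).sub (h2.div_const (1 - t))
    simpa using this
  filter_upwards [hlim.eventually (lt_mem_nhds (by linarith : -p / 2 < -p)),
    eventually_gt_atTop 0] with n hn hn0
  have hn' : (0 : ℝ) < n := by exact_mod_cast hn0
  have hsum : ∑ k ∈ Finset.range n, (relInc w k ξ - relInc w k ξ ^ 2 / (1 - t))
      ≤ Real.log (tot w n 0 ξ) := by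
    rw [h.log_tot_eq_sum]
    exact Finset.sum_le_sum fun k _ => Real.le_log_one_add h.t_lt
      (abs_le.1 (h.abs_relInc_le k ξ)).1
  rw [Finset.sum_sub_distrib, ← Finset.sum_div] at hsum
  rw [Finset.sum_sub_distrib, ← Finset.mul_sum] at hn
  set A := ∑ k ∈ Finset.range n, relInc w k ξ
  set B := ∑ k ∈ Finset.range n, relInc w k ξ ^ 2
  set O := ∑ k ∈ Finset.range n, overlap w k ξ
  have hO : 0 ≤ O := Finset.sum_nonneg fun k _ => overlap_nonneg k ξ
  have h4 : -p / 2 < v * O / (1 - t) / n := by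
    have h5 : (A - B / (1 - t)) / n ≤ Real.log (tot w n 0 ξ) / n :=
      div_le_div_of_nonneg_right hsum hn'.le
    have h6 : (A - B / (1 - t)) / n = A / n - B / (1 - t) / n := sub_div _ _ _
    have h7 : (B - v * O) / n / (1 - t) = B / (1 - t) / n - v * O / (1 - t) / n := by
      field_simp
    linarith
  rw [div_le_iff₀ (by positivity)]
  have h8 : -p / 2 * (1 - t) < v * (O / n) := by
    have : v * O / (1 - t) / n = v * (O / n) / (1 - t) := by field_simp
    rw [this, lt_div_iff₀ h1t] at h4
    exact h4
  have h9 : 0 ≤ O / n := by positivity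
  linarith

/-- The converse direction, from `log(1+u) ≤ u - u²/8`. Without linear decay of `log W_n` the
squared increments average to zero, and dividing by `v` passes this on to the overlap. -/
theorem ae_tendsto_overlap (h : IsWeight μ a t w) (hp : freeEnergy μ w = 0)
    (hv : 0 < ∫ r, fluct w r ^ 2 ∂μ) :
    ∀ᵐ ξ ∂fieldLaw (Site d) μ,
      Tendsto (fun n : ℕ => (∑ k ∈ Finset.range n, overlap w k ξ) / n) atTop (𝓝 0) := by
  set v := ∫ r, fluct w r ^ 2 ∂μ with hv'
  filter_upwards [h.ae_tendsto_avg_relInc, h.ae_tendsto_avg_relInc_sq, h.ae_tendsto_log_tot]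
    with ξ h1 h2 h3
  rw [hp] at h3
  have hlim : Tendsto (fun n : ℕ => (8 * (-(Real.log (tot w n 0 ξ) / n)
      + ((∑ k ∈ Finset.range n, relInc w k ξ) / n))
      - ((∑ k ∈ Finset.range n, (relInc w k ξ ^ 2 - v * overlap w k ξ)) / n)) / v)
      atTop (𝓝 0) := by
    have := ((((h3.neg.add h1).const_mul 8).sub h2)).div_const v
    simpa using this
  refine squeeze_zero' (Eventually.of_forall fun n => div_nonneg
    (Finset.sum_nonneg fun k _ => overlap_nonneg k ξ) (Nat.cast_nonneg n)) ?_ hlim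
  filter_upwards [eventually_gt_atTop 0] with n hn0
  have hn' : (0 : ℝ) < n := by exact_mod_cast hn0
  have hsum : Real.log (tot w n 0 ξ)
      ≤ ∑ k ∈ Finset.range n, (relInc w k ξ - relInc w k ξ ^ 2 / 8) := by
    rw [h.log_tot_eq_sum]
    refine Finset.sum_le_sum fun k _ => ?_
    have hk := abs_le.1 (h.abs_relInc_le k ξ)
    have ht := h.t_lt
    exact Real.log_one_add_le (by linarith) (by linarith)
  rw [Finset.sum_sub_distrib, ← Finset.sum_div] at hsum
  rw [Finset.sum_sub_distrib, ← Finset.mul_sum]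
  set A := ∑ k ∈ Finset.range n, relInc w k ξ
  set B := ∑ k ∈ Finset.range n, relInc w k ξ ^ 2
  set O := ∑ k ∈ Finset.range n, overlap w k ξ
  rw [le_div_iff₀ hv]
  have h5 : Real.log (tot w n 0 ξ) / n ≤ (A - B / 8) / n :=
    div_le_div_of_nonneg_right hsum hn'.le
  have h6 : (A - B / 8) / n = A / n - B / n / 8 := by rw [sub_div]; ring
  have h7 : (B - v * O) / n = B / n - O / n * v := by rw [sub_div]; ring
  linarith

end IsWeight

/-! ### From the averaged overlap to localization and delocalization. -/

theorem liminf_pos_of_eventually_ge {u : ℕ → ℝ} {δ C : ℝ} (hδ : 0 < δ) (hC : ∀ n, u n ≤ C)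
    (h : ∀ᶠ n in atTop, δ ≤ u n) : 0 < liminf u atTop :=
  hδ.trans_le (le_liminf_of_le (isCoboundedUnder_ge_of_le atTop hC) h)

/-- A subsequence suffices for a lower limit. The degenerate case uses this freedom, where the
overlap is controlled only along fourth powers. -/
theorem liminf_eq_zero_of_subseq {u : ℕ → ℝ} (h0 : ∀ n, 0 ≤ u n) {φ : ℕ → ℕ}
    (hφ : Tendsto φ atTop atTop) {C : ℝ} (hC : ∀ n, u n ≤ C)
    (h : Tendsto (fun n => u (φ n)) atTop (𝓝 0)) : liminf u atTop = 0 := by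
  refine le_antisymm (le_of_forall_pos_le_add fun ε hε => ?_)
    (le_liminf_of_le (isCoboundedUnder_ge_of_le atTop hC) (Eventually.of_forall h0))
  rw [zero_add]
  refine liminf_le_of_frequently_le ?_ (isBoundedUnder_of ⟨0, h0⟩)
  refine hφ.frequently (Eventually.frequently ?_)
  filter_upwards [h.eventually (gt_mem_nhds hε)] with n hn using hn.le

/-- The running average of the largest mass of the endpoint law. -/
def avgMaxEnd (w : E → Fin d → ℝ) (ξ : Site d → E) (n : ℕ) : ℝ :=
  (1 / (n : ℝ)) * ∑ m ∈ Finset.range n, maxEnd w m ξ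

namespace IsWeight

theorem avgMaxEnd_nonneg (h : IsWeight μ a t w) (ξ : Site d → E) (n : ℕ) :
    0 ≤ avgMaxEnd w ξ n :=
  mul_nonneg (by positivity) (Finset.sum_nonneg fun m _ => h.maxEnd_nonneg m ξ)

theorem avgMaxEnd_le_one (h : IsWeight μ a t w) (ξ : Site d → E) (n : ℕ) :
    avgMaxEnd w ξ n ≤ 1 := by
  have : ∑ m ∈ Finset.range n, maxEnd w m ξ ≤ n := by
    simpa using Finset.sum_le_sum fun m (_ : m ∈ Finset.range n) => h.maxEnd_le_one m ξ
  rw [avgMaxEnd, one_div, inv_mul_eq_div]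
  exact div_le_one_of_le₀ this (Nat.cast_nonneg n)

/-- Cauchy–Schwarz over the times `m < n`, with the square of each largest mass bounded by the
overlap. -/
theorem avgMaxEnd_le_sqrt (h : IsWeight μ a t w) (ξ : Site d → E) (n : ℕ) :
    avgMaxEnd w ξ n ≤ √((∑ k ∈ Finset.range n, overlap w k ξ) / n) := by
  rcases Nat.eq_zero_or_pos n with rfl | hn
  · simp [avgMaxEnd]
  have hn' : (0 : ℝ) < n := by exact_mod_cast hn
  refine Real.le_sqrt_of_sq_le ?_
  have hcs : (∑ m ∈ Finset.range n, maxEnd w m ξ) ^ 2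
      ≤ n * ∑ m ∈ Finset.range n, maxEnd w m ξ ^ 2 := by
    simpa using sq_sum_le_card_mul_sum_sq (s := Finset.range n) (f := fun m => maxEnd w m ξ)
  have hle : ∑ m ∈ Finset.range n, maxEnd w m ξ ^ 2 ≤ ∑ m ∈ Finset.range n, overlap w m ξ := by
    refine Finset.sum_le_sum fun m _ => ?_
    have := pow_le_pow_left₀ (h.maxEnd_nonneg m ξ) (maxEnd_le_sqrt_overlap m ξ) 2
    rwa [Real.sq_sqrt (overlap_nonneg m ξ)] at this
  rw [avgMaxEnd, mul_pow, div_pow, one_pow, one_div, inv_mul_eq_div,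
    div_le_div_iff₀ (by positivity) hn']
  nlinarith [mul_le_mul_of_nonneg_left hle hn'.le]

theorem overlap_avg_le (h : IsWeight μ a t w) (ξ : Site d → E) (n : ℕ) :
    (∑ k ∈ Finset.range n, overlap w k ξ) / n ≤ avgMaxEnd w ξ n := by
  rw [avgMaxEnd, one_div, inv_mul_eq_div]
  exact div_le_div_of_nonneg_right (Finset.sum_le_sum fun m _ => h.overlap_le_maxEnd m ξ)
    (Nat.cast_nonneg n)

variable [IsProbabilityMeasure μ] [Nonempty (Fin d)]

theorem ae_localized (h : IsWeight μ a t w) (hp : freeEnergy μ w < 0) :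
    ∀ᵐ ξ ∂fieldLaw (Site d) μ, 0 < liminf (fun n => avgMaxEnd w ξ n) atTop := by
  obtain ⟨δ, hδ, hae⟩ := h.ae_eventually_overlap_ge hp
  filter_upwards [hae] with ξ hξ
  exact liminf_pos_of_eventually_ge hδ (h.avgMaxEnd_le_one ξ)
    (hξ.mono fun n hn => hn.trans (h.overlap_avg_le ξ n))

theorem liminf_avgMaxEnd_eq_zero (h : IsWeight μ a t w) {ξ : Site d → E} {φ : ℕ → ℕ}
    (hφ : Tendsto φ atTop atTop)
    (hξ : Tendsto (fun n => (∑ k ∈ Finset.range (φ n), overlap w k ξ) / (φ n : ℝ)) atTop (𝓝 0)) :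
    liminf (fun n => avgMaxEnd w ξ n) atTop = 0 := by
  refine liminf_eq_zero_of_subseq (h.avgMaxEnd_nonneg ξ) hφ (h.avgMaxEnd_le_one ξ) ?_
  refine squeeze_zero (fun n => h.avgMaxEnd_nonneg ξ _) (fun n => h.avgMaxEnd_le_sqrt ξ _) ?_
  simpa using hξ.sqrt

theorem ae_delocalized (h : IsWeight μ a t w) (hp : freeEnergy μ w = 0)
    (hv : 0 < ∫ r, fluct w r ^ 2 ∂μ) :
    ∀ᵐ ξ ∂fieldLaw (Site d) μ, liminf (fun n => avgMaxEnd w ξ n) atTop = 0 := by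
  filter_upwards [h.ae_tendsto_overlap hp hv] with ξ hξ
  exact h.liminf_avgMaxEnd_eq_zero tendsto_id hξ

end IsWeight

end Overlap

/-! ### Two replicas in the same environment -/

section Replica

variable {d : ℕ} {E : Type*} [MeasurableSpace E]

/-- The mean of the product of the weights of the jumps `i` and `j` of two replicas whose positions
differ by `y`. -/
def pairWt (μ : Measure E) (w : E → Fin d → ℝ) (a : Fin d → ℝ) (y : Site d) (i j : Fin d) : ℝ :=
  if y = 0 then ∫ r, w r i * w r j ∂μ else a i * a j

/-- The transfer operator of the difference of two replicas. -/
def pairOp (μ : Measure E) (w : E → Fin d → ℝ) (a : Fin d → ℝ) (φ : Site d → ℝ) (y : Site d) : ℝ :=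
  ∑ i, ∑ j, pairWt μ w a y i j * φ (y + unitStep i - unitStep j)

/-- The partition function of two replicas, with a terminal function of the difference of the
endpoints. -/
def pairPart (w : E → Fin d → ℝ) (φ : Site d → ℝ) (n : ℕ) (x x' : Site d) (ξ : Site d → E) : ℝ :=
  part w (fun z => part w (fun z' => φ (z - z')) n x' ξ) n x ξ

variable {μ : Measure E} {a : Fin d → ℝ} {t : ℝ} {w : E → Fin d → ℝ}

theorem pairPart_succ (φ : Site d → ℝ) (n : ℕ) (x x' : Site d) (ξ : Site d → E) :
    pairPart w φ (n + 1) x x' ξ = ∑ i, ∑ j, (w (ξ x) i * w (ξ x') j)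
      * pairPart w φ n (x + unitStep i) (x' + unitStep j) ξ := by
  simp only [pairPart]
  rw [part_succ]
  simp only [part_succ _ n x' ξ, part_sum, part_const_mul, Finset.mul_sum, mul_assoc]

theorem pairPart_dependsOn (φ : Site d → ℝ) (n : ℕ) {x x' : Site d} (hx : level x = level x') :
    DependsOn (pairPart w φ n x x') {y | level x ≤ level y} := by
  intro ξ ξ' hξ
  simp only [pairPart]
  rw [part_dependsOn _ n x fun y hy => hξ y hy.1]
  congr 1
  funext z
  rw [part_dependsOn _ n x' fun y hy => hξ y (by
    simp only [Set.mem_ofPred_eq] at hy ⊢; omega)]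

theorem pairPart_one (n : ℕ) (x x' : Site d) (ξ : Site d → E) :
    pairPart w (fun _ => 1) n x x' ξ = tot w n x ξ * tot w n x' ξ := by
  have := part_const_mul (w := w) (tot w n x' ξ) (fun _ => 1) n x ξ
  simp only [mul_one] at this
  rw [pairPart, this, mul_comm]

/-- The terminal function requires the two replicas to end at the same site. -/
theorem pairPart_single (n : ℕ) (x : Site d) (ξ : Site d → E) :
    pairPart w (Pi.single 0 1) n x x ξ = ∑ y ∈ ends n x, ptp w n x y ξ ^ 2 := by
  rw [pairPart, part_eq_sum_ptp]
  refine Finset.sum_congr rfl fun y _ => ?_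
  rw [sq]
  congr 2
  funext z
  by_cases h : z = y
  · subst h; simp
  · have : y - z ≠ 0 := fun h' => h (sub_eq_zero.1 h').symm
    simp [h, this]

namespace IsWeight

theorem bmeas_pairPart (h : IsWeight μ a t w) (φ : Site d → ℝ) (n : ℕ) (x x' : Site d) :
    BMeas (fun ξ : Site d → E => pairPart w φ n x x' ξ) := by
  induction n generalizing x x' with
  | zero => simpa [pairPart] using BMeas.const _
  | succ n ih =>
    simp only [pairPart_succ]
    exact BMeas.sum _ fun i _ => BMeas.sum _ fun j _ =>
      ((h.bmeas_eval i x).mul (h.bmeas_eval j x')).mul (ih _ _)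

theorem pairWt_nonneg (h : IsWeight μ a t w) (y : Site d) (i j : Fin d) :
    0 ≤ pairWt μ w a y i j := by
  rw [pairWt]
  split_ifs
  · exact integral_nonneg fun r => mul_nonneg (h.w_nonneg _ _) (h.w_nonneg _ _)
  · exact mul_nonneg (h.a_nonneg _) (h.a_nonneg _)

theorem pairOp_mono (h : IsWeight μ a t w) {φ φ' : Site d → ℝ} (hφ : ∀ y, φ y ≤ φ' y)
    (y : Site d) : pairOp μ w a φ y ≤ pairOp μ w a φ' y :=
  Finset.sum_le_sum fun _ _ => Finset.sum_le_sum fun _ _ =>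
    mul_le_mul_of_nonneg_left (hφ _) (h.pairWt_nonneg _ _ _)

theorem pairOp_iterate_mono (h : IsWeight μ a t w) {φ φ' : Site d → ℝ} (hφ : ∀ y, φ y ≤ φ' y)
    (n : ℕ) (y : Site d) : (pairOp μ w a)^[n] φ y ≤ (pairOp μ w a)^[n] φ' y := by
  induction n generalizing y with
  | zero => exact hφ y
  | succ n ih =>
    rw [Function.iterate_succ_apply', Function.iterate_succ_apply']
    exact h.pairOp_mono ih y

theorem pairOp_add_smul (φ φ' : Site d → ℝ) (c : ℝ) (y : Site d) :
    pairOp μ w a (fun z => φ z + c * φ' z) y = pairOp μ w a φ y + c * pairOp μ w a φ' y := by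
  simp only [pairOp, Finset.mul_sum, ← Finset.sum_add_distrib]
  exact Finset.sum_congr rfl fun i _ => Finset.sum_congr rfl fun j _ => by ring

theorem pairOp_iterate_add_smul (φ φ' : Site d → ℝ) (c : ℝ) (n : ℕ) (y : Site d) :
    (pairOp μ w a)^[n] (fun z => φ z + c * φ' z) y
      = (pairOp μ w a)^[n] φ y + c * (pairOp μ w a)^[n] φ' y := by
  induction n generalizing y with
  | zero => rfl
  | succ n ih =>
    simp only [Function.iterate_succ_apply']
    rw [← pairOp_add_smul]
    congr 1
    funext z
    exact ih z

variable [IsProbabilityMeasure μ]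

/-- At equal levels the weights of the first step are independent of what follows. Their mean
factorizes at distinct sites and is the joint moment at a common site, and it depends on the
positions only through their difference; hence one operator is iterated. -/
theorem integral_pairPart (h : IsWeight μ a t w) (φ : Site d → ℝ) (n : ℕ) {x x' : Site d}
    (hx : level x = level x') :
    ∫ ξ, pairPart w φ n x x' ξ ∂fieldLaw (Site d) μ = (pairOp μ w a)^[n] φ (x - x') := by
  induction n generalizing x x' with
  | zero => simp [pairPart]
  | succ n ih =>
    have hb : ∀ i j, BMeas fun ξ : Site d → E => (w (ξ x) i * w (ξ x') j)
        * pairPart w φ n (x + unitStep i) (x' + unitStep j) ξ := fun i j =>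
      ((h.bmeas_eval i x).mul (h.bmeas_eval j x')).mul (h.bmeas_pairPart _ _ _ _)
    simp only [pairPart_succ]
    rw [integral_finsetSum _ fun i _ => (BMeas.sum _ fun j _ => hb i j).integrable _,
      Function.iterate_succ_apply']
    refine Finset.sum_congr rfl fun i _ => ?_
    rw [integral_finsetSum _ fun j _ => (hb i j).integrable _]
    refine Finset.sum_congr rfl fun j _ => ?_
    rw [integral_mul_of_dependsOn (S := {z | level z = level x})
      (T := {z | level (x + unitStep i) ≤ level z})
      ((h.bmeas_eval i x).mul (h.bmeas_eval j x')) (h.bmeas_pairPart _ _ _ _) ?_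
      (pairPart_dependsOn φ n (by simp [hx])) ?_, ih (by simp [hx]),
      show x + unitStep i - (x' + unitStep j) = x - x' + unitStep i - unitStep j by abel]
    · congr 1
      · rw [pairWt]
        split_ifs with hxx
        · rw [sub_eq_zero] at hxx
          subst hxx
          exact integral_eval (f := fun r => w r i * w r j) ((h.bmeas i).mul (h.bmeas j)).meas x
        · have hne : x ≠ x' := fun hh => hxx (sub_eq_zero.2 hh)
          rw [integral_mul_of_dependsOn (S := {x}) (T := {x'}) (h.bmeas_eval i x)
            (h.bmeas_eval j x'), h.integral_w, h.integral_w]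
          · intro ξ ξ' hξ; simp only [hξ x rfl]
          · intro ξ ξ' hξ; simp only [hξ x' rfl]
          · simpa using hne.symm
    · intro ξ ξ' hξ
      simp only [hξ x rfl, hξ x' hx.symm]
    · refine Set.disjoint_left.2 fun z hz hz' => ?_
      simp only [Set.mem_ofPred_eq, level_add_unitStep] at hz hz'
      omega

/-! ### Environments without fluctuation of the total weight -/

theorem ae_fluct_eq_zero (h : IsWeight μ a t w) (hv : ∫ r, fluct w r ^ 2 ∂μ = 0) :
    ∀ᵐ r ∂μ, fluct w r = 0 := by
  have := (integral_eq_zero_iff_of_nonneg (fun r => sq_nonneg (fluct w r))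
    ((h.bmeas_fluct.pow 2).integrable μ)).1 hv
  filter_upwards [this] with r hr
  simpa using hr

/-- Total weight one at every site forces `W_n = 1`. The endpoint law then needs no normalization,
so the mean overlap is an exact two-replica quantity. -/
theorem ae_overlap_eq (h : IsWeight μ a t w) (hv : ∫ r, fluct w r ^ 2 ∂μ = 0) :
    ∀ᵐ ξ ∂fieldLaw (Site d) μ, ∀ n, tot w n 0 ξ = 1 ∧
      overlap w n ξ = pairPart w (Pi.single 0 1) n 0 0 ξ := by
  have hae : ∀ᵐ ξ ∂fieldLaw (Site d) μ, ∀ x : Site d, fluct w (ξ x) = 0 := by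
    refine ae_all_iff.2 fun x => ?_
    exact (measurePreserving_eval_infinitePi (fun _ : Site d => μ) x).quasiMeasurePreserving.ae
      (h.ae_fluct_eq_zero hv)
  filter_upwards [hae] with ξ hξ n
  have h1 : tot w n 0 ξ = 1 := by
    induction n with
    | zero => simp [tot]
    | succ n ih => rw [h.tot_succ_eq, ih]; simp [relInc, hξ]
  refine ⟨h1, ?_⟩
  rw [pairPart_single, overlap]
  simp only [endLaw, h1, div_one]

/-- This makes `pairOp` a Markov operator: the difference of the replicas is a random walk whose
step law is altered only at the origin. -/
theorem sum_pairWt (h : IsWeight μ a t w) (hv : ∫ r, fluct w r ^ 2 ∂μ = 0) (y : Site d) :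
    ∑ i, ∑ j, pairWt μ w a y i j = 1 := by
  by_cases hy : y = 0
  · simp only [pairWt, hy, if_true]
    have hb : ∀ i j, BMeas fun r => w r i * w r j := fun i j => (h.bmeas i).mul (h.bmeas j)
    have : ∀ i, ∑ j, ∫ r, w r i * w r j ∂μ = ∫ r, ∑ j, w r i * w r j ∂μ := fun i =>
      (integral_finsetSum _ fun j _ => (hb i j).integrable μ).symm
    simp only [this]
    rw [← integral_finsetSum _ fun i _ => (BMeas.sum _ fun j _ => hb i j).integrable μ]
    have h1 : ∀ᵐ r ∂μ, ∑ i, ∑ j, w r i * w r j = 1 := by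
      filter_upwards [h.ae_fluct_eq_zero hv] with r hr
      have : ∑ i, w r i = 1 := by rw [fluct] at hr; linarith
      rw [← Finset.sum_mul_sum, this, one_mul]
    rw [integral_congr_ae h1]
    simp
  · simp only [pairWt, hy, if_false]
    rw [← Finset.sum_mul_sum, h.sum_one, one_mul]

theorem sum_mul_antisymm (a c : Fin d → ℝ) : ∑ i, ∑ j, a i * a j * (c i - c j) = 0 := by
  have h1 : ∑ i, ∑ j, a i * a j * c i = ∑ i, ∑ j, a i * a j * c j := by
    rw [Finset.sum_comm]
    exact Finset.sum_congr rfl fun i _ => Finset.sum_congr rfl fun j _ => by ring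
  simp only [mul_sub, Finset.sum_sub_distrib]
  rw [h1, sub_self]

theorem pairOp_sq_le (h : IsWeight μ a t w) (hv : ∫ r, fluct w r ^ 2 ∂μ = 0) (l : Fin d)
    (y : Site d) :
    pairOp μ w a (fun z => (z l : ℝ) ^ 2) y ≤ (y l : ℝ) ^ 2 + 1 := by
  set c : Fin d → ℝ := fun i => if i = l then 1 else 0 with hc
  have hc' : ∀ i, ((unitStep i l : ℤ) : ℝ) = c i := fun i => by
    simp [unitStep, hc, Pi.single_apply, eq_comm]
  have hc1 : ∀ i j, (c i - c j) ^ 2 ≤ 1 := fun i j => by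
    simp only [hc]; split_ifs <;> norm_num
  -- At the origin the factor `y l` vanishes; elsewhere the weights are symmetric in `i` and `j`.
  have hcross : ∑ i, ∑ j, pairWt μ w a y i j * (2 * (y l : ℝ) * (c i - c j)) = 0 := by
    by_cases hy : y = 0
    · simp [hy]
    · have : ∀ i j, pairWt μ w a y i j * (2 * (y l : ℝ) * (c i - c j))
          = 2 * (y l : ℝ) * (a i * a j * (c i - c j)) := fun i j => by
        rw [pairWt, if_neg hy]; ring
      simp only [this, ← Finset.mul_sum]
      rw [sum_mul_antisymm, mul_zero]
  calc pairOp μ w a (fun z => (z l : ℝ) ^ 2) y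
      = ∑ i, ∑ j, (pairWt μ w a y i j * (y l : ℝ) ^ 2
        + pairWt μ w a y i j * (2 * (y l : ℝ) * (c i - c j))
        + pairWt μ w a y i j * (c i - c j) ^ 2) := by
        refine Finset.sum_congr rfl fun i _ => Finset.sum_congr rfl fun j _ => ?_
        simp only [Pi.add_apply, Pi.sub_apply]
        push_cast
        rw [hc', hc']
        ring
    _ ≤ ∑ i, ∑ j, (pairWt μ w a y i j * (y l : ℝ) ^ 2
        + pairWt μ w a y i j * (2 * (y l : ℝ) * (c i - c j))
        + pairWt μ w a y i j * 1) := by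
        gcongr with i _ j _
        · exact h.pairWt_nonneg _ _ _
        · exact hc1 i j
    _ = (y l : ℝ) ^ 2 + 1 := by
        simp only [Finset.sum_add_distrib, ← Finset.sum_mul]
        rw [hcross, h.sum_pairWt hv]
        ring

/-- One step of a discrete Tanaka formula. Off the origin the step is centered, so the absolute
value is subharmonic. At the origin the jump pair `(l, l')` alone separates the replicas in
coordinate `l`, and its weight is bounded below. -/
theorem le_pairOp_abs (h : IsWeight μ a t w) (hv : ∫ r, fluct w r ^ 2 ∂μ = 0) {l l' : Fin d}
    (hl : l ≠ l') (y : Site d) :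
    |(y l : ℝ)| + (1 - t) ^ 2 * (a l * a l') * (Pi.single 0 1 : Site d → ℝ) y
      ≤ pairOp μ w a (fun z => |(z l : ℝ)|) y := by
  set c : Fin d → ℝ := fun i => if i = l then 1 else 0 with hc
  have hc' : ∀ i, ((unitStep i l : ℤ) : ℝ) = c i := fun i => by
    simp [unitStep, hc, Pi.single_apply, eq_comm]
  have he : pairOp μ w a (fun z => |(z l : ℝ)|) y
      = ∑ i, ∑ j, pairWt μ w a y i j * |(y l : ℝ) + (c i - c j)| := by
    refine Finset.sum_congr rfl fun i _ => Finset.sum_congr rfl fun j _ => ?_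
    simp only [Pi.add_apply, Pi.sub_apply]
    push_cast
    rw [hc', hc', add_sub_assoc]
  rw [he]
  by_cases hy : y = 0
  · subst hy
    simp only [Pi.zero_apply, Int.cast_zero, abs_zero, zero_add, Pi.single_eq_same, mul_one]
    have h1 : (1 - t) ^ 2 * (a l * a l') ≤ pairWt μ w a 0 l l' * |c l - c l'| := by
      have hcl : |c l - c l'| = 1 := by simp [hc, hl.symm]
      have h1t : 0 < 1 - t := sub_pos.2 h.t_lt
      rw [hcl, mul_one, pairWt, if_pos rfl]
      have := integral_mono (μ := μ) (integrable_const ((1 - t) * a l * ((1 - t) * a l')))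
        (((h.bmeas l).mul (h.bmeas l')).integrable μ) (fun r =>
          mul_le_mul (h.lower r l) (h.lower r l') (mul_pos h1t (h.pos _)).le (h.w_nonneg _ _))
      simp only [integral_const, probReal_univ, smul_eq_mul, one_mul] at this
      linarith
    have hnn : ∀ i j, 0 ≤ pairWt μ w a 0 i j * |c i - c j| := fun i j =>
      mul_nonneg (h.pairWt_nonneg _ _ _) (abs_nonneg _)
    calc _ ≤ pairWt μ w a 0 l l' * |c l - c l'| := h1
      _ ≤ ∑ j, pairWt μ w a 0 l j * |c l - c j| :=
          Finset.single_le_sum (f := fun j => pairWt μ w a 0 l j * |c l - c j|)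
            (fun j _ => hnn l j) (Finset.mem_univ l')
      _ ≤ _ := Finset.single_le_sum (f := fun i => ∑ j, pairWt μ w a 0 i j * |c i - c j|)
            (fun i _ => Finset.sum_nonneg fun j _ => hnn i j) (Finset.mem_univ l)
  · have hs : (Pi.single 0 1 : Site d → ℝ) y = 0 := by simp [hy]
    rw [hs, mul_zero, add_zero]
    have hsum : ∑ i, ∑ j, pairWt μ w a y i j * ((y l : ℝ) + (c i - c j)) = y l := by
      have h1 := h.sum_pairWt hv y
      have h2 : ∑ i, ∑ j, pairWt μ w a y i j * (c i - c j) = 0 := by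
        simp only [pairWt, if_neg hy]
        exact sum_mul_antisymm a c
      simp only [mul_add, Finset.sum_add_distrib, ← Finset.sum_mul]
      rw [h1, h2]
      ring
    calc |(y l : ℝ)| = |∑ i, ∑ j, pairWt μ w a y i j * ((y l : ℝ) + (c i - c j))| := by rw [hsum]
      _ ≤ ∑ i, ∑ j, |pairWt μ w a y i j * ((y l : ℝ) + (c i - c j))| :=
          (Finset.abs_sum_le_sum_abs _ _).trans
            (Finset.sum_le_sum fun i _ => Finset.abs_sum_le_sum_abs _ _)
      _ = _ := by
          refine Finset.sum_congr rfl fun i _ => Finset.sum_congr rfl fun j _ => ?_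
          rw [abs_mul, abs_of_nonneg (h.pairWt_nonneg _ _ _)]

theorem pairOp_one (h : IsWeight μ a t w) (hv : ∫ r, fluct w r ^ 2 ∂μ = 0) (c : ℝ) (y : Site d) :
    pairOp μ w a (fun _ => c) y = c := by
  simp only [pairOp, ← Finset.sum_mul]
  rw [h.sum_pairWt hv, one_mul]

/-- Without fluctuation of the total weight, the mean number of collisions of two replicas up to
time `n` is at most of order `√n`. -/
theorem sum_collisions_le (h : IsWeight μ a t w) (hv : ∫ r, fluct w r ^ 2 ∂μ = 0) {l l' : Fin d}
    (hl : l ≠ l') {n : ℕ} (hn : 0 < n) :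
    (1 - t) ^ 2 * (a l * a l') * ∑ k ∈ Finset.range n, (pairOp μ w a)^[k] (Pi.single 0 1) 0
      ≤ √n := by
  set T := pairOp μ w a
  set δ := (1 - t) ^ 2 * (a l * a l')
  -- Each visit to the origin raises the expected absolute value by at least `δ`, so visits are
  -- counted by its growth.
  have hlow : ∀ n : ℕ, ∀ y, |(y l : ℝ)| + δ * ∑ k ∈ Finset.range n, T^[k] (Pi.single 0 1) y
      ≤ T^[n] (fun z => |(z l : ℝ)|) y := by
    intro n
    induction n with
    | zero => intro y; simp
    | succ n ih =>
      intro y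
      have h1 := h.pairOp_iterate_mono (h.le_pairOp_abs hv hl) n y
      rw [pairOp_iterate_add_smul] at h1
      rw [Function.iterate_succ_apply, Finset.sum_range_succ]
      have h2 := ih y
      calc _ = (|(y l : ℝ)| + δ * ∑ k ∈ Finset.range n, T^[k] (Pi.single 0 1) y)
            + δ * T^[n] (Pi.single 0 1) y := by ring
        _ ≤ T^[n] (fun z => |(z l : ℝ)|) y + δ * T^[n] (Pi.single 0 1) y := by gcongr
        _ ≤ _ := h1
  have hsq : ∀ n : ℕ, ∀ y, T^[n] (fun z => (z l : ℝ) ^ 2) y ≤ (y l : ℝ) ^ 2 + n := by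
    intro n
    induction n with
    | zero => intro y; simp
    | succ n ih =>
      intro y
      rw [Function.iterate_succ_apply']
      calc T (T^[n] fun z => (z l : ℝ) ^ 2) y
          ≤ T (fun z => (z l : ℝ) ^ 2 + n * 1) y := h.pairOp_mono (fun z => by
            rw [mul_one]; exact ih z) y
        _ = T (fun z => (z l : ℝ) ^ 2) y + n * T (fun _ => 1) y := pairOp_add_smul _ _ _ _
        _ ≤ ((y l : ℝ) ^ 2 + 1) + n * 1 := by
            have h1 : T (fun _ => 1) y = 1 := h.pairOp_one hv 1 y
            rw [h1]
            gcongr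
            exact h.pairOp_sq_le hv l y
        _ = _ := by push_cast; ring
  have hn' : (0 : ℝ) < n := by exact_mod_cast hn
  set s := √(n : ℝ) with hs
  have hs0 : 0 < s := Real.sqrt_pos.2 hn'
  have hss : s * s = n := Real.mul_self_sqrt hn'.le
  have hconst : ∀ n : ℕ, ∀ c : ℝ, ∀ y, T^[n] (fun _ => c) y = c := by
    intro n c
    induction n with
    | zero => intro y; rfl
    | succ n ih =>
      intro y
      rw [Function.iterate_succ_apply']
      have : T^[n] (fun _ => c) = fun _ => c := funext ih
      rw [this]
      exact h.pairOp_one hv c y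
  -- The pointwise bound `|z| ≤ s/2 + z²/(2s)` with `s = √n` replaces Cauchy–Schwarz and uses the
  -- second moment, which is at most `n`.
  have hup : T^[n] (fun z => |(z l : ℝ)|) 0 ≤ s := by
    calc T^[n] (fun z => |(z l : ℝ)|) 0
        ≤ T^[n] (fun z => (fun _ => s / 2) z + (1 / (2 * s)) * (z l : ℝ) ^ 2) 0 := by
          refine h.pairOp_iterate_mono (fun z => ?_) n 0
          have h1 : |(z l : ℝ)| ^ 2 = (z l : ℝ) ^ 2 := sq_abs _
          have h2 : s / 2 + (1 / (2 * s)) * (z l : ℝ) ^ 2 = (s ^ 2 + |(z l : ℝ)| ^ 2) / (2 * s) := by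
            rw [h1]; field_simp
          simp only
          rw [h2, le_div_iff₀ (by positivity)]
          nlinarith [sq_nonneg (s - |(z l : ℝ)|)]
      _ = s / 2 + (1 / (2 * s)) * T^[n] (fun z => (z l : ℝ) ^ 2) 0 := by
          rw [pairOp_iterate_add_smul, hconst]
      _ ≤ s / 2 + (1 / (2 * s)) * n := by
          gcongr
          simpa using hsq n 0
      _ = s := by rw [← hss]; field_simp; ring
  have := hlow n 0
  simp only [Pi.zero_apply, Int.cast_zero, abs_zero, zero_add] at this
  exact this.trans hup

/-- Without fluctuation of the total weight, the endpoint is delocalized. -/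
theorem ae_delocalized_of_degenerate (h : IsWeight μ a t w) (hd : 2 ≤ d)
    (hv : ∫ r, fluct w r ^ 2 ∂μ = 0) :
    ∀ᵐ ξ ∂fieldLaw (Site d) μ, liminf (fun n => avgMaxEnd w ξ n) atTop = 0 := by
  obtain ⟨l, l', hl⟩ : ∃ l l' : Fin d, l ≠ l' :=
    ⟨⟨0, by omega⟩, ⟨1, by omega⟩, by simp [Fin.ext_iff]⟩
  have : Nonempty (Fin d) := ⟨l⟩
  set Q := fieldLaw (Site d) μ
  set δ := (1 - t) ^ 2 * (a l * a l') with hδ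
  have hδ0 : 0 < δ := mul_pos (pow_pos (sub_pos.2 h.t_lt) 2) (mul_pos (h.pos l) (h.pos l'))
  have hO : ∀ n, BMeas fun ξ : Site d → E => (∑ k ∈ Finset.range n, overlap w k ξ) / n := fun n =>
    (BMeas.sum _ fun k _ => h.bmeas_overlap k).div_const _
  have hO0 : ∀ (n : ℕ) (ξ : Site d → E), 0 ≤ (∑ k ∈ Finset.range n, overlap w k ξ) / n := fun n ξ =>
    div_nonneg (Finset.sum_nonneg fun k _ => overlap_nonneg k ξ) (Nat.cast_nonneg n)
  -- At most order `√n` collisions in `n` steps: for `n = k⁴` the mean averaged overlap is of order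
  -- `k⁻²`, which is summable.
  have hint : ∀ k : ℕ, ∫ ξ, (∑ j ∈ Finset.range (k ^ 4), overlap w j ξ) / ((k ^ 4 : ℕ) : ℝ) ∂Q
      ≤ δ⁻¹ / (k : ℝ) ^ 2 := by
    intro k
    rcases Nat.eq_zero_or_pos k with rfl | hk
    · simp
    have hk' : (0 : ℝ) < k := by exact_mod_cast hk
    have he : ∀ j, ∫ ξ, overlap w j ξ ∂Q = (pairOp μ w a)^[j] (Pi.single 0 1) 0 := by
      intro j
      have h1 : ∀ᵐ ξ ∂Q, overlap w j ξ = pairPart w (Pi.single 0 1) j 0 0 ξ := by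
        filter_upwards [h.ae_overlap_eq hv] with ξ hξ using (hξ j).2
      rw [integral_congr_ae h1, h.integral_pairPart _ _ rfl, sub_self]
    rw [integral_div, integral_finsetSum _ fun j _ => (h.bmeas_overlap j).integrable Q]
    simp only [he]
    have h1 := h.sum_collisions_le hv hl (n := k ^ 4) (by positivity)
    have h2 : √((k ^ 4 : ℕ) : ℝ) = (k : ℝ) ^ 2 := by
      rw [show ((k ^ 4 : ℕ) : ℝ) = ((k : ℝ) ^ 2) ^ 2 by push_cast; ring]
      exact Real.sqrt_sq (by positivity)
    rw [h2, ← hδ] at h1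
    rw [div_le_div_iff₀ (by positivity) (by positivity)]
    push_cast
    calc _ = δ⁻¹ * (δ * ∑ j ∈ Finset.range (k ^ 4), (pairOp μ w a)^[j] (Pi.single 0 1) 0)
          * (k : ℝ) ^ 2 := by field_simp
      _ ≤ δ⁻¹ * (k : ℝ) ^ 2 * (k : ℝ) ^ 2 := by gcongr
      _ = _ := by ring
  have hsum : Summable fun k : ℕ => δ⁻¹ / (k : ℝ) ^ 2 := by
    simpa [div_eq_mul_inv] using (Real.summable_nat_pow_inv.2 (by norm_num : 1 < 2)).mul_left δ⁻¹
  have hfin : ∫⁻ ξ, ∑' k : ℕ, ENNReal.ofReal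
      ((∑ j ∈ Finset.range (k ^ 4), overlap w j ξ) / ((k ^ 4 : ℕ) : ℝ)) ∂Q ≠ ⊤ := by
    rw [lintegral_tsum fun k => ((hO _).meas.ennreal_ofReal).aemeasurable]
    refine ne_top_of_le_ne_top hsum.tsum_ofReal_ne_top (ENNReal.tsum_le_tsum fun k => ?_)
    rw [← ofReal_integral_eq_lintegral_ofReal ((hO _).integrable Q) (ae_of_all _ (hO0 _))]
    exact ENNReal.ofReal_le_ofReal (hint k)
  have hae := ae_lt_top' (μ := Q) (AEMeasurable.tsum fun k =>
    ((hO (k ^ 4)).meas.ennreal_ofReal).aemeasurable) hfin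
  filter_upwards [hae] with ξ hξ
  refine h.liminf_avgMaxEnd_eq_zero (φ := fun k => k ^ 4) (tendsto_pow_atTop (by norm_num)) ?_
  have h1 := (ENNReal.tendsto_toReal ENNReal.zero_ne_top).comp
    (ENNReal.tendsto_atTop_zero_of_tsum_ne_top hξ.ne)
  simpa only [Function.comp_def, ENNReal.toReal_ofReal (hO0 _ _), ENNReal.toReal_zero] using h1

theorem freeEnergy_eq_zero_of_degenerate [Nonempty (Fin d)] (h : IsWeight μ a t w)
    (hv : ∫ r, fluct w r ^ 2 ∂μ = 0) : freeEnergy μ w = 0 := by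
  refine h.freeEnergy_eq_zero_of_prob one_pos fun n => ?_
  have h1 : ∀ᵐ ξ ∂fieldLaw (Site d) μ, ξ ∈ {ξ : Site d → E | 1 ≤ tot w n 0 ξ} := by
    filter_upwards [h.ae_overlap_eq hv] with ξ hξ
    exact (hξ n).1.ge
  rw [(mem_ae_iff_prob_eq_one (measurableSet_le measurable_const
    (h.bmeas_part _ n 0).meas)).1 h1]
  simp

/-! ### The second moment method -/

/-- Iterating `1 ≤ g` and `pairOp g ≤ g` bounds `E[W_n²]` by `g 0` for all `n`. With mean one, a
Paley–Zygmund argument keeps `W_n` away from zero with uniformly positive probability. -/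
theorem freeEnergy_eq_zero_of_supersolution [Nonempty (Fin d)] (h : IsWeight μ a t w)
    {g : Site d → ℝ} (hg1 : ∀ y, 1 ≤ g y) (hg : ∀ y, pairOp μ w a g y ≤ g y) :
    freeEnergy μ w = 0 := by
  set Q := fieldLaw (Site d) μ
  have hg0 : 0 < g 0 := zero_lt_one.trans_le (hg1 0)
  have hit : ∀ n : ℕ, ∀ y, (pairOp μ w a)^[n] g y ≤ g y := by
    intro n
    induction n with
    | zero => intro y; rfl
    | succ n ih =>
      intro y
      rw [Function.iterate_succ_apply']
      exact (h.pairOp_mono ih y).trans (hg y)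
  have h2 : ∀ n : ℕ, ∫ ξ, tot w n 0 ξ ^ 2 ∂Q ≤ g 0 := by
    intro n
    simp only [sq, ← pairPart_one]
    rw [h.integral_pairPart _ _ rfl, sub_self]
    exact (h.pairOp_iterate_mono hg1 n 0).trans (hit n 0)
  have hδ : 0 < 1 / (4 * g 0) := by positivity
  refine h.freeEnergy_eq_zero_of_prob hδ fun n => ?_
  set W : (Site d → E) → ℝ := fun ξ => tot w n 0 ξ with hW
  have hWb : BMeas W := h.bmeas_part _ n 0
  set A : Set (Site d → E) := {ξ | 1 / (4 * g 0) ≤ W ξ} with hA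
  have hAm : MeasurableSet A := measurableSet_le measurable_const hWb.meas
  have hle14 : 1 / (4 * g 0) ≤ 1 / 2 := by
    rw [div_le_div_iff₀ (by positivity) (by norm_num)]
    linarith [hg1 0]
  -- On `A` this is `(W - 2 g 0)² ≥ 0`; off `A`, `W` is below `1/2`. The integral reads `1 ≤ 1/2 +
  -- 1/4 + g 0 · P(A)`.
  have hpt : ∀ ξ, W ξ ≤ 1 / 2 + (1 / (4 * g 0) * W ξ ^ 2 + g 0 * A.indicator (fun _ => 1) ξ) := by
    intro ξ
    by_cases hξ : ξ ∈ A
    · rw [Set.indicator_of_mem hξ, mul_one]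
      have : 0 ≤ (W ξ - 2 * g 0) ^ 2 / (4 * g 0) := by positivity
      have he : (W ξ - 2 * g 0) ^ 2 / (4 * g 0) = 1 / (4 * g 0) * W ξ ^ 2 - W ξ + g 0 := by
        field_simp; ring
      linarith
    · rw [Set.indicator_of_notMem hξ, mul_zero, add_zero]
      have h3 : W ξ ≤ 1 / (4 * g 0) := (not_le.1 hξ).le
      have : 0 ≤ 1 / (4 * g 0) * W ξ ^ 2 := by positivity
      linarith
  have hint := integral_mono (μ := Q) (hWb.integrable Q)
    (((BMeas.const (1 / 2)).add (((hWb.pow 2).const_mul (1 / (4 * g 0))).add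
      (((BMeas.const 1).indicator hAm).const_mul (g 0)))).integrable Q) hpt
  rw [integral_add (integrable_const _) ((((hWb.pow 2).const_mul _).add
      (((BMeas.const 1).indicator hAm).const_mul _)).integrable Q),
    integral_add (((hWb.pow 2).const_mul _).integrable Q)
      ((((BMeas.const 1).indicator hAm).const_mul _).integrable Q),
    integral_const_mul, integral_const_mul, integral_indicator hAm, h.integral_tot] at hint
  simp only [integral_const, probReal_univ, smul_eq_mul, one_mul, mul_one,
    measureReal_restrict_apply_univ] at hint
  have h3 : 1 / (4 * g 0) * ∫ ξ, W ξ ^ 2 ∂Q ≤ 1 / 4 := by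
    calc _ ≤ 1 / (4 * g 0) * g 0 := by gcongr; exact h2 n
      _ = 1 / 4 := by field_simp
  refine (ENNReal.ofReal_le_iff_le_toReal (measure_ne_top _ _)).2 ?_
  change 1 / (4 * g 0) ≤ Q.real A
  rw [div_le_iff₀ (by positivity)]
  linarith

theorem integral_mul_le (h : IsWeight μ a t w) (i j : Fin d) :
    ∫ r, w r i * w r j ∂μ ≤ (1 + t ^ 2) * (a i * a j) := by
  have habs : ∀ r i, |w r i - a i| ≤ t * a i := fun r i => by
    have h1 := h.lower r i
    have h2 := h.upper r i
    rw [abs_le]; constructor <;> linarith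
  have hpt : ∀ r, w r i * w r j
      ≤ (a j * w r i + a i * w r j) + (t ^ 2 * (a i * a j) - a i * a j) := fun r => by
    have h1 : (w r i - a i) * (w r j - a j) ≤ (t * a i) * (t * a j) :=
      (le_abs_self _).trans (by
        rw [abs_mul]
        exact mul_le_mul (habs r i) (habs r j) (abs_nonneg _)
          (mul_nonneg h.t_nonneg (h.a_nonneg i)))
    linarith
  have := integral_mono (μ := μ) (((h.bmeas i).mul (h.bmeas j)).integrable μ)
    (((((h.bmeas i).const_mul (a j)).add ((h.bmeas j).const_mul (a i))).add
      (BMeas.const _)).integrable μ) hpt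
  rw [integral_add ((((h.bmeas i).const_mul (a j)).add ((h.bmeas j).const_mul (a i))).integrable μ)
    (integrable_const _), integral_add (((h.bmeas i).const_mul (a j)).integrable μ)
    (((h.bmeas j).const_mul (a i)).integrable μ), integral_const_mul, integral_const_mul,
    h.mean, h.mean] at this
  simp only [integral_const, probReal_univ, smul_eq_mul, one_mul] at this
  linarith

/-- A Green function of the difference of two independent walks yields weak disorder for small
disorder. -/
theorem freeEnergy_eq_zero_of_green [Nonempty (Fin d)] (h : IsWeight μ a t w)
    {G : Site d → ℝ} {M : ℝ} (hG0 : ∀ y, 0 ≤ G y) (hGM : ∀ y, G y ≤ M)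
    (hG : ∀ y, ∑ i, ∑ j, a i * a j * G (y + unitStep i - unitStep j)
      ≤ G y - (Pi.single 0 1 : Site d → ℝ) y)
    (ht : t ^ 2 * (2 * M + 1) ≤ 1) : freeEnergy μ w = 0 := by
  have ht0 : 0 ≤ t ^ 2 := sq_nonneg t
  have hM : 0 ≤ M := (hG0 0).trans (hGM 0)
  -- The origin has extra weight of at most a factor `1 + t²`. The drop of `G` by one there, scaled
  -- by `2t²`, compensates it as soon as `t² (2M + 1) ≤ 1`.
  refine h.freeEnergy_eq_zero_of_supersolution (g := fun y => 1 + 2 * t ^ 2 * G y) (fun y => by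
    have := hG0 y
    have : 0 ≤ 2 * t ^ 2 * G y := by positivity
    linarith) fun y => ?_
  have hlin : ∑ i, ∑ j, a i * a j * (1 + 2 * t ^ 2 * G (y + unitStep i - unitStep j))
      = 1 + 2 * t ^ 2 * ∑ i, ∑ j, a i * a j * G (y + unitStep i - unitStep j) := by
    have h1 : ∑ i, ∑ j, a i * a j = 1 := by rw [← Finset.sum_mul_sum, h.sum_one, one_mul]
    rw [Finset.mul_sum]
    nth_rewrite 2 [← h1]
    rw [← Finset.sum_add_distrib]
    refine Finset.sum_congr rfl fun i _ => ?_
    rw [Finset.mul_sum, ← Finset.sum_add_distrib]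
    exact Finset.sum_congr rfl fun j _ => by ring
  have hGy := hG y
  by_cases hy : y = 0
  · subst hy
    rw [Pi.single_eq_same] at hGy
    have hnn : ∀ i j, 0 ≤ 1 + 2 * t ^ 2 * G (0 + unitStep i - unitStep j) := fun i j => by
      have := hG0 (0 + unitStep i - unitStep j)
      positivity
    calc pairOp μ w a (fun y => 1 + 2 * t ^ 2 * G y) 0
        ≤ ∑ i, ∑ j, (1 + t ^ 2) * (a i * a j)
          * (1 + 2 * t ^ 2 * G (0 + unitStep i - unitStep j)) := by
          refine Finset.sum_le_sum fun i _ => Finset.sum_le_sum fun j _ => ?_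
          rw [pairWt, if_pos rfl]
          exact mul_le_mul_of_nonneg_right (h.integral_mul_le i j) (hnn i j)
      _ = (1 + t ^ 2) * (1 + 2 * t ^ 2 * ∑ i, ∑ j, a i * a j
          * G (0 + unitStep i - unitStep j)) := by
          rw [← hlin, Finset.mul_sum]
          refine Finset.sum_congr rfl fun i _ => ?_
          rw [Finset.mul_sum]
          exact Finset.sum_congr rfl fun j _ => by ring
      _ ≤ (1 + t ^ 2) * (1 + 2 * t ^ 2 * (G 0 - 1)) := by gcongr
      _ ≤ 1 + 2 * t ^ 2 * G 0 := by
          have h1 : t ^ 2 * (2 * G 0) ≤ t ^ 2 * (2 * M) := by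
            have := hGM 0
            gcongr
          nlinarith
  · have hs : (Pi.single 0 1 : Site d → ℝ) y = 0 := by simp [hy]
    rw [hs, sub_zero] at hGy
    simp only [pairOp, pairWt, if_neg hy]
    rw [hlin]
    gcongr

end IsWeight

end Replica

/-! ### The Green function of the difference of two independent directed walks -/

/-- This is `|x| ^ (-2/3)`, written through `x²` so that it matches the geometric mean of three
squares below. -/
theorem integrableOn_sq_rpow :
    Integrable (fun x : ℝ => (x ^ 2) ^ (-(1 / 3) : ℝ))
      (volume.restrict (Set.Ioc (-Real.pi) Real.pi)) := by
  have h1 : IntegrableOn (fun x : ℝ => (x ^ 2) ^ (-(1 / 3) : ℝ)) (Set.Ioc 0 Real.pi) := by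
    have h := (intervalIntegrable_iff_integrableOn_Ioc_of_le Real.pi_pos.le).1
      (intervalIntegral.intervalIntegrable_rpow' (a := 0) (b := Real.pi)
        (by norm_num : (-1 : ℝ) < -(2 / 3)))
    refine h.congr_fun (fun x hx => ?_) measurableSet_Ioc
    simp only
    rw [← Real.rpow_natCast x 2, ← Real.rpow_mul hx.1.le]
    norm_num
  have h2 : IntegrableOn (fun x : ℝ => (x ^ 2) ^ (-(1 / 3) : ℝ)) (-(Set.Ioc 0 Real.pi)) := by
    simpa only [neg_sq] using h1.comp_neg
  have h3 : IntegrableOn (fun x : ℝ => (x ^ 2) ^ (-(1 / 3) : ℝ)) {0} := by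
    rw [IntegrableOn, Measure.restrict_eq_zero.2 (measure_singleton (0 : ℝ))]
    exact integrable_zero_measure
  refine ((h1.union h2).union h3).mono_set fun x hx => ?_
  rcases lt_trichotomy x 0 with h | h | h
  · exact Or.inl (Or.inr ⟨by linarith, by linarith [hx.1]⟩)
  · exact Or.inr h
  · exact Or.inl (Or.inl ⟨h, hx.2⟩)

/-- The uniform measure on the cube `(-π, π]³`. -/
def cubeMeasure : Measure (Fin 3 → ℝ) :=
  Measure.pi fun _ => volume.restrict (Set.Ioc (-Real.pi) Real.pi)

theorem ae_abs_le_pi : ∀ᵐ θ ∂cubeMeasure, ∀ l, |θ l| ≤ Real.pi ∧ θ l ≠ 0 := by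
  refine ae_all_iff.2 fun l => Filter.Eventually.and ?_ (Measure.ae_eval_ne _ l 0)
  have h : ∀ᵐ x : ℝ ∂(volume.restrict (Set.Ioc (-Real.pi) Real.pi)), |x| ≤ Real.pi := by
    filter_upwards [ae_restrict_mem measurableSet_Ioc] with x hx
    exact abs_le.2 ⟨hx.1.le, hx.2⟩
  exact (Measure.tendsto_eval_ae_ae (i := l)
    (μ := fun _ : Fin 3 => volume.restrict (Set.Ioc (-Real.pi) Real.pi))).eventually h

theorem integral_exp_int_mul (n : ℤ) :
    ∫ x : ℝ in Set.Ioc (-Real.pi) Real.pi, Complex.exp ((n : ℂ) * Complex.I * x)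
      = ((if n = 0 then 2 * Real.pi else 0 : ℝ) : ℂ) := by
  rw [← intervalIntegral.integral_of_le (by linarith [Real.pi_pos])]
  split_ifs with h
  · subst h
    simp
    ring
  · have hc : (n : ℂ) * Complex.I ≠ 0 :=
      mul_ne_zero (by exact_mod_cast h) Complex.I_ne_zero
    rw [integral_exp_mul_complex hc]
    have : Complex.exp ((n : ℂ) * Complex.I * (Real.pi : ℝ))
        = Complex.exp ((n : ℂ) * Complex.I * ((-Real.pi : ℝ) : ℂ)) := by
      refine Complex.exp_eq_exp_iff_exists_int.2 ⟨n, ?_⟩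
      push_cast
      ring
    rw [this, sub_self, zero_div]
    simp

/-- Orthogonality of characters: the cosine is the real part of a product of one-variable
exponentials. -/
theorem integral_cos_cube (n : Fin 3 → ℤ) :
    ∫ θ, Real.cos (∑ l, θ l * n l) ∂cubeMeasure
      = ∏ l, (if n l = 0 then 2 * Real.pi else 0) := by
  have h1 : ∀ θ : Fin 3 → ℝ, Real.cos (∑ l, θ l * n l)
      = RCLike.re (∏ l, Complex.exp ((n l : ℂ) * Complex.I * θ l)) := by
    intro θ
    rw [← Complex.exp_sum]
    have : ∑ l, (n l : ℂ) * Complex.I * θ l = ((∑ l, θ l * n l : ℝ) : ℂ) * Complex.I := by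
      push_cast
      rw [Finset.sum_mul]
      exact Finset.sum_congr rfl fun l _ => by ring
    rw [this]
    exact (Complex.exp_ofReal_mul_I_re _).symm
  have hint : Integrable (fun θ : Fin 3 → ℝ => ∏ l, Complex.exp ((n l : ℂ) * Complex.I * θ l))
      cubeMeasure := by
    refine Integrable.fintype_prod (f := fun l (x : ℝ) => Complex.exp ((n l : ℂ) * Complex.I * x))
      fun l => ?_
    refine Integrable.of_bound (by fun_prop) 1 (ae_of_all _ fun x => ?_)
    rw [show (n l : ℂ) * Complex.I * x = ((n l * x : ℝ) : ℂ) * Complex.I by push_cast; ring,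
      Complex.norm_exp_ofReal_mul_I]
  simp only [h1]
  rw [integral_re hint, cubeMeasure,
    integral_fintype_prod_eq_prod (fun l (x : ℝ) => Complex.exp ((n l : ℂ) * Complex.I * x))]
  simp only [integral_exp_int_mul]
  rw [← Complex.ofReal_prod]
  exact Complex.ofReal_re _

section Green

variable {d : ℕ}

/-- The phase of a site. -/
def phase (c : Fin 3 → Fin d) (θ : Fin 3 → ℝ) (y : Site d) : ℝ := ∑ l, θ l * y (c l)

/-- The characteristic function of the difference of two independent steps. -/
def diffChar (c : Fin 3 → Fin d) (a : Fin d → ℝ) (θ : Fin 3 → ℝ) : ℝ :=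
  ∑ i, ∑ j, a i * a j * Real.cos (phase c θ (unitStep i) - phase c θ (unitStep j))

theorem phase_add_sub (c : Fin 3 → Fin d) (θ : Fin 3 → ℝ) (x y z : Site d) :
    phase c θ (x + y - z) = phase c θ x + (phase c θ y - phase c θ z) := by
  simp only [phase, ← Finset.sum_add_distrib, ← Finset.sum_sub_distrib]
  exact Finset.sum_congr rfl fun l _ => by
    simp only [Pi.add_apply, Pi.sub_apply]; push_cast; ring

/-- Cosines of the phase are eigenfunctions of the difference walk, since its step law is symmetric
and the sine part cancels. -/
theorem sum_cos_phase (c : Fin 3 → Fin d) (a : Fin d → ℝ) (θ : Fin 3 → ℝ) (y : Site d) :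
    ∑ i, ∑ j, a i * a j * Real.cos (phase c θ (y + unitStep i - unitStep j))
      = Real.cos (phase c θ y) * diffChar c a θ := by
  have hsin : ∑ i, ∑ j, a i * a j
      * Real.sin (phase c θ (unitStep i) - phase c θ (unitStep j)) = 0 := by
    have h : ∑ i, ∑ j, a i * a j
        * Real.sin (phase c θ (unitStep i) - phase c θ (unitStep j))
        = -∑ i, ∑ j, a i * a j
        * Real.sin (phase c θ (unitStep i) - phase c θ (unitStep j)) := by
      conv_lhs => rw [Finset.sum_comm]
      rw [← Finset.sum_neg_distrib]
      refine Finset.sum_congr rfl fun i _ => ?_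
      rw [← Finset.sum_neg_distrib]
      refine Finset.sum_congr rfl fun j _ => ?_
      rw [← neg_sub (phase c θ (unitStep i)), Real.sin_neg]
      ring
    linarith
  calc _ = ∑ i, ∑ j, (Real.cos (phase c θ y) * (a i * a j
          * Real.cos (phase c θ (unitStep i) - phase c θ (unitStep j)))
        - Real.sin (phase c θ y) * (a i * a j
          * Real.sin (phase c θ (unitStep i) - phase c θ (unitStep j)))) := by
        refine Finset.sum_congr rfl fun i _ => Finset.sum_congr rfl fun j _ => ?_
        rw [phase_add_sub, Real.cos_add]
        ring
    _ = _ := by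
        simp only [Finset.sum_sub_distrib, ← Finset.mul_sum]
        rw [hsin, mul_zero, sub_zero, diffChar]

variable {a : Fin d → ℝ}

theorem one_sub_diffChar (ha1 : ∑ i, a i = 1) (c : Fin 3 → Fin d) (θ : Fin 3 → ℝ) :
    1 - diffChar c a θ = ∑ i, ∑ j, a i * a j
      * (1 - Real.cos (phase c θ (unitStep i) - phase c θ (unitStep j))) := by
  have h1 : ∑ i, ∑ j, a i * a j = 1 := by rw [← Finset.sum_mul_sum, ha1, one_mul]
  simp only [mul_sub, mul_one, Finset.sum_sub_distrib, h1, diffChar]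

theorem one_sub_diffChar_nonneg (ha : ∀ i, 0 < a i) (ha1 : ∑ i, a i = 1) (c : Fin 3 → Fin d)
    (θ : Fin 3 → ℝ) : 0 ≤ 1 - diffChar c a θ := by
  rw [one_sub_diffChar ha1]
  exact Finset.sum_nonneg fun i _ => Finset.sum_nonneg fun j _ =>
    mul_nonneg (mul_pos (ha i) (ha j)).le (sub_nonneg.2 (Real.cos_le_one _))

/-- Only the pairs of a step `c l` with the step `k` are kept. The latter has phase zero, so each
pair contributes a multiple of `1 - cos θ_l`, which is at least `2 θ_l² / π²`. By the
arithmetic-geometric mean inequality the sum of the three squares dominates a product of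
one-variable functions with integrable inverses. -/
theorem exists_le_one_sub_diffChar (ha : ∀ i, 0 < a i) (ha1 : ∑ i, a i = 1) {c : Fin 3 → Fin d}
    (hc : Function.Injective c) {k : Fin d} (hk : ∀ l, c l ≠ k) :
    ∃ C > 0, ∀ θ : Fin 3 → ℝ, (∀ l, |θ l| ≤ Real.pi) →
      C * ∏ l, (θ l ^ 2) ^ (1 / 3 : ℝ) ≤ 1 - diffChar c a θ := by
  obtain ⟨a0, ha0, hle⟩ : ∃ a0 > 0, ∀ i, a0 ≤ a i := by
    obtain ⟨m, -, hm⟩ := Finset.exists_min_image Finset.univ a ⟨k, Finset.mem_univ k⟩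
    exact ⟨a m, ha m, fun i => hm i (Finset.mem_univ i)⟩
  have hpi := Real.pi_pos
  refine ⟨3 * (a0 * a0 * (2 / Real.pi ^ 2)), by positivity, fun θ hθ => ?_⟩
  have hph : ∀ l, phase c θ (unitStep (c l)) = θ l := fun l => by
    rw [phase, Finset.sum_eq_single l]
    · simp [unitStep]
    · intro m _ hm
      have : c m ≠ c l := fun h => hm (hc h)
      simp [unitStep, this]
    · simp
  have hph0 : phase c θ (unitStep k) = 0 := by
    rw [phase]
    refine Finset.sum_eq_zero fun l _ => ?_
    simp [unitStep, hk l]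
  have hnn : ∀ i j, 0 ≤ a i * a j
      * (1 - Real.cos (phase c θ (unitStep i) - phase c θ (unitStep j))) := fun i j =>
    mul_nonneg (mul_pos (ha i) (ha j)).le (sub_nonneg.2 (Real.cos_le_one _))
  have h1 : ∑ l, a0 * a0 * (2 / Real.pi ^ 2 * θ l ^ 2) ≤ 1 - diffChar c a θ := by
    rw [one_sub_diffChar ha1]
    calc ∑ l, a0 * a0 * (2 / Real.pi ^ 2 * θ l ^ 2)
        ≤ ∑ l, a (c l) * a k
          * (1 - Real.cos (phase c θ (unitStep (c l)) - phase c θ (unitStep k))) := by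
          refine Finset.sum_le_sum fun l _ => ?_
          rw [hph, hph0, sub_zero]
          have := Real.cos_le_one_sub_mul_cos_sq (hθ l)
          exact mul_le_mul (mul_le_mul (hle _) (hle _) ha0.le (ha _).le) (by linarith)
            (by positivity) (mul_pos (ha _) (ha _)).le
      _ = ∑ i ∈ Finset.univ.image c, a i * a k
          * (1 - Real.cos (phase c θ (unitStep i) - phase c θ (unitStep k))) := by
          rw [Finset.sum_image fun _ _ _ _ h => hc h]
      _ ≤ ∑ i, a i * a k
          * (1 - Real.cos (phase c θ (unitStep i) - phase c θ (unitStep k))) :=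
          Finset.sum_le_univ_sum_of_nonneg fun i => hnn i k
      _ ≤ _ := Finset.sum_le_sum fun i _ =>
          Finset.single_le_sum (f := fun j => a i * a j
            * (1 - Real.cos (phase c θ (unitStep i) - phase c θ (unitStep j))))
            (fun j _ => hnn i j) (Finset.mem_univ k)
  have h2 := Real.geom_mean_le_arith_mean3_weighted (w₁ := 1 / 3) (w₂ := 1 / 3) (w₃ := 1 / 3)
    (by norm_num) (by norm_num) (by norm_num) (sq_nonneg (θ 0)) (sq_nonneg (θ 1))
    (sq_nonneg (θ 2)) (by norm_num)
  rw [Fin.prod_univ_three]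
  rw [Fin.sum_univ_three] at h1
  have h3 : 0 < a0 * a0 * (2 / Real.pi ^ 2) := by positivity
  calc _ ≤ 3 * (a0 * a0 * (2 / Real.pi ^ 2))
        * (1 / 3 * θ 0 ^ 2 + 1 / 3 * θ 1 ^ 2 + 1 / 3 * θ 2 ^ 2) := by gcongr
    _ = _ := by ring
    _ ≤ _ := h1

theorem measurable_phase (c : Fin 3 → Fin d) (y : Site d) : Measurable fun θ => phase c θ y := by
  unfold phase
  fun_prop

theorem measurable_diffChar (c : Fin 3 → Fin d) : Measurable fun θ => diffChar c a θ := by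
  unfold diffChar phase
  fun_prop

theorem integrable_inv_one_sub_diffChar (ha : ∀ i, 0 < a i) (ha1 : ∑ i, a i = 1)
    {c : Fin 3 → Fin d} (hc : Function.Injective c) {k : Fin d} (hk : ∀ l, c l ≠ k) :
    Integrable (fun θ => (1 - diffChar c a θ)⁻¹) cubeMeasure := by
  obtain ⟨C, hC, hle⟩ := exists_le_one_sub_diffChar ha ha1 hc hk
  have hint : Integrable (fun θ : Fin 3 → ℝ => C⁻¹ * ∏ l, (θ l ^ 2) ^ (-(1 / 3) : ℝ))
      cubeMeasure :=
    (Integrable.fintype_prod (f := fun (_ : Fin 3) (x : ℝ) => (x ^ 2) ^ (-(1 / 3) : ℝ))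
      fun _ => integrableOn_sq_rpow).const_mul _
  refine hint.mono' ((measurable_const.sub (measurable_diffChar c)).inv.aestronglyMeasurable) ?_
  filter_upwards [ae_abs_le_pi] with θ hθ
  have h0 := one_sub_diffChar_nonneg ha ha1 c θ
  rw [Real.norm_of_nonneg (inv_nonneg.2 h0)]
  have hpos : ∀ l, 0 < (θ l ^ 2) ^ (1 / 3 : ℝ) := fun l =>
    Real.rpow_pos_of_pos (pow_pos (abs_pos.2 (hθ l).2) 2 |>.trans_le (sq_abs _).le) _
  have hp : 0 < C * ∏ l, (θ l ^ 2) ^ (1 / 3 : ℝ) := mul_pos hC (Finset.prod_pos fun l _ => hpos l)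
  calc (1 - diffChar c a θ)⁻¹ ≤ (C * ∏ l, (θ l ^ 2) ^ (1 / 3 : ℝ))⁻¹ :=
        inv_anti₀ hp (hle θ fun l => (hθ l).1)
    _ = _ := by
        rw [mul_inv, ← Finset.prod_inv_distrib]
        congr 1
        exact Finset.prod_congr rfl fun l _ => (Real.rpow_neg (sq_nonneg _) _).symm

/-- Divide each character by `1 - diffChar` and integrate: applying the step operator multiplies by
`diffChar`, and the difference is the integral of a character, supported where the three chosen
coordinates vanish. -/
theorem exists_green (hd : 4 ≤ d) (ha : ∀ i, 0 < a i) (ha1 : ∑ i, a i = 1) :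
    ∃ (G : Site d → ℝ) (M : ℝ), (∀ y, 0 ≤ G y) ∧ (∀ y, G y ≤ M) ∧
      ∀ y, ∑ i, ∑ j, a i * a j * G (y + unitStep i - unitStep j)
        ≤ G y - (Pi.single 0 1 : Site d → ℝ) y := by
  -- Three coordinates already give transience; a fourth direction `k` supplies the step of phase
  -- zero.
  set c : Fin 3 → Fin d := Fin.castLE (by omega) with hcdef
  have hc : Function.Injective c := Fin.castLE_injective _
  set k : Fin d := ⟨3, by omega⟩
  have hk : ∀ l, c l ≠ k := fun l h => by
    have := congrArg Fin.val h
    simp only [hcdef, Fin.val_castLE, k] at this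
    omega
  have hint := integrable_inv_one_sub_diffChar ha ha1 hc hk
  have hfin : IsFiniteMeasure cubeMeasure := by
    unfold cubeMeasure; infer_instance
  set g : (Fin 3 → ℝ) → ℝ := fun θ => (1 - diffChar c a θ)⁻¹ with hg
  have hg0 : ∀ θ, 0 ≤ g θ := fun θ => inv_nonneg.2 (one_sub_diffChar_nonneg ha ha1 c θ)
  have hbd : ∀ y : Site d, Integrable (fun θ => (1 + Real.cos (phase c θ y)) * g θ) cubeMeasure :=
    fun y => hint.bdd_mul (c := 2)
      ((measurable_const.add (Real.measurable_cos.comp (measurable_phase c y))).aestronglyMeasurable)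
      (ae_of_all _ fun θ => by
        have h1 := Real.cos_le_one (phase c θ y)
        have h2 := Real.neg_one_le_cos (phase c θ y)
        rw [Real.norm_eq_abs, abs_le]; constructor <;> linarith)
  set Z : ℝ := (2 * Real.pi) ^ 3 with hZ
  have hZ0 : 0 < Z := by have := Real.pi_pos; positivity
  -- The added `1` contributes a constant, which the step operator preserves, and makes the
  -- integrand nonnegative.
  refine ⟨fun y => Z⁻¹ * ∫ θ, (1 + Real.cos (phase c θ y)) * g θ ∂cubeMeasure,
    Z⁻¹ * ∫ θ, 2 * g θ ∂cubeMeasure, fun y => ?_, fun y => ?_, fun y => ?_⟩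
  · refine mul_nonneg (inv_nonneg.2 hZ0.le) (integral_nonneg fun θ => mul_nonneg ?_ (hg0 θ))
    have := Real.neg_one_le_cos (phase c θ y)
    linarith
  · refine mul_le_mul_of_nonneg_left (integral_mono (hbd y) (hint.const_mul 2) fun θ => ?_)
      (inv_nonneg.2 hZ0.le)
    have := Real.cos_le_one (phase c θ y)
    exact mul_le_mul_of_nonneg_right (by linarith) (hg0 θ)
  · have h1 : ∑ i, ∑ j, a i * a j * (Z⁻¹ * ∫ θ, (1 + Real.cos
        (phase c θ (y + unitStep i - unitStep j))) * g θ ∂cubeMeasure)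
        = Z⁻¹ * ∫ θ, (1 + Real.cos (phase c θ y) * diffChar c a θ) * g θ ∂cubeMeasure := by
      have h2 : ∀ θ, (1 + Real.cos (phase c θ y) * diffChar c a θ) * g θ
          = ∑ i, ∑ j, a i * a j * ((1 + Real.cos
            (phase c θ (y + unitStep i - unitStep j))) * g θ) := by
        intro θ
        have h3 : ∑ i, ∑ j, a i * a j = 1 := by rw [← Finset.sum_mul_sum, ha1, one_mul]
        rw [← sum_cos_phase, add_mul, one_mul, ← one_mul (g θ)]
        nth_rewrite 1 [← h3]
        rw [one_mul, Finset.sum_mul, Finset.sum_mul, ← Finset.sum_add_distrib]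
        refine Finset.sum_congr rfl fun i _ => ?_
        rw [Finset.sum_mul, Finset.sum_mul, ← Finset.sum_add_distrib]
        exact Finset.sum_congr rfl fun j _ => by ring
      simp only [h2]
      rw [integral_finsetSum _ fun i _ => integrable_finsetSum _ fun j _ => (hbd _).const_mul _,
        Finset.mul_sum]
      refine Finset.sum_congr rfl fun i _ => ?_
      rw [integral_finsetSum _ fun j _ => (hbd _).const_mul _, Finset.mul_sum]
      refine Finset.sum_congr rfl fun j _ => ?_
      rw [integral_const_mul]
      ring
    have h4 : ∫ θ, (1 + Real.cos (phase c θ y)) * g θ ∂cubeMeasure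
        = ∫ θ, (1 + Real.cos (phase c θ y) * diffChar c a θ) * g θ ∂cubeMeasure
          + ∫ θ, Real.cos (phase c θ y) ∂cubeMeasure := by
      have hcos : Integrable (fun θ => Real.cos (phase c θ y)) cubeMeasure :=
        Integrable.of_bound
          (Real.measurable_cos.comp (measurable_phase c y)).aestronglyMeasurable 1
          (ae_of_all _ fun θ => Real.abs_cos_le_one _)
      have hae : ∀ᵐ θ ∂cubeMeasure, (1 + Real.cos (phase c θ y) * diffChar c a θ) * g θ
          = (1 + Real.cos (phase c θ y)) * g θ - Real.cos (phase c θ y) := by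
        obtain ⟨C, hC, hle⟩ := exists_le_one_sub_diffChar ha ha1 hc hk
        filter_upwards [ae_abs_le_pi] with θ hθ
        have hpos : ∀ l, 0 < (θ l ^ 2) ^ (1 / 3 : ℝ) := fun l =>
          Real.rpow_pos_of_pos (pow_pos (abs_pos.2 (hθ l).2) 2 |>.trans_le (sq_abs _).le) _
        have hp : 0 < 1 - diffChar c a θ :=
          (mul_pos hC (Finset.prod_pos fun l _ => hpos l)).trans_le (hle θ fun l => (hθ l).1)
        simp only [hg]
        field_simp
        ring
      rw [integral_congr_ae hae, integral_sub (hbd y) hcos]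
      ring
    -- Only an inequality, since the right side is `1` whenever the three observed coordinates of
    -- `y` vanish.
    have h5 : (Pi.single 0 1 : Site d → ℝ) y ≤ Z⁻¹ * ∫ θ, Real.cos (phase c θ y) ∂cubeMeasure := by
      simp only [phase]
      rw [integral_cos_cube fun l => y (c l)]
      by_cases hy : y = 0
      · subst hy
        simp only [Pi.single_eq_same, Pi.zero_apply, if_true, Finset.prod_const, Finset.card_univ,
          Fintype.card_fin]
        rw [← hZ, inv_mul_cancel₀ hZ0.ne']
      · rw [Pi.single_eq_of_ne hy]
        refine mul_nonneg (inv_nonneg.2 hZ0.le) (Finset.prod_nonneg fun l _ => ?_)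
        have := Real.pi_pos
        split_ifs <;> positivity
    rw [h1]
    beta_reduce
    rw [h4, mul_add]
    linarith

end Green

/-- In dimension at least `4`, weak disorder holds for small disorder. -/
theorem exists_weak_disorder {d : ℕ} (hd : 4 ≤ d) {a : Fin d → ℝ} (ha : ∀ i, 0 < a i)
    (ha1 : ∑ i, a i = 1) :
    ∃ t0 > 0, ∀ {E : Type} [MeasurableSpace E] (μ : Measure E) [IsProbabilityMeasure μ] (t : ℝ)
      (w : E → Fin d → ℝ), IsWeight μ a t w → t ≤ t0 → freeEnergy μ w = 0 := by
  obtain ⟨G, M, hG0, hGM, hG⟩ := exists_green hd ha ha1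
  have hM : 0 ≤ M := (hG0 0).trans (hGM 0)
  refine ⟨√(1 / (2 * M + 1)), by positivity, fun μ _ t w h ht => ?_⟩
  have : Nonempty (Fin d) := ⟨⟨0, by omega⟩⟩
  refine h.freeEnergy_eq_zero_of_green hG0 hGM hG ?_
  have h1 := pow_le_pow_left₀ h.t_nonneg ht 2
  rw [Real.sq_sqrt (by positivity)] at h1
  calc t ^ 2 * (2 * M + 1) ≤ 1 / (2 * M + 1) * (2 * M + 1) := by gcongr
    _ = 1 := by field_simp

/-! ### The size-biased law of path and environment -/

theorem integral_prod_eval {ι κ E : Type*} [MeasurableSpace E] {μ : Measure E}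
    [IsProbabilityMeasure μ] (s : Finset κ) {p : κ → ι} (hp : Set.InjOn p s) {φ : κ → E → ℝ}
    (hφ : ∀ i, BMeas (φ i)) :
    ∫ ξ, ∏ i ∈ s, φ i (ξ (p i)) ∂fieldLaw ι μ = ∏ i ∈ s, ∫ r, φ i r ∂μ := by
  classical
  induction s using Finset.induction_on with
  | empty => simp
  | insert k s hk ih =>
    simp only [Finset.prod_insert hk]
    rw [integral_mul_of_dependsOn (S := {p k}) (T := p '' s)
      ((hφ k).comp (measurable_pi_apply (p k)))
      (BMeas.prod s fun i _ => (hφ i).comp (measurable_pi_apply (p i))),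
      integral_eval (hφ k).meas, ih (hp.mono (by simp))]
    · intro ξ ξ' hξ
      simp only [hξ (p k) rfl]
    · intro ξ ξ' hξ
      exact Finset.prod_congr rfl fun i hi => by rw [hξ (p i) ⟨i, hi, rfl⟩]
    · rw [Set.disjoint_singleton_right]
      rintro ⟨i, hi, hik⟩
      have := hp (by simp) (by simp [Finset.mem_coe.1 hi]) hik.symm
      exact hk (this ▸ hi)

theorem sum_prod_paths {d N : ℕ} (g : Fin N → Fin d → ℝ) :
    ∑ e : Fin N → Fin d, ∏ i, g i (e i) = ∏ i, ∑ j, g i j := by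
  rw [Finset.prod_univ_sum, Fintype.piFinset_univ]

/-- Expectation with respect to the directed walk with step law `a`. -/
def wexp {d : ℕ} (a : Fin d → ℝ) (N : ℕ) (f : (Fin N → Fin d) → ℝ) : ℝ :=
  ∑ e, (∏ i, a (e i)) * f e

section Walk

variable {d N : ℕ} {a : Fin d → ℝ}

theorem wexp_mono (ha : ∀ i, 0 ≤ a i) {f g : (Fin N → Fin d) → ℝ} (h : ∀ e, f e ≤ g e) :
    wexp a N f ≤ wexp a N g :=
  Finset.sum_le_sum fun e _ => mul_le_mul_of_nonneg_left (h e) (Finset.prod_nonneg fun _ _ => ha _)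

theorem wexp_sum {ι : Type*} (s : Finset ι) (f : ι → (Fin N → Fin d) → ℝ) :
    wexp a N (fun e => ∑ i ∈ s, f i e) = ∑ i ∈ s, wexp a N (f i) := by
  simp only [wexp, Finset.mul_sum]
  exact Finset.sum_comm

theorem wexp_const_mul (c : ℝ) (f : (Fin N → Fin d) → ℝ) :
    wexp a N (fun e => c * f e) = c * wexp a N f := by
  simp only [wexp, Finset.mul_sum]
  exact Finset.sum_congr rfl fun e _ => by ring

theorem wexp_add (f g : (Fin N → Fin d) → ℝ) :
    wexp a N (fun e => f e + g e) = wexp a N f + wexp a N g := by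
  simp only [wexp, mul_add, Finset.sum_add_distrib]

theorem wexp_prod (g : Fin N → Fin d → ℝ) :
    wexp a N (fun e => ∏ i, g i (e i)) = ∏ i, ∑ j, a j * g i j := by
  simp only [wexp, ← Finset.prod_mul_distrib]
  exact sum_prod_paths fun i j => a j * g i j

theorem wexp_const (ha1 : ∑ i, a i = 1) (c : ℝ) : wexp a N (fun _ => c) = c := by
  have h := wexp_prod (N := N) (a := a) fun _ _ => 1
  simp only [Finset.prod_const_one, mul_one, ha1] at h
  have := wexp_const_mul (N := N) (a := a) c fun _ => 1
  simpa [h] using this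

/-- The second moment of a sum of independent centered steps. -/
theorem wexp_sum_sq_le (ha : ∀ i, 0 ≤ a i) (ha1 : ∑ i, a i = 1) {b : Fin d → ℝ}
    (hb : ∑ j, a j * b j = 0) (hb1 : ∀ j, |b j| ≤ 1) (I : Finset (Fin N)) :
    wexp a N (fun e => (∑ i ∈ I, b (e i)) ^ 2) ≤ I.card := by
  have hpair : ∀ i i' : Fin N, wexp a N (fun e => b (e i) * b (e i')) ≤ if i = i' then 1 else 0 := by
    intro i i'
    split_ifs with h
    · subst h
      calc wexp a N (fun e => b (e i) * b (e i)) ≤ wexp a N (fun _ => 1) := by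
            refine wexp_mono ha fun e => ?_
            rw [← abs_mul_abs_self]
            exact mul_le_one₀ (hb1 _) (abs_nonneg _) (hb1 _)
        _ = 1 := wexp_const ha1 1
    · have he : ∀ e : Fin N → Fin d, b (e i) * b (e i')
          = ∏ m, (if m = i then b (e m) else if m = i' then b (e m) else 1) := by
        intro e
        rw [← Finset.mul_prod_erase Finset.univ _ (Finset.mem_univ i), if_pos rfl]
        congr 1
        rw [Finset.prod_eq_single i']
        · simp [Ne.symm h]
        · intro m hm hm'
          simp [(Finset.mem_erase.1 hm).1, hm']
        · intro hi'
          exact absurd (Finset.mem_erase.2 ⟨fun h' => h h'.symm, Finset.mem_univ _⟩) hi'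
      simp only [he]
      rw [wexp_prod (fun m j => if m = i then b j else if m = i' then b j else 1)]
      refine (Finset.prod_eq_zero (Finset.mem_univ i) ?_).le
      simpa using hb
  have hexp : ∀ e : Fin N → Fin d, (∑ i ∈ I, b (e i)) ^ 2
      = ∑ i ∈ I, ∑ i' ∈ I, b (e i) * b (e i') := fun e => by
    rw [sq, Finset.sum_mul_sum]
  simp only [hexp, wexp_sum]
  calc _ ≤ ∑ i ∈ I, ∑ i' ∈ I, (if i = i' then (1 : ℝ) else 0) :=
        Finset.sum_le_sum fun i _ => Finset.sum_le_sum fun i' _ => hpair i i'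
    _ = I.card := by simp

/-- The exponential moment of a sum of independent centered steps. -/
theorem wexp_exp_le (ha : ∀ i, 0 ≤ a i) (ha1 : ∑ i, a i = 1) {b : Fin d → ℝ}
    (hb : ∑ j, a j * b j = 0) (hb1 : ∀ j, |b j| ≤ 1) {s : ℝ} (hs : |s| ≤ 1) :
    wexp a N (fun e => Real.exp (s * ∑ i, b (e i))) ≤ Real.exp (N * s ^ 2) := by
  have he : ∀ e : Fin N → Fin d, Real.exp (s * ∑ i, b (e i)) = ∏ i, Real.exp (s * b (e i)) :=
    fun e => by rw [Finset.mul_sum, Real.exp_sum]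
  simp only [he]
  rw [wexp_prod fun _ j => Real.exp (s * b j), Finset.prod_const, Finset.card_univ,
    Fintype.card_fin]
  have h1 : ∑ j, a j * Real.exp (s * b j) ≤ Real.exp (s ^ 2) := by
    have hj : ∀ j, a j * Real.exp (s * b j) ≤ a j * (1 + s * b j + s ^ 2) := by
      intro j
      refine mul_le_mul_of_nonneg_left ?_ (ha j)
      have hsb : |s * b j| ≤ 1 := by
        rw [abs_mul]; exact mul_le_one₀ hs (abs_nonneg _) (hb1 j)
      -- `exp x ≤ 1 + x + x²` for `|x| ≤ 1`; the linear term disappears on averaging.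
      have h2 := Real.abs_exp_sub_one_sub_id_le hsb
      have h3 : (s * b j) ^ 2 ≤ s ^ 2 := by
        rw [mul_pow]
        have : b j ^ 2 ≤ 1 := by rw [← sq_abs]; exact pow_le_one₀ (abs_nonneg _) (hb1 j)
        nlinarith [sq_nonneg s]
      linarith [(abs_le.1 h2).2]
    calc _ ≤ ∑ j, a j * (1 + s * b j + s ^ 2) := Finset.sum_le_sum fun j _ => hj j
      _ = (∑ j, a j) * (1 + s ^ 2) + s * ∑ j, a j * b j := by
          rw [Finset.sum_mul, Finset.mul_sum, ← Finset.sum_add_distrib]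
          exact Finset.sum_congr rfl fun j _ => by ring
      _ = s ^ 2 + 1 := by rw [ha1, hb]; ring
      _ ≤ _ := Real.add_one_le_exp _
  calc _ ≤ Real.exp (s ^ 2) ^ N := pow_le_pow_left₀ (Finset.sum_nonneg fun j _ =>
        mul_nonneg (ha j) (Real.exp_pos _).le) h1 N
    _ = _ := by rw [← Real.exp_nat_mul]

end Walk

theorem dirPos_injOn {d N : ℕ} (x : Site d) (e : Fin N → Fin d) :
    Set.InjOn (fun i : ℕ => dirPos x e i) {i | i ≤ N} := by
  intro i hi j hj hij
  have := congrArg level hij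
  simp only [level_dirPos x e hi, level_dirPos x e hj] at this
  omega

namespace IsWeight

variable {d N : ℕ} {E : Type*} [MeasurableSpace E] {μ : Measure E} [IsProbabilityMeasure μ]
  {a : Fin d → ℝ} {t : ℝ} {w : E → Fin d → ℝ}

theorem integral_pathWt (h : IsWeight μ a t w) (x : Site d) (e : Fin N → Fin d) :
    ∫ ξ, pathWt w ξ x e ∂fieldLaw (Site d) μ = ∏ i, a (e i) := by
  have := integral_prod_eval (μ := μ) Finset.univ (p := fun i : Fin N => dirPos x e i)
    (fun i _ j _ hij => Fin.ext (dirPos_injOn x e i.2.le j.2.le hij))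
    (φ := fun i r => w r (e i)) (fun i => h.bmeas (e i))
  simpa only [pathWt, h.mean] using this

/-- The fluctuations along the path are independent with mean `v` under the size-biased law. -/
theorem tilt_prod_fluct (h : IsWeight μ a t w) (x : Site d) {I : Finset ℕ}
    (hI : I ⊆ Finset.range N) :
    ∑ e : Fin N → Fin d, ∫ ξ, pathWt w ξ x e * ∏ i ∈ I, fluct w (ξ (dirPos x e i))
      ∂fieldLaw (Site d) μ = (∫ r, fluct w r ^ 2 ∂μ) ^ I.card := by
  set v := ∫ r, fluct w r ^ 2 ∂μ with hv
  have h1 : ∀ (e : Fin N → Fin d) (ξ : Site d → E),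
      pathWt w ξ x e * ∏ i ∈ I, fluct w (ξ (dirPos x e i))
        = ∏ i : Fin N, w (ξ (dirPos x e i)) (e i)
          * (if i.val ∈ I then fluct w (ξ (dirPos x e i)) else 1) := by
    intro e ξ
    rw [Finset.prod_mul_distrib, pathWt]
    congr 1
    rw [Fin.prod_univ_eq_prod_range (fun i => if i ∈ I then fluct w (ξ (dirPos x e i)) else 1) N,
      Finset.prod_ite_mem, Finset.inter_eq_right.2 hI]
  have hb : ∀ (i : Fin N) (j : Fin d), BMeas fun r => w r j * (if i.val ∈ I then fluct w r else 1) :=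
    fun i j => (h.bmeas j).mul (by split_ifs; exacts [h.bmeas_fluct, BMeas.const 1])
  have h2 : ∀ e : Fin N → Fin d, ∫ ξ, pathWt w ξ x e * ∏ i ∈ I, fluct w (ξ (dirPos x e i))
      ∂fieldLaw (Site d) μ
        = ∏ i, ∫ r, w r (e i) * (if i.val ∈ I then fluct w r else 1) ∂μ := by
    intro e
    simp only [h1]
    exact integral_prod_eval (μ := μ) Finset.univ (p := fun i : Fin N => dirPos x e i)
      (fun i _ j _ hij => Fin.ext (dirPos_injOn x e i.2.le j.2.le hij))
      (φ := fun i r => w r (e i) * (if i.val ∈ I then fluct w r else 1)) (fun i => hb i (e i))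
  simp only [h2]
  rw [sum_prod_paths fun (i : Fin N) j => ∫ r, w r j * (if i.val ∈ I then fluct w r else 1) ∂μ]
  have h3 : ∀ i : Fin N, ∑ j, ∫ r, w r j * (if i.val ∈ I then fluct w r else 1) ∂μ
      = if i.val ∈ I then v else 1 := by
    intro i
    rw [← integral_finsetSum _ fun j _ => (hb i j).integrable μ]
    simp only [← Finset.sum_mul]
    split_ifs with hi
    -- Size-biasing multiplies by the total weight `1 + fluct`, which turns a centered fluctuation
    -- into one of mean `v`.
    · have : ∀ r, (∑ j, w r j) * fluct w r = fluct w r + fluct w r ^ 2 := fun r => by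
        rw [fluct]; ring
      simp only [this]
      rw [integral_add (h.bmeas_fluct.integrable μ) ((h.bmeas_fluct.pow 2).integrable μ),
        h.integral_fluct, zero_add]
    · simp only [mul_one]
      rw [integral_finsetSum _ fun j _ => (h.bmeas j).integrable μ]
      simp [h.mean, h.sum_one]
  simp only [h3]
  rw [Fin.prod_univ_eq_prod_range (fun i => if i ∈ I then v else 1) N, Finset.prod_ite_mem,
    Finset.inter_eq_right.2 hI, Finset.prod_const]

end IsWeight

/-! ### Counting sites near the axis of the walk -/

/-- The deviation of a site from the mean position of the directed walk. -/
def dev {d : ℕ} (a : Fin d → ℝ) (x : Site d) (j : Fin d) : ℝ := x j - level x * a j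

/-- The distance of the levels of two sites. -/
def gap {d : ℕ} (x y : Site d) : ℕ := (level y - level x).natAbs

/-- The partial sums of the harmonic series. -/
def harm (n : ℕ) : ℝ := ∑ k ∈ Finset.range n, 1 / ((k : ℝ) + 1)

theorem harm_nonneg (n : ℕ) : 0 ≤ harm n := Finset.sum_nonneg fun _ _ => by positivity

/-- Two sites on different levels at most `n` apart, at diffusive distance. -/
def Near {d : ℕ} (a : Fin d → ℝ) (n : ℕ) (R : ℝ) (x y : Site d) : Prop :=
  (1 ≤ gap x y ∧ gap x y ≤ n) ∧ ∀ j, |dev a y j - dev a x j| ≤ R * √(gap x y)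

open Classical in
/-- The kernel of the quadratic form. -/
def dkern {d : ℕ} (a : Fin d → ℝ) (n : ℕ) (R : ℝ) (x y : Site d) : ℝ :=
  if Near a n R x y then 1 / (gap x y : ℝ) else 0

section Count

variable {d : ℕ} {a : Fin d → ℝ} {n : ℕ} {R : ℝ}

theorem dev_add (x y : Site d) (j : Fin d) : dev a (x + y) j = dev a x j + dev a y j := by
  simp only [dev, level_add, Pi.add_apply]
  push_cast
  ring

theorem gap_comm (x y : Site d) : gap x y = gap y x := by
  simp only [gap]; omega

theorem near_comm (x y : Site d) : Near a n R x y ↔ Near a n R y x := by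
  simp only [Near, gap_comm x y, abs_sub_comm]

theorem dkern_comm (x y : Site d) : dkern a n R x y = dkern a n R y x := by
  rw [dkern, dkern, gap_comm x y]
  by_cases h : Near a n R x y
  · rw [if_pos h, if_pos ((near_comm x y).1 h)]
  · rw [if_neg h, if_neg fun h' => h ((near_comm x y).2 h')]

theorem dkern_self (x : Site d) : dkern a n R x x = 0 := by
  simp [dkern, Near, gap]

theorem dkern_nonneg (x y : Site d) : 0 ≤ dkern a n R x y := by
  simp only [dkern]; split_ifs <;> positivity

theorem card_int_le (S : Finset ℤ) {u r : ℝ} (hr : 0 ≤ r) (h : ∀ z ∈ S, |(z : ℝ) - u| ≤ r) :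
    (S.card : ℝ) ≤ 2 * r + 1 := by
  have hsub : S ⊆ Finset.Icc ⌈u - r⌉ ⌊u + r⌋ := by
    intro z hz
    have := abs_le.1 (h z hz)
    rw [Finset.mem_Icc]
    exact ⟨Int.ceil_le.2 (by linarith), Int.le_floor.2 (by linarith)⟩
  have h1 := Finset.card_le_card hsub
  rw [Int.card_Icc] at h1
  have h2 : (S.card : ℤ) ≤ max (⌊u + r⌋ + 1 - ⌈u - r⌉) 0 := by omega
  have h3 : (S.card : ℝ) ≤ max ((⌊u + r⌋ : ℝ) + 1 - ⌈u - r⌉) 0 := by exact_mod_cast h2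
  refine h3.trans (max_le ?_ (by linarith))
  have := Int.floor_le (u + r)
  have := Int.le_ceil (u - r)
  linarith

/-- The place where the dimension enters: on a fixed level, two coordinates determine a site, and
each takes at most `2r + 1` values. In dimension two the exponent is not optimal, but it suffices.
-/
theorem card_level_le (hd : d = 2 ∨ d = 3) (S : Finset (Site d)) {l : ℤ} {c : Fin d → ℝ} {r : ℝ}
    (hr : 0 ≤ r) (hl : ∀ y ∈ S, level y = l) (hc : ∀ y ∈ S, ∀ j, |dev a y j - c j| ≤ r) :
    (S.card : ℝ) ≤ (2 * r + 1) ^ 2 := by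
  have hcoord : ∀ j, ((S.image fun y => y j).card : ℝ) ≤ 2 * r + 1 := by
    intro j
    refine card_int_le _ (u := c j + l * a j) hr ?_
    intro z hz
    obtain ⟨y, hy, rfl⟩ := Finset.mem_image.1 hz
    have := hc y hy j
    rw [dev, hl y hy] at this
    convert this using 2
    ring
  have key : ∀ i j : Fin d, (Set.InjOn (fun y : Site d => (y i, y j)) S) →
      (S.card : ℝ) ≤ (2 * r + 1) ^ 2 := by
    intro i j hinj
    have h1 : S.card ≤ ((S.image fun y => y i) ×ˢ (S.image fun y => y j)).card :=
      Finset.card_le_card_of_injOn (fun y => (y i, y j)) (fun y hy => by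
        simp only [Finset.coe_product, Set.mem_prod, Finset.mem_coe, Finset.mem_image]
        exact ⟨⟨y, hy, rfl⟩, ⟨y, hy, rfl⟩⟩) hinj
    rw [Finset.card_product] at h1
    calc (S.card : ℝ) ≤ ((S.image fun y => y i).card : ℝ) * (S.image fun y => y j).card := by
          exact_mod_cast h1
      _ ≤ (2 * r + 1) * (2 * r + 1) := by
          gcongr
          exacts [hcoord i, hcoord j]
      _ = _ := by ring
  rcases hd with rfl | rfl
  · refine key 0 1 fun x hx y hy hxy => ?_
    simp only [Prod.mk.injEq] at hxy
    ext j
    fin_cases j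
    exacts [hxy.1, hxy.2]
  · refine key 0 1 fun x hx y hy hxy => ?_
    simp only [Prod.mk.injEq] at hxy
    have h1 := hl x hx
    have h2 := hl y hy
    simp only [level, Fin.sum_univ_three] at h1 h2
    ext j
    fin_cases j
    exacts [hxy.1, hxy.2, by simp only [Fin.reduceFinMk]; omega]

open Classical in
-- At level distance `k + 1` the radius is `R √(k+1)`, which leaves at most `9 R² (k+1)` sites on
-- each of the two levels, above and below.
theorem sum_near_le (hd : d = 2 ∨ d = 3) (hR : 1 ≤ R) (S : Finset (Site d)) (x : Site d)
    {f : ℕ → ℝ} (hf : ∀ k, 0 ≤ f k) :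
    ∑ y ∈ S with Near a n R x y, f (gap x y)
      ≤ ∑ k ∈ Finset.range n, 18 * R ^ 2 * ((k : ℝ) + 1) * f (k + 1) := by
  rw [← Finset.sum_fiberwise_of_maps_to (s := S.filter (Near a n R x)) (t := Finset.range n)
    (g := fun y => gap x y - 1) (fun y hy => by
      have := (Finset.mem_filter.1 hy).2.1
      rw [Finset.mem_range]; omega)]
  refine Finset.sum_le_sum fun k _ => ?_
  set F := (S.filter (Near a n R x)).filter fun y => gap x y - 1 = k with hF
  have hgap : ∀ y ∈ F, gap x y = k + 1 := by
    intro y hy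
    rw [hF, Finset.mem_filter, Finset.mem_filter] at hy
    have := hy.1.2.1
    omega
  have hdev : ∀ y ∈ F, ∀ j, |dev a y j - dev a x j| ≤ R * √((k : ℝ) + 1) := by
    intro y hy j
    have h1 := hgap y hy
    rw [hF, Finset.mem_filter, Finset.mem_filter] at hy
    have := hy.1.2.2 j
    rw [h1] at this
    exact_mod_cast this
  have hs1 : 1 ≤ √((k : ℝ) + 1) := Real.one_le_sqrt.2 (by linarith [Nat.cast_nonneg (α := ℝ) k])
  have hs2 : √((k : ℝ) + 1) ^ 2 = (k : ℝ) + 1 := Real.sq_sqrt (by positivity)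
  have hr1 : 1 ≤ R * √((k : ℝ) + 1) := one_le_mul_of_one_le_of_one_le hR hs1
  have hone : ∀ l : ℤ, ((F.filter fun y => level y = l).card : ℝ) ≤ 9 * R ^ 2 * ((k : ℝ) + 1) := by
    intro l
    refine (card_level_le (a := a) hd _ (l := l) (c := dev a x) (r := R * √((k : ℝ) + 1))
      (by linarith) (fun y hy => (Finset.mem_filter.1 hy).2)
      fun y hy => hdev y (Finset.mem_filter.1 hy).1).trans ?_
    calc _ ≤ (3 * (R * √((k : ℝ) + 1))) ^ 2 := by gcongr; linarith
      _ = 9 * R ^ 2 * √((k : ℝ) + 1) ^ 2 := by ring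
      _ = _ := by rw [hs2]
  have hcard : (F.card : ℝ) ≤ 18 * R ^ 2 * ((k : ℝ) + 1) := by
    have hsub : F ⊆ (F.filter fun y => level y = level x + (k + 1)) ∪
        (F.filter fun y => level y = level x - (k + 1)) := by
      intro y hy
      have h1 := hgap y hy
      simp only [gap] at h1
      rw [Finset.mem_union]
      have : level y = level x + (k + 1) ∨ level y = level x - (k + 1) := by omega
      exact this.imp (fun h => Finset.mem_filter.2 ⟨hy, h⟩) fun h => Finset.mem_filter.2 ⟨hy, h⟩
    have h1 := (Finset.card_le_card hsub).trans (Finset.card_union_le _ _)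
    have h2 : (F.card : ℝ) ≤ ((F.filter fun y => level y = level x + (k + 1)).card : ℝ)
        + (F.filter fun y => level y = level x - (k + 1)).card := by exact_mod_cast h1
    linarith [hone (level x + (k + 1)), hone (level x - (k + 1))]
  calc ∑ y ∈ F, f (gap x y) = ∑ y ∈ F, f (k + 1) :=
        Finset.sum_congr rfl fun y hy => by rw [hgap y hy]
    _ = F.card * f (k + 1) := by simp
    _ ≤ _ := mul_le_mul_of_nonneg_right hcard (hf _)

/-- About `k` sites with squared kernel `k⁻²` at distance `k` produce a harmonic sum: only a
logarithm, the marginal case. -/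
theorem sum_dkern_sq_le (hd : d = 2 ∨ d = 3) (hR : 1 ≤ R) (S : Finset (Site d)) (x : Site d) :
    ∑ y ∈ S, dkern a n R x y ^ 2 ≤ 18 * R ^ 2 * harm n := by
  classical
  calc ∑ y ∈ S, dkern a n R x y ^ 2
      = ∑ y ∈ S with Near a n R x y, (fun k : ℕ => (1 / (k : ℝ)) ^ 2) (gap x y) := by
        rw [Finset.sum_filter]
        refine Finset.sum_congr rfl fun y _ => ?_
        rw [dkern]
        split_ifs <;> simp
    _ ≤ _ := sum_near_le hd hR S x (f := fun k : ℕ => (1 / (k : ℝ)) ^ 2) fun k => by positivity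
    _ = _ := by
        rw [harm, Finset.mul_sum]
        refine Finset.sum_congr rfl fun k _ => ?_
        push_cast
        field_simp

theorem sum_dkern_sq_gap_le (hd : d = 2 ∨ d = 3) (hR : 1 ≤ R) (S : Finset (Site d)) (x : Site d) :
    ∑ y ∈ S, dkern a n R x y ^ 2 * gap x y ≤ 18 * R ^ 2 * n := by
  classical
  calc ∑ y ∈ S, dkern a n R x y ^ 2 * gap x y
      = ∑ y ∈ S with Near a n R x y, (fun k : ℕ => (1 / (k : ℝ)) ^ 2 * k) (gap x y) := by
        rw [Finset.sum_filter]
        refine Finset.sum_congr rfl fun y _ => ?_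
        rw [dkern]
        split_ifs <;> simp
    _ ≤ _ := sum_near_le hd hR S x (f := fun k : ℕ => (1 / (k : ℝ)) ^ 2 * k) fun k => by positivity
    _ = ∑ k ∈ Finset.range n, 18 * R ^ 2 := by
        refine Finset.sum_congr rfl fun k _ => ?_
        push_cast
        field_simp
    _ = _ := by simp [mul_comm]

/-- The sites of a slab of height `N` and radius `r` above level `k`. -/
theorem finite_slab (a : Fin d → ℝ) (k : ℤ) (N : ℕ) (c : Fin d → ℝ) (r : ℝ) :
    {x : Site d | (k ≤ level x ∧ level x < k + N) ∧ ∀ j, |dev a x j - c j| ≤ r}.Finite := by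
  set M : Fin d → ℝ := fun j => |c j| + r + (|(k : ℝ)| + N) * |a j| with hM
  refine (Set.finite_Icc (fun j => -⌈M j⌉) fun j => ⌈M j⌉).subset ?_
  rintro x ⟨⟨h1, h2⟩, h3⟩
  have hx : ∀ j, |(x j : ℝ)| ≤ ⌈M j⌉ := by
    intro j
    refine le_trans ?_ (Int.le_ceil _)
    have hl : |(level x : ℝ)| ≤ |(k : ℝ)| + N := by
      have h1' : (k : ℝ) ≤ level x := by exact_mod_cast h1
      have h2' : (level x : ℝ) ≤ k + N := by exact_mod_cast h2.le
      rw [abs_le]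
      have := neg_abs_le (k : ℝ)
      have := le_abs_self (k : ℝ)
      have : (0 : ℝ) ≤ N := Nat.cast_nonneg N
      constructor <;> linarith
    have he : (x j : ℝ) = (dev a x j - c j) + c j + level x * a j := by rw [dev]; ring
    rw [he]
    calc _ ≤ |dev a x j - c j| + |c j| + |(level x : ℝ) * a j| := by
          refine (abs_add_le _ _).trans ?_
          gcongr
          exact abs_add_le _ _
      _ ≤ r + |c j| + (|(k : ℝ)| + N) * |a j| := by
          rw [abs_mul]
          gcongr
          exact h3 j
      _ = M j := by rw [hM]; ring
  have hx' : ∀ j, |x j| ≤ ⌈M j⌉ := fun j => by exact_mod_cast hx j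
  exact ⟨fun j => (abs_le.1 (hx' j)).1, fun j => (abs_le.1 (hx' j)).2⟩

def slab (a : Fin d → ℝ) (k : ℤ) (N : ℕ) (c : Fin d → ℝ) (r : ℝ) : Finset (Site d) :=
  (finite_slab a k N c r).toFinset

theorem mem_slab {k : ℤ} {N : ℕ} {c : Fin d → ℝ} {r : ℝ} {x : Site d} : x ∈ slab a k N c r ↔
    (k ≤ level x ∧ level x < k + N) ∧ ∀ j, |dev a x j - c j| ≤ r := by
  simp [slab]

theorem card_slab_le (hd : d = 2 ∨ d = 3) {k : ℤ} {N : ℕ} {c : Fin d → ℝ} {r : ℝ} (hr : 0 ≤ r) :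
    ((slab a k N c r).card : ℝ) ≤ N * (2 * r + 1) ^ 2 := by
  have h := Finset.card_eq_sum_card_fiberwise (s := slab a k N c r) (t := Finset.range N)
    (f := fun x => (level x - k).toNat) (fun x hx => by
      have := (mem_slab.1 (Finset.mem_coe.1 hx)).1
      rw [Finset.coe_range, Set.mem_Iio]; dsimp only; omega)
  rw [h]
  push_cast
  calc _ ≤ ∑ i ∈ Finset.range N, (2 * r + 1) ^ 2 := by
        refine Finset.sum_le_sum fun i _ => card_level_le (a := a) hd _ (l := k + i) (c := c) hr
          (fun y hy => ?_) fun y hy => (mem_slab.1 (Finset.mem_filter.1 hy).1).2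
        have h1 := (mem_slab.1 (Finset.mem_filter.1 hy).1).1
        have h2 := (Finset.mem_filter.1 hy).2
        omega
    _ = _ := by simp

end Count

/-! ### Quadratic forms in the fluctuations -/

namespace IsWeight

variable {d : ℕ} {E : Type*} [MeasurableSpace E] {μ : Measure E} [IsProbabilityMeasure μ]
  {a : Fin d → ℝ} {t : ℝ} {w : E → Fin d → ℝ}

/-- Exposing a new site `z`: its fluctuation is centered and independent of everything on `S`, so
the cross term drops out. This is the induction step for second moments of linear and quadratic
forms. -/
theorem integral_sq_add_fluct_mul (h : IsWeight μ a t w) {S : Finset (Site d)} {z : Site d}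
    (hz : z ∉ S) {F G : (Site d → E) → ℝ} (hF : BMeas F) (hG : BMeas G) (hFS : DependsOn F S)
    (hGS : DependsOn G S) :
    ∫ ξ, (F ξ + fluct w (ξ z) * G ξ) ^ 2 ∂fieldLaw (Site d) μ
      = ∫ ξ, F ξ ^ 2 ∂fieldLaw (Site d) μ
        + (∫ r, fluct w r ^ 2 ∂μ) * ∫ ξ, G ξ ^ 2 ∂fieldLaw (Site d) μ := by
  have hζ := h.bmeas_fluct_eval z
  have hdisj : Disjoint ({z} : Set (Site d)) (S : Set (Site d)) := by simpa using hz
  have h1 : ∀ φ : E → ℝ, BMeas φ → ∀ K : (Site d → E) → ℝ, BMeas K → DependsOn K S →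
      ∫ ξ, φ (ξ z) * K ξ ∂fieldLaw (Site d) μ
        = (∫ r, φ r ∂μ) * ∫ ξ, K ξ ∂fieldLaw (Site d) μ := by
    intro φ hφ K hK hKS
    rw [integral_mul_of_dependsOn (S := {z}) (T := S)
      (hφ.comp (measurable_pi_apply z)) hK _ hKS hdisj.symm, integral_eval hφ.meas]
    intro ξ ξ' hξ
    simp only [hξ z rfl]
  have h2 : ∀ ξ : Site d → E, (F ξ + fluct w (ξ z) * G ξ) ^ 2
      = F ξ ^ 2 + fluct w (ξ z) * (2 * (F ξ * G ξ)) + fluct w (ξ z) ^ 2 * G ξ ^ 2 :=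
    fun ξ => by ring
  simp only [h2]
  rw [integral_add, integral_add,
    h1 _ h.bmeas_fluct _ ((hF.mul hG).const_mul 2), h.integral_fluct,
    h1 (fun r => fluct w r ^ 2) (h.bmeas_fluct.pow 2) _ (hG.pow 2)]
  · ring
  · intro ξ ξ' hξ; simp only [hGS hξ]
  · intro ξ ξ' hξ; simp only [hGS hξ, hFS hξ]
  · exact (hF.pow 2).integrable _
  · exact (hζ.mul ((hF.mul hG).const_mul 2)).integrable _
  · exact ((hF.pow 2).add (hζ.mul ((hF.mul hG).const_mul 2))).integrable _
  · exact ((hζ.pow 2).mul (hG.pow 2)).integrable _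

theorem bmeas_linear (h : IsWeight μ a t w) (S : Finset (Site d)) (b : ℝ) (l : Site d → ℝ) :
    BMeas fun ξ : Site d → E => b + ∑ y ∈ S, l y * fluct w (ξ y) :=
  (BMeas.const b).add (BMeas.sum S fun y _ => (h.bmeas_fluct_eval y).const_mul (l y))

theorem integral_linear_sq (h : IsWeight μ a t w) (S : Finset (Site d)) (b : ℝ)
    (l : Site d → ℝ) :
    ∫ ξ, (b + ∑ y ∈ S, l y * fluct w (ξ y)) ^ 2 ∂fieldLaw (Site d) μ
      = b ^ 2 + (∫ r, fluct w r ^ 2 ∂μ) * ∑ y ∈ S, l y ^ 2 := by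
  classical
  induction S using Finset.induction_on with
  | empty => simp
  | insert z S hz ih =>
    have h1 : ∀ ξ : Site d → E, b + ∑ y ∈ insert z S, l y * fluct w (ξ y)
        = (b + ∑ y ∈ S, l y * fluct w (ξ y)) + fluct w (ξ z) * l z := fun ξ => by
      rw [Finset.sum_insert hz]; ring
    simp only [h1]
    rw [h.integral_sq_add_fluct_mul hz (h.bmeas_linear S b l) (BMeas.const (l z)) _
      (fun _ _ _ => rfl), ih, Finset.sum_insert hz]
    · simp
      ring
    · intro ξ ξ' hξ
      simp only
      rw [Finset.sum_congr rfl fun y hy => by rw [hξ y hy]]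

theorem bmeas_quadratic (h : IsWeight μ a t w) (S : Finset (Site d)) (V : Site d → Site d → ℝ) :
    BMeas fun ξ : Site d → E => ∑ x ∈ S, ∑ y ∈ S, V x y * (fluct w (ξ x) * fluct w (ξ y)) :=
  BMeas.sum S fun x _ => BMeas.sum S fun y _ =>
    ((h.bmeas_fluct_eval x).mul (h.bmeas_fluct_eval y)).const_mul (V x y)

/-- A new site contributes its fluctuation times a linear form. The two symmetric off-diagonal
entries give the coefficient `2 V z y`, and the zero diagonal excludes squared fluctuations. -/
theorem integral_quadratic_sq (h : IsWeight μ a t w) (S : Finset (Site d)) (c : Site d → ℝ)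
    {V : Site d → Site d → ℝ} (hV : ∀ x y, V x y = V y x) (hV0 : ∀ x, V x x = 0) :
    ∫ ξ, (∑ x ∈ S, c x * fluct w (ξ x)
        + ∑ x ∈ S, ∑ y ∈ S, V x y * (fluct w (ξ x) * fluct w (ξ y))) ^ 2 ∂fieldLaw (Site d) μ
      = (∫ r, fluct w r ^ 2 ∂μ) * ∑ x ∈ S, c x ^ 2
        + 2 * (∫ r, fluct w r ^ 2 ∂μ) ^ 2 * ∑ x ∈ S, ∑ y ∈ S, V x y ^ 2 := by
  classical
  induction S using Finset.induction_on with
  | empty => simp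
  | insert z S hz ih =>
    have h1 : ∀ ξ : Site d → E, ∑ x ∈ insert z S, c x * fluct w (ξ x)
        + ∑ x ∈ insert z S, ∑ y ∈ insert z S, V x y * (fluct w (ξ x) * fluct w (ξ y))
        = (∑ x ∈ S, c x * fluct w (ξ x)
          + ∑ x ∈ S, ∑ y ∈ S, V x y * (fluct w (ξ x) * fluct w (ξ y)))
          + fluct w (ξ z) * (c z + ∑ y ∈ S, (2 * V z y) * fluct w (ξ y)) := by
      intro ξ
      simp only [Finset.sum_insert hz, hV0, Finset.sum_add_distrib]
      have : ∑ x ∈ S, V x z * (fluct w (ξ x) * fluct w (ξ z))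
          = ∑ y ∈ S, V z y * (fluct w (ξ z) * fluct w (ξ y)) :=
        Finset.sum_congr rfl fun x _ => by rw [hV x z]; ring
      rw [this, mul_add, Finset.mul_sum]
      have h3 : ∑ y ∈ S, fluct w (ξ z) * (2 * V z y * fluct w (ξ y))
          = 2 * ∑ y ∈ S, V z y * (fluct w (ξ z) * fluct w (ξ y)) := by
        rw [Finset.mul_sum]; exact Finset.sum_congr rfl fun y _ => by ring
      rw [h3]
      ring
    simp only [h1]
    rw [h.integral_sq_add_fluct_mul hz _ (h.bmeas_linear S (c z) fun y => 2 * V z y),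
      ih, h.integral_linear_sq]
    · simp only [Finset.sum_insert hz, hV0, Finset.sum_add_distrib]
      have h2 : ∑ x ∈ S, V x z ^ 2 = ∑ y ∈ S, V z y ^ 2 :=
        Finset.sum_congr rfl fun x _ => by rw [hV x z]
      have h3 : ∑ y ∈ S, (2 * V z y) ^ 2 = 4 * ∑ y ∈ S, V z y ^ 2 := by
        rw [Finset.mul_sum]; exact Finset.sum_congr rfl fun y _ => by ring
      rw [h2, h3]
      ring
    · intro ξ ξ' hξ
      simp only
      congr 1
      · exact Finset.sum_congr rfl fun y hy => by rw [hξ y hy]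
      · exact Finset.sum_congr rfl fun x hx => Finset.sum_congr rfl fun y hy => by
          rw [hξ y hy, hξ x hx]
    · intro ξ ξ' hξ
      simp only
      rw [Finset.sum_congr rfl fun y hy => by rw [hξ y hy]]
    · exact (BMeas.sum S fun y _ => (h.bmeas_fluct_eval y).const_mul (c y)).add
        (h.bmeas_quadratic S V)

end IsWeight

/-! ### Quadratic forms under the size-biased law -/

/-- The expectation of a functional of path and environment under the size-biased law. -/
def tilt {d : ℕ} {E : Type*} [MeasurableSpace E] (μ : Measure E) (w : E → Fin d → ℝ) (N : ℕ)
    (x : Site d) (F : (Fin N → Fin d) → (Site d → E) → ℝ) : ℝ :=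
  ∑ e, ∫ ξ, pathWt w ξ x e * F e ξ ∂fieldLaw (Site d) μ

/-- The quadratic form of the fluctuations in a finite set. -/
def quadForm {d : ℕ} {E : Type*} (w : E → Fin d → ℝ) (V : Site d → Site d → ℝ)
    (S : Finset (Site d)) (ξ : Site d → E) : ℝ :=
  ∑ x ∈ S, ∑ y ∈ S, V x y * (fluct w (ξ x) * fluct w (ξ y))

open Classical in
/-- The sites of a path, except for the last one. -/
def pathSites {d N : ℕ} (x : Site d) (e : Fin N → Fin d) : Finset (Site d) :=
  (Finset.range N).image fun i => dirPos x e i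

/-- The kernel `1/|i-j|`, cut off at distance `n`. -/
def kap (n : ℕ) (i j : ℤ) : ℝ :=
  if 1 ≤ (j - i).natAbs ∧ (j - i).natAbs ≤ n then 1 / ((j - i).natAbs : ℝ) else 0

theorem kap_nonneg (n : ℕ) (i j : ℤ) : 0 ≤ kap n i j := by
  rw [kap]; split_ifs <;> positivity

theorem kap_comm (n : ℕ) (i j : ℤ) : kap n i j = kap n j i := by
  have : (j - i).natAbs = (i - j).natAbs := by omega
  rw [kap, kap, this]

theorem kap_self (n : ℕ) (i : ℤ) : kap n i i = 0 := by simp [kap]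

/-- Each distance from `m` is attained by at most two integers. -/
theorem sum_kap_le {ι : Type*} (n : ℕ) (m : ℤ) (S : Finset ι) {g : ι → ℤ} (hg : Set.InjOn g S) :
    ∑ i ∈ S, kap n m (g i) ≤ 2 * harm n := by
  classical
  set P : ι → Prop := fun i => 1 ≤ (g i - m).natAbs ∧ (g i - m).natAbs ≤ n with hP
  have h1 : ∑ i ∈ S, kap n m (g i) = ∑ i ∈ S with P i, 1 / ((g i - m).natAbs : ℝ) := by
    rw [Finset.sum_filter]
    rfl
  rw [h1, ← Finset.sum_fiberwise_of_maps_to (s := S.filter P) (t := Finset.range n)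
    (g := fun i => (g i - m).natAbs - 1) (fun i hi => by
      have := (Finset.mem_filter.1 hi).2
      rw [Finset.mem_range]; omega), harm, Finset.mul_sum]
  refine Finset.sum_le_sum fun k _ => ?_
  set F := (S.filter P).filter fun i => (g i - m).natAbs - 1 = k with hF
  have hk : ∀ i ∈ F, (g i - m).natAbs = k + 1 := by
    intro i hi
    rw [hF, Finset.mem_filter, Finset.mem_filter] at hi
    have := hi.1.2.1
    omega
  have hcard : F.card ≤ 2 := by
    have h2 : F.card ≤ ({m + (k + 1), m - (k + 1)} : Finset ℤ).card := by
      refine Finset.card_le_card_of_injOn g (fun i hi => ?_) (hg.mono fun i hi => ?_)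
      · have := hk i (Finset.mem_coe.1 hi)
        have h3 : g i = m + (k + 1) ∨ g i = m - (k + 1) := by omega
        simpa using h3
      · have := Finset.mem_coe.1 hi
        rw [hF, Finset.mem_filter, Finset.mem_filter] at this
        exact this.1.1
    exact h2.trans Finset.card_le_two
  calc ∑ i ∈ F, 1 / ((g i - m).natAbs : ℝ) = ∑ i ∈ F, 1 / ((k : ℝ) + 1) :=
        Finset.sum_congr rfl fun i hi => by rw [hk i hi]; push_cast; rfl
    _ = F.card * (1 / ((k : ℝ) + 1)) := by simp
    _ ≤ 2 * (1 / ((k : ℝ) + 1)) :=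
        mul_le_mul_of_nonneg_right (by exact_mod_cast hcard) (by positivity)

/-- Weighted Cauchy–Schwarz: the squared kernel is the product of `kap`, whose sum along a path is
at most `2 * harm n`, and the squared kernel times the gap, whose sum over sites is at most of order
`n`. -/
theorem sum_dkern_path_le {d n N : ℕ} {a : Fin d → ℝ} {R : ℝ} (hd : d = 2 ∨ d = 3) (hR : 1 ≤ R)
    (B : Finset (Site d)) (x : Site d) (e : Fin N → Fin d) :
    ∑ y ∈ B, (∑ z ∈ pathSites x e, dkern a n R y z) ^ 2 ≤ 36 * R ^ 2 * harm n * n * N := by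
  classical
  have hinj : Set.InjOn (fun i : ℕ => dirPos x e i) (Finset.range N) :=
    (dirPos_injOn x e).mono fun i hi => by simpa using (Finset.mem_range.1 (Finset.mem_coe.1 hi)).le
  have hlev : Set.InjOn (fun i : ℕ => level (dirPos x e i)) (Finset.range N) := by
    intro i hi j hj hij
    simp only [Finset.coe_range, Set.mem_Iio] at hi hj
    simp only [level_dirPos x e hi.le, level_dirPos x e hj.le] at hij
    omega
  have hy : ∀ y ∈ B, (∑ z ∈ pathSites x e, dkern a n R y z) ^ 2 ≤ 2 * harm n *
      ∑ i ∈ Finset.range N, dkern a n R (dirPos x e i) y ^ 2 * gap (dirPos x e i) y := by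
    intro y _
    rw [pathSites, Finset.sum_image hinj]
    refine (Finset.sum_sq_le_sum_mul_sum_of_sq_le_mul (Finset.range N)
      (f := fun i : ℕ => kap n (level y) (level (dirPos x e i)))
      (g := fun i : ℕ => dkern a n R (dirPos x e i) y ^ 2 * gap (dirPos x e i) y)
      (fun i _ => kap_nonneg _ _ _) (fun i _ => by positivity) fun i _ => Eq.le ?_).trans ?_
    · rw [dkern_comm (dirPos x e i) y, gap_comm (dirPos x e i) y, dkern]
      split_ifs with hN
      · have h1 := hN.1.1
        have h2 : (gap y (dirPos x e i) : ℝ) ≠ 0 := by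
          have : gap y (dirPos x e i) ≠ 0 := by omega
          exact_mod_cast this
        have h3 : kap n (level y) (level (dirPos x e i)) = 1 / (gap y (dirPos x e i) : ℝ) :=
          if_pos hN.1
        rw [h3]
        field_simp
      · simp
    · exact mul_le_mul_of_nonneg_right (sum_kap_le n _ _ hlev)
        (Finset.sum_nonneg fun i _ => by positivity)
  calc _ ≤ ∑ y ∈ B, 2 * harm n *
        ∑ i ∈ Finset.range N, dkern a n R (dirPos x e i) y ^ 2 * gap (dirPos x e i) y :=
        Finset.sum_le_sum hy
    _ = 2 * harm n * ∑ i ∈ Finset.range N,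
        ∑ y ∈ B, dkern a n R (dirPos x e i) y ^ 2 * gap (dirPos x e i) y := by
        rw [← Finset.mul_sum, Finset.sum_comm]
    _ ≤ 2 * harm n * ∑ i ∈ Finset.range N, 18 * R ^ 2 * n := by
        refine mul_le_mul_of_nonneg_left (Finset.sum_le_sum fun i _ => ?_)
          (by linarith [harm_nonneg n])
        exact sum_dkern_sq_gap_le hd hR B _
    _ = _ := by
        simp only [Finset.sum_const, Finset.card_range, nsmul_eq_mul]
        ring

namespace IsWeight

variable {d N : ℕ} {E : Type*} [MeasurableSpace E] {μ : Measure E} [IsProbabilityMeasure μ]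
  {a : Fin d → ℝ} {t : ℝ} {w : E → Fin d → ℝ}

theorem tilt_mono (h : IsWeight μ a t w) {x : Site d} {F G : (Fin N → Fin d) → (Site d → E) → ℝ}
    (hF : ∀ e, BMeas (F e)) (hG : ∀ e, BMeas (G e)) (hFG : ∀ e ξ, F e ξ ≤ G e ξ) :
    tilt μ w N x F ≤ tilt μ w N x G :=
  Finset.sum_le_sum fun e _ => integral_mono (((h.bmeas_pathWt x e).mul (hF e)).integrable _)
    (((h.bmeas_pathWt x e).mul (hG e)).integrable _)
    fun ξ => mul_le_mul_of_nonneg_left (hFG e ξ) (h.pathWt_pos x e ξ).le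

theorem tilt_add (h : IsWeight μ a t w) {x : Site d} {F G : (Fin N → Fin d) → (Site d → E) → ℝ}
    (hF : ∀ e, BMeas (F e)) (hG : ∀ e, BMeas (G e)) :
    tilt μ w N x (fun e ξ => F e ξ + G e ξ) = tilt μ w N x F + tilt μ w N x G := by
  simp only [tilt, mul_add, ← Finset.sum_add_distrib]
  exact Finset.sum_congr rfl fun e _ => integral_add
    (((h.bmeas_pathWt x e).mul (hF e)).integrable _) (((h.bmeas_pathWt x e).mul (hG e)).integrable _)

theorem tilt_const_mul (x : Site d) (c : ℝ) (F : (Fin N → Fin d) → (Site d → E) → ℝ) :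
    tilt μ w N x (fun e ξ => c * F e ξ) = c * tilt μ w N x F := by
  simp only [tilt, Finset.mul_sum, ← integral_const_mul]
  refine Finset.sum_congr rfl fun e _ => ?_
  congr 1
  ext ξ
  ring

theorem tilt_sum (h : IsWeight μ a t w) {x : Site d} {ι : Type*} (s : Finset ι)
    {F : ι → (Fin N → Fin d) → (Site d → E) → ℝ} (hF : ∀ i e, BMeas (F i e)) :
    tilt μ w N x (fun e ξ => ∑ i ∈ s, F i e ξ) = ∑ i ∈ s, tilt μ w N x (F i) := by
  simp only [tilt, Finset.mul_sum]
  rw [Finset.sum_comm]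
  exact Finset.sum_congr rfl fun e _ => integral_finsetSum s fun i _ =>
    ((h.bmeas_pathWt x e).mul (hF i e)).integrable _

theorem tilt_path (h : IsWeight μ a t w) (x : Site d) (f : (Fin N → Fin d) → ℝ) :
    tilt μ w N x (fun e _ => f e) = wexp a N f := by
  simp only [tilt, wexp, integral_mul_const, h.integral_pathWt]

theorem tilt_field (h : IsWeight μ a t w) (x : Site d) {f : (Site d → E) → ℝ} (hf : BMeas f) :
    tilt μ w N x (fun _ => f) = ∫ ξ, tot w N x ξ * f ξ ∂fieldLaw (Site d) μ := by
  simp only [tilt, tot, part, mul_one, Finset.sum_mul]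
  exact (integral_finsetSum _ fun e _ => ((h.bmeas_pathWt x e).mul hf).integrable _).symm

theorem pathWt_dependsOn_pathSites (x : Site d) (e : Fin N → Fin d) :
    DependsOn (fun ξ : Site d → E => pathWt w ξ x e) (pathSites x e : Set (Site d)) := by
  classical
  intro ξ ξ' hξ
  refine Finset.prod_congr rfl fun i _ => ?_
  rw [hξ _ (by
    rw [pathSites, Finset.coe_image]
    exact ⟨i, by simp, rfl⟩)]

/-- Integrating out the field off the path. -/
theorem tilt_le_of_glue (h : IsWeight μ a t w) (x : Site d)
    {F : (Fin N → Fin d) → (Site d → E) → ℝ} (hF : ∀ e, BMeas (F e)) {C : ℝ}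
    (hC : ∀ e ξ, ∫ ξ', F e (glue (pathSites x e) ξ ξ') ∂fieldLaw (Site d) μ ≤ C) :
    tilt μ w N x F ≤ C := by
  have he : ∀ e, ∫ ξ, pathWt w ξ x e * F e ξ ∂fieldLaw (Site d) μ ≤ (∏ i, a (e i)) * C := by
    intro e
    have hp := h.bmeas_pathWt (n := N) x e
    rw [integral_eq_glue (hp.mul (hF e)) (pathSites x e), ← h.integral_pathWt x e,
      ← integral_mul_const]
    have hd : ∀ ξ ξ' : Site d → E, pathWt w (glue (pathSites x e) ξ ξ') x e = pathWt w ξ x e :=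
      fun ξ ξ' => (pathWt_dependsOn_pathSites (w := w) x e).glue_left ξ ξ'
    simp only [hd, integral_const_mul]
    refine integral_mono ?_ ((hp.mul_const C).integrable _)
      fun ξ => mul_le_mul_of_nonneg_left (hC e ξ) (h.pathWt_pos x e ξ).le
    exact (hp.mul (((hF e).glue (pathSites x e)).integral_right (fieldLaw (Site d) μ))).integrable _
  calc tilt μ w N x F ≤ ∑ e : Fin N → Fin d, (∏ i, a (e i)) * C := Finset.sum_le_sum fun e _ => he e
    _ = wexp a N fun _ => C := rfl
    _ = C := wexp_const h.sum_one C

theorem fluct_sq_le_one (h : IsWeight μ a t w) (r : E) : fluct w r ^ 2 ≤ 1 := by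
  rw [← sq_abs]
  exact pow_le_one₀ (abs_nonneg _) ((h.abs_fluct_le r).trans h.t_lt.le)

theorem integral_fluct_sq_le_one (h : IsWeight μ a t w) : ∫ r, fluct w r ^ 2 ∂μ ≤ 1 := by
  calc ∫ r, fluct w r ^ 2 ∂μ ≤ ∫ _, (1 : ℝ) ∂μ :=
        integral_mono ((h.bmeas_fluct.pow 2).integrable μ) (integrable_const 1) h.fluct_sq_le_one
    _ = 1 := by simp

theorem bmeas_quadForm (h : IsWeight μ a t w) (V : Site d → Site d → ℝ) (S : Finset (Site d)) :
    BMeas fun ξ : Site d → E => quadForm w V S ξ := h.bmeas_quadratic S V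

theorem integral_quadForm_sq_le (h : IsWeight μ a t w) {V : Site d → Site d → ℝ}
    (hV : ∀ x y, V x y = V y x) (hV0 : ∀ x, V x x = 0) (S : Finset (Site d)) :
    ∫ ξ, quadForm w V S ξ ^ 2 ∂fieldLaw (Site d) μ ≤ 2 * ∑ x ∈ S, ∑ y ∈ S, V x y ^ 2 := by
  have h1 := h.integral_quadratic_sq S (fun _ => 0) hV hV0
  simp only [zero_mul, Finset.sum_const_zero, zero_add, ne_eq, OfNat.ofNat_ne_zero,
    not_false_eq_true, zero_pow, mul_zero] at h1
  simp only [quadForm]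
  rw [h1]
  have h2 : (∫ r, fluct w r ^ 2 ∂μ) ^ 2 ≤ 1 :=
    pow_le_one₀ (integral_nonneg fun r => sq_nonneg _) h.integral_fluct_sq_le_one
  have h3 : 0 ≤ ∑ x ∈ S, ∑ y ∈ S, V x y ^ 2 :=
    Finset.sum_nonneg fun _ _ => Finset.sum_nonneg fun _ _ => sq_nonneg _
  nlinarith

open Classical in
-- With the field on `Γ` frozen, the rest of the form is a linear form plus a quadratic form in
-- fresh centered variables. The frozen fluctuations are bounded by one, so the linear coefficients
-- are controlled by row sums of `V` over `Γ`.
theorem integral_quadForm_sub_sq_le (h : IsWeight μ a t w) {V : Site d → Site d → ℝ}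
    (hV : ∀ x y, V x y = V y x) (hV0 : ∀ x, V x x = 0) (hVn : ∀ x y, 0 ≤ V x y)
    (B Γ : Finset (Site d)) (ξ : Site d → E) :
    ∫ ξ', (quadForm w V B (glue Γ ξ ξ') - quadForm w V (B.filter (· ∈ Γ)) (glue Γ ξ ξ')) ^ 2
      ∂fieldLaw (Site d) μ
      ≤ 4 * ∑ y ∈ B, (∑ z ∈ Γ, V y z) ^ 2 + 2 * ∑ x ∈ B, ∑ y ∈ B, V x y ^ 2 := by
  set v := ∫ r, fluct w r ^ 2 ∂μ with hv
  set S := B.filter (· ∉ Γ) with hS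
  set I := B.filter (· ∈ Γ) with hI
  set c : Site d → ℝ := fun y => 2 * ∑ z ∈ I, V y z * fluct w (ξ z) with hc
  have hsplit : ∀ f : Site d → ℝ, ∑ y ∈ B, f y = ∑ y ∈ I, f y + ∑ y ∈ S, f y := fun f =>
    (Finset.sum_filter_add_sum_filter_not B (· ∈ Γ) f).symm
  have hin : ∀ ξ' : Site d → E, ∀ y ∈ I, glue (Γ : Set (Site d)) ξ ξ' y = ξ y := fun ξ' y hy =>
    glue_of_mem (by simpa using (Finset.mem_filter.1 hy).2)
  have hout : ∀ ξ' : Site d → E, ∀ y ∈ S, glue (Γ : Set (Site d)) ξ ξ' y = ξ' y := fun ξ' y hy =>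
    glue_of_notMem (by simpa using (Finset.mem_filter.1 hy).2)
  have hexp : ∀ ξ' : Site d → E, quadForm w V B (glue Γ ξ ξ') - quadForm w V I (glue Γ ξ ξ')
      = ∑ x ∈ S, c x * fluct w (ξ' x)
        + ∑ x ∈ S, ∑ y ∈ S, V x y * (fluct w (ξ' x) * fluct w (ξ' y)) := by
    intro ξ'
    have e1 : ∑ x ∈ I, ∑ y ∈ S, V x y * (fluct w (glue (Γ : Set (Site d)) ξ ξ' x)
        * fluct w (glue (Γ : Set (Site d)) ξ ξ' y))
        = ∑ y ∈ S, (∑ z ∈ I, V y z * fluct w (ξ z)) * fluct w (ξ' y) := by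
      rw [Finset.sum_comm]
      refine Finset.sum_congr rfl fun y hy => ?_
      rw [Finset.sum_mul]
      refine Finset.sum_congr rfl fun x hx => ?_
      rw [hin ξ' x hx, hout ξ' y hy, hV x y]
      ring
    have e2 : ∑ y ∈ S, ∑ x ∈ I, V y x * (fluct w (glue (Γ : Set (Site d)) ξ ξ' y)
        * fluct w (glue (Γ : Set (Site d)) ξ ξ' x))
        = ∑ y ∈ S, (∑ z ∈ I, V y z * fluct w (ξ z)) * fluct w (ξ' y) := by
      refine Finset.sum_congr rfl fun y hy => ?_
      rw [Finset.sum_mul]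
      refine Finset.sum_congr rfl fun x hx => ?_
      rw [hin ξ' x hx, hout ξ' y hy]
      ring
    have e3 : ∑ x ∈ S, ∑ y ∈ S, V x y * (fluct w (glue (Γ : Set (Site d)) ξ ξ' x)
        * fluct w (glue (Γ : Set (Site d)) ξ ξ' y))
        = ∑ x ∈ S, ∑ y ∈ S, V x y * (fluct w (ξ' x) * fluct w (ξ' y)) :=
      Finset.sum_congr rfl fun x hx => Finset.sum_congr rfl fun y hy => by
        rw [hout ξ' x hx, hout ξ' y hy]
    simp only [quadForm]
    rw [hsplit]
    simp only [hsplit, Finset.sum_add_distrib]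
    rw [e1, e2, e3]
    have e4 : ∑ x ∈ S, c x * fluct w (ξ' x)
        = 2 * ∑ y ∈ S, (∑ z ∈ I, V y z * fluct w (ξ z)) * fluct w (ξ' y) := by
      rw [Finset.mul_sum]
      exact Finset.sum_congr rfl fun y _ => by rw [hc]; ring
    rw [e4]
    ring
  simp only [hexp]
  rw [h.integral_quadratic_sq S c hV hV0]
  have hv0 : 0 ≤ v := integral_nonneg fun r => sq_nonneg _
  have hv1 : v ≤ 1 := h.integral_fluct_sq_le_one
  have hv2 : v ^ 2 ≤ 1 := pow_le_one₀ hv0 hv1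
  have hc2 : ∀ y, c y ^ 2 ≤ 4 * (∑ z ∈ Γ, V y z) ^ 2 := by
    intro y
    have h1 : |∑ z ∈ I, V y z * fluct w (ξ z)| ≤ ∑ z ∈ Γ, V y z := by
      calc _ ≤ ∑ z ∈ I, |V y z * fluct w (ξ z)| := Finset.abs_sum_le_sum_abs _ _
        _ ≤ ∑ z ∈ I, V y z := by
            refine Finset.sum_le_sum fun z _ => ?_
            rw [abs_mul, abs_of_nonneg (hVn y z)]
            exact mul_le_of_le_one_right (hVn y z) ((h.abs_fluct_le _).trans h.t_lt.le)
        _ ≤ _ := Finset.sum_le_sum_of_subset_of_nonneg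
            (fun z hz => (Finset.mem_filter.1 hz).2) fun z _ _ => hVn y z
    have h2 := pow_le_pow_left₀ (abs_nonneg _) h1 2
    rw [sq_abs] at h2
    rw [hc]
    nlinarith
  have hS1 : ∑ x ∈ S, c x ^ 2 ≤ 4 * ∑ y ∈ B, (∑ z ∈ Γ, V y z) ^ 2 := by
    rw [Finset.mul_sum]
    refine (Finset.sum_le_sum fun y _ => hc2 y).trans ?_
    exact Finset.sum_le_sum_of_subset_of_nonneg (Finset.filter_subset _ _)
      fun y _ _ => by positivity
  have hS2 : ∑ x ∈ S, ∑ y ∈ S, V x y ^ 2 ≤ ∑ x ∈ B, ∑ y ∈ B, V x y ^ 2 := by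
    refine (Finset.sum_le_sum fun x _ => Finset.sum_le_sum_of_subset_of_nonneg
      (Finset.filter_subset _ _) fun y _ _ => sq_nonneg _).trans ?_
    exact Finset.sum_le_sum_of_subset_of_nonneg (Finset.filter_subset _ _)
      fun x _ _ => Finset.sum_nonneg fun y _ => sq_nonneg _
  have hn1 : 0 ≤ ∑ x ∈ S, c x ^ 2 := Finset.sum_nonneg fun _ _ => sq_nonneg _
  have hn2 : 0 ≤ ∑ x ∈ S, ∑ y ∈ S, V x y ^ 2 :=
    Finset.sum_nonneg fun _ _ => Finset.sum_nonneg fun _ _ => sq_nonneg _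
  nlinarith

end IsWeight

/-! ### The quadratic form along a path -/

/-- The total mass of the kernel `kap n` on `{0, …, N-1}²`. -/
def kapMass (n N : ℕ) : ℝ := ∑ i ∈ Finset.range N, ∑ j ∈ Finset.range N, kap n (i : ℤ) (j : ℤ)

/-- Blocks have length `2n` for this reason: each of the first `n` times sees all `n` distances to
its right. -/
theorem mul_harm_le_kapMass (n : ℕ) : n * harm n ≤ kapMass n (2 * n) := by
  have hrow : ∀ i ∈ Finset.range n, harm n ≤ ∑ j ∈ Finset.range (2 * n), kap n (i : ℤ) (j : ℤ) := by
    intro i hi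
    rw [Finset.mem_range] at hi
    have h1 : harm n = ∑ j ∈ (Finset.range n).image fun k => i + 1 + k, kap n (i : ℤ) (j : ℤ) := by
      rw [Finset.sum_image fun k _ l _ hkl => by simpa using hkl, harm]
      refine Finset.sum_congr rfl fun k hk => ?_
      rw [Finset.mem_range] at hk
      have h2 : ((i + 1 + k : ℕ) - (i : ℤ)).natAbs = k + 1 := by omega
      rw [kap, h2, if_pos (by omega)]
      push_cast
      rfl
    rw [h1]
    refine Finset.sum_le_sum_of_subset_of_nonneg (fun j hj => ?_) fun j _ _ => kap_nonneg _ _ _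
    obtain ⟨k, hk, rfl⟩ := Finset.mem_image.1 hj
    rw [Finset.mem_range] at hk ⊢
    omega
  calc n * harm n = ∑ i ∈ Finset.range n, harm n := by simp
    _ ≤ ∑ i ∈ Finset.range n, ∑ j ∈ Finset.range (2 * n), kap n (i : ℤ) (j : ℤ) :=
        Finset.sum_le_sum hrow
    _ ≤ _ := Finset.sum_le_sum_of_subset_of_nonneg (Finset.range_mono (by omega))
        fun i _ _ => Finset.sum_nonneg fun j _ => kap_nonneg _ _ _

/-! ### Second moments of the deviation of the directed walk. -/

section Dev

variable {d N : ℕ} {a : Fin d → ℝ}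

theorem dev_sum {ι : Type*} (s : Finset ι) (f : ι → Site d) (l : Fin d) :
    dev a (∑ i ∈ s, f i) l = ∑ i ∈ s, dev a (f i) l := by
  classical
  induction s using Finset.induction_on with
  | empty => simp [dev]
  | insert i s hi ih => rw [Finset.sum_insert hi, Finset.sum_insert hi, dev_add, ih]

theorem dev_zero (l : Fin d) : dev a 0 l = 0 := by simp [dev]

theorem dev_unitStep (i l : Fin d) : dev a (unitStep i) l = (if i = l then 1 else 0) - a l := by
  rw [dev, level_unitStep, unitStep, Pi.single_apply]
  by_cases h : i = l
  · simp [h]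
  · simp [h, Ne.symm h]

theorem dev_dirPos_sub (x : Site d) (e : Fin N → Fin d) (l : Fin d) {i j : ℕ} (hij : i ≤ j) :
    dev a (dirPos x e j) l - dev a (dirPos x e i) l
      = ∑ m : Fin N with i ≤ m.val ∧ m.val < j, dev a (unitStep (e m)) l := by
  simp only [dirPos, dev_add, dev_sum, Finset.sum_filter]
  rw [add_sub_add_left_eq_sub, ← Finset.sum_sub_distrib]
  refine Finset.sum_congr rfl fun m _ => ?_
  by_cases h1 : m.val < i
  · rw [if_pos (by omega), if_pos h1, if_neg (by omega), sub_self]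
  · by_cases h2 : m.val < j
    · rw [if_pos h2, if_neg h1, if_pos ⟨by omega, h2⟩, dev_zero, sub_zero]
    · rw [if_neg h2, if_neg h1, if_neg (fun h => h2 h.2), sub_self]

theorem sum_mul_dev_unitStep (ha1 : ∑ i, a i = 1) (l : Fin d) :
    ∑ i, a i * dev a (unitStep i) l = 0 := by
  simp only [dev_unitStep, mul_sub, Finset.sum_sub_distrib, ← Finset.sum_mul, ha1]
  simp

theorem abs_dev_unitStep_le (ha : ∀ i, 0 ≤ a i) (ha1 : ∑ i, a i = 1) (i l : Fin d) :
    |dev a (unitStep i) l| ≤ 1 := by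
  have h1 : a l ≤ 1 := ha1 ▸ Finset.single_le_sum (f := a) (fun i _ => ha i) (Finset.mem_univ l)
  have h2 := ha l
  rw [dev_unitStep, abs_le]
  split_ifs <;> constructor <;> linarith

theorem wexp_dev_sq_le (ha : ∀ i, 0 ≤ a i) (ha1 : ∑ i, a i = 1) (x : Site d) (l : Fin d) {i j : ℕ}
    (hi : i ≤ N) (hj : j ≤ N) :
    wexp a N (fun e => (dev a (dirPos x e j) l - dev a (dirPos x e i) l) ^ 2)
      ≤ ((j : ℤ) - (i : ℤ)).natAbs := by
  wlog hij : i ≤ j generalizing i j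
  · have h1 := this hj hi (by omega)
    have h2 : ((i : ℤ) - (j : ℤ)).natAbs = ((j : ℤ) - (i : ℤ)).natAbs := by omega
    rw [h2] at h1
    refine le_trans (le_of_eq ?_) h1
    congr 1
    ext e
    ring
  simp only [dev_dirPos_sub x _ l hij]
  refine (wexp_sum_sq_le ha ha1 (b := fun i => dev a (unitStep i) l)
    (sum_mul_dev_unitStep ha1 l) (fun i => abs_dev_unitStep_le ha ha1 i l) _).trans ?_
  have h1 : (Finset.univ.filter fun m : Fin N => i ≤ m.val ∧ m.val < j).card ≤ j - i := by
    rw [← Nat.card_Ico, ← Finset.card_map Fin.valEmbedding]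
    refine Finset.card_le_card fun m hm => ?_
    obtain ⟨m', hm', rfl⟩ := Finset.mem_map.1 hm
    rw [Finset.mem_Ico]
    exact (Finset.mem_filter.1 hm').2
  have h2 : ((j : ℤ) - (i : ℤ)).natAbs = j - i := by omega
  rw [h2]
  exact_mod_cast h1

end Dev

/-- A bound for the indicator that two sites of a path are not in a good position. -/
def failBound {d N : ℕ} (a : Fin d → ℝ) (n : ℕ) (R : ℝ) (x : Site d) (e : Fin N → Fin d)
    (i j : ℕ) : ℝ :=
  ∑ l, ((dev a (dirPos x e i) l - dev a (dirPos x e 0) l) ^ 2 / (R ^ 2 * n)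
    + (dev a (dirPos x e j) l - dev a (dirPos x e 0) l) ^ 2 / (R ^ 2 * n)
    + (dev a (dirPos x e j) l - dev a (dirPos x e i) l) ^ 2
      / (R ^ 2 * ((j : ℤ) - (i : ℤ)).natAbs))

theorem one_le_div_of_not_abs_le {u R s : ℝ} (hR : 0 < R) (hs : 0 < s) (h : ¬ |u| ≤ R * √s) :
    1 ≤ u ^ 2 / (R ^ 2 * s) := by
  rw [one_le_div (by positivity)]
  have h1 : (R * √s) ^ 2 ≤ |u| ^ 2 := pow_le_pow_left₀ (by positivity) (not_le.1 h).le 2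
  rwa [mul_pow, Real.sq_sqrt hs.le, sq_abs] at h1

section Fail

variable {d N : ℕ} {a : Fin d → ℝ} {n : ℕ} {R : ℝ}

theorem failBound_nonneg (x : Site d) (e : Fin N → Fin d) (i j : ℕ) :
    0 ≤ failBound a n R x e i j := Finset.sum_nonneg fun l _ => by positivity

theorem dkern_eq_kap {x y : Site d} (h : Near a n R x y) :
    dkern a n R x y = kap n (level x) (level y) := by
  rw [dkern, if_pos h, kap]
  exact (if_pos h.1).symm

/-- Chebyshev's inequality in pointwise form: if a site leaves the slab, or the two sites are not
diffusively close, then some coordinate makes one of the normalized squares at least one. -/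
theorem one_le_failBound (hR : 0 < R) {k : ℤ} {c : Fin d → ℝ} {x : Site d} (hx : level x = k)
    (hc : ∀ l, |dev a x l - c l| ≤ √n) (e : Fin N → Fin d) {i j : ℕ} (hi : i < N) (hj : j < N)
    (hij : 1 ≤ ((j : ℤ) - (i : ℤ)).natAbs ∧ ((j : ℤ) - (i : ℤ)).natAbs ≤ n)
    (hbad : ¬ (dirPos x e i ∈ slab a k N c ((R + 1) * √n) ∧
      dirPos x e j ∈ slab a k N c ((R + 1) * √n) ∧ Near a n R (dirPos x e i) (dirPos x e j))) :
    1 ≤ failBound a n R x e i j := by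
  have hn : (0 : ℝ) < n := by
    have : 0 < n := by omega
    exact_mod_cast this
  have hgap0 : (0 : ℝ) < ((j : ℤ) - (i : ℤ)).natAbs := by exact_mod_cast hij.1
  by_contra hlt
  have hterm : ∀ l, (dev a (dirPos x e i) l - dev a (dirPos x e 0) l) ^ 2 / (R ^ 2 * n)
    + (dev a (dirPos x e j) l - dev a (dirPos x e 0) l) ^ 2 / (R ^ 2 * n)
    + (dev a (dirPos x e j) l - dev a (dirPos x e i) l) ^ 2
      / (R ^ 2 * ((j : ℤ) - (i : ℤ)).natAbs) < 1 := by
    intro l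
    refine lt_of_le_of_lt ?_ (not_le.1 hlt)
    exact Finset.single_le_sum (f := fun l =>
      (dev a (dirPos x e i) l - dev a (dirPos x e 0) l) ^ 2 / (R ^ 2 * n)
      + (dev a (dirPos x e j) l - dev a (dirPos x e 0) l) ^ 2 / (R ^ 2 * n)
      + (dev a (dirPos x e j) l - dev a (dirPos x e i) l) ^ 2
        / (R ^ 2 * ((j : ℤ) - (i : ℤ)).natAbs)) (fun l _ => by positivity) (Finset.mem_univ l)
  have hp : ∀ u s : ℝ, 0 < s → 0 ≤ u ^ 2 / (R ^ 2 * s) := fun u s hs => by positivity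
  have h1 : ∀ l, |dev a (dirPos x e i) l - dev a (dirPos x e 0) l| ≤ R * √n := by
    intro l
    by_contra h
    have := one_le_div_of_not_abs_le hR hn h
    linarith [hterm l, hp (dev a (dirPos x e j) l - dev a (dirPos x e 0) l) n hn,
      hp (dev a (dirPos x e j) l - dev a (dirPos x e i) l) _ hgap0]
  have h2 : ∀ l, |dev a (dirPos x e j) l - dev a (dirPos x e 0) l| ≤ R * √n := by
    intro l
    by_contra h
    have := one_le_div_of_not_abs_le hR hn h
    linarith [hterm l, hp (dev a (dirPos x e i) l - dev a (dirPos x e 0) l) n hn,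
      hp (dev a (dirPos x e j) l - dev a (dirPos x e i) l) _ hgap0]
  have h3 : ∀ l, |dev a (dirPos x e j) l - dev a (dirPos x e i) l|
      ≤ R * √(((j : ℤ) - (i : ℤ)).natAbs : ℝ) := by
    intro l
    by_contra h
    have := one_le_div_of_not_abs_le hR hgap0 h
    linarith [hterm l, hp (dev a (dirPos x e i) l - dev a (dirPos x e 0) l) n hn,
      hp (dev a (dirPos x e j) l - dev a (dirPos x e 0) l) n hn]
  have hmem : ∀ m : ℕ, m < N →
      (∀ l, |dev a (dirPos x e m) l - dev a (dirPos x e 0) l| ≤ R * √n) →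
      dirPos x e m ∈ slab a k N c ((R + 1) * √n) := by
    intro m hm hdev
    rw [mem_slab, level_dirPos x e hm.le, hx]
    refine ⟨⟨by omega, by omega⟩, fun l => ?_⟩
    have h4 := hdev l
    have h5 := hc l
    rw [dirPos_zero] at h4
    calc |dev a (dirPos x e m) l - c l|
        = |(dev a (dirPos x e m) l - dev a x l) + (dev a x l - c l)| := by ring_nf
      _ ≤ R * √n + √n := (abs_add_le _ _).trans (add_le_add h4 h5)
      _ = _ := by ring
  have hgap : gap (dirPos x e i) (dirPos x e j) = ((j : ℤ) - (i : ℤ)).natAbs := by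
    rw [gap, level_dirPos x e hi.le, level_dirPos x e hj.le]; omega
  refine hbad ⟨hmem i hi h1, hmem j hj h2, ?_, fun l => ?_⟩
  · rw [hgap]; exact hij
  · rw [hgap]; exact h3 l

/-- Per coordinate, `5 = 2 + 2 + 1`: two displacements over at most `2n` steps measured against `n`,
and one measured against its own duration. -/
theorem wexp_failBound_le (ha : ∀ i, 0 ≤ a i) (ha1 : ∑ i, a i = 1) (hR : 0 < R) (x : Site d)
    {i j : ℕ} (hi : i < N) (hj : j < N) (hn : 0 < n) (hN : N ≤ 2 * n) :
    wexp a N (fun e => failBound a n R x e i j) ≤ 5 * d / R ^ 2 := by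
  have hn' : (0 : ℝ) < n := by exact_mod_cast hn
  have hone : ∀ m : ℕ, m < N → ∀ l, wexp a N (fun e =>
      (dev a (dirPos x e m) l - dev a (dirPos x e 0) l) ^ 2 / (R ^ 2 * n)) ≤ 2 / R ^ 2 := by
    intro m hm l
    have h1 := wexp_dev_sq_le ha ha1 x l (Nat.zero_le N) hm.le
    have h2 : ((m : ℤ) - ((0 : ℕ) : ℤ)).natAbs = m := by simp
    rw [h2] at h1
    have h3 : (m : ℝ) ≤ 2 * n := by exact_mod_cast (hm.le.trans hN)
    simp only [div_eq_inv_mul]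
    rw [wexp_const_mul]
    calc _ ≤ (R ^ 2 * n)⁻¹ * (2 * n) := by
          refine mul_le_mul_of_nonneg_left (h1.trans h3) (by positivity)
      _ = _ := by field_simp
  have htwo : ∀ l, wexp a N (fun e => (dev a (dirPos x e j) l - dev a (dirPos x e i) l) ^ 2
      / (R ^ 2 * ((j : ℤ) - (i : ℤ)).natAbs)) ≤ 1 / R ^ 2 := by
    intro l
    have h1 := wexp_dev_sq_le ha ha1 x l hi.le hj.le
    simp only [div_eq_inv_mul]
    rw [wexp_const_mul]
    refine (mul_le_mul_of_nonneg_left h1 (by positivity)).trans ?_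
    rw [mul_inv, mul_assoc, mul_one]
    refine mul_le_of_le_one_right (by positivity) inv_mul_le_one
  simp only [failBound]
  rw [wexp_sum]
  calc _ ≤ ∑ l : Fin d, 5 / R ^ 2 := by
        refine Finset.sum_le_sum fun l _ => ?_
        rw [wexp_add, wexp_add]
        have h1 := hone i hi l
        have h2 := hone j hj l
        have h3 := htwo l
        have h4 : 5 / R ^ 2 = 2 / R ^ 2 + 2 / R ^ 2 + 1 / R ^ 2 := by ring
        linarith
    _ = _ := by simp; ring

end Fail

/-- The quadratic form along a path with the kernel `kap n`. -/
def pathForm {d N : ℕ} {E : Type*} (w : E → Fin d → ℝ) (n : ℕ) (x : Site d) (e : Fin N → Fin d)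
    (ξ : Site d → E) : ℝ :=
  ∑ i ∈ Finset.range N, ∑ j ∈ Finset.range N,
    kap n (i : ℤ) (j : ℤ) * (fluct w (ξ (dirPos x e i)) * fluct w (ξ (dirPos x e j)))

namespace IsWeight

variable {d N : ℕ} {E : Type*} [MeasurableSpace E] {μ : Measure E} [IsProbabilityMeasure μ]
  {a : Fin d → ℝ} {t : ℝ} {w : E → Fin d → ℝ} {n : ℕ} {R : ℝ}

theorem abs_fluct_mul_fluct_le (h : IsWeight μ a t w) (r r' : E) :
    |fluct w r * fluct w r'| ≤ 1 := by
  rw [abs_mul]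
  exact mul_le_one₀ ((h.abs_fluct_le r).trans h.t_lt.le) (abs_nonneg _)
    ((h.abs_fluct_le r').trans h.t_lt.le)

open Classical in
-- Good pairs have the same coefficient in both forms and cancel. The remaining pairs have products
-- of fluctuations of at most one and are charged to `failBound`.
theorem pathForm_sub_le (h : IsWeight μ a t w) (hR : 0 < R) {k : ℤ} {c : Fin d → ℝ} {x : Site d}
    (hx : level x = k) (hc : ∀ l, |dev a x l - c l| ≤ √n) (e : Fin N → Fin d) (ξ : Site d → E) :
    pathForm w n x e ξ - quadForm w (dkern a n R)
        ((slab a k N c ((R + 1) * √n)).filter (· ∈ pathSites x e)) ξ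
      ≤ ∑ i ∈ Finset.range N, ∑ j ∈ Finset.range N,
        kap n (i : ℤ) (j : ℤ) * failBound a n R x e i j := by
  set B := slab a k N c ((R + 1) * √n) with hB
  have hinj : Set.InjOn (fun i : ℕ => dirPos x e i) (Finset.range N) :=
    (dirPos_injOn x e).mono fun i hi => by simpa using (Finset.mem_range.1 (Finset.mem_coe.1 hi)).le
  have hsum : ∀ f : Site d → ℝ, ∑ y ∈ B.filter (· ∈ pathSites x e), f y
      = ∑ i ∈ Finset.range N, if dirPos x e i ∈ B then f (dirPos x e i) else 0 := by
    intro f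
    have h1 : B.filter (· ∈ pathSites x e) = (pathSites x e).filter (· ∈ B) := by
      ext y; simp [and_comm]
    rw [h1, Finset.sum_filter, pathSites, Finset.sum_image hinj]
  simp only [quadForm, hsum, pathForm]
  rw [← Finset.sum_sub_distrib]
  refine Finset.sum_le_sum fun i hi => ?_
  rw [Finset.mem_range] at hi
  have h2 : (if dirPos x e i ∈ B then ∑ j ∈ Finset.range N, (if dirPos x e j ∈ B then
      dkern a n R (dirPos x e i) (dirPos x e j)
        * (fluct w (ξ (dirPos x e i)) * fluct w (ξ (dirPos x e j))) else 0) else 0)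
      = ∑ j ∈ Finset.range N, if dirPos x e i ∈ B then (if dirPos x e j ∈ B then
      dkern a n R (dirPos x e i) (dirPos x e j)
        * (fluct w (ξ (dirPos x e i)) * fluct w (ξ (dirPos x e j))) else 0) else 0 := by
    split_ifs <;> simp
  rw [h2, ← Finset.sum_sub_distrib]
  refine Finset.sum_le_sum fun j hj => ?_
  rw [Finset.mem_range] at hj
  have hlev : kap n (level (dirPos x e i)) (level (dirPos x e j)) = kap n (i : ℤ) (j : ℤ) := by
    rw [level_dirPos x e hi.le, level_dirPos x e hj.le, kap, kap]
    simp only [add_sub_add_left_eq_sub]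
  by_cases hgood : dirPos x e i ∈ B ∧ dirPos x e j ∈ B ∧ Near a n R (dirPos x e i) (dirPos x e j)
  · rw [if_pos hgood.1, if_pos hgood.2.1, dkern_eq_kap hgood.2.2, hlev, sub_self]
    exact mul_nonneg (kap_nonneg _ _ _) (failBound_nonneg _ _ _ _)
  · have hzero : (if dirPos x e i ∈ B then (if dirPos x e j ∈ B then
        dkern a n R (dirPos x e i) (dirPos x e j)
        * (fluct w (ξ (dirPos x e i)) * fluct w (ξ (dirPos x e j))) else 0) else 0) = 0 := by
      split_ifs with h3 h4
      · rw [dkern, if_neg fun h5 => hgood ⟨h3, h4, h5⟩, zero_mul]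
      · rfl
      · rfl
    rw [hzero, sub_zero]
    by_cases hij : 1 ≤ ((j : ℤ) - (i : ℤ)).natAbs ∧ ((j : ℤ) - (i : ℤ)).natAbs ≤ n
    · refine mul_le_mul_of_nonneg_left ?_ (kap_nonneg _ _ _)
      exact ((le_abs_self _).trans (h.abs_fluct_mul_fluct_le _ _)).trans
        (one_le_failBound hR hx hc e hi hj hij hgood)
    · rw [kap, if_neg hij]; simp

/-- Under the size-biased law the fluctuations along the path behave like independent variables of
mean `v`, so products over two disjoint pairs of times are uncorrelated. Only pairs sharing a time
contribute, which costs one row sum `2 * harm n` of the kernel for each possible coincidence. -/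
theorem tilt_pathForm_sq_le (h : IsWeight μ a t w) (x : Site d) :
    tilt μ w N x (fun e ξ => (pathForm w n x e ξ - (∫ r, fluct w r ^ 2 ∂μ) ^ 2 * kapMass n N) ^ 2)
      ≤ 32 * harm n * kapMass n N := by
  classical
  set v := ∫ r, fluct w r ^ 2 ∂μ with hv
  have hv0 : 0 ≤ v := integral_nonneg fun r => sq_nonneg _
  have hv2 : v ^ 2 ≤ 1 := pow_le_one₀ hv0 h.integral_fluct_sq_le_one
  set P := Finset.range N ×ˢ Finset.range N with hP
  let K : ℕ × ℕ → ℝ := fun p => kap n (p.1 : ℤ) (p.2 : ℤ)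
  let Z : ℕ × ℕ → (Fin N → Fin d) → (Site d → E) → ℝ := fun p e ξ =>
    fluct w (ξ (dirPos x e p.1)) * fluct w (ξ (dirPos x e p.2)) - v ^ 2
  have hK : ∀ p, 0 ≤ K p := fun p => kap_nonneg _ _ _
  have hZb : ∀ p e, BMeas (Z p e) := fun p e =>
    ((h.bmeas_fluct_eval _).mul (h.bmeas_fluct_eval _)).sub (BMeas.const _)
  have hsq : ∀ (e : Fin N → Fin d) (ξ : Site d → E),
      (pathForm w n x e ξ - v ^ 2 * kapMass n N) ^ 2
        = ∑ p ∈ P, ∑ q ∈ P, (K p * K q) * (Z p e ξ * Z q e ξ) := by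
    intro e ξ
    have h1 : pathForm w n x e ξ - v ^ 2 * kapMass n N = ∑ p ∈ P, K p * Z p e ξ := by
      rw [hP, Finset.sum_product, pathForm, kapMass, Finset.mul_sum, ← Finset.sum_sub_distrib]
      refine Finset.sum_congr rfl fun i _ => ?_
      rw [Finset.mul_sum, ← Finset.sum_sub_distrib]
      exact Finset.sum_congr rfl fun j _ => by simp only [K, Z]; ring
    rw [h1, sq, Finset.sum_mul_sum]
    exact Finset.sum_congr rfl fun p _ => Finset.sum_congr rfl fun q _ => by ring
  -- Counts the coincidences between the two pairs: zero exactly when the pairs are disjoint, and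
  -- otherwise at least one.
  let m : ℕ × ℕ → ℕ × ℕ → ℝ := fun p q =>
    (if q.1 = p.1 then 1 else 0) + (if q.1 = p.2 then 1 else 0)
      + (if q.2 = p.1 then 1 else 0) + (if q.2 = p.2 then 1 else 0)
  have hcov : ∀ p ∈ P, ∀ q ∈ P, (K p * K q) * tilt μ w N x (fun e ξ => Z p e ξ * Z q e ξ)
      ≤ (K p * K q) * (4 * m p q) := by
    intro p hp q hq
    by_cases hp0 : p.1 = p.2
    · have : K p = 0 := by simp only [K]; rw [hp0, kap_self]
      simp [this]
    by_cases hq0 : q.1 = q.2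
    · have : K q = 0 := by simp only [K]; rw [hq0, kap_self]
      simp [this]
    refine mul_le_mul_of_nonneg_left ?_ (mul_nonneg (hK p) (hK q))
    by_cases hdis : q.1 ≠ p.1 ∧ q.1 ≠ p.2 ∧ q.2 ≠ p.1 ∧ q.2 ≠ p.2
    · obtain ⟨d1, d2, d3, d4⟩ := hdis
      have hm0 : m p q = 0 := by simp [m, d1, d2, d3, d4]
      rw [hm0, mul_zero]
      refine le_of_eq ?_
      rw [hP, Finset.mem_product, Finset.mem_range, Finset.mem_range] at hp hq
      let pr : Finset ℕ → (Fin N → Fin d) → (Site d → E) → ℝ := fun I e ξ =>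
        ∏ i ∈ I, fluct w (ξ (dirPos x e i))
      have hprb : ∀ I e, BMeas (pr I e) := fun I e => BMeas.prod I fun i _ => h.bmeas_fluct_eval _
      have hpr : ∀ I : Finset ℕ, I ⊆ Finset.range N → tilt μ w N x (pr I) = v ^ I.card :=
        fun I hI => h.tilt_prod_fluct x hI
      have hex : ∀ (e : Fin N → Fin d) (ξ : Site d → E), Z p e ξ * Z q e ξ
          = (pr {p.1, p.2, q.1, q.2} e ξ + (-v ^ 2) * pr {p.1, p.2} e ξ)
            + ((-v ^ 2) * pr {q.1, q.2} e ξ + v ^ 4 * pr ∅ e ξ) := by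
        intro e ξ
        have e4 : pr {p.1, p.2, q.1, q.2} e ξ = fluct w (ξ (dirPos x e p.1))
            * (fluct w (ξ (dirPos x e p.2)) * (fluct w (ξ (dirPos x e q.1))
              * fluct w (ξ (dirPos x e q.2)))) := by
          simp only [pr]
          rw [Finset.prod_insert (by simp [hp0, d1.symm, d3.symm]),
            Finset.prod_insert (by simp [d2.symm, d4.symm]), Finset.prod_insert (by simp [hq0]),
            Finset.prod_singleton]
        have e2 : ∀ s : ℕ × ℕ, s.1 ≠ s.2 → pr {s.1, s.2} e ξ
            = fluct w (ξ (dirPos x e s.1)) * fluct w (ξ (dirPos x e s.2)) := by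
          intro s hs
          simp only [pr]
          rw [Finset.prod_insert (by simpa using hs), Finset.prod_singleton]
        rw [e4, e2 p hp0, e2 q hq0]
        simp only [Z, pr, Finset.prod_empty]
        ring
      simp only [hex]
      rw [h.tilt_add (fun e => (hprb _ e).add ((hprb _ e).const_mul _))
          (fun e => ((hprb _ e).const_mul _).add ((hprb _ e).const_mul _)),
        h.tilt_add (hprb _) (fun e => (hprb _ e).const_mul _),
        h.tilt_add (fun e => (hprb _ e).const_mul _) (fun e => (hprb _ e).const_mul _),
        tilt_const_mul, tilt_const_mul, tilt_const_mul, hpr, hpr, hpr, hpr]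
      · have c4 : ({p.1, p.2, q.1, q.2} : Finset ℕ).card = 4 := by
          rw [Finset.card_insert_of_notMem (by simp [hp0, d1.symm, d3.symm]),
            Finset.card_insert_of_notMem (by simp [d2.symm, d4.symm]),
            Finset.card_insert_of_notMem (by simp [hq0]), Finset.card_singleton]
        rw [c4, Finset.card_pair hp0, Finset.card_pair hq0, Finset.card_empty]
        ring
      · simp
      · intro i hi
        simp only [Finset.mem_insert, Finset.mem_singleton] at hi
        rw [Finset.mem_range]; omega
      · intro i hi
        simp only [Finset.mem_insert, Finset.mem_singleton] at hi
        rw [Finset.mem_range]; omega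
      · intro i hi
        simp only [Finset.mem_insert, Finset.mem_singleton] at hi
        rw [Finset.mem_range]; omega
    · have hm1 : 1 ≤ m p q := by
        have i0 : ∀ (c : Prop) [Decidable c], (0 : ℝ) ≤ if c then 1 else 0 := by
          intro c _; split_ifs <;> norm_num
        have t1 := i0 (q.1 = p.1)
        have t2 := i0 (q.1 = p.2)
        have t3 := i0 (q.2 = p.1)
        have t4 := i0 (q.2 = p.2)
        simp only [m]
        by_cases c1 : q.1 = p.1
        · rw [if_pos c1]; linarith
        by_cases c2 : q.1 = p.2
        · rw [if_pos c2]; linarith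
        by_cases c3 : q.2 = p.1
        · rw [if_pos c3]; linarith
        by_cases c4 : q.2 = p.2
        · rw [if_pos c4]; linarith
        exact absurd ⟨c1, c2, c3, c4⟩ hdis
      have hZ2 : ∀ p e ξ, |Z p e ξ| ≤ 2 := by
        intro p e ξ
        have h1 := abs_le.1 (h.abs_fluct_mul_fluct_le (ξ (dirPos x e p.1)) (ξ (dirPos x e p.2)))
        simp only [Z]
        rw [abs_le]
        constructor <;> nlinarith [sq_nonneg v]
      calc tilt μ w N x (fun e ξ => Z p e ξ * Z q e ξ) ≤ tilt μ w N x (fun _ _ => 4) := by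
            refine h.tilt_mono (fun e => (hZb p e).mul (hZb q e)) (fun _ => BMeas.const 4)
              fun e ξ => ?_
            refine (le_abs_self _).trans ?_
            rw [abs_mul]
            nlinarith [hZ2 p e ξ, hZ2 q e ξ, abs_nonneg (Z p e ξ), abs_nonneg (Z q e ξ)]
        _ = 4 := by rw [h.tilt_path x fun _ => 4, wexp_const h.sum_one]
        _ ≤ 4 * m p q := by linarith
  have hrow : ∀ i : ℕ, ∑ j ∈ Finset.range N, kap n (i : ℤ) (j : ℤ) ≤ 2 * harm n := fun i =>
    sum_kap_le n i _ (g := fun j : ℕ => (j : ℤ)) fun _ _ _ _ h => by simpa using h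
  have hcol : ∀ i : ℕ, ∑ j ∈ Finset.range N, kap n (j : ℤ) (i : ℤ) ≤ 2 * harm n := fun i => by
    simp only [kap_comm n _ (i : ℤ)]; exact hrow i
  have hH := harm_nonneg n
  have f1 : ∀ i : ℕ, ∑ q ∈ P, K q * (if q.1 = i then 1 else 0) ≤ 2 * harm n := by
    intro i
    rw [hP, Finset.sum_product]
    simp only [K, mul_ite, mul_one, mul_zero]
    rw [Finset.sum_comm]
    simp only [Finset.sum_ite_eq']
    split_ifs
    · exact hrow i
    · simpa using hH
  have f2 : ∀ i : ℕ, ∑ q ∈ P, K q * (if q.2 = i then 1 else 0) ≤ 2 * harm n := by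
    intro i
    rw [hP, Finset.sum_product_right]
    simp only [K, mul_ite, mul_one, mul_zero]
    rw [Finset.sum_comm]
    simp only [Finset.sum_ite_eq']
    split_ifs
    · exact hcol i
    · simpa using hH
  simp only [hsq]
  rw [h.tilt_sum P (F := fun p e ξ => ∑ q ∈ P, (K p * K q) * (Z p e ξ * Z q e ξ))
    fun p e => BMeas.sum P fun q _ => ((hZb p e).mul (hZb q e)).const_mul _]
  calc _ = ∑ p ∈ P, ∑ q ∈ P, (K p * K q) * tilt μ w N x (fun e ξ => Z p e ξ * Z q e ξ) := by
        refine Finset.sum_congr rfl fun p _ => ?_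
        rw [h.tilt_sum P (F := fun q e ξ => (K p * K q) * (Z p e ξ * Z q e ξ))
          fun q e => ((hZb p e).mul (hZb q e)).const_mul _]
        exact Finset.sum_congr rfl fun q _ => tilt_const_mul x _ _
    _ ≤ ∑ p ∈ P, ∑ q ∈ P, (K p * K q) * (4 * m p q) :=
        Finset.sum_le_sum fun p hp => Finset.sum_le_sum fun q hq => hcov p hp q hq
    _ = ∑ p ∈ P, (4 * K p) * (∑ q ∈ P, K q * (if q.1 = p.1 then 1 else 0)
          + ∑ q ∈ P, K q * (if q.1 = p.2 then 1 else 0)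
          + ∑ q ∈ P, K q * (if q.2 = p.1 then 1 else 0)
          + ∑ q ∈ P, K q * (if q.2 = p.2 then 1 else 0)) := by
        refine Finset.sum_congr rfl fun p _ => ?_
        simp only [← Finset.sum_add_distrib, Finset.mul_sum]
        refine Finset.sum_congr rfl fun q _ => ?_
        simp only [m]
        ring
    _ ≤ ∑ p ∈ P, (4 * K p) * (8 * harm n) := by
        refine Finset.sum_le_sum fun p _ => mul_le_mul_of_nonneg_left ?_ (by linarith [hK p])
        linarith [f1 p.1, f1 p.2, f2 p.1, f2 p.2]
    _ = 32 * harm n * kapMass n N := by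
        rw [← Finset.sum_mul, ← Finset.mul_sum, hP, Finset.sum_product, kapMass]
        ring

end IsWeight

/-! ### A change of measure in dimensions two and three -/

theorem tendsto_harm : Tendsto harm atTop atTop := Real.tendsto_sum_range_one_div_nat_succ_atTop

namespace IsWeight

variable {d : ℕ} {E : Type*} [MeasurableSpace E] {μ : Measure E} [IsProbabilityMeasure μ]
  {a : Fin d → ℝ} {t : ℝ} {w : E → Fin d → ℝ} {n : ℕ} {R : ℝ}

theorem sum_slab_dkern_sq_le (hd : d = 2 ∨ d = 3) (hR : 1 ≤ R) (hn : 0 < n) (k : ℤ)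
    (c : Fin d → ℝ) :
    ∑ x ∈ slab a k (2 * n) c ((R + 1) * √n), ∑ y ∈ slab a k (2 * n) c ((R + 1) * √n),
      dkern a n R x y ^ 2 ≤ 900 * R ^ 4 * n ^ 2 * harm n := by
  set B := slab a k (2 * n) c ((R + 1) * √n) with hB
  have hn1 : (1 : ℝ) ≤ n := by exact_mod_cast hn
  have hs1 : 1 ≤ √(n : ℝ) := Real.one_le_sqrt.2 hn1
  have hs2 : √(n : ℝ) ^ 2 = n := Real.sq_sqrt (by linarith)
  have hcard : (B.card : ℝ) ≤ 50 * R ^ 2 * n ^ 2 := by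
    refine (card_slab_le hd (by positivity)).trans ?_
    have h1 : 2 * ((R + 1) * √(n : ℝ)) + 1 ≤ 5 * (R * √n) := by nlinarith
    calc ((2 * n : ℕ) : ℝ) * (2 * ((R + 1) * √n) + 1) ^ 2
        ≤ ((2 * n : ℕ) : ℝ) * (5 * (R * √n)) ^ 2 := by gcongr
      _ = 50 * R ^ 2 * n * √(n : ℝ) ^ 2 := by push_cast; ring
      _ = _ := by rw [hs2]; ring
  have hH := harm_nonneg n
  calc _ ≤ ∑ x ∈ B, 18 * R ^ 2 * harm n :=
        Finset.sum_le_sum fun x _ => sum_dkern_sq_le hd hR B x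
    _ = B.card * (18 * R ^ 2 * harm n) := by simp
    _ ≤ 50 * R ^ 2 * n ^ 2 * (18 * R ^ 2 * harm n) := by gcongr
    _ = _ := by ring

theorem bmeas_pathForm (h : IsWeight μ a t w) {N : ℕ} (x : Site d) (e : Fin N → Fin d) :
    BMeas fun ξ : Site d → E => pathForm w n x e ξ :=
  BMeas.sum _ fun _ _ => BMeas.sum _ fun _ _ =>
    ((h.bmeas_fluct_eval _).mul (h.bmeas_fluct_eval _)).const_mul _

open Classical in
/-- Under the size-biased law the quadratic form is unlikely to be small. -/
theorem integral_tot_indicator_le (hd : d = 2 ∨ d = 3) (h : IsWeight μ a t w) (hR : 1 ≤ R)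
    (hn : 0 < n) {k : ℤ} {c : Fin d → ℝ} {x : Site d} (hx : level x = k)
    (hc : ∀ l, |dev a x l - c l| ≤ √n) {θ : ℝ} (hθ : 0 < θ)
    (hθv : 4 * θ = (∫ r, fluct w r ^ 2 ∂μ) ^ 2 * kapMass n (2 * n)) :
    ∫ ξ, tot w (2 * n) x ξ * {ξ | θ ≤ quadForm w (dkern a n R)
        (slab a k (2 * n) c ((R + 1) * √n)) ξ}ᶜ.indicator (fun _ => 1) ξ ∂fieldLaw (Site d) μ
      ≤ (1 / θ ^ 2) * (32 * harm n * kapMass n (2 * n))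
        + (1 / θ) * (kapMass n (2 * n) * (5 * d / R ^ 2))
        + (1 / θ ^ 2) * (2088 * R ^ 4 * n ^ 2 * harm n) := by
  have hR0 : 0 < R := by linarith
  have ha := h.a_nonneg
  set B := slab a k (2 * n) c ((R + 1) * √n) with hB
  set V := dkern a n R with hV
  set v := ∫ r, fluct w r ^ 2 ∂μ with hv
  set N := 2 * n with hN
  have hQ := h.bmeas_quadForm V B
  have hmeas : MeasurableSet {ξ | θ ≤ quadForm w V B ξ} :=
    measurableSet_le measurable_const hQ.meas
  have hind : BMeas ({ξ | θ ≤ quadForm w V B ξ}ᶜ.indicator fun _ : Site d → E => (1 : ℝ)) :=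
    (BMeas.const 1).indicator hmeas.compl
  let f1 : (Fin N → Fin d) → (Site d → E) → ℝ := fun e ξ =>
    (pathForm w n x e ξ - v ^ 2 * kapMass n N) ^ 2
  let f2 : (Fin N → Fin d) → (Site d → E) → ℝ := fun e _ =>
    ∑ i ∈ Finset.range N, ∑ j ∈ Finset.range N, kap n (i : ℤ) (j : ℤ) * failBound a n R x e i j
  let f3 : (Fin N → Fin d) → (Site d → E) → ℝ := fun e ξ =>
    (quadForm w V B ξ - quadForm w V (B.filter (· ∈ pathSites x e)) ξ) ^ 2
  have hf1 : ∀ e, BMeas (f1 e) := fun e => ((h.bmeas_pathForm x e).sub (BMeas.const _)).pow 2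
  have hf2 : ∀ e, BMeas (f2 e) := fun e => BMeas.const _
  have hf3 : ∀ e, BMeas (f3 e) := fun e => (hQ.sub (h.bmeas_quadForm _ _)).pow 2
  -- The mean of the path form is `4θ`. If the full form is below `θ`, then one of three errors has
  -- size at least `θ`: the deviation of the path form, the loss from bad pairs, or the contribution
  -- of sites off the path. The first and third are bounded through squares, the second linearly.
  have hpt : ∀ e ξ, {ξ | θ ≤ quadForm w V B ξ}ᶜ.indicator (fun _ : Site d → E => (1 : ℝ)) ξ
      ≤ (1 / θ ^ 2) * f1 e ξ + (1 / θ) * f2 e ξ + (1 / θ ^ 2) * f3 e ξ := by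
    intro e ξ
    have n1 : 0 ≤ (1 / θ ^ 2) * f1 e ξ := by simp only [f1]; positivity
    have n3 : 0 ≤ (1 / θ ^ 2) * f3 e ξ := by simp only [f3]; positivity
    have n2 : 0 ≤ (1 / θ) * f2 e ξ := mul_nonneg (by positivity)
      (Finset.sum_nonneg fun i _ => Finset.sum_nonneg fun j _ =>
        mul_nonneg (kap_nonneg _ _ _) (failBound_nonneg _ _ _ _))
    by_cases hY : ξ ∈ {ξ | θ ≤ quadForm w V B ξ}
    · rw [Set.indicator_of_notMem (Set.notMem_compl_iff.2 hY)]
      linarith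
    · rw [Set.indicator_of_mem (Set.mem_compl hY)]
      have hY' : quadForm w V B ξ < θ := not_le.1 hY
      have hsq : ∀ u : ℝ, u ≤ -θ → 1 ≤ (1 / θ ^ 2) * u ^ 2 := by
        intro u hu
        rw [div_mul_eq_mul_div, one_mul, one_le_div (by positivity)]
        nlinarith
      have hU := h.pathForm_sub_le hR0 hx hc e ξ
      change pathForm w n x e ξ - quadForm w V (B.filter (· ∈ pathSites x e)) ξ ≤ f2 e ξ at hU
      by_cases c1 : pathForm w n x e ξ - v ^ 2 * kapMass n N ≤ -θ
      · have := hsq _ c1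
        simp only [f1] at n1 ⊢
        linarith
      by_cases c2 : θ ≤ f2 e ξ
      · have : 1 ≤ (1 / θ) * f2 e ξ := by
          rw [div_mul_eq_mul_div, one_mul, one_le_div hθ]; exact c2
        linarith
      have c3 : quadForm w V B ξ - quadForm w V (B.filter (· ∈ pathSites x e)) ξ ≤ -θ := by
        push Not at c1 c2
        linarith
      have := hsq _ c3
      simp only [f3] at n3 ⊢
      linarith
  have b1 : tilt μ w N x f1 ≤ 32 * harm n * kapMass n N := h.tilt_pathForm_sq_le x
  have b2 : tilt μ w N x f2 ≤ kapMass n N * (5 * d / R ^ 2) := by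
    simp only [f2]
    rw [h.tilt_path x, wexp_sum, kapMass, Finset.sum_mul]
    refine Finset.sum_le_sum fun i hi => ?_
    rw [wexp_sum, Finset.sum_mul]
    refine Finset.sum_le_sum fun j hj => ?_
    rw [wexp_const_mul]
    exact mul_le_mul_of_nonneg_left (wexp_failBound_le ha h.sum_one hR0 x (Finset.mem_range.1 hi)
      (Finset.mem_range.1 hj) hn le_rfl) (kap_nonneg _ _ _)
  -- The constant is `4 · 72 + 2 · 900`: the linear part over the path and the quadratic part over
  -- the slab.
  have b3 : tilt μ w N x f3 ≤ 2088 * R ^ 4 * n ^ 2 * harm n := by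
    refine h.tilt_le_of_glue x hf3 fun e ξ => ?_
    refine (h.integral_quadForm_sub_sq_le dkern_comm dkern_self dkern_nonneg B
      (pathSites x e) ξ).trans ?_
    have g1 := sum_dkern_path_le (a := a) (n := n) hd hR B x e
    have g2 := sum_slab_dkern_sq_le (a := a) hd hR hn k c
    have hH := harm_nonneg n
    have hR4 : R ^ 2 ≤ R ^ 4 := pow_le_pow_right₀ hR (by norm_num)
    have g3 : 36 * R ^ 2 * harm n * n * (N : ℕ) ≤ 72 * R ^ 4 * n ^ 2 * harm n := by
      have : 36 * R ^ 2 * harm n * n * (N : ℕ) = R ^ 2 * (72 * harm n * n ^ 2) := by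
        rw [hN]; push_cast; ring
      rw [this]
      calc _ ≤ R ^ 4 * (72 * harm n * n ^ 2) := by gcongr
        _ = _ := by ring
    linarith
  rw [← h.tilt_field x hind]
  calc _ ≤ tilt μ w N x (fun e ξ => (1 / θ ^ 2) * f1 e ξ + (1 / θ) * f2 e ξ
          + (1 / θ ^ 2) * f3 e ξ) :=
        h.tilt_mono (fun _ => hind) (fun e => (((hf1 e).const_mul _).add
          ((hf2 e).const_mul _)).add ((hf3 e).const_mul _)) hpt
    _ = (1 / θ ^ 2) * tilt μ w N x f1 + (1 / θ) * tilt μ w N x f2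
          + (1 / θ ^ 2) * tilt μ w N x f3 := by
        rw [h.tilt_add (fun e => ((hf1 e).const_mul _).add ((hf2 e).const_mul _))
          (fun e => (hf3 e).const_mul _), h.tilt_add (fun e => (hf1 e).const_mul _)
          (fun e => (hf2 e).const_mul _), tilt_const_mul, tilt_const_mul, tilt_const_mul]
    _ ≤ _ := by gcongr

/-- A rare event off which the partition function of a block is small in mean. -/
theorem exists_block_event (hd : d = 2 ∨ d = 3) (h : IsWeight μ a t w)
    (hv : 0 < ∫ r, fluct w r ^ 2 ∂μ) {δ : ℝ} (hδ : 0 < δ) :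
    ∃ n₀ : ℕ, ∀ n ≥ n₀, ∀ (k : ℤ) (c : Fin d → ℝ), ∃ A : Set (Site d → E), MeasurableSet A ∧
      (fieldLaw (Site d) μ).real A ≤ δ ∧
      ∀ x : Site d, level x = k → (∀ l, |dev a x l - c l| ≤ √n) →
        ∫ ξ, tot w (2 * n) x ξ * Aᶜ.indicator (fun _ => 1) ξ ∂fieldLaw (Site d) μ ≤ δ := by
  set v := ∫ r, fluct w r ^ 2 ∂μ with hv'
  -- Since `θ = v² D / 4`, the error from bad pairs is `20 d / (v² R²)`; this choice makes it at
  -- most `δ/3`.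
  set R : ℝ := 1 + 60 * d / (v ^ 2 * δ) with hRdef
  have hq : 0 ≤ 60 * d / (v ^ 2 * δ) := by positivity
  have hR : 1 ≤ R := by linarith
  have hR2 : 60 * d / (v ^ 2 * δ) ≤ R ^ 2 := by nlinarith
  -- With `θ ≥ v² n H / 4`, the off-path error is at most `16 · 2088 R⁴ / (v⁴ H)`, hence at most
  -- `δ/3` once `H ≥ M`. The divergence of the harmonic sum provides this after `R` has been fixed.
  set M : ℝ := 110000 * R ^ 4 / (v ^ 4 * δ) with hM
  have hev : ∀ᶠ n : ℕ in atTop, 0 < n ∧ 1 + M ≤ harm n ∧ 1536 / (v ^ 4 * δ) ≤ (n : ℝ) :=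
    (eventually_gt_atTop 0).and ((tendsto_harm.eventually_ge_atTop _).and
      (tendsto_natCast_atTop_atTop.eventually_ge_atTop _))
  obtain ⟨n₀, hn₀⟩ := eventually_atTop.1 hev
  refine ⟨n₀, fun n hn k c => ?_⟩
  obtain ⟨hn0, hH, hn1⟩ := hn₀ n hn
  set H := harm n with hHdef
  set D := kapMass n (2 * n) with hD
  have hn' : (0 : ℝ) < n := by exact_mod_cast hn0
  have hM0 : 0 < M := by positivity
  have hH0 : 0 < H := by linarith
  have hnD : n * H ≤ D := mul_harm_le_kapMass n
  have hD0 : 0 < D := lt_of_lt_of_le (by positivity) hnD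
  set θ := v ^ 2 * D / 4 with hθ
  have hθ0 : 0 < θ := by positivity
  set B := slab a k (2 * n) c ((R + 1) * √n) with hB
  have hQ := h.bmeas_quadForm (dkern a n R) B
  have hmeas : MeasurableSet {ξ : Site d → E | θ ≤ quadForm w (dkern a n R) B ξ} :=
    measurableSet_le measurable_const hQ.meas
  have hMH : 110000 * R ^ 4 ≤ v ^ 4 * δ * H := by
    have h1 : M ≤ H := by linarith
    rw [hM, div_le_iff₀ (by positivity)] at h1
    linarith
  have hθ2 : v ^ 4 * (n * H) ^ 2 ≤ 16 * θ ^ 2 := by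
    calc v ^ 4 * (n * H) ^ 2 ≤ v ^ 4 * D ^ 2 := by gcongr
      _ = _ := by rw [hθ]; ring
  have hbig : (1 / θ ^ 2) * (2088 * R ^ 4 * n ^ 2 * H) ≤ δ / 3 := by
    rw [div_mul_eq_mul_div, one_mul, div_le_iff₀ (by positivity)]
    have h1 : 110000 * R ^ 4 * (n ^ 2 * H) ≤ v ^ 4 * δ * H * (n ^ 2 * H) :=
      mul_le_mul_of_nonneg_right hMH (by positivity)
    have h2 : δ * (v ^ 4 * (n * H) ^ 2) ≤ δ * (16 * θ ^ 2) := mul_le_mul_of_nonneg_left hθ2 hδ.le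
    have h3 : 0 ≤ R ^ 4 * (n ^ 2 * H) := by positivity
    nlinarith
  refine ⟨{ξ | θ ≤ quadForm w (dkern a n R) B ξ}, hmeas, ?_, fun x hx hc => ?_⟩
  · have h1 : (fieldLaw (Site d) μ).real {ξ | θ ≤ quadForm w (dkern a n R) B ξ}
        ≤ ∫ ξ, (1 / θ ^ 2) * quadForm w (dkern a n R) B ξ ^ 2 ∂fieldLaw (Site d) μ := by
      rw [← integral_indicator_one hmeas]
      refine integral_mono (((BMeas.const 1).indicator hmeas).integrable _)
        (((hQ.pow 2).const_mul _).integrable _) fun ξ => ?_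
      by_cases hξ : ξ ∈ {ξ | θ ≤ quadForm w (dkern a n R) B ξ}
      · rw [Set.indicator_of_mem hξ]
        simp only [Pi.one_apply]
        rw [div_mul_eq_mul_div, one_mul, one_le_div (by positivity)]
        exact pow_le_pow_left₀ hθ0.le hξ 2
      · rw [Set.indicator_of_notMem hξ]
        positivity
    rw [integral_const_mul] at h1
    have h2 := h.integral_quadForm_sq_le dkern_comm dkern_self B (V := dkern a n R)
    have h3 := sum_slab_dkern_sq_le (a := a) hd hR hn0 k c
    have h4 : (1 / θ ^ 2) * ∫ ξ, quadForm w (dkern a n R) B ξ ^ 2 ∂fieldLaw (Site d) μ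
        ≤ (1 / θ ^ 2) * (2088 * R ^ 4 * n ^ 2 * H) := by
      refine mul_le_mul_of_nonneg_left ?_ (by positivity)
      have h5 : 0 ≤ R ^ 4 * n ^ 2 * H := by positivity
      linarith
    linarith
  · refine (integral_tot_indicator_le hd h hR hn0 hx hc hθ0 (by rw [hθ]; ring)).trans ?_
    have t1 : (1 / θ ^ 2) * (32 * H * D) ≤ δ / 3 := by
      rw [div_mul_eq_mul_div, one_mul, div_le_iff₀ (by positivity)]
      rw [div_le_iff₀ (by positivity)] at hn1
      have h1 : 1536 * (H * D) ≤ v ^ 4 * δ * D * D := by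
        calc 1536 * (H * D) ≤ n * (v ^ 4 * δ) * (H * D) :=
              mul_le_mul_of_nonneg_right hn1 (by positivity)
          _ = v ^ 4 * δ * (n * H) * D := by ring
          _ ≤ _ := by gcongr
      have h2 : 16 * θ ^ 2 = v ^ 4 * D * D := by rw [hθ]; ring
      nlinarith
    have t2 : (1 / θ) * (D * (5 * d / R ^ 2)) ≤ δ / 3 := by
      rw [div_mul_eq_mul_div, one_mul, div_le_iff₀ hθ0, mul_div_assoc', div_le_iff₀ (by positivity)]
      rw [div_le_iff₀ (by positivity)] at hR2
      have h1 : 60 * d * D ≤ R ^ 2 * (v ^ 2 * δ) * D := mul_le_mul_of_nonneg_right hR2 hD0.le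
      have h2 : δ / 3 * θ * R ^ 2 = R ^ 2 * (v ^ 2 * δ) * D / 12 := by rw [hθ]; ring
      rw [h2]
      linarith
    linarith

end IsWeight

/-! ### Coarse graining into diffusive cells -/

theorem sqrt_sum_le_sum_sqrt {ι : Type*} (s : Finset ι) {f : ι → ℝ} (hf : ∀ i ∈ s, 0 ≤ f i) :
    √(∑ i ∈ s, f i) ≤ ∑ i ∈ s, √(f i) := by
  refine Real.sqrt_le_iff.2 ⟨Finset.sum_nonneg fun _ _ => Real.sqrt_nonneg _, ?_⟩
  calc ∑ i ∈ s, f i = ∑ i ∈ s, √(f i) ^ 2 :=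
        Finset.sum_congr rfl fun i hi => (Real.sq_sqrt (hf i hi)).symm
    _ ≤ _ := Finset.sum_sq_le_sq_sum_of_nonneg fun _ _ => Real.sqrt_nonneg _

/-- The diffusive cell of a site. -/
def cell {d : ℕ} (a : Fin d → ℝ) (r : ℝ) (x : Site d) : Fin d → ℤ := fun j => ⌊dev a x j / r⌋

/-- The weight by which the contributions of distant cells are bounded. -/
def cellDecay {d : ℕ} (u : Fin d → ℤ) : ℝ := ∏ j, Real.exp (-|(u j : ℝ)|)

theorem cellDecay_pos {d : ℕ} (u : Fin d → ℤ) : 0 < cellDecay u :=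
  Finset.prod_pos fun _ _ => Real.exp_pos _

theorem summable_cellDecay (d : ℕ) : Summable (cellDecay : (Fin d → ℤ) → ℝ) := by
  classical
  have h1 : Summable fun k : ℤ => Real.exp (-|(k : ℝ)|) := by
    have h2 : Summable fun n : ℕ => Real.exp (-(n : ℝ)) := Real.summable_exp_neg_nat
    refine Summable.of_nat_of_neg ?_ ?_
    · simpa using h2
    · simpa using h2
  refine summable_of_sum_le (c := (∑' k : ℤ, Real.exp (-|(k : ℝ)|)) ^ d)
    (fun u => (cellDecay_pos u).le) fun Z => ?_
  calc ∑ u ∈ Z, cellDecay u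
      ≤ ∑ u ∈ Fintype.piFinset fun j => Z.image fun u => u j, cellDecay u :=
        Finset.sum_le_sum_of_subset_of_nonneg (fun u hu => Fintype.mem_piFinset.2 fun j =>
          Finset.mem_image_of_mem _ hu) fun u _ _ => (cellDecay_pos u).le
    _ = ∏ j : Fin d, ∑ k ∈ (Z.image fun u => u j : Finset ℤ),
          Real.exp (-|((k : ℤ) : ℝ)|) := by
        rw [Finset.prod_univ_sum]
        rfl
    _ ≤ ∏ _j : Fin d, ∑' k : ℤ, Real.exp (-|(k : ℝ)|) :=
        Finset.prod_le_prod (fun j _ => Finset.sum_nonneg fun _ _ => (Real.exp_pos _).le)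
          fun j _ => h1.sum_le_tsum _ fun _ _ => (Real.exp_pos _).le
    _ = _ := by simp

/-- The constant in the large deviation bound for cells. -/
def cellConst (d : ℕ) : ℝ := 2 * d * Real.exp (2 * d + 8 * d ^ 2)

section Cells

variable {d : ℕ} {a : Fin d → ℝ} {n : ℕ}

open Classical in
-- Exponential Markov inequality for a coordinate carrying at least the fraction `1/d` of the
-- displacement. The square of `cellDecay` is needed because a square root is taken later.
theorem wexp_cell_le (ha : ∀ i, 0 ≤ a i) (ha1 : ∑ i, a i = 1) (hd : 0 < d) (hn : 4 * d ^ 2 ≤ n)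
    (x : Site d) (z : Fin d → ℤ) :
    wexp a (2 * n) (fun e => if cell a √n (dirPos x e (2 * n)) = z then 1 else 0)
      ≤ cellConst d * cellDecay (z - cell a √n x) ^ 2 := by
  have hd' : (0 : ℝ) < d := by exact_mod_cast hd
  have hn4 : 4 * (d : ℝ) ^ 2 ≤ n := by exact_mod_cast hn
  have hn0 : (0 : ℝ) < n := lt_of_lt_of_le (by positivity) hn4
  have hr : 0 < √(n : ℝ) := Real.sqrt_pos.2 hn0
  have hr2 : √(n : ℝ) ^ 2 = n := Real.sq_sqrt hn0.le
  -- The factor `2d` yields decay `exp(-2M)` from one coordinate; `4d² ≤ n` ensures `s ≤ 1`, and `2n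
  -- s² = 8d²` does not depend on `n`.
  set s : ℝ := 2 * d / √n with hs
  have hs1 : |s| ≤ 1 := by
    rw [abs_of_pos (by positivity), div_le_one hr]
    exact Real.le_sqrt_of_sq_le (by nlinarith)
  set u := z - cell a √n x with hu
  set M : ℝ := ∑ j, |(u j : ℝ)| with hM
  have hdec : cellDecay u ^ 2 = Real.exp (-(2 * M)) := by
    rw [cellDecay, ← Real.exp_sum, ← Real.exp_nat_mul, Finset.sum_neg_distrib]
    congr 1
    push_cast
    ring
  let Δ : Fin d → (Fin (2 * n) → Fin d) → ℝ := fun j e => ∑ i, dev a (unitStep (e i)) j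
  have hΔ : ∀ j e, Δ j e = dev a (dirPos x e (2 * n)) j - dev a x j := by
    intro j e
    have h1 := dev_dirPos_sub (a := a) x e j (Nat.zero_le (2 * n))
    rw [dirPos_zero] at h1
    rw [h1]
    simp [Δ]
  have hpt : ∀ e : Fin (2 * n) → Fin d,
      (if cell a √n (dirPos x e (2 * n)) = z then (1 : ℝ) else 0)
        ≤ Real.exp (2 * d - 2 * M)
          * ∑ j, (Real.exp (s * Δ j e) + Real.exp (-s * Δ j e)) := by
    intro e
    split_ifs with hz
    · obtain ⟨j, hj⟩ : ∃ j, M ≤ d * |(u j : ℝ)| := by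
        by_contra hcon
        push Not at hcon
        have h1 : ∑ j : Fin d, (d : ℝ) * |(u j : ℝ)| < ∑ j : Fin d, M :=
          Finset.sum_lt_sum_of_nonempty ⟨⟨0, hd⟩, Finset.mem_univ _⟩ fun j _ => hcon j
        rw [← Finset.mul_sum] at h1
        simp only [Finset.sum_const, Finset.card_univ, Fintype.card_fin, nsmul_eq_mul] at h1
        exact lt_irrefl _ h1
      have hfl : |(u j : ℝ)| ≤ |Δ j e| / √n + 1 := by
        have h1 : u j = ⌊dev a (dirPos x e (2 * n)) j / √n⌋ - ⌊dev a x j / √n⌋ := by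
          rw [hu, ← hz]; rfl
        have h2 : Δ j e / √n = dev a (dirPos x e (2 * n)) j / √n - dev a x j / √n := by
          rw [hΔ, sub_div]
        have h3 : |Δ j e| / √n = |Δ j e / √n| := by rw [abs_div, abs_of_pos hr]
        rw [h3, h2, h1]
        push_cast
        have f1 := Int.floor_le (dev a (dirPos x e (2 * n)) j / √n)
        have f2 := Int.lt_floor_add_one (dev a (dirPos x e (2 * n)) j / √n)
        have f3 := Int.floor_le (dev a x j / √n)
        have f4 := Int.lt_floor_add_one (dev a x j / √n)
        have f5 := abs_le.1 (le_refl |dev a (dirPos x e (2 * n)) j / √n - dev a x j / √n|)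
        rw [abs_le]
        constructor <;> linarith
      have hexp : Real.exp (2 * M - 2 * d) ≤ Real.exp (s * Δ j e) + Real.exp (-s * Δ j e) := by
        have h1 : 2 * M - 2 * d ≤ s * |Δ j e| := by
          have h2 : s * |Δ j e| = 2 * (d * (|Δ j e| / √n)) := by rw [hs]; ring
          have h3 : d * |(u j : ℝ)| ≤ d * (|Δ j e| / √n + 1) := mul_le_mul_of_nonneg_left hfl hd'.le
          rw [h2]
          linarith
        rcases abs_cases (Δ j e) with ⟨h2, -⟩ | ⟨h2, -⟩
        · rw [h2] at h1
          linarith [Real.exp_le_exp.2 h1, Real.exp_pos (-s * Δ j e)]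
        · rw [h2, mul_neg, ← neg_mul] at h1
          linarith [Real.exp_le_exp.2 h1, Real.exp_pos (s * Δ j e)]
      calc (1 : ℝ) = Real.exp (2 * d - 2 * M) * Real.exp (2 * M - 2 * d) := by
            rw [← Real.exp_add]; simp
        _ ≤ Real.exp (2 * d - 2 * M) * (Real.exp (s * Δ j e) + Real.exp (-s * Δ j e)) := by
            gcongr
        _ ≤ _ := by
            gcongr
            exact Finset.single_le_sum
              (f := fun j => Real.exp (s * Δ j e) + Real.exp (-s * Δ j e))
              (fun j _ => by positivity) (Finset.mem_univ j)
    · exact mul_nonneg (Real.exp_pos _).le (Finset.sum_nonneg fun j _ => by positivity)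
  refine (wexp_mono ha hpt).trans ?_
  rw [wexp_const_mul, wexp_sum]
  have hone : ∀ j, wexp a (2 * n) (fun e => Real.exp (s * Δ j e) + Real.exp (-s * Δ j e))
      ≤ 2 * Real.exp (8 * d ^ 2) := by
    intro j
    have hvar : ((2 * n : ℕ) : ℝ) * s ^ 2 = 8 * d ^ 2 := by
      rw [hs, div_pow, hr2]
      push_cast
      field_simp
      ring
    have e1 := wexp_exp_le ha ha1 (N := 2 * n) (sum_mul_dev_unitStep ha1 j)
      (fun i => abs_dev_unitStep_le ha ha1 i j) hs1
    have e2 := wexp_exp_le ha ha1 (N := 2 * n) (sum_mul_dev_unitStep ha1 j)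
      (fun i => abs_dev_unitStep_le ha ha1 i j) (s := -s) (by rwa [abs_neg])
    rw [neg_sq, hvar] at e2
    rw [hvar] at e1
    rw [wexp_add]
    simp only [Δ]
    linarith
  calc _ ≤ Real.exp (2 * d - 2 * M) * ∑ j : Fin d, 2 * Real.exp (8 * d ^ 2) :=
        mul_le_mul_of_nonneg_left (Finset.sum_le_sum fun j _ => hone j) (Real.exp_pos _).le
    _ = _ := by
        rw [hdec, cellConst]
        simp only [Finset.sum_const, Finset.card_univ, Fintype.card_fin, nsmul_eq_mul]
        rw [sub_eq_add_neg, Real.exp_add, Real.exp_add]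
        ring

end Cells

namespace IsWeight

variable {d : ℕ} {E : Type*} [MeasurableSpace E] {μ : Measure E} [IsProbabilityMeasure μ]
  {a : Fin d → ℝ} {t : ℝ} {w : E → Fin d → ℝ} {n : ℕ}

theorem integral_part (h : IsWeight μ a t w) (g : Site d → ℝ) (N : ℕ) (x : Site d) :
    ∫ ξ, part w g N x ξ ∂fieldLaw (Site d) μ = wexp a N fun e => g (dirPos x e N) := by
  simp only [part]
  rw [integral_finsetSum _ fun e _ => ((h.bmeas_pathWt x e).mul_const _).integrable _]
  simp only [integral_mul_const, h.integral_pathWt]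
  rfl

/-- The part of the partition function of a block, with weighted starting points, which ends in a
given set of sites. -/
def blockSum (w : E → Fin d → ℝ) (S : Finset (Site d)) (ν : Site d → ℝ) (N : ℕ)
    (g : Site d → ℝ) (ξ : Site d → E) : ℝ := ∑ x ∈ S, ν x * part w g N x ξ

theorem bmeas_blockSum (h : IsWeight μ a t w) (S : Finset (Site d)) (ν : Site d → ℝ) (N : ℕ)
    (g : Site d → ℝ) : BMeas (blockSum w S ν N g) :=
  BMeas.sum S fun x _ => (h.bmeas_part g N x).const_mul (ν x)

theorem blockSum_nonneg (h : IsWeight μ a t w) {S : Finset (Site d)} {ν : Site d → ℝ}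
    (hν : ∀ x, 0 ≤ ν x) (N : ℕ) {g : Site d → ℝ} (hg : ∀ y, 0 ≤ g y) (ξ : Site d → E) :
    0 ≤ blockSum w S ν N g ξ :=
  Finset.sum_nonneg fun x _ => mul_nonneg (hν x) (part_nonneg h.w_nonneg hg N x ξ)

/-- Jensen's inequality for the square root, through the tangent line at `q²`. -/
theorem integral_sqrt_le (Q : Measure (Site d → E)) [IsProbabilityMeasure Q]
    {f : (Site d → E) → ℝ} (hf : BMeas f) (hf0 : ∀ ξ, 0 ≤ f ξ) {q : ℝ} (hq : 0 < q)
    (hfq : ∫ ξ, f ξ ∂Q ≤ q ^ 2) : ∫ ξ, √(f ξ) ∂Q ≤ q := by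
  calc ∫ ξ, √(f ξ) ∂Q ≤ ∫ ξ, (1 / (2 * q)) * f ξ + q / 2 ∂Q := by
        refine integral_mono (hf.sqrt.integrable _)
          (((hf.const_mul _).add (BMeas.const _)).integrable _) fun ξ => ?_
        have h1 : √(f ξ) ^ 2 = f ξ := Real.sq_sqrt (hf0 ξ)
        have h2 : (1 / (2 * q)) * f ξ + q / 2 - √(f ξ) = (√(f ξ) - q) ^ 2 / (2 * q) := by
          field_simp
          rw [← h1]
          simp only [Real.sqrt_sq (Real.sqrt_nonneg _)]
          ring
        have h3 : 0 ≤ (√(f ξ) - q) ^ 2 / (2 * q) := by positivity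
        linarith
    _ = (1 / (2 * q)) * (∫ ξ, f ξ ∂Q) + q / 2 := by
        rw [integral_add ((hf.const_mul _).integrable _) (integrable_const _), integral_const_mul]
        simp
    _ ≤ (1 / (2 * q)) * q ^ 2 + q / 2 := by gcongr
    _ = q := by field_simp; ring

/-- Cauchy–Schwarz on the rare event `A` and Jensen off it each give `s q`; both are linearized so
that a single pointwise inequality suffices. -/
theorem integral_sqrt_le_of_event (Q : Measure (Site d → E)) [IsProbabilityMeasure Q]
    {f : (Site d → E) → ℝ} (hf : BMeas f) (hf0 : ∀ ξ, 0 ≤ f ξ) {q s : ℝ} (hq : 0 < q)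
    (hs : 0 < s) {A : Set (Site d → E)} (hA : MeasurableSet A) (hfq : ∫ ξ, f ξ ∂Q ≤ q ^ 2)
    (hQA : Q.real A ≤ s ^ 2)
    (hfA : ∫ ξ, f ξ * Aᶜ.indicator (fun _ => 1) ξ ∂Q ≤ s ^ 2 * q ^ 2) :
    ∫ ξ, √(f ξ) ∂Q ≤ 2 * s * q := by
  have hI : BMeas (A.indicator fun _ : Site d → E => (1 : ℝ)) := (BMeas.const 1).indicator hA
  have hI' : BMeas (Aᶜ.indicator fun _ : Site d → E => (1 : ℝ)) :=
    (BMeas.const 1).indicator hA.compl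
  have b1 := hf.const_mul (s / (2 * q))
  have b2 := hI.const_mul (q / (2 * s))
  have b3 := (hf.mul hI').const_mul (1 / (2 * s * q))
  have hpt : ∀ ξ, √(f ξ) ≤ (s / (2 * q)) * f ξ + (q / (2 * s)) * A.indicator (fun _ => 1) ξ
      + (1 / (2 * s * q)) * (f ξ * Aᶜ.indicator (fun _ => 1) ξ) + s * q / 2 := by
    intro ξ
    set y := √(f ξ) with hy
    have h1 : f ξ = y ^ 2 := (Real.sq_sqrt (hf0 ξ)).symm
    rw [h1]
    by_cases hξ : ξ ∈ A
    · rw [Set.indicator_of_mem hξ, Set.indicator_of_notMem (Set.notMem_compl_iff.2 hξ)]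
      have h2 : (s / (2 * q)) * y ^ 2 + (q / (2 * s)) * 1 - y = (s * y - q) ^ 2 / (2 * s * q) := by
        field_simp; ring
      have h3 : 0 ≤ (s * y - q) ^ 2 / (2 * s * q) := by positivity
      have h4 : 0 < s * q / 2 := by positivity
      linarith
    · rw [Set.indicator_of_notMem hξ, Set.indicator_of_mem (Set.mem_compl hξ)]
      have h2 : (1 / (2 * s * q)) * (y ^ 2 * 1) + s * q / 2 - y
          = (y - s * q) ^ 2 / (2 * s * q) := by
        field_simp; ring
      have h3 : 0 ≤ (y - s * q) ^ 2 / (2 * s * q) := by positivity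
      have h4 : 0 ≤ (s / (2 * q)) * y ^ 2 := by positivity
      linarith
  calc ∫ ξ, √(f ξ) ∂Q ≤ ∫ ξ, (s / (2 * q)) * f ξ + (q / (2 * s)) * A.indicator (fun _ => 1) ξ
      + (1 / (2 * s * q)) * (f ξ * Aᶜ.indicator (fun _ => 1) ξ) + s * q / 2 ∂Q :=
        integral_mono (hf.sqrt.integrable _)
          ((((b1.add b2).add b3).add (BMeas.const _)).integrable _) hpt
    _ = (s / (2 * q)) * (∫ ξ, f ξ ∂Q) + (q / (2 * s)) * Q.real A
      + (1 / (2 * s * q)) * (∫ ξ, f ξ * Aᶜ.indicator (fun _ => 1) ξ ∂Q) + s * q / 2 := by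
        rw [integral_add (((b1.add b2).add b3).integrable _) (integrable_const _),
          integral_add ((b1.add b2).integrable _) (b3.integrable _),
          integral_add (b1.integrable _) (b2.integrable _), integral_const_mul,
          integral_const_mul, integral_const_mul]
        have : ∫ ξ, A.indicator (fun _ => (1 : ℝ)) ξ ∂Q = Q.real A := integral_indicator_one hA
        rw [this]
        simp
    _ ≤ (s / (2 * q)) * q ^ 2 + (q / (2 * s)) * s ^ 2 + (1 / (2 * s * q)) * (s ^ 2 * q ^ 2)
        + s * q / 2 := by gcongr
    _ = 2 * s * q := by field_simp; ring

end IsWeight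

/-! ### Exponential decay of a fractional moment in dimensions two and three -/

namespace IsWeight

variable {d : ℕ} {E : Type*} [MeasurableSpace E] {μ : Measure E} [IsProbabilityMeasure μ]
  {a : Fin d → ℝ} {t : ℝ} {w : E → Fin d → ℝ} {n : ℕ}

open Classical in
-- One block reduces the fractional moment, summed over the terminal cells, by a factor of two.
-- Finitely many near cells are made small by the rare event, and the far cells by the summable
-- decay.
theorem exists_block_contraction (hd : d = 2 ∨ d = 3) (h : IsWeight μ a t w)
    (hv : 0 < ∫ r, fluct w r ^ 2 ∂μ) : ∃ N > 0, ∃ r : ℝ, ∀ (k : ℤ) (u : Fin d → ℤ)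
      (S : Finset (Site d)) (ν : Site d → ℝ), (∀ x, 0 ≤ ν x) →
      (∀ x ∈ S, level x = k ∧ cell a r x = u) → ∀ Z : Finset (Fin d → ℤ),
      ∑ z ∈ Z, ∫ ξ, √(blockSum w S ν N (fun y => if cell a r y = z then 1 else 0) ξ)
        ∂fieldLaw (Site d) μ ≤ 1 / 2 * √(∑ x ∈ S, ν x) := by
  have hd0 : 0 < d := by omega
  set C := cellConst d with hC
  have hCpos : 0 < C := by
    have : (0 : ℝ) < d := by exact_mod_cast hd0
    rw [hC, cellConst]
    positivity
  have hsC : 0 < √C := Real.sqrt_pos.2 hCpos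
  have hsum : Summable fun u : Fin d → ℤ => √C * cellDecay u := (summable_cellDecay d).mul_left _
  -- The far cells get a budget of `1/4`, uniformly in the block length. The remaining finite set
  -- `F` is fixed before `s` and `n` are chosen.
  obtain ⟨F, hF⟩ := summable_iff_vanishing_norm.1 hsum (1 / 4) (by norm_num)
  set s : ℝ := 1 / (8 * (F.card + 1)) with hs
  have hs0 : 0 < s := by positivity
  obtain ⟨n₀, hn₀⟩ := h.exists_block_event hd hv (δ := s ^ 2) (by positivity)
  set n := max n₀ (4 * d ^ 2) with hn
  have hn0 : 0 < n := lt_of_lt_of_le (by positivity) (le_max_right n₀ (4 * d ^ 2))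
  have hr : 0 < √(n : ℝ) := Real.sqrt_pos.2 (by exact_mod_cast hn0)
  refine ⟨2 * n, by omega, √n, fun k u S ν hν hS Z => ?_⟩
  set σ := ∑ x ∈ S, ν x with hσ
  have hσ0 : 0 ≤ σ := Finset.sum_nonneg fun x _ => hν x
  let g : (Fin d → ℤ) → Site d → ℝ := fun z y => if cell a √n y = z then 1 else 0
  have hg0 : ∀ z y, 0 ≤ g z y := fun z y => by simp only [g]; split_ifs <;> norm_num
  have hg1 : ∀ z y, g z y ≤ 1 := fun z y => by simp only [g]; split_ifs <;> norm_num
  have hb : ∀ z, BMeas (blockSum w S ν (2 * n) (g z)) := fun z => h.bmeas_blockSum _ _ _ _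
  have hint : ∀ f : Site d → ℝ, ∫ ξ, blockSum w S ν (2 * n) f ξ ∂fieldLaw (Site d) μ
      = ∑ x ∈ S, ν x * wexp a (2 * n) fun e => f (dirPos x e (2 * n)) := by
    intro f
    simp only [blockSum]
    rw [integral_finsetSum _ fun x _ => ((h.bmeas_part f _ x).const_mul _).integrable _]
    simp only [integral_const_mul, h.integral_part]
  rcases hσ0.eq_or_lt with hσe | hσp
  · have hν0 : ∀ x ∈ S, ν x = 0 := (Finset.sum_eq_zero_iff_of_nonneg fun x _ => hν x).1 hσe.symm
    have : ∀ z ξ, blockSum w S ν (2 * n) (g z) ξ = 0 := fun z ξ =>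
      Finset.sum_eq_zero fun x hx => by rw [hν0 x hx, zero_mul]
    change ∑ z ∈ Z, ∫ ξ, √(blockSum w S ν (2 * n) (g z) ξ) ∂fieldLaw (Site d) μ ≤ _
    simp [this]
  set q := √σ with hq
  have hq0 : 0 < q := Real.sqrt_pos.2 hσp
  have hq2 : q ^ 2 = σ := Real.sq_sqrt hσ0
  have hnear : ∀ z, ∫ ξ, √(blockSum w S ν (2 * n) (g z) ξ) ∂fieldLaw (Site d) μ ≤ 2 * s * q := by
    intro z
    -- The event is centered at the lower corner of the cell, from which every site of the cell
    -- deviates by less than `√n` in each coordinate. One event therefore serves all starting points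
    -- of the cell.
    obtain ⟨A, hA, hQA, hAc⟩ := hn₀ n (le_max_left _ _) k fun j => u j * √n
    have hWb := h.bmeas_blockSum S ν (2 * n) fun _ => 1
    have hmono : ∀ ξ, blockSum w S ν (2 * n) (g z) ξ ≤ blockSum w S ν (2 * n) (fun _ => 1) ξ :=
      fun ξ => Finset.sum_le_sum fun x _ => mul_le_mul_of_nonneg_left
        (part_mono h.w_nonneg (fun y _ => hg1 z y) ξ) (hν x)
    refine (integral_mono ((hb z).sqrt.integrable _) (hWb.sqrt.integrable _)
      fun ξ => Real.sqrt_le_sqrt (hmono ξ)).trans ?_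
    refine integral_sqrt_le_of_event _ hWb
      (h.blockSum_nonneg hν _ fun _ => zero_le_one) hq0 hs0 hA ?_ hQA ?_
    · rw [hint, hq2]
      simp only [wexp_const h.sum_one, mul_one]
      exact le_rfl
    · have hI : BMeas (Aᶜ.indicator fun _ : Site d → E => (1 : ℝ)) :=
        (BMeas.const 1).indicator hA.compl
      have he : ∀ ξ, blockSum w S ν (2 * n) (fun _ => 1) ξ * Aᶜ.indicator (fun _ => 1) ξ
          = ∑ x ∈ S, ν x * (tot w (2 * n) x ξ * Aᶜ.indicator (fun _ => 1) ξ) := fun ξ => by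
        rw [blockSum, Finset.sum_mul]
        exact Finset.sum_congr rfl fun x _ => by ring
      simp only [he]
      rw [integral_finsetSum _ fun x _ =>
        (((h.bmeas_part _ _ x).mul hI).const_mul _).integrable _, hq2, hσ, Finset.mul_sum]
      refine Finset.sum_le_sum fun x hx => ?_
      rw [integral_const_mul, mul_comm (s ^ 2)]
      refine mul_le_mul_of_nonneg_left (hAc x (hS x hx).1 fun l => ?_) (hν x)
      have h1 : u l = ⌊dev a x l / √n⌋ := by rw [← (hS x hx).2]; rfl
      have f1 := Int.floor_le (dev a x l / √n)
      have f2 := Int.lt_floor_add_one (dev a x l / √n)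
      rw [← h1] at f1 f2
      rw [le_div_iff₀ hr] at f1
      rw [div_lt_iff₀ hr] at f2
      rw [abs_le]
      constructor <;> linarith
  have hfar : ∀ z, ∫ ξ, √(blockSum w S ν (2 * n) (g z) ξ) ∂fieldLaw (Site d) μ
      ≤ √C * cellDecay (z - u) * q := by
    intro z
    refine integral_sqrt_le _ (hb z) (h.blockSum_nonneg hν _ (hg0 z))
      (by have := cellDecay_pos (z - u); positivity) ?_
    rw [hint, mul_pow, mul_pow, Real.sq_sqrt hCpos.le, hq2, hσ, Finset.mul_sum]
    refine Finset.sum_le_sum fun x hx => ?_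
    rw [mul_comm (C * _)]
    refine mul_le_mul_of_nonneg_left ?_ (hν x)
    have h1 := wexp_cell_le (a := a) (n := n) h.a_nonneg h.sum_one hd0 (le_max_right _ _) x z
    rw [(hS x hx).2] at h1
    exact h1
  change ∑ z ∈ Z, ∫ ξ, √(blockSum w S ν (2 * n) (g z) ξ) ∂fieldLaw (Site d) μ ≤ _
  rw [← Finset.sum_filter_add_sum_filter_not Z fun z => z - u ∈ F]
  have h1 : ∑ z ∈ Z with z - u ∈ F,
      ∫ ξ, √(blockSum w S ν (2 * n) (g z) ξ) ∂fieldLaw (Site d) μ ≤ 1 / 4 * q := by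
    have hcard : ((Z.filter fun z => z - u ∈ F).card : ℝ) ≤ F.card := by
      exact_mod_cast Finset.card_le_card_of_injOn (fun z => z - u)
        (fun z hz => (Finset.mem_filter.1 hz).2) fun z _ z' _ hzz => by simpa using hzz
    calc _ ≤ ∑ z ∈ Z with z - u ∈ F, 2 * s * q := Finset.sum_le_sum fun z _ => hnear z
      _ = (Z.filter fun z => z - u ∈ F).card * (2 * s * q) := by simp
      _ ≤ (F.card + 1) * (2 * s * q) := by gcongr; linarith
      _ = 1 / 4 * q := by rw [hs]; field_simp; norm_num
  have h2 : ∑ z ∈ Z with ¬ z - u ∈ F,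
      ∫ ξ, √(blockSum w S ν (2 * n) (g z) ξ) ∂fieldLaw (Site d) μ ≤ 1 / 4 * q := by
    have h3 := hF ((Z.filter fun z => ¬ z - u ∈ F).image fun z => z - u) (by
      rw [Finset.disjoint_left]
      intro y hy
      obtain ⟨z, hz, rfl⟩ := Finset.mem_image.1 hy
      exact (Finset.mem_filter.1 hz).2)
    rw [Finset.sum_image fun z _ z' _ hzz => by simpa using hzz] at h3
    calc _ ≤ ∑ z ∈ Z with ¬ z - u ∈ F, √C * cellDecay (z - u) * q :=
          Finset.sum_le_sum fun z _ => hfar z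
      _ = (∑ z ∈ Z with ¬ z - u ∈ F, √C * cellDecay (z - u)) * q := by rw [Finset.sum_mul]
      _ ≤ 1 / 4 * q := by
          refine mul_le_mul_of_nonneg_right ?_ hq0.le
          exact (le_abs_self _).trans h3.le
  linarith

theorem blockSum_dependsOn (S : Finset (Site d)) (ν : Site d → ℝ) {k : ℤ}
    (hS : ∀ x ∈ S, level x = k) (N : ℕ) (g : Site d → ℝ) :
    DependsOn (blockSum w S ν N g) {y | level y < k + N} := by
  intro ξ ξ' hξ
  refine Finset.sum_congr rfl fun x hx => ?_
  rw [part_dependsOn g N x fun y hy => hξ y (by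
    have := hy.2
    rw [hS x hx] at this
    exact this)]

open Classical in
/-- The fractional moment of a weighted family of partition functions which start in one cell. -/
theorem integral_sqrt_blockSum_le (h : IsWeight μ a t w) {N : ℕ} {r ρ : ℝ} (hρ : 0 ≤ ρ)
    (hstep : ∀ (k : ℤ) (u : Fin d → ℤ) (S : Finset (Site d)) (ν : Site d → ℝ), (∀ x, 0 ≤ ν x) →
      (∀ x ∈ S, level x = k ∧ cell a r x = u) → ∀ Z : Finset (Fin d → ℤ),
      ∑ z ∈ Z, ∫ ξ, √(blockSum w S ν N (fun y => if cell a r y = z then 1 else 0) ξ)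
        ∂fieldLaw (Site d) μ ≤ ρ * √(∑ x ∈ S, ν x)) (m : ℕ) :
    ∀ (k : ℤ) (u : Fin d → ℤ) (S : Finset (Site d)) (ν : Site d → ℝ), (∀ x, 0 ≤ ν x) →
      (∀ x ∈ S, level x = k ∧ cell a r x = u) →
      ∫ ξ, √(blockSum w S ν (N * m) (fun _ => 1) ξ) ∂fieldLaw (Site d) μ
        ≤ ρ ^ m * √(∑ x ∈ S, ν x) := by
  induction m with
  | zero =>
    intro k u S ν hν hS
    simp [blockSum]
  | succ m ih =>
    intro k u S ν hν hS
    set T := S.biUnion fun x => ends N x with hT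
    set Z := T.image (cell a r) with hZ
    let g : (Fin d → ℤ) → Site d → ℝ := fun z y => if cell a r y = z then 1 else 0
    have hg0 : ∀ z y, 0 ≤ g z y := fun z y => by simp only [g]; split_ifs <;> norm_num
    -- The random masses after the first block. Grouped by cells, they serve as the initial masses
    -- of the remaining blocks.
    let ν' : (Site d → E) → Site d → ℝ := fun ξ y => blockSum w S ν N (Pi.single y 1) ξ
    have hν' : ∀ ξ y, 0 ≤ ν' ξ y := fun ξ y => Finset.sum_nonneg fun x _ =>
      mul_nonneg (hν x) (h.ptp_nonneg _ _ _ _)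
    have hptp : ∀ (f : Site d → ℝ) (x : Site d) (_ : x ∈ S) (ξ : Site d → E),
        part w f N x ξ = ∑ y ∈ T, ptp w N x y ξ * f y := by
      intro f x hx ξ
      rw [part_eq_sum_ptp]
      refine Finset.sum_subset (Finset.subset_biUnion_of_mem (fun x => ends N x) hx) ?_
      intro y _ hy
      rw [ptp_eq_zero hy, zero_mul]
    have hblock : ∀ (f : Site d → ℝ) (ξ : Site d → E),
        blockSum w S ν N f ξ = ∑ y ∈ T, ν' ξ y * f y := by
      intro f ξ
      simp only [blockSum, ν']
      rw [Finset.sum_congr rfl fun x hx => by rw [hptp f x hx ξ]]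
      simp only [Finset.mul_sum, Finset.sum_mul]
      rw [Finset.sum_comm]
      exact Finset.sum_congr rfl fun y _ => Finset.sum_congr rfl fun x _ => by ring
    have hTz : ∀ (z : Fin d → ℤ) (ξ : Site d → E),
        ∑ y ∈ T with cell a r y = z, ν' ξ y = blockSum w S ν N (g z) ξ := by
      intro z ξ
      rw [hblock, Finset.sum_filter]
      exact Finset.sum_congr rfl fun y _ => by simp only [g]; split_ifs <;> simp
    have hsplit : ∀ ξ : Site d → E, blockSum w S ν (N * (m + 1)) (fun _ => 1) ξ
        = ∑ z ∈ Z, blockSum w (T.filter fun y => cell a r y = z) (ν' ξ) (N * m) (fun _ => 1) ξ := by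
      intro ξ
      have h1 : blockSum w S ν (N * (m + 1)) (fun _ => 1) ξ
          = blockSum w S ν N (fun y => tot w (N * m) y ξ) ξ := by
        refine Finset.sum_congr rfl fun x _ => ?_
        have h2 : N * (m + 1) = N + N * m := by ring
        rw [h2]
        congr 1
        rw [part_eq_sum_ptp (fun y => tot w (N * m) y ξ)]
        exact tot_add N (N * m) x ξ
      rw [h1, hblock, ← Finset.sum_fiberwise_of_maps_to (s := T) (t := Z) (g := cell a r)
        fun y hy => Finset.mem_image_of_mem _ hy]
      rfl
    have hlevT : ∀ y ∈ T, level y = k + N := by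
      intro y hy
      obtain ⟨x, hx, hxy⟩ := Finset.mem_biUnion.1 hy
      rw [level_of_mem_ends hxy, (hS x hx).1]
    have hb1 : ∀ z, BMeas fun ξ : Site d → E =>
        blockSum w (T.filter fun y => cell a r y = z) (ν' ξ) (N * m) (fun _ => 1) ξ := fun z =>
      BMeas.sum _ fun y _ => (h.bmeas_blockSum S ν N (Pi.single y 1)).mul (h.bmeas_part _ _ y)
    have hz : ∀ z ∈ Z, ∫ ξ, √(blockSum w (T.filter fun y => cell a r y = z) (ν' ξ) (N * m)
        (fun _ => 1) ξ) ∂fieldLaw (Site d) μ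
        ≤ ρ ^ m * ∫ ξ, √(blockSum w S ν N (g z) ξ) ∂fieldLaw (Site d) μ := by
      intro z _
      set A : Set (Site d) := {y | level y < k + N} with hA
      set Tz := T.filter fun y => cell a r y = z with hTzdef
      have hbz : BMeas fun ξ : Site d → E => √(blockSum w Tz (ν' ξ) (N * m) (fun _ => 1) ξ) :=
        (hb1 z).sqrt
      rw [integral_eq_glue hbz A, ← integral_const_mul]
      have hglue : ∀ ξ ξ' : Site d → E,
          blockSum w Tz (ν' (glue A ξ ξ')) (N * m) (fun _ => 1) (glue A ξ ξ')
            = blockSum w Tz (ν' ξ) (N * m) (fun _ => 1) ξ' := by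
        intro ξ ξ'
        refine Finset.sum_congr rfl fun y hy => ?_
        have h1 : ν' (glue A ξ ξ') y = ν' ξ y :=
          (blockSum_dependsOn S ν (fun x hx => (hS x hx).1) N (Pi.single y 1)).glue_left ξ ξ'
        have h2 : tot w (N * m) y (glue A ξ ξ') = tot w (N * m) y ξ' := by
          refine (part_dependsOn (fun _ => 1) (N * m) y).glue_right ?_ ξ ξ'
          rw [Set.disjoint_left]
          intro y' hy' hy''
          have h3 := hlevT y (Finset.mem_filter.1 hy).1
          have h4 := hy'.1
          rw [h3] at h4
          exact absurd hy'' (not_lt.2 h4)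
        rw [h1]
        exact congrArg _ h2
      simp only [hglue]
      refine integral_mono ?_ (((h.bmeas_blockSum S ν N (g z)).sqrt.const_mul _).integrable _)
        fun ξ => ?_
      · have h4 := hbz.glue A
        simp only [hglue] at h4
        exact (h4.integral_right (fieldLaw (Site d) μ)).integrable _
      -- The first block is frozen and the later levels are fresh, so the induction hypothesis
      -- applies with the deterministic masses `ν' ξ`.
      · have h6 := ih (k + N) z Tz (ν' ξ) (hν' ξ) fun y hy =>
          ⟨hlevT y (Finset.mem_filter.1 hy).1, (Finset.mem_filter.1 hy).2⟩
        rw [hTzdef, hTz z ξ] at h6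
        exact h6
    calc ∫ ξ, √(blockSum w S ν (N * (m + 1)) (fun _ => 1) ξ) ∂fieldLaw (Site d) μ
        ≤ ∫ ξ, ∑ z ∈ Z, √(blockSum w (T.filter fun y => cell a r y = z) (ν' ξ) (N * m)
          (fun _ => 1) ξ) ∂fieldLaw (Site d) μ := by
          refine integral_mono ((h.bmeas_blockSum S ν _ _).sqrt.integrable _)
            ((BMeas.sum Z fun z _ => (hb1 z).sqrt).integrable _) fun ξ => ?_
          simp only [hsplit]
          exact sqrt_sum_le_sum_sqrt Z fun z _ => Finset.sum_nonneg fun y _ =>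
            mul_nonneg (hν' ξ y) (h.tot_pos _ _ _).le
      _ = ∑ z ∈ Z, ∫ ξ, √(blockSum w (T.filter fun y => cell a r y = z) (ν' ξ) (N * m)
          (fun _ => 1) ξ) ∂fieldLaw (Site d) μ :=
          integral_finsetSum _ fun z _ => (hb1 z).sqrt.integrable _
      _ ≤ ∑ z ∈ Z, ρ ^ m * ∫ ξ, √(blockSum w S ν N (g z) ξ) ∂fieldLaw (Site d) μ :=
          Finset.sum_le_sum hz
      _ = ρ ^ m * ∑ z ∈ Z, ∫ ξ, √(blockSum w S ν N (g z) ξ) ∂fieldLaw (Site d) μ := by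
          rw [Finset.mul_sum]
      _ ≤ ρ ^ m * (ρ * √(∑ x ∈ S, ν x)) :=
          mul_le_mul_of_nonneg_left (hstep k u S ν hν hS Z) (pow_nonneg hρ m)
      _ = _ := by ring

/-- In dimensions two and three disorder is always relevant. -/
theorem freeEnergy_neg_of_dim (hd : d = 2 ∨ d = 3) (h : IsWeight μ a t w)
    (hv : 0 < ∫ r, fluct w r ^ 2 ∂μ) : freeEnergy μ w < 0 := by
  classical
  obtain ⟨N, hN, r, hstep⟩ := h.exists_block_contraction hd hv
  refine h.freeEnergy_neg_of_sqrt hN (ρ := 1 / 2) (by norm_num) (by norm_num) fun m => ?_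
  have h1 := h.integral_sqrt_blockSum_le (by norm_num) hstep m 0 (cell a r 0) {0} (fun _ => 1)
    (fun _ => zero_le_one) (by simp)
  simpa [blockSum] using h1

end IsWeight

/-! ### Directed paths of the walk in a random environment -/

section Paths

variable {d n : ℕ}

/-- The sequence of jumps of a directed path. -/
def liftPath (e : Fin n → Fin d) : Fin n → Jump d := fun i => (e i, 1)

theorem liftPath_injective : Function.Injective (liftPath : (Fin n → Fin d) → Fin n → Jump d) :=
  fun e e' h => funext fun i => by simpa [liftPath] using congrFun h i

theorem exists_liftPath {s : Fin n → Jump d} (h : ∀ i, (s i).2 = 1) :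
    ∃ e : Fin n → Fin d, liftPath e = s :=
  ⟨fun i => (s i).1, funext fun i => Prod.ext rfl (h i).symm⟩

theorem pos_liftPath (e : Fin n → Fin d) (k : ℕ) : pos (liftPath e) k = dirPos 0 e k := by
  simp [pos, dirPos, liftPath, Jump.vec, unitStep]

theorem sum_paths_eq {f : (Fin n → Jump d) → ℝ} (hf : ∀ s, (∃ i, (s i).2 ≠ 1) → f s = 0) :
    ∑ s, f s = ∑ e : Fin n → Fin d, f (liftPath e) := by
  refine (Finset.sum_of_injOn liftPath (fun _ _ _ _ h => liftPath_injective h)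
    (fun _ _ => by simp) (fun s _ hs => hf s ?_) fun _ _ => rfl).symm
  by_contra hcon
  push Not at hcon
  obtain ⟨e, he⟩ := exists_liftPath hcon
  exact hs ⟨e, by simp, he⟩

theorem level_vec (e : Jump d) : level e.vec = (e.2 : ℤ) := by
  simp [level, Jump.vec]

theorem unit_le_one (u : ℤˣ) : ((u : ℤ) : ℤ) ≤ 1 := by
  rcases Int.units_eq_one_or u with rfl | rfl <;> simp

/-- The level rises by at most one per jump; being `n` after `n` jumps, it rises by exactly one each
time. -/
theorem directed_of_pos_mem {s : Fin n → Jump d} (h : pos s n ∈ boundaryFace d n) (i : Fin n) :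
    (s i).2 = 1 := by
  have h1 : level (pos s n) = n := by
    rw [← h.1, level]
    exact Finset.sum_congr rfl fun j _ => (abs_of_nonneg (h.2 j)).symm
  have h2 : level (pos s n) = ∑ i : Fin n, ((s i).2 : ℤ) := by
    have h3 : pos s n = ∑ i : Fin n, (s i).vec := by
      rw [pos, Finset.filter_true_of_mem fun i _ => i.2]
    rw [h3]
    simp only [level, Finset.sum_apply]
    rw [Finset.sum_comm]
    exact Finset.sum_congr rfl fun i _ => level_vec (s i)
  have h4 : ∑ i : Fin n, (1 - ((s i).2 : ℤ)) = 0 := by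
    rw [Finset.sum_sub_distrib, ← h2, h1]; simp
  have h5 := (Finset.sum_eq_zero_iff_of_nonneg fun i _ => sub_nonneg.2 (unit_le_one (s i).2)).1 h4 i
    (Finset.mem_univ i)
  exact Units.ext (by simpa using (sub_eq_zero.1 h5).symm)

theorem dirPos_zero_mem_boundaryFace (e : Fin n → Fin d) : dirPos 0 e n ∈ boundaryFace d n := by
  have h0 : ∀ j, 0 ≤ dirPos 0 e n j := by
    intro j
    simp only [dirPos, zero_add, Finset.sum_apply]
    refine Finset.sum_nonneg fun i _ => ?_
    rw [unitStep, Pi.single_apply]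
    split_ifs <;> simp
  refine ⟨?_, h0⟩
  have h1 := level_dirPos (0 : Site d) e le_rfl
  rw [level_zero, zero_add] at h1
  rw [← h1, level]
  exact Finset.sum_congr rfl fun j _ => abs_of_nonneg (h0 j)

end Paths

/-! ### The normalized weights of a perturbed environment -/

section Weights

variable {d : ℕ} {α : Jump d → ℝ}

/-- The total weight of the positive jumps. -/
def dirMass (α : Jump d → ℝ) : ℝ := ∑ i : Fin d, α (i, 1)

/-- The normalized weights of the positive jumps. -/
def dirLaw (α : Jump d → ℝ) (i : Fin d) : ℝ := α (i, 1) / dirMass α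

/-- The normalized weights of the positive jumps at a site of the perturbed environment. -/
def dirWt (α : Jump d → ℝ) (ε : ℝ) (r : disorderSet α) (i : Fin d) : ℝ :=
  α (i, 1) * (1 + ε * (r : Jump d → ℝ) (i, 1)) / dirMass α

theorem dirMass_pos [Nonempty (Fin d)] (hα : ∀ e, 0 < α e) : 0 < dirMass α :=
  Finset.sum_pos (fun _ _ => hα _) Finset.univ_nonempty

theorem perturbedEnv_eq [Nonempty (Fin d)] (hα : ∀ e, 0 < α e) (ε : ℝ)
    (ξ : Site d → disorderSet α) (x : Site d) (i : Fin d) :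
    perturbedEnv α ε ξ x (i, 1) = dirMass α * dirWt α ε (ξ x) i := by
  have := (dirMass_pos hα).ne'
  rw [perturbedEnv, dirWt]
  field_simp

theorem pathProb_liftPath [Nonempty (Fin d)] (hα : ∀ e, 0 < α e) (ε : ℝ)
    (ξ : Site d → disorderSet α) {n : ℕ} (e : Fin n → Fin d) :
    pathProb (perturbedEnv α ε ξ) (liftPath e) = dirMass α ^ n * pathWt (dirWt α ε) ξ 0 e := by
  have h1 : ∀ i : Fin n, perturbedEnv α ε ξ (pos (liftPath e) i) (liftPath e i)
      = dirMass α * dirWt α ε (ξ (dirPos 0 e i)) (e i) := fun i => by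
    rw [pos_liftPath]; exact perturbedEnv_eq hα ε ξ _ _
  simp only [pathProb, pathWt, h1, Finset.prod_mul_distrib]
  simp

open Classical in
theorem quenchedProb_eq [Nonempty (Fin d)] (hα : ∀ e, 0 < α e) (ε : ℝ)
    (ξ : Site d → disorderSet α) (n : ℕ) (S : Set (Site d)) :
    quenchedProb (perturbedEnv α ε ξ) n (S ∩ boundaryFace d n)
      = dirMass α ^ n * part (dirWt α ε) (fun y => if y ∈ S then 1 else 0) n 0 ξ := by
  rw [quenchedProb, Finset.sum_filter, sum_paths_eq, part, Finset.mul_sum]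
  · refine Finset.sum_congr rfl fun e _ => ?_
    have h1 : (pos (liftPath e) n ∈ S ∩ boundaryFace d n) ↔ dirPos 0 e n ∈ S := by
      rw [pos_liftPath]
      exact and_iff_left (dirPos_zero_mem_boundaryFace e)
    by_cases h : dirPos 0 e n ∈ S
    · rw [if_pos (h1.2 h), if_pos h, pathProb_liftPath hα]; ring
    · rw [if_neg fun h' => h (h1.1 h'), if_neg h]; ring
  · rintro s ⟨i, hi⟩
    rw [if_neg fun h => hi (directed_of_pos_mem h.2 i)]

theorem maxCondProb_eq [Nonempty (Fin d)] (hα : ∀ e, 0 < α e) (ε : ℝ)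
    (ξ : Site d → disorderSet α) (n : ℕ) :
    maxCondProb (perturbedEnv α ε ξ) n = maxEnd (dirWt α ε) n ξ := by
  classical
  have hc : dirMass α ^ n ≠ 0 := pow_ne_zero _ (dirMass_pos hα).ne'
  have h1 : quenchedProb (perturbedEnv α ε ξ) n (boundaryFace d n)
      = dirMass α ^ n * tot (dirWt α ε) n 0 ξ := by
    have := quenchedProb_eq hα ε ξ n Set.univ
    simpa using this
  have h2 : ∀ x, quenchedProb (perturbedEnv α ε ξ) n ({x} ∩ boundaryFace d n)
      = dirMass α ^ n * ptp (dirWt α ε) n 0 x ξ := by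
    intro x
    rw [quenchedProb_eq hα ε ξ n {x}]
    congr 2
    ext y
    simp [Pi.single_apply]
  simp only [maxCondProb, maxEnd, endLaw, h1, h2, mul_div_mul_left _ _ hc]

theorem avgMaxProb_eq [Nonempty (Fin d)] (hα : ∀ e, 0 < α e) (ε : ℝ)
    (ξ : Site d → disorderSet α) (n : ℕ) :
    avgMaxProb (perturbedEnv α ε ξ) n = avgMaxEnd (dirWt α ε) ξ n := by
  simp only [avgMaxProb, avgMaxEnd, maxCondProb_eq hα]

theorem dirWt_pos [Nonempty (Fin d)] (hα : ∀ e, 0 < α e) {ε : ℝ} (h0 : 0 ≤ ε) (h1 : ε < 1)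
    (r : disorderSet α) (i : Fin d) : 0 < dirWt α ε r i := by
  have := (r.2.1 (i, 1)).1
  have h2 : 0 < 1 + ε * (r : Jump d → ℝ) (i, 1) := by nlinarith
  exact div_pos (mul_pos (hα _) h2) (dirMass_pos hα)

/-- The exponential of `Psi` cancels the normalization in `dirEnv`, step by step along the path. -/
theorem partitionFn_eq [Nonempty (Fin d)] (hα : ∀ e, 0 < α e) {ε : ℝ} (h0 : 0 ≤ ε) (h1 : ε < 1)
    (ξ : Site d → disorderSet α) (n : ℕ) :
    partitionFn (perturbedEnv α ε ξ) n = dirMass α ^ n * tot (dirWt α ε) n 0 ξ := by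
  set ω := perturbedEnv α ε ξ with hω
  have hpos : ∀ x, 0 < ∑ i : Fin d, ω x (i, 1) := fun x =>
    Finset.sum_pos (fun i _ => by
      rw [hω, perturbedEnv_eq hα]
      exact mul_pos (dirMass_pos hα) (dirWt_pos hα h0 h1 _ _)) Finset.univ_nonempty
  rw [partitionFn, sum_paths_eq, tot, part, Finset.mul_sum]
  · refine Finset.sum_congr rfl fun e _ => ?_
    rw [mul_one, ← pathProb_liftPath hα, Real.exp_sum, pathProb, pathProb,
      ← Finset.prod_mul_distrib]
    refine Finset.prod_congr rfl fun i _ => ?_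
    have h2 := hpos (pos (liftPath e) i)
    rw [Psi, Real.exp_log h2, dirEnv, if_pos (by rfl), div_mul_cancel₀ _ h2.ne']
  · rintro s ⟨i, hi⟩
    have : pathProb (dirEnv ω) s = 0 := Finset.prod_eq_zero (Finset.mem_univ i) (if_neg hi)
    rw [this, zero_mul]

/-- The normalized one-site fluctuation for `ε = 1`. -/
def dirFluct (α : Jump d → ℝ) (r : disorderSet α) : ℝ :=
  (∑ i : Fin d, α (i, 1) * (r : Jump d → ℝ) (i, 1)) / dirMass α

/-- The fluctuation is linear in `ε`, so degeneracy holds for all positive `ε` or for none. -/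
theorem fluct_dirWt [Nonempty (Fin d)] (hα : ∀ e, 0 < α e) (ε : ℝ) (r : disorderSet α) :
    fluct (dirWt α ε) r = ε * dirFluct α r := by
  have hc := (dirMass_pos hα).ne'
  simp only [fluct, dirWt, dirFluct]
  rw [← Finset.sum_div, div_sub_one hc, mul_div_assoc', Finset.mul_sum]
  congr 1
  rw [dirMass, ← Finset.sum_sub_distrib]
  exact Finset.sum_congr rfl fun i _ => by ring

theorem measurable_coord (e : Jump d) :
    Measurable fun r : disorderSet α => (r : Jump d → ℝ) e :=
  (measurable_pi_apply e).comp measurable_subtype_coe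

theorem integrable_coord (μ : Measure (disorderSet α)) [IsFiniteMeasure μ] (e : Jump d) :
    Integrable (fun r : disorderSet α => (r : Jump d → ℝ) e) μ :=
  Integrable.of_bound (measurable_coord e).aestronglyMeasurable 1
    (ae_of_all _ fun r => abs_le.2 (r.2.1 e))

theorem isWeight_dirWt [Nonempty (Fin d)] (hα : ∀ e, 0 < α e) (μ : Measure (disorderSet α))
    [IsProbabilityMeasure μ] (hμ : ∀ e, ∫ r, (r : Jump d → ℝ) e ∂μ = 0) {ε : ℝ} (h0 : 0 ≤ ε)
    (h1 : ε < 1) : IsWeight μ (dirLaw α) ε (dirWt α ε) where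
  meas i := ((measurable_const.mul
    (measurable_const.add (measurable_const.mul (measurable_coord (i, 1))))).div_const _)
  pos i := div_pos (hα _) (dirMass_pos hα)
  sum_one := by
    simp only [dirLaw]
    rw [← Finset.sum_div]
    exact div_self (dirMass_pos hα).ne'
  t_nonneg := h0
  t_lt := h1
  lower r i := by
    have hr := r.2.1 (i, 1)
    rw [dirLaw, dirWt, mul_div_assoc', mul_comm]
    refine div_le_div_of_nonneg_right (mul_le_mul_of_nonneg_left ?_ (hα _).le)
      (dirMass_pos hα).le
    nlinarith [hr.1]
  upper r i := by
    have hr := r.2.1 (i, 1)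
    rw [dirLaw, dirWt, mul_div_assoc', mul_comm (1 + ε)]
    refine div_le_div_of_nonneg_right (mul_le_mul_of_nonneg_left ?_ (hα _).le)
      (dirMass_pos hα).le
    nlinarith [hr.2]
  mean i := by
    simp only [dirWt, dirLaw]
    rw [integral_div, integral_const_mul,
      integral_add (integrable_const _) ((integrable_coord μ _).const_mul ε), integral_const_mul,
      hμ]
    simp

end Weights

/-! ### The law of the disorder -/

section Law

variable {d : ℕ} {α : Jump d → ℝ} {Q : Measure (Site d → disorderSet α)}

/-- The law of the disorder at a site. -/
def siteLaw (Q : Measure (Site d → disorderSet α)) : Measure (disorderSet α) :=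
  Q.map fun ξ => ξ 0

theorem isProbabilityMeasure_siteLaw (hQ : IsDisorderLaw α Q) :
    IsProbabilityMeasure (siteLaw Q) :=
  have := hQ.isProb
  Measure.isProbabilityMeasure_map (measurable_pi_apply 0).aemeasurable

theorem eq_fieldLaw (hQ : IsDisorderLaw α Q) : Q = fieldLaw (Site d) (siteLaw Q) := by
  have := hQ.isProb
  have h1 := hQ.indep.map_fun_eq_infinitePi_map fun x => measurable_pi_apply x
  have h2 : ∀ x : Site d, Q.map (fun ξ => ξ x) = siteLaw Q := fun x => (hQ.ident x).map_eq
  simp only [h2] at h1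
  exact Measure.map_id.symm.trans h1

theorem integral_siteLaw_coord (hQ : IsDisorderLaw α Q) (e : Jump d) :
    ∫ r : disorderSet α, (r : Jump d → ℝ) e ∂siteLaw Q = 0 := by
  rw [siteLaw, integral_map (measurable_pi_apply 0).aemeasurable
    (measurable_coord e).aestronglyMeasurable]
  exact hQ.centered 0 e

theorem measurable_perturbedEnv (ε : ℝ) : Measurable (perturbedEnv α ε) := by
  refine measurable_pi_lambda _ fun x => measurable_pi_lambda _ fun e => ?_
  exact measurable_const.mul (measurable_const.add (measurable_const.mul
    ((measurable_coord e).comp (measurable_pi_apply x))))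

theorem measurable_env_eval (x : Site d) (e : Jump d) : Measurable fun ω : Env d => ω x e :=
  (measurable_pi_apply e).comp (measurable_pi_apply x)

theorem measurable_pathProb {n : ℕ} (s : Fin n → Jump d) :
    Measurable fun ω : Env d => pathProb ω s :=
  Finset.measurable_fun_prod _ fun _ _ => measurable_env_eval _ _

theorem measurable_avgMaxProb (n : ℕ) : Measurable fun ω : Env d => avgMaxProb ω n := by
  have hq : ∀ (m : ℕ) (S : Set (Site d)), Measurable fun ω : Env d => quenchedProb ω m S :=
    fun m S => Finset.measurable_fun_sum _ fun s _ => measurable_pathProb s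
  have hm : ∀ m, Measurable fun ω : Env d => maxCondProb ω m := fun m =>
    Measurable.iSup fun x => (hq m _).div (hq m _)
  exact measurable_const.mul (Finset.measurable_fun_sum _ fun m _ => hm m)

theorem measurable_Psi (x : Site d) : Measurable fun ω : Env d => Psi ω x :=
  Real.measurable_log.comp (Finset.measurable_fun_sum _ fun i _ => measurable_env_eval x (i, 1))

theorem measurable_partitionFn (n : ℕ) : Measurable fun ω : Env d => partitionFn ω n := by
  have hd : ∀ (x : Site d) (e : Jump d), Measurable fun ω : Env d => dirEnv ω x e := by
    intro x e
    simp only [dirEnv]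
    split_ifs
    · exact (measurable_env_eval x e).div
        (Finset.measurable_fun_sum _ fun i _ => measurable_env_eval x (i, 1))
    · exact measurable_const
  refine Finset.measurable_fun_sum _ fun s _ => Measurable.mul ?_ ?_
  · exact Finset.measurable_fun_prod _ fun i _ => hd _ _
  · exact Real.measurable_exp.comp (Finset.measurable_fun_sum _ fun i _ => measurable_Psi _)

theorem localized_envLaw [Nonempty (Fin d)] (hα : ∀ e, 0 < α e) {ε : ℝ}
    (h : ∀ᵐ ξ ∂Q, 0 < liminf (fun n => avgMaxEnd (dirWt α ε) ξ n) atTop) :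
    Localized (envLaw α Q ε) := by
  rw [Localized, envLaw, ae_map_iff (measurable_perturbedEnv ε).aemeasurable
    (measurableSet_lt measurable_const (Measurable.liminf measurable_avgMaxProb))]
  simpa only [avgMaxProb_eq hα] using h

theorem delocalized_envLaw [Nonempty (Fin d)] (hα : ∀ e, 0 < α e) {ε : ℝ}
    (h : ∀ᵐ ξ ∂Q, liminf (fun n => avgMaxEnd (dirWt α ε) ξ n) atTop = 0) :
    Delocalized (envLaw α Q ε) := by
  rw [Delocalized, envLaw, ae_map_iff (measurable_perturbedEnv ε).aemeasurable
    (measurableSet_eq_fun (Measurable.liminf measurable_avgMaxProb) measurable_const)]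
  simpa only [avgMaxProb_eq hα] using h

theorem isWeight_siteLaw [Nonempty (Fin d)] (hα : ∀ e, 0 < α e) (hQ : IsDisorderLaw α Q) {ε : ℝ}
    (h0 : 0 ≤ ε) (h1 : ε < 1) : IsWeight (siteLaw Q) (dirLaw α) ε (dirWt α ε) :=
  have := isProbabilityMeasure_siteLaw hQ
  isWeight_dirWt hα _ (integral_siteLaw_coord hQ) h0 h1

theorem hasQuenchedFreeEnergy_envLaw [Nonempty (Fin d)] (hα : ∀ e, 0 < α e)
    (hQ : IsDisorderLaw α Q) {ε : ℝ} (h0 : 0 ≤ ε) (h1 : ε < 1) :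
    HasQuenchedFreeEnergy (envLaw α Q ε) (lam α + freeEnergy (siteLaw Q) (dirWt α ε)) := by
  have := isProbabilityMeasure_siteLaw hQ
  have hw := isWeight_siteLaw hα hQ h0 h1
  have hms : MeasurableSet {ω : Env d | Tendsto
      (fun n : ℕ => (1 / (n : ℝ)) * Real.log (partitionFn ω n)) atTop
      (𝓝 (lam α + freeEnergy (siteLaw Q) (dirWt α ε)))} :=
    measurableSet_tendsto _ fun n => measurable_const.mul
      (Real.measurable_log.comp (measurable_partitionFn n))
  rw [HasQuenchedFreeEnergy, envLaw, ae_map_iff (measurable_perturbedEnv ε).aemeasurable hms]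
  have h := hw.ae_tendsto_log_tot
  rw [← eq_fieldLaw hQ] at h
  filter_upwards [h] with ξ hξ
  refine (hξ.const_add (lam α)).congr' ?_
  filter_upwards [eventually_gt_atTop 0] with n hn
  have hn' : (n : ℝ) ≠ 0 := by exact_mod_cast hn.ne'
  rw [partitionFn_eq hα h0 h1, Real.log_mul (pow_ne_zero _ (dirMass_pos hα).ne')
    (hw.tot_pos n 0 ξ).ne', Real.log_pow]
  change Real.log (dirMass α) + _ = _
  field_simp

theorem hasAnnealedFreeEnergy_envLaw [Nonempty (Fin d)] (hα : ∀ e, 0 < α e)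
    (hQ : IsDisorderLaw α Q) {ε : ℝ} (h0 : 0 ≤ ε) (h1 : ε < 1) :
    HasAnnealedFreeEnergy (envLaw α Q ε) (lam α) := by
  have := isProbabilityMeasure_siteLaw hQ
  have hw := isWeight_siteLaw hα hQ h0 h1
  have hint : ∀ n, ∫ ω, partitionFn ω n ∂envLaw α Q ε = dirMass α ^ n := by
    intro n
    rw [envLaw, integral_map (measurable_perturbedEnv ε).aemeasurable
      (measurable_partitionFn n).aestronglyMeasurable]
    simp only [partitionFn_eq hα h0 h1]
    have h2 := hw.integral_tot n 0
    rw [← eq_fieldLaw hQ] at h2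
    rw [integral_const_mul, h2, mul_one]
  rw [HasAnnealedFreeEnergy]
  refine tendsto_const_nhds.congr' ?_
  filter_upwards [eventually_gt_atTop 0] with n hn
  have hn' : (n : ℝ) ≠ 0 := by exact_mod_cast hn.ne'
  rw [hint, Real.log_pow]
  change Real.log (dirMass α) = _
  field_simp

theorem integral_fluct_sq_dirWt [Nonempty (Fin d)] (hα : ∀ e, 0 < α e)
    (μ : Measure (disorderSet α)) (ε : ℝ) :
    ∫ r, fluct (dirWt α ε) r ^ 2 ∂μ = ε ^ 2 * ∫ r, dirFluct α r ^ 2 ∂μ := by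
  simp only [fluct_dirWt hα, mul_pow]
  exact integral_const_mul _ _

/-- The mean of the forward mass is `dirMass α`, so the logarithms agree exactly where the
fluctuation at the site vanishes; this is almost sure if and only if its second moment is zero. -/
theorem envCondition_iff [Nonempty (Fin d)] (hα : ∀ e, 0 < α e) (hQ : IsDisorderLaw α Q) {ε : ℝ}
    (h0 : 0 ≤ ε) (h1 : ε < 1) : EnvCondition (envLaw α Q ε) ↔
      0 < ∫ r, fluct (dirWt α ε) r ^ 2 ∂siteLaw Q := by
  have := isProbabilityMeasure_siteLaw hQ
  have := hQ.isProb
  have hw := isWeight_siteLaw hα hQ h0 h1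
  have hc := dirMass_pos hα
  have hmean : ∑ i : Fin d, ∫ ω', ω' 0 (i, 1) ∂envLaw α Q ε = dirMass α := by
    rw [dirMass]
    refine Finset.sum_congr rfl fun i _ => ?_
    rw [envLaw, integral_map (measurable_perturbedEnv ε).aemeasurable
      (measurable_env_eval 0 (i, 1)).aestronglyMeasurable]
    have h2 := hw.mean i
    rw [siteLaw, integral_map (measurable_pi_apply 0).aemeasurable
      (hw.meas i).aestronglyMeasurable] at h2
    simp only [perturbedEnv_eq hα]
    rw [integral_const_mul, h2, dirLaw]
    field_simp
  have hset : ∀ ξ : Site d → disorderSet α,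
      Psi (perturbedEnv α ε ξ) 0 = Real.log (dirMass α) ↔ fluct (dirWt α ε) (ξ 0) = 0 := by
    intro ξ
    have h2 : ∑ i : Fin d, perturbedEnv α ε ξ 0 (i, 1)
        = dirMass α * (1 + fluct (dirWt α ε) (ξ 0)) := by
      simp only [perturbedEnv_eq hα, fluct, ← Finset.mul_sum]
      ring
    have h3 : 0 < 1 + fluct (dirWt α ε) (ξ 0) := by
      have := (abs_le.1 (hw.abs_fluct_le (ξ 0))).1
      linarith
    rw [Psi, h2, Real.log_mul hc.ne' h3.ne', add_eq_left]
    constructor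
    · intro h4
      have := Real.eq_one_of_pos_of_log_eq_zero h3 h4
      linarith
    · intro h4
      rw [h4, add_zero, Real.log_one]
  have hmeas : MeasurableSet {r : disorderSet α | fluct (dirWt α ε) r = 0} :=
    measurableSet_eq_fun hw.bmeas_fluct.meas measurable_const
  have hprob : envLaw α Q ε {ω | Psi ω 0 = Real.log (dirMass α)}
      = siteLaw Q {r | fluct (dirWt α ε) r = 0} := by
    rw [envLaw, Measure.map_apply (measurable_perturbedEnv ε)
      (measurableSet_eq_fun (measurable_Psi 0) measurable_const), siteLaw,
      Measure.map_apply (measurable_pi_apply 0) hmeas]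
    congr 1
    ext ξ
    exact hset ξ
  rw [EnvCondition, hmean, hprob, prob_le_one.lt_iff_ne, ne_eq,
    ← mem_ae_iff_prob_eq_one hmeas,
    (integral_nonneg fun r => sq_nonneg (fluct (dirWt α ε) r)).lt_iff_ne, ne_comm, ne_eq, not_iff_not,
    integral_eq_zero_iff_of_nonneg (fun r => sq_nonneg _) ((hw.bmeas_fluct.pow 2).integrable _)]
  refine Filter.eventually_congr (Eventually.of_forall fun r => ?_)
  simp

end Law

/-! ### The threshold -/

/-- The zero set is compact by continuity and closed downwards by monotonicity and the sign of `f`;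
its largest element is the threshold. -/
theorem exists_threshold_of_antitoneOn {m : ℝ} (hm : 0 ≤ m) {f : ℝ → ℝ} (h0 : f 0 = 0)
    (hnp : ∀ ε ∈ Set.Icc 0 m, f ε ≤ 0) (hanti : AntitoneOn f (Set.Icc 0 m))
    (hcont : ContinuousOn f (Set.Icc 0 m)) :
    ∃ b ∈ Set.Icc 0 m, ∀ ε ∈ Set.Icc 0 m, f ε = 0 ↔ ε ≤ b := by
  set S := Set.Icc 0 m ∩ f ⁻¹' {0} with hS
  have hne : S.Nonempty := ⟨0, ⟨le_rfl, hm⟩, h0⟩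
  have hcomp : IsCompact S := by
    refine isCompact_Icc.of_isClosed_subset ?_ Set.inter_subset_left
    exact hcont.preimage_isClosed_of_isClosed isClosed_Icc isClosed_singleton
  have hb := hcomp.sSup_mem hne
  refine ⟨sSup S, hb.1, fun ε hε => ⟨fun h => le_csSup hcomp.bddAbove ⟨hε, h⟩, fun h => ?_⟩⟩
  refine le_antisymm (hnp ε hε) ?_
  have h1 : f (sSup S) = 0 := hb.2
  rw [← h1]
  exact hanti hε hb.1 h

section Threshold

variable {d : ℕ} {α : Jump d → ℝ} {Q : Measure (Site d → disorderSet α)} {κ : ℝ}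

theorem epsMax_mem [Nonempty (Fin d)] (hκ : 0 < κ) (hκα : κ < ⨅ e, α e) :
    0 < epsMax α κ ∧ epsMax α κ < 1 := by
  have h1 : 0 < ⨅ e, α e := hκ.trans hκα
  refine ⟨?_, ?_⟩
  · rw [epsMax, sub_pos, div_lt_one h1]; exact hκα
  · rw [epsMax, sub_lt_self_iff]; positivity

/-- All weights stay above a fixed fraction `1 - m` of their means, so changing `ε` alters each by a
factor of at most `1 + |ε - ε'| / (1 - m)`. -/
theorem continuousOn_freeEnergy [Nonempty (Fin d)] (hα : ∀ e, 0 < α e) (hQ : IsDisorderLaw α Q)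
    {m : ℝ} (hm : m < 1) :
    ContinuousOn (fun ε => freeEnergy (siteLaw Q) (dirWt α ε)) (Set.Icc 0 m) := by
  have := isProbabilityMeasure_siteLaw hQ
  have hm' : 0 < 1 - m := sub_pos.2 hm
  have key : ∀ ε ∈ Set.Icc 0 m, ∀ ε' ∈ Set.Icc 0 m,
      freeEnergy (siteLaw Q) (dirWt α ε) - freeEnergy (siteLaw Q) (dirWt α ε')
        ≤ 1 / (1 - m) * |ε - ε'| := by
    intro ε hε ε' hε'
    set c := 1 + 1 / (1 - m) * |ε - ε'| with hc
    have hc0 : 0 < c := by positivity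
    have h1 := (isWeight_siteLaw hα hQ hε.1 (hε.2.trans_lt hm)).freeEnergy_le_add
      (isWeight_siteLaw hα hQ hε'.1 (hε'.2.trans_lt hm)) hc0 fun r i => by
        have hr := r.2.1 (i, 1)
        set s := (r : Jump d → ℝ) (i, 1) with hs
        have h2 : 1 + ε * s ≤ c * (1 + ε' * s) := by
          have h3 : 1 - m ≤ 1 + ε' * s := by nlinarith [hε'.1, hε'.2, hr.1]
          have h4 : (ε - ε') * s ≤ |ε - ε'| := by
            refine (le_abs_self _).trans ?_
            rw [abs_mul]
            exact mul_le_of_le_one_right (abs_nonneg _) (abs_le.2 hr)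
          have h5 : |ε - ε'| ≤ 1 / (1 - m) * |ε - ε'| * (1 + ε' * s) := by
            calc |ε - ε'| = 1 / (1 - m) * |ε - ε'| * (1 - m) := by field_simp
              _ ≤ _ := by gcongr
          rw [hc]
          linarith
        rw [dirWt, dirWt, mul_div_assoc']
        refine div_le_div_of_nonneg_right ?_ (dirMass_pos hα).le
        calc α (i, 1) * (1 + ε * s) ≤ α (i, 1) * (c * (1 + ε' * s)) :=
              mul_le_mul_of_nonneg_left h2 (hα _).le
          _ = _ := by ring
    have h2 := Real.log_le_sub_one_of_pos hc0
    linarith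
  have hlip : LipschitzOnWith (1 / (1 - m)).toNNReal
      (fun ε => freeEnergy (siteLaw Q) (dirWt α ε)) (Set.Icc 0 m) := by
    refine LipschitzOnWith.of_dist_le_mul fun ε hε ε' hε' => ?_
    rw [Real.dist_eq, Real.dist_eq, Real.coe_toNNReal _ (by positivity), abs_le]
    have h1 := key ε hε ε' hε'
    have h2 := key ε' hε' ε hε
    rw [abs_sub_comm] at h2
    constructor <;> linarith
  exact hlip.continuousOn

theorem antitoneOn_freeEnergy [Nonempty (Fin d)] (hα : ∀ e, 0 < α e) (hQ : IsDisorderLaw α Q)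
    {m : ℝ} (hm : m < 1) :
    AntitoneOn (fun ε => freeEnergy (siteLaw Q) (dirWt α ε)) (Set.Icc 0 m) := by
  intro ε hε ε' hε' hle
  have := isProbabilityMeasure_siteLaw hQ
  -- The scaling factor is `ε / ε'`, which requires `ε' > 0`; for `ε' = 0` both parameters coincide.
  rcases hε'.1.eq_or_lt with h0 | h0
  · have : ε = ε' := le_antisymm hle (h0 ▸ hε.1)
    rw [this]
  refine (isWeight_siteLaw hα hQ hε.1 (hε.2.trans_lt hm)).freeEnergy_antitone
    (isWeight_siteLaw hα hQ hε'.1 (hε'.2.trans_lt hm)) (s := ε / ε')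
    (div_nonneg hε.1 hε'.1) ((div_le_one h0).2 hle) fun r i => ?_
  rw [dirWt, dirWt, dirLaw]
  have := (dirMass_pos hα).ne'
  field_simp
  ring

theorem exists_isThreshold (hd : 2 ≤ d) (hα : ∀ e, 0 < α e) (hQ : IsDisorderLaw α Q)
    (hκ : 0 < κ) (hκα : κ < ⨅ e, α e) : ∃ b, IsThreshold α Q κ b ∧
      ∀ ε ∈ Set.Icc 0 (epsMax α κ), freeEnergy (siteLaw Q) (dirWt α ε) = 0 ↔ ε ≤ b := by
  have : Nonempty (Fin d) := ⟨⟨0, by omega⟩⟩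
  have := isProbabilityMeasure_siteLaw hQ
  obtain ⟨hm0, hm1⟩ := epsMax_mem hκ hκα
  have hw : ∀ ε ∈ Set.Icc 0 (epsMax α κ), IsWeight (siteLaw Q) (dirLaw α) ε (dirWt α ε) :=
    fun ε hε => isWeight_siteLaw hα hQ hε.1 (hε.2.trans_lt hm1)
  obtain ⟨b, hb, hbf⟩ := exists_threshold_of_antitoneOn hm0.le
    (f := fun ε => freeEnergy (siteLaw Q) (dirWt α ε))
    ((hw 0 ⟨le_rfl, hm0.le⟩).freeEnergy_eq_zero_of_degenerate
      (by rw [integral_fluct_sq_dirWt hα]; simp))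
    (fun ε hε => (hw ε hε).freeEnergy_nonpos) (antitoneOn_freeEnergy hα hQ hm1)
    (continuousOn_freeEnergy hα hQ hm1)
  refine ⟨b, ⟨hb, fun ε hε => hasAnnealedFreeEnergy_envLaw hα hQ hε.1 (hε.2.trans_lt hm1),
    fun ε hε => ?_, fun ε hε => ?_⟩, hbf⟩
  · have hε' : ε ∈ Set.Icc 0 (epsMax α κ) := ⟨hε.1, hε.2.trans hb.2⟩
    have hf : freeEnergy (siteLaw Q) (dirWt α ε) = 0 := (hbf ε hε').2 hε.2
    refine ⟨delocalized_envLaw hα ?_, ?_⟩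
    · rw [eq_fieldLaw hQ]
      -- The overlap argument divides by the variance, so environments with constant total weight,
      -- including `ε = 0`, take the collision argument.
      rcases (integral_nonneg fun r => sq_nonneg (fluct (dirWt α ε) r) :
        0 ≤ ∫ r, fluct (dirWt α ε) r ^ 2 ∂siteLaw Q).eq_or_lt with h | h
      · exact (hw ε hε').ae_delocalized_of_degenerate hd h.symm
      · exact (hw ε hε').ae_delocalized hf h
    · have := hasQuenchedFreeEnergy_envLaw hα hQ hε'.1 (hε'.2.trans_lt hm1)
      rwa [hf, add_zero] at this
  · have hε' : ε ∈ Set.Icc 0 (epsMax α κ) := ⟨hb.1.trans hε.1.le, hε.2⟩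
    have hf : freeEnergy (siteLaw Q) (dirWt α ε) < 0 :=
      lt_of_le_of_ne (hw ε hε').freeEnergy_nonpos fun h => absurd ((hbf ε hε').1 h) (not_le.2 hε.1)
    refine ⟨localized_envLaw hα ?_, _, ?_,
      hasQuenchedFreeEnergy_envLaw hα hQ hε'.1 (hε'.2.trans_lt hm1)⟩
    · rw [eq_fieldLaw hQ]
      exact (hw ε hε').ae_localized hf
    · linarith

theorem threshold_pos (hd : 4 ≤ d) (hα : ∀ e, 0 < α e) (hQ : IsDisorderLaw α Q)
    {m b : ℝ} (hm0 : 0 < m) (hm1 : m < 1)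
    (hb : ∀ ε ∈ Set.Icc 0 m, freeEnergy (siteLaw Q) (dirWt α ε) = 0 ↔ ε ≤ b) : 0 < b := by
  have : Nonempty (Fin d) := ⟨⟨0, by omega⟩⟩
  have := isProbabilityMeasure_siteLaw hQ
  have hw0 := isWeight_siteLaw hα hQ le_rfl one_pos
  obtain ⟨t, ht, hweak⟩ := exists_weak_disorder hd hw0.pos hw0.sum_one
  have hmin : 0 < min t m := lt_min ht hm0
  have hmem : min t m ∈ Set.Icc 0 m := ⟨hmin.le, min_le_right _ _⟩
  have hf := hweak (siteLaw Q) _ _ (isWeight_siteLaw hα hQ hmin.le (hmem.2.trans_lt hm1))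
    (min_le_left _ _)
  exact hmin.trans_le ((hb _ hmem).1 hf)

theorem exists_threshold_dichotomy (hd : 2 ≤ d) (hα : ∀ e, 0 < α e) (hQ : IsDisorderLaw α Q)
    (hκ : 0 < κ) (hκα : κ < ⨅ e, α e) : ∃ b : ℝ, IsThreshold α Q κ b ∧
      ∀ ε ∈ Set.Ioc 0 (epsMax α κ), (¬ EnvCondition (envLaw α Q ε) → b = epsMax α κ) ∧
        (EnvCondition (envLaw α Q ε) → ((d = 2 ∨ d = 3) → b = 0) ∧ (4 ≤ d → 0 < b)) := by
  have : Nonempty (Fin d) := ⟨⟨0, by omega⟩⟩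
  have := isProbabilityMeasure_siteLaw hQ
  obtain ⟨hm0, hm1⟩ := epsMax_mem hκ hκα
  obtain ⟨b, hb, hbf⟩ := exists_isThreshold hd hα hQ hκ hκα
  refine ⟨b, hb, fun ε hε => ?_⟩
  rw [envCondition_iff hα hQ hε.1.le (hε.2.trans_lt hm1), integral_fluct_sq_dirWt hα,
    mul_pos_iff_of_pos_left (pow_pos hε.1 2)]
  refine ⟨fun hdeg => ?_, fun hnd => ⟨fun hd23 => ?_, fun hd4 =>
    threshold_pos hd4 hα hQ hm0 hm1 hbf⟩⟩
  · have hv : ∫ r, dirFluct α r ^ 2 ∂siteLaw Q = 0 :=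
      le_antisymm (not_lt.1 hdeg) (integral_nonneg fun r => sq_nonneg _)
    have hf := (isWeight_siteLaw hα hQ hm0.le hm1).freeEnergy_eq_zero_of_degenerate
      (by rw [integral_fluct_sq_dirWt hα, hv, mul_zero])
    exact le_antisymm hb.mem.2 ((hbf _ ⟨hm0.le, le_rfl⟩).1 hf)
  · refine (hb.mem.1.eq_or_lt.resolve_right fun hpos => ?_).symm
    have hneg := (isWeight_siteLaw hα hQ hpos.le (hb.mem.2.trans_lt hm1)).freeEnergy_neg_of_dim hd23
      (by rw [integral_fluct_sq_dirWt hα]; positivity)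
    exact hneg.ne ((hbf b hb.mem).2 le_rfl)

end Threshold

/-! ### Strong disorder from a fractional moment of one step -/

/-- Subadditivity of the square root is applied at every step, treating all paths separately. This
is wasteful in general, but effective when one direction carries almost all the mass. -/
theorem IsWeight.integral_sqrt_tot_le {d : ℕ} {E : Type*} [MeasurableSpace E] {μ : Measure E}
    [IsProbabilityMeasure μ] {a : Fin d → ℝ} {t : ℝ} {w : E → Fin d → ℝ} (h : IsWeight μ a t w)
    (n : ℕ) (x : Site d) :
    ∫ ξ, √(tot w n x ξ) ∂fieldLaw (Site d) μ ≤ (∑ i, ∫ r, √(w r i) ∂μ) ^ n := by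
  induction n generalizing x with
  | zero => simp [tot]
  | succ n ih =>
    have hs : ∀ i, BMeas fun r => √(w r i) := fun i => (h.bmeas i).sqrt
    have ht : ∀ i, BMeas fun ξ : Site d → E => √(tot w n (x + unitStep i) ξ) := fun i =>
      (h.bmeas_part _ n _).sqrt
    have hb : ∀ i, BMeas fun ξ : Site d → E => √(w (ξ x) i) * √(tot w n (x + unitStep i) ξ) :=
      fun i => ((hs i).comp (measurable_pi_apply x)).mul (ht i)
    calc ∫ ξ, √(tot w (n + 1) x ξ) ∂fieldLaw (Site d) μ
        ≤ ∫ ξ, ∑ i, √(w (ξ x) i) * √(tot w n (x + unitStep i) ξ) ∂fieldLaw (Site d) μ := by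
          refine integral_mono ((h.bmeas_part _ (n + 1) x).sqrt.integrable _)
            ((BMeas.sum _ fun i _ => hb i).integrable _) fun ξ => ?_
          simp only [tot, part_succ]
          refine (sqrt_sum_le_sum_sqrt _ fun i _ =>
            mul_nonneg (h.w_nonneg _ _) (h.tot_pos n _ ξ).le).trans (le_of_eq ?_)
          exact Finset.sum_congr rfl fun i _ => Real.sqrt_mul (h.w_nonneg _ _) _
      _ = ∑ i, (∫ r, √(w r i) ∂μ)
            * ∫ ξ, √(tot w n (x + unitStep i) ξ) ∂fieldLaw (Site d) μ := by
          rw [integral_finsetSum _ fun i _ => (hb i).integrable _]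
          refine Finset.sum_congr rfl fun i _ => ?_
          rw [integral_mul_of_dependsOn (S := {x})
            (T := {y | level (x + unitStep i) ≤ level y ∧ level y < level (x + unitStep i) + n})
            ((hs i).comp (measurable_pi_apply x)) (ht i), integral_eval (hs i).meas]
          · intro ξ ξ' hξ
            simp only [hξ x rfl]
          · intro ξ ξ' hξ
            simp only [tot]
            rw [part_dependsOn _ n _ hξ]
          · rw [Set.disjoint_singleton_right]
            intro hx
            have := hx.1
            rw [level_add_unitStep] at this
            omega
      _ ≤ ∑ i, (∫ r, √(w r i) ∂μ) * (∑ i, ∫ r, √(w r i) ∂μ) ^ n :=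
          Finset.sum_le_sum fun i _ => mul_le_mul_of_nonneg_left (ih _)
            (integral_nonneg fun r => Real.sqrt_nonneg _)
      _ = _ := by rw [← Finset.sum_mul, pow_succ']

theorem IsWeight.freeEnergy_neg_of_sum_sqrt {d : ℕ} [Nonempty (Fin d)] {E : Type*}
    [MeasurableSpace E] {μ : Measure E} [IsProbabilityMeasure μ] {a : Fin d → ℝ} {t : ℝ}
    {w : E → Fin d → ℝ} (h : IsWeight μ a t w) {ρ : ℝ} (hρ : ρ < 1)
    (hle : ∑ i, ∫ r, √(w r i) ∂μ ≤ ρ) : freeEnergy μ w < 0 := by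
  have h0 : 0 ≤ ∑ i, ∫ r, √(w r i) ∂μ :=
    Finset.sum_nonneg fun i _ => integral_nonneg fun r => Real.sqrt_nonneg _
  -- The maximum with `1/2` only ensures a positive rate.
  refine h.freeEnergy_neg_of_sqrt one_pos (ρ := max ρ (1 / 2))
    (lt_max_of_lt_right (by norm_num)) (max_lt hρ (by norm_num)) fun m => ?_
  rw [one_mul]
  exact (h.integral_sqrt_tot_le m 0).trans (pow_le_pow_left₀ h0 (hle.trans (le_max_left _ _)) m)

/-! ### Rademacher disorder with an intermediate threshold -/

section Rademacher

variable {d : ℕ} {α : Jump d → ℝ}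

/-- The vector with entries `σ` at the positive and `-σ` at the negative jumps. -/
def signVec [Nonempty (Fin d)] (hα : ∀ i, α (i, 1) = α (i, -1)) (σ : ℤˣ) : disorderSet α :=
  ⟨fun e => ((σ * e.2 : ℤˣ) : ℤ), by
    have habs : ∀ u : ℤˣ, |((u : ℤ) : ℝ)| = 1 := fun u => by
      rcases Int.units_eq_one_or u with rfl | rfl <;> simp
    refine ⟨fun e => abs_le.1 (habs _).le, ?_, ?_⟩
    · rw [Fintype.sum_prod_type]
      refine Finset.sum_eq_zero fun i _ => ?_
      have hu : (Finset.univ : Finset ℤˣ) = {1, -1} := by decide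
      rw [hu, Finset.sum_pair (by decide)]
      simp [hα i]
    · simp only [habs]
      exact ciSup_const⟩

theorem signVec_apply [Nonempty (Fin d)] (hα : ∀ i, α (i, 1) = α (i, -1)) (σ : ℤˣ) (e : Jump d) :
    (signVec hα σ : Jump d → ℝ) e = ((σ : ℤ) : ℝ) * ((e.2 : ℤ) : ℝ) := by
  simp [signVec]

/-- A fair random sign, as a law on vectors. -/
def signLaw [Nonempty (Fin d)] (hα : ∀ i, α (i, 1) = α (i, -1)) : Measure (disorderSet α) :=
  (2⁻¹ : ENNReal) • Measure.dirac (signVec hα 1) + (2⁻¹ : ENNReal) • Measure.dirac (signVec hα (-1))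

variable [Nonempty (Fin d)] (hα : ∀ i, α (i, 1) = α (i, -1))

instance : IsProbabilityMeasure (signLaw hα) :=
  ⟨by simp [signLaw, ENNReal.inv_two_add_inv_two]⟩

theorem integral_signLaw {f : disorderSet α → ℝ} (hf : Measurable f) :
    ∫ r, f r ∂signLaw hα = (f (signVec hα 1) + f (signVec hα (-1))) / 2 := by
  have hi : ∀ σ, Integrable f (Measure.dirac (signVec hα σ)) := fun σ =>
    integrable_dirac' hf.stronglyMeasurable (by simp)
  rw [signLaw, integral_add_measure ((hi 1).smul_measure (by simp))
    ((hi (-1)).smul_measure (by simp)), integral_smul_measure, integral_smul_measure,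
    integral_dirac' _ _ hf.stronglyMeasurable, integral_dirac' _ _ hf.stronglyMeasurable]
  simp
  ring

theorem signLaw_apply {s : Set (disorderSet α)} (hs : MeasurableSet s) :
    signLaw hα s = 2⁻¹ * s.indicator 1 (signVec hα 1) + 2⁻¹ * s.indicator 1 (signVec hα (-1)) := by
  simp [signLaw, Measure.dirac_apply' _ hs]

theorem isDisorderLaw_signLaw : IsDisorderLaw α (fieldLaw (Site d) (signLaw hα)) where
  isProb := inferInstance
  indep := by
    rw [iIndepFun_iff_map_fun_eq_infinitePi_map fun x => measurable_pi_apply x]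
    simp only [Measure.infinitePi_map_eval]
    exact Measure.map_id
  ident x := ⟨(measurable_pi_apply x).aemeasurable, (measurable_pi_apply 0).aemeasurable, by
    simp only [Measure.infinitePi_map_eval]⟩
  centered x e := by
    have h1 := integral_eval (μ := signLaw hα) (measurable_coord e) x
    rw [h1, integral_signLaw hα (measurable_coord e)]
    simp [signVec_apply]

theorem siteLaw_signLaw : siteLaw (fieldLaw (Site d) (signLaw hα)) = signLaw hα := by
  rw [siteLaw, Measure.infinitePi_map_eval]

theorem isRademacher_signLaw : IsRademacher (fieldLaw (Site d) (signLaw hα)) := by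
  have hmp : ∀ x : Site d, MeasurePreserving (fun ξ : Site d → disorderSet α => ξ x)
      (fieldLaw (Site d) (signLaw hα)) (signLaw hα) := fun x =>
    ⟨measurable_pi_apply x, Measure.infinitePi_map_eval _ _⟩
  refine ⟨?_, fun i => ?_⟩
  · rw [ae_all_iff]
    intro x
    have hms : MeasurableSet {r : disorderSet α | ∀ i j : Fin d,
        (r : Jump d → ℝ) (i, 1) = (r : Jump d → ℝ) (j, 1) ∧
        (r : Jump d → ℝ) (i, -1) = -(r : Jump d → ℝ) (i, 1)} := by
      have he : ∀ (p : Fin d → Fin d → disorderSet α → Prop), (∀ i j, MeasurableSet {r | p i j r}) →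
          MeasurableSet {r | ∀ i j, p i j r} := by
        intro p hp
        have : {r | ∀ i j, p i j r} = ⋂ i, ⋂ j, {r | p i j r} := by
          ext r
          simp
        rw [this]
        exact MeasurableSet.iInter fun i => MeasurableSet.iInter fun j => hp i j
      refine he _ fun i j => MeasurableSet.inter ?_ ?_
      · exact measurableSet_eq_fun (measurable_coord _) (measurable_coord _)
      · exact measurableSet_eq_fun (measurable_coord _) (measurable_coord _).neg
    have h1 : ∀ᵐ r : disorderSet α ∂signLaw hα, ∀ i j : Fin d,
        (r : Jump d → ℝ) (i, 1) = (r : Jump d → ℝ) (j, 1) ∧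
        (r : Jump d → ℝ) (i, -1) = -(r : Jump d → ℝ) (i, 1) := by
      rw [ae_iff]
      have := signLaw_apply hα hms.compl
      refine this.trans ?_
      rw [Set.indicator_of_notMem, Set.indicator_of_notMem]
      · simp
      · simp [signVec_apply]
      · simp [signVec_apply]
    exact (hmp x).quasiMeasurePreserving.ae h1
  · have hs : ∀ u : ℝ, MeasurableSet {r : disorderSet α | (r : Jump d → ℝ) (i, 1) = u} := fun u =>
      measurableSet_eq_fun (measurable_coord _) measurable_const
    have h1 : ∀ u : ℝ, fieldLaw (Site d) (signLaw hα)
        {ξ | (ξ 0 : Jump d → ℝ) (i, 1) = u}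
        = signLaw hα {r : disorderSet α | (r : Jump d → ℝ) (i, 1) = u} := fun u =>
      (hmp 0).measure_preimage (hs u).nullMeasurableSet
    rw [h1, h1, signLaw_apply hα (hs 1), signLaw_apply hα (hs (-1))]
    constructor
    · rw [Set.indicator_of_mem (by simp [signVec_apply]),
        Set.indicator_of_notMem (by simp [signVec_apply]; norm_num)]
      simp
    · rw [Set.indicator_of_notMem (by simp [signVec_apply]; norm_num),
        Set.indicator_of_mem (by simp [signVec_apply])]
      simp

theorem freeEnergy_signLaw_neg (hα0 : ∀ e, 0 < α e)
    (hsum : ∑ i, √(dirLaw α i) ≤ 101 / 100) :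
    freeEnergy (signLaw hα) (dirWt α (1 / 2)) < 0 := by
  have hw : IsWeight (signLaw hα) (dirLaw α) (1 / 2) (dirWt α (1 / 2)) := by
    have := isWeight_siteLaw hα0 (isDisorderLaw_signLaw hα) (ε := 1 / 2) (by norm_num) (by norm_num)
    rwa [siteLaw_signLaw] at this
  -- The two values of `√(1 ± 1/2)` average to less than `0.967`, a gain that beats the factor
  -- `1.01` lost by splitting the directions.
  have h1 : √(3 / 2 : ℝ) ≤ 1225 / 1000 := Real.sqrt_le_iff.2 ⟨by norm_num, by norm_num⟩
  have h2 : √(1 / 2 : ℝ) ≤ 708 / 1000 := Real.sqrt_le_iff.2 ⟨by norm_num, by norm_num⟩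
  refine hw.freeEnergy_neg_of_sum_sqrt (ρ := 101 / 100 * (967 / 1000)) (by norm_num) ?_
  have h3 : ∀ i, ∫ r, √(dirWt α (1 / 2) r i) ∂signLaw hα
      = √(dirLaw α i) * ((√(3 / 2) + √(1 / 2)) / 2) := by
    intro i
    rw [integral_signLaw hα (hw.bmeas i).sqrt.meas]
    have hval : ∀ σ : ℤˣ, dirWt α (1 / 2) (signVec hα σ) i
        = dirLaw α i * (1 + 1 / 2 * ((σ : ℤ) : ℝ)) := fun σ => by
      rw [dirWt, signVec_apply, dirLaw]
      simp only [Units.val_one, Int.cast_one, mul_one]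
      ring
    rw [hval, hval, Real.sqrt_mul (hw.a_nonneg i), Real.sqrt_mul (hw.a_nonneg i)]
    have e1 : (1 : ℝ) + 1 / 2 * (((1 : ℤˣ) : ℤ) : ℝ) = 3 / 2 := by norm_num
    have e2 : (1 : ℝ) + 1 / 2 * (((-1 : ℤˣ) : ℤ) : ℝ) = 1 / 2 := by norm_num
    rw [e1, e2]
    ring
  simp only [h3]
  rw [← Finset.sum_mul]
  exact mul_le_mul hsum (by linarith) (by positivity) (by norm_num)

end Rademacher

/-! ### A jump law concentrated on one axis. -/

section Example

/-- The small entries of the example. -/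
def smallRate (d : ℕ) : ℝ := 1 / (20000 * ((d : ℝ) - 1) ^ 2)

open Classical in
/-- A probability vector which is concentrated on one axis. -/
def axisVec {d : ℕ} (o : Fin d) (e : Jump d) : ℝ :=
  if e.1 = o then 1 / 2 - ((d : ℝ) - 1) * smallRate d else smallRate d

theorem sum_axisVec {d : ℕ} (o : Fin d) (g : ℝ → ℝ) (s : ℤˣ) :
    ∑ i : Fin d, g (axisVec o (i, s))
      = g (1 / 2 - ((d : ℝ) - 1) * smallRate d) + ((d : ℝ) - 1) * g (smallRate d) := by
  classical
  rw [← Finset.add_sum_erase _ _ (Finset.mem_univ o)]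
  congr 1
  · simp [axisVec]
  · rw [Finset.sum_congr rfl fun i hi => by rw [axisVec, if_neg (Finset.ne_of_mem_erase hi)],
      Finset.sum_const, Finset.card_erase_of_mem (Finset.mem_univ o), Finset.card_univ,
      Fintype.card_fin, nsmul_eq_mul, Nat.cast_sub (by have := o.pos; omega), Nat.cast_one]

theorem exists_intermediate_threshold {d : ℕ} (hd : 4 ≤ d) :
    ∃ (α : Jump d → ℝ) (Q : Measure (Site d → disorderSet α)) (κ b : ℝ),
      (∀ e, 0 < α e) ∧ ∑ e, α e = 1 ∧ (∀ i, α (i, 1) = α (i, -1)) ∧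
      (∃ i j, α (i, 1) ≠ α (j, 1)) ∧
      IsDisorderLaw α Q ∧ IsRademacher Q ∧ 0 < κ ∧ κ < ⨅ e, α e ∧
      IsThreshold α Q κ b ∧ 0 < b ∧ b < epsMax α κ := by
  let o : Fin d := ⟨0, by omega⟩
  let o' : Fin d := ⟨1, by omega⟩
  have hoo : o' ≠ o := by simp [o, o', Fin.ext_iff]
  have : Nonempty (Fin d) := ⟨o⟩
  have hd3 : (3 : ℝ) ≤ (d : ℝ) - 1 := by
    have : (4 : ℝ) ≤ d := by exact_mod_cast hd
    linarith
  set D : ℝ := (d : ℝ) - 1 with hD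
  set δ := smallRate d with hδ
  have hδe : δ = 1 / (20000 * D ^ 2) := rfl
  have hδ0 : 0 < δ := by rw [hδe]; positivity
  have hδD : D * δ ≤ 1 / 60000 := by
    rw [hδe, mul_one_div, div_le_div_iff₀ (by positivity) (by norm_num)]
    nlinarith
  have hbig : δ < 1 / 2 - D * δ := by nlinarith
  let α : Jump d → ℝ := axisVec o
  have hα : ∀ e, 0 < α e := by
    intro e
    simp only [α, axisVec]
    split_ifs
    · exact hδ0.trans hbig
    · exact hδ0
  have hsym : ∀ i, α (i, 1) = α (i, -1) := fun i => rfl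
  have hmass : dirMass α = 1 / 2 := by
    have := sum_axisVec o (fun u => u) 1
    rw [dirMass]
    refine this.trans ?_
    ring
  have hsum : ∑ e, α e = 1 := by
    rw [Fintype.sum_prod_type_right]
    have hu : (Finset.univ : Finset ℤˣ) = {1, -1} := by decide
    rw [hu, Finset.sum_pair (by decide)]
    have e1 := sum_axisVec o (fun u => u) 1
    have e2 := sum_axisVec o (fun u => u) (-1)
    simp only [α]
    rw [e1, e2]
    ring
  have hinf : ⨅ e, α e = δ := by
    refine le_antisymm ?_ (le_ciInf fun e => ?_)
    · refine (ciInf_le ⟨0, ?_⟩ ((o', 1) : Jump d)).trans (le_of_eq (if_neg hoo))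
      rintro _ ⟨e, rfl⟩
      exact (hα e).le
    · simp only [α, axisVec]
      split_ifs
      · exact hbig.le
      · exact le_rfl
  have hQ := isDisorderLaw_signLaw hsym
  -- Taking `κ` to be half the smallest rate makes the maximal disorder `1/2`, whatever the
  -- dimension.
  have heps : epsMax α (δ / 2) = 1 / 2 := by
    rw [epsMax, hinf]
    field_simp
    norm_num
  obtain ⟨b, hb, hbf⟩ := exists_isThreshold (by omega) hα hQ (κ := δ / 2) (by positivity)
    (by rw [hinf]; linarith)
  rw [heps] at hbf
  have hsqrt : ∑ i, √(dirLaw α i) ≤ 101 / 100 := by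
    simp only [dirLaw, hmass]
    have := sum_axisVec o (fun u => √(u / (1 / 2))) 1
    refine (this.trans_le ?_)
    have h1 : √((1 / 2 - D * δ) / (1 / 2)) ≤ 1 := by
      rw [Real.sqrt_le_one]
      have : 0 < D * δ := by positivity
      linarith
    -- The constant `20000 D²` is chosen for this: the `D` small directions together contribute
    -- `1/100` to the sum of square roots.
    have h2 : √(δ / (1 / 2)) = 1 / (100 * D) := by
      rw [Real.sqrt_eq_iff_mul_self_eq_of_pos (by positivity), hδe]
      field_simp
      norm_num
    rw [h2]
    have h3 : D * (1 / (100 * D)) = 1 / 100 := by field_simp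
    linarith
  have hneg : freeEnergy (siteLaw (fieldLaw (Site d) (signLaw hsym))) (dirWt α (1 / 2)) < 0 := by
    rw [siteLaw_signLaw]
    exact freeEnergy_signLaw_neg hsym hα hsqrt
  refine ⟨α, fieldLaw (Site d) (signLaw hsym), δ / 2, b, hα, hsum, hsym, ⟨o, o', ?_⟩, hQ,
    isRademacher_signLaw hsym, by positivity, by rw [hinf]; linarith, hb,
    threshold_pos hd hα hQ (by norm_num) (by norm_num) hbf, ?_⟩
  · simp only [α, axisVec, if_true, if_neg hoo]
    exact hbig.ne'
  · rw [heps]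
    by_contra hcon
    exact hneg.ne ((hbf (1 / 2) ⟨by norm_num, le_rfl⟩).2 (not_lt.1 hcon))

end Example

end

theorem proposition1p4 (d : ℕ) (hd : 2 ≤ d) :
    (∀ (α : Jump d → ℝ) (_ : ∀ e, 0 < α e) (_ : ∑ e, α e = 1)
      (Q : Measure (Site d → disorderSet α)) (_ : IsDisorderLaw α Q)
      (κ : ℝ) (_ : 0 < κ) (_ : κ < ⨅ e, α e),
      ∃ b : ℝ, IsThreshold α Q κ b ∧
        ∀ ε ∈ Set.Ioc 0 (epsMax α κ),
          (¬ EnvCondition (envLaw α Q ε) → b = epsMax α κ) ∧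
          (EnvCondition (envLaw α Q ε) →
            ((d = 2 ∨ d = 3) → b = 0) ∧ (4 ≤ d → 0 < b))) ∧
    (4 ≤ d →
      ∃ (α : Jump d → ℝ) (Q : Measure (Site d → disorderSet α)) (κ b : ℝ),
        (∀ e, 0 < α e) ∧ ∑ e, α e = 1 ∧ (∀ i, α (i, 1) = α (i, -1)) ∧
        (∃ i j, α (i, 1) ≠ α (j, 1)) ∧
        IsDisorderLaw α Q ∧ IsRademacher Q ∧ 0 < κ ∧ κ < ⨅ e, α e ∧
        IsThreshold α Q κ b ∧ 0 < b ∧ b < epsMax α κ) := by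
  refine ⟨fun α hα _ Q hQ κ hκ hκα => exists_threshold_dichotomy hd hα hQ hκ hκα,
    fun hd4 => exists_intermediate_threshold hd4⟩
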